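/- Let $n,l\ge 1$ be integers, $p,q,r\in(0,\infty]$, $\theta\in(0,\min\{p,r\}]$, $\alpha_3\ge 0$, and let $\{\alpha^1_k\}_{k\ge0},\{\alpha^2_k\}_{k\ge0}$ be sequences of positive numbers. Put $p_\theta=p/\theta$ (with $p_\theta=1$ if $p=\theta$), let a prime denote the conjugate Hölder exponent, and put $\sigma_1=\theta p'_\theta$ (equal to $\infty$ if $p=\theta$) and $\sigma_2=p$. Usual modifications (essential suprema, suprema) are made for infinite exponents. Notation. For $k\in\mathbb N_0$, $m\in\mathbb Z^n$ let $Q_{k,m}=\prod_i(\frac{m_i}{2^k},\frac{m_i+1}{2^k})$, let $\widetilde Q_{k,m}$ be the corresponding half-open cube $\prod_i[\frac{m_i}{2^k},\frac{m_i+1}{2^k})$, and let $I^n=(-1,1)^n$. A $p$-admissible weight sequence is a sequence of measurable functions $t_k$ ($k\ge0$) on $\mathbb R^n$ that are positive a.e. and belong to $L_p^{\rm loc}(\mathbb R^n)$; for it, $t_{k,m}=\|t_k|L_p(Q_{k,m})\|$ and $\overline t_k=2^{kn/p}\sum_m t_{k,m}\chi_{\widetilde Q_{k,m}}$. A $p$-admissible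 weight sequence $\{s_k\}$ belongs to $X^{\alpha_3}_{\alpha,\sigma,p}$ if for some $C_1,C_2>0$ and all $0\le k\le j$, $m\in\mathbb Z^n$, $$\Bigl(2^{kn}\!\int_{Q_{k,m}}\! s_k^p\Bigr)^{1/p}\Bigl(2^{kn}\!\int_{Q_{k,m}}\! s_j^{-\sigma_1}\Bigr)^{1/\sigma_1}\le C_1\frac{\alpha^1_k}{\alpha^1_j},\qquad \Bigl(2^{kn}\!\int_{Q_{k,m}}\! s_k^p\Bigr)^{-1/p}\Bigl(2^{kn}\!\int_{Q_{k,m}}\! s_j^{\sigma_2}\Bigr)^{1/\sigma_2}\le C_2\frac{\alpha^2_j}{\alpha^2_k},$$ and $0<s_{k,m}\le 2^{\alpha_3}s_{k,\widetilde m}$ whenever $|m_i-\widetilde m_i|\le1$ for all $i$, where $s_{k,m}=\|s_k|L_p(Q_{k,m})\|$. With $\Delta^l(h)f(x)=\sum_{i=0}^l(-1)^{l+i}\binom li f(x+ih)$ and $$\delta^l_r(x+2^{-k}I^n)f=\Bigl(2^{2kn}\int_{x+2^{-k}I^n}\int_{2^{-k}I^n}|\Delta^l(h)f(y)|^r\,dh\,dy\Bigr)^{1/r},$$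 the space $\widetilde B^l_{p,q,r}(\mathbb R^n,\{t_k\})$ consists of all $f\in L_r^{\rm loc}(\mathbb R^n)$ with $$\|f\|_{\widetilde B}:=\Bigl(\sum_{k\ge0}\bigl\|t_k\,\delta^l_r(\cdot+2^{-k}I^n)f\,\big|L_p(\mathbb R^n)\bigr\|^q\Bigr)^{1/q}+\bigl\|t_0\,\|f|L_r(\cdot+I^n)\|\,\big|L_p(\mathbb R^n)\bigr\|<\infty .$$ Let $N^l$ be the cardinal B-spline of degree $l$ with knots $0,1,\dots,l+1$ and $N^l_{k,m}(x)=\prod_{i=1}^n N^l(2^kx_i-m_i)$. For real coefficients $\beta=\{\beta_{k,m}\}$ put $$\|\beta\|_t=\Bigl(\sum_{k\ge0}\Bigl(\sum_{m\in\mathbb Z^n}t_{k,m}^p|\beta_{k,m}|^p\Bigr)^{q/p}\Bigr)^{1/q},$$ and let $N(f)=\inf\|\beta\|_t$ over all $\beta$ such that $\sum_{k\ge0}\sum_m\beta_{k,m}N^l_{k,m}$ converges to $f$ in $L_r^{\rm loc}(\mathbb R^n)$, i.e. its partial sums in $k$ converge to $f$ in $L_r(K)$ for every compact $K$. Hypotheses.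 For some $\mu\in(0,\min\{1,\theta,q\}]$ and $s=q/\mu$, $$\sup_N\Bigl(\sum_{k\le N}b_k^s\Bigr)^{1/s}\Bigl(\sum_{k\ge N}b_k^{-s'}\Bigr)^{1/s'}<\infty\quad\text{for } b_k=\bigl(\alpha^1_k2^{-kn(1/\theta-1/r)}\bigr)^\mu,$$ $$\sup_N\Bigl(\sum_{k\ge N}b_k^s\Bigr)^{1/s}\Bigl(\sum_{k\le N}b_k^{-s'}\Bigr)^{1/s'}<\infty\quad\text{for } b_k=\bigl(2^{-kl}\alpha^2_k\bigr)^\mu .$$ Further, $\{t_k\}$ is a $p$-admissible weight sequence with $\{\overline t_k\}\in X^{\alpha_3}_{\alpha,\sigma,p}$. Theorem. Under these hypotheses: 1) There is $C>0$ such that every $f\in\widetilde B^l_{p,q,r}(\mathbb R^n,\{t_k\})$ is the sum of an $L_r^{\rm loc}(\mathbb R^n)$-convergent series $f=\sum_{k\ge0}\sum_m\beta_{k,m}N^l_{k,m}$ with $\|\beta\|_t\le C\|f\|_{\widetilde B}$; in particular $N(f)\le C\|f\|_{\widetilde B}$. 2) There is $C>0$ such that for every $\beta$ with $\|\beta\|_t<\infty$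 the series $\sum_{k\ge0}\sum_m\beta_{k,m}N^l_{k,m}$ converges in $L_r^{\rm loc}(\mathbb R^n)$ to some $f\in\widetilde B^l_{p,q,r}(\mathbb R^n,\{t_k\})$, and $\|f\|_{\widetilde B}\le C\,N(f)$. -/

import Mathlib

open MeasureTheory Filter Topology
open scoped ENNReal NNReal

namespace VarBesov

noncomputable section

/-! ### Cubes, local Lebesgue classes, sequence quasi-norms

Points of `ℝⁿ` are functions `Fin n → ℝ`, and `volume` is Lebesgue measure.
Quasi-norms take values in `[0,∞]`; an exponent `1/p` is written `(p⁻¹).toReal`,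
which is `0` for `p = ∞`. -/

/-- The open dyadic cube `∏ᵢ (mᵢ / 2ᵏ, (mᵢ + 1) / 2ᵏ)`. -/
def dyadicCube {n : ℕ} (k : ℕ) (m : Fin n → ℤ) : Set (Fin n → ℝ) :=
  Set.univ.pi fun i => Set.Ioo ((m i : ℝ) / 2 ^ k) (((m i : ℝ) + 1) / 2 ^ k)

/-- The half-open dyadic cube `∏ᵢ [mᵢ / 2ᵏ, (mᵢ + 1) / 2ᵏ)`. -/
def dyadicCubeIco {n : ℕ} (k : ℕ) (m : Fin n → ℤ) : Set (Fin n → ℝ) :=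
  Set.univ.pi fun i => Set.Ico ((m i : ℝ) / 2 ^ k) (((m i : ℝ) + 1) / 2 ^ k)

/-- The cube `x + ρ (-1, 1)ⁿ`. -/
def cubeAt {n : ℕ} (x : Fin n → ℝ) (ρ : ℝ) : Set (Fin n → ℝ) :=
  Set.univ.pi fun i => Set.Ioo (x i - ρ) (x i + ρ)

/-- `f ∈ L_r^loc(ℝⁿ)`. -/
def MemLpLoc {n : ℕ} (f : (Fin n → ℝ) → ℝ) (r : ℝ≥0∞) : Prop :=
  ∀ K : Set (Fin n → ℝ), IsCompact K → MemLp f r (volume.restrict K)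

/-- The `l_q` quasi-norm of a family in `[0,∞]` (the supremum for `q = ∞`). -/
def lqNorm {ι : Type} (q : ℝ≥0∞) (a : ι → ℝ≥0∞) : ℝ≥0∞ :=
  if q = ∞ then ⨆ i, a i else (∑' i, a i ^ q.toReal) ^ (1 / q.toReal)

/-! ### Exponents and the conditions for Hardy's inequality -/

/-- The exponent `p_θ = p / θ`, with `p_θ = 1` for `p = θ ∈ (0,∞]`. -/
def ratioExp (p θ : ℝ≥0∞) : ℝ≥0∞ := if p = θ then 1 else p / θ

/-- `sup_N (∑_{k ≤ N} βₖˢ)^{1/s} (∑_{k ≥ N} βₖ^{-s'})^{1/s'} < ∞`. -/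
def HardyTail (s : ℝ≥0∞) (β : ℕ → ℝ) : Prop :=
  (⨆ N : ℕ, lqNorm s (fun k : Set.Iic N => ENNReal.ofReal (β k)) *
    lqNorm s.conjExponent (fun k : Set.Ici N => ENNReal.ofReal (β k)⁻¹)) < ∞

/-- `sup_N (∑_{k ≥ N} βₖˢ)^{1/s} (∑_{k ≤ N} βₖ^{-s'})^{1/s'} < ∞`. -/
def HardyHead (s : ℝ≥0∞) (β : ℕ → ℝ) : Prop :=
  (⨆ N : ℕ, lqNorm s (fun k : Set.Ici N => ENNReal.ofReal (β k)) *
    lqNorm s.conjExponent (fun k : Set.Iic N => ENNReal.ofReal (β k)⁻¹)) < ∞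

/-! ### Weight sequences -/

/-- A `p`-admissible weight sequence: functions in `L_p^loc(ℝⁿ)` (in particular measurable),
positive almost everywhere. -/
def Admissible {n : ℕ} (p : ℝ≥0∞) (t : ℕ → (Fin n → ℝ) → ℝ) : Prop :=
  ∀ k, MemLpLoc (t k) p ∧ ∀ᵐ x, 0 < t k x

/-- `t_{k,m} = ‖t_k | L_p(Q_{k,m})‖`. -/
def weightCoef {n : ℕ} (p : ℝ≥0∞) (t : ℕ → (Fin n → ℝ) → ℝ) (k : ℕ) (m : Fin n → ℤ) : ℝ≥0∞ :=
  eLpNorm (t k) p (volume.restrict (dyadicCube k m))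

/-- The averaged weights `2^{kn/p} ∑_m t_{k,m} χ_{k,m}(x)`, with `χ_{k,m}` the characteristic
function of the half-open dyadic cube. -/
def avgWeight {n : ℕ} (p : ℝ≥0∞) (t : ℕ → (Fin n → ℝ) → ℝ) (k : ℕ) (x : Fin n → ℝ) : ℝ :=
  (2 : ℝ) ^ ((k : ℝ) * n * (p⁻¹).toReal) *
    ∑' m : Fin n → ℤ, (dyadicCubeIco k m).indicator (fun _ => (weightCoef p t k m).toReal) x

/-- The mean `(2^{kn} ∫_{Q_{k,m}} |g|^p)^{1/p}`; the essential supremum over `Q_{k,m}` if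
`p = ∞`. -/
def cubeMean {n : ℕ} (p : ℝ≥0∞) (g : (Fin n → ℝ) → ℝ) (k : ℕ) (m : Fin n → ℤ) : ℝ≥0∞ :=
  ((2 : ℝ≥0∞) ^ (k * n)) ^ (p⁻¹).toReal * eLpNorm g p (volume.restrict (dyadicCube k m))

/-- The weight class `X^{α₃}_{α,σ,p}`, `α = (α¹, α²)`, `σ = (σ₁, σ₂)`. Note that
`(2^{kn} ∫ t^{-σ₁})^{1/σ₁}` is the mean of `1 / t` with exponent `σ₁`. -/
structure WeightClass {n : ℕ} (α₁ α₂ : ℕ → ℝ) (α₃ : ℝ) (σ₁ σ₂ p : ℝ≥0∞)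
    (t : ℕ → (Fin n → ℝ) → ℝ) : Prop where
  admissible : Admissible p t
  lower : ∃ C : ℝ, 0 < C ∧ ∀ k j : ℕ, k ≤ j → ∀ m : Fin n → ℤ,
    cubeMean p (t k) k m * cubeMean σ₁ (fun x => (t j x)⁻¹) k m ≤
      ENNReal.ofReal (C * (α₁ k / α₁ j))
  upper : ∃ C : ℝ, 0 < C ∧ ∀ k j : ℕ, k ≤ j → ∀ m : Fin n → ℤ,
    (cubeMean p (t k) k m)⁻¹ * cubeMean σ₂ (t j) k m ≤ ENNReal.ofReal (C * (α₂ j / α₂ k))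
  neighbours : ∀ (k : ℕ) (m m' : Fin n → ℤ), (∀ i, |m i - m' i| ≤ 1) →
    0 < weightCoef p t k m ∧
      weightCoef p t k m ≤ ENNReal.ofReal ((2 : ℝ) ^ α₃) * weightCoef p t k m'

/-! ### The Besov-type space -/

/-- The difference `Δˡ(h) f(x) = ∑_{i=0}^{l} (-1)^{l+i} C(l,i) f(x + i h)`. -/
def diffOp {n : ℕ} (l : ℕ) (h : Fin n → ℝ) (f : (Fin n → ℝ) → ℝ) (x : Fin n → ℝ) : ℝ :=
  ∑ i ∈ Finset.range (l + 1), (-1 : ℝ) ^ (l + i) * (l.choose i : ℝ) * f (x + (i : ℝ) • h)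

/-- `δ_r^l(x + 2^{-k} Iⁿ) f = (2^{2kn} ∫_{x + 2^{-k} Iⁿ} ∫_{2^{-k} Iⁿ} |Δˡ(h) f(y)|^r dh dy)^{1/r}`,
`Iⁿ = (-1,1)ⁿ`; the essential supremum if `r = ∞`. -/
def localDiff {n : ℕ} (l : ℕ) (r : ℝ≥0∞) (k : ℕ) (f : (Fin n → ℝ) → ℝ) (x : Fin n → ℝ) : ℝ≥0∞ :=
  ((2 : ℝ≥0∞) ^ (2 * k * n)) ^ (r⁻¹).toReal *
    eLpNorm (fun z : (Fin n → ℝ) × (Fin n → ℝ) => diffOp l z.2 f z.1) r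
      ((volume.restrict (cubeAt x ((2 : ℝ) ^ k)⁻¹)).prod
        (volume.restrict (cubeAt 0 ((2 : ℝ) ^ k)⁻¹)))

/-- The quasi-norm of `B̃^l_{p,q,r}(ℝⁿ, {t_k})`. -/
def besovNorm {n : ℕ} (l : ℕ) (p q r : ℝ≥0∞) (t : ℕ → (Fin n → ℝ) → ℝ)
    (f : (Fin n → ℝ) → ℝ) : ℝ≥0∞ :=
  lqNorm q (fun k : ℕ => eLpNorm (fun x => ‖t k x‖ₑ * localDiff l r k f x) p volume) +
    eLpNorm (fun x => ‖t 0 x‖ₑ * eLpNorm f r (volume.restrict (cubeAt x 1))) p volume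

/-- `f ∈ B̃^l_{p,q,r}(ℝⁿ, {t_k})`. -/
def MemBesov {n : ℕ} (l : ℕ) (p q r : ℝ≥0∞) (t : ℕ → (Fin n → ℝ) → ℝ)
    (f : (Fin n → ℝ) → ℝ) : Prop :=
  MemLpLoc f r ∧ besovNorm l p q r t f < ∞

/-! ### Splines -/

/-- The cardinal B-spline `N^l` of degree `l` with knots `0, 1, …, l + 1`, through the
Cox-de Boor recursion. -/
def cardinalBSpline : ℕ → ℝ → ℝ
  | 0, x => (Set.Ico (0 : ℝ) 1).indicator (fun _ => 1) x
  | l + 1, x => x / (l + 1) * cardinalBSpline l x +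
      ((l : ℝ) + 2 - x) / (l + 1) * cardinalBSpline l (x - 1)

/-- The dyadic B-spline `N^l_{k,m}(x) = ∏ᵢ N^l(2ᵏ xᵢ - mᵢ)`. -/
def dyadicBSpline {n : ℕ} (l k : ℕ) (m : Fin n → ℤ) (x : Fin n → ℝ) : ℝ :=
  ∏ i, cardinalBSpline l ((2 : ℝ) ^ k * x i - m i)

/-- The spline `v_k = ∑_m β_{k,m} N^l_{k,m}`; at each point only finitely many terms are
nonzero. -/
def splineLevel {n : ℕ} (l : ℕ) (β : ℕ → (Fin n → ℤ) → ℝ) (k : ℕ) (x : Fin n → ℝ) : ℝ :=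
  ∑' m : Fin n → ℤ, β k m * dyadicBSpline l k m x

/-- The series `∑_{k ≥ 0} ∑_m β_{k,m} N^l_{k,m}` converges to `f` in `L_r^loc(ℝⁿ)`. -/
def SplineSeriesTendsto {n : ℕ} (l : ℕ) (r : ℝ≥0∞) (β : ℕ → (Fin n → ℤ) → ℝ)
    (f : (Fin n → ℝ) → ℝ) : Prop :=
  ∀ K : Set (Fin n → ℝ), IsCompact K →
    Tendsto (fun J : ℕ => eLpNorm (fun x => f x - ∑ k ∈ Finset.range J, splineLevel l β k x) r
      (volume.restrict K)) atTop (𝓝 0)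

/-- `(∑_k (∑_m t_{k,m}^p |β_{k,m}|^p)^{q/p})^{1/q}`, with suprema if `p = ∞` or `q = ∞`. -/
def coefNorm {n : ℕ} (p q : ℝ≥0∞) (t : ℕ → (Fin n → ℝ) → ℝ)
    (β : ℕ → (Fin n → ℤ) → ℝ) : ℝ≥0∞ :=
  lqNorm q (fun k : ℕ => lqNorm p (fun m : Fin n → ℤ => weightCoef p t k m * ‖β k m‖ₑ))

/-- `N(f, l, {t_k})`: the infimum of the coefficient quasi-norm over all series of splines that
converge to `f` in `L_r^loc(ℝⁿ)`. -/
def splineNorm {n : ℕ} (l : ℕ) (p q r : ℝ≥0∞) (t : ℕ → (Fin n → ℝ) → ℝ)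
    (f : (Fin n → ℝ) → ℝ) : ℝ≥0∞ :=
  ⨅ (β : ℕ → (Fin n → ℤ) → ℝ) (_ : SplineSeriesTendsto l r β f), coefNorm p q t β

end

end VarBesov

open VarBesov

namespace VarBesov

/-! ### Mixed quasi-norms -/

section Norms

variable {α : Type*} [MeasurableSpace α] {μ : Measure α} {ι κ : Type}

/-! The weights enter only through the numbers `weightCoef p t k m`. The averaged weights are
constant on dyadic cubes, so the two integral conditions of the weight class become inequalities
between a cube and its descendants. Hardy's conditions force geometric growth
(`exists_geometric_of_hardy`) and therefore contribute a factor `ρ ^ d` with `ρ < 1` for every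
passage across `d` levels. The outcome, `exists_coefWeight`, is the structure `CoefWeight`. Its
field `fine` bounds an `l_r` sum over descendants by a weighted `l_p` sum. Its field `coarse` says
that the weights of the descendants grow more slowly than `2 ^ (l * d)`. All later estimates use
these properties alone.

From splines to functions. A spline of level `k` has small differences at every level `j` far from
`k` (`CoefWeight.exists_cubeDiff_splineOf_le`). If `k ≥ j`, the spline itself is bounded by means of
`fine`. If `k < j`, a difference of order `l` of a B-spline of degree `l` gains `2 ^ (-l (j - k))`,
and this outweighs the growth in `coarse`. Summation over `k` is a discrete convolution with `ρ ^ |k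
- j|`. Exponents below one are allowed, so sums are estimated in `l_κ` with `κ ≤ min(1, p, q, r)`,
where Minkowski's inequality is available; in the end `κ = μ`.

From functions to splines. On each dyadic cube a polynomial of degree less than `l` in each variable
is needed whose distance from `f` is controlled by the differences of `f` at all finer scales. This
is Whitney's estimate, `exists_mem_polySpace_eLpNorm_sub_le`, proved for every `r > 0` by multiscale
interpolation. One interpolates `f` near `x` on the lattice `a + 2⁻ʲ ℤⁿ`. Passing from `j` to `j +
1` changes the value at `x` by at most a sum of differences along the lattice. As `j` grows the
values tend to `f x` along a subsequence, for almost every pair `(x, a)`. Integration over `a` turns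
the lattice differences into `L_r` quasi-norms of differences with a fixed step, and some `a` is at
least as good as the average. Differences with a fixed step are bounded by averaged ones through the
identity `diffOp_eq_sum_diffOp`.

The local polynomials are turned into splines by quasi-interpolation weights that reproduce
polynomials and commute with refinement (`exists_weights`). A spline of level `k` is also a spline
of level `k + 1`, so consecutive splines have increments, and the required series is the series of
increments. Near a given cube all local polynomials differ by no more than the approximation errors,
hence so do the coefficients of the increments, and `fine` makes the remainders tend to zero.

The bound by the infimum over all representations follows because the estimate holds for each of
them and limits in `L_r^loc` are unique almost everywhere. -/

theorem eLpNorm_tsum_le [Countable ι] {r : ℝ≥0∞} (hr : 1 ≤ r) {g : ι → α → ℝ≥0∞}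
    (hg : ∀ j, AEMeasurable (g j) μ) :
    eLpNorm (fun x => ∑' j, g j x) r μ ≤ ∑' j, eLpNorm (g j) r μ := by
  rcases eq_or_ne r ∞ with rfl | hrt
  · rw [eLpNorm_exponent_top]
    refine essSup_le_of_ae_le _ ?_
    have h : ∀ᵐ x ∂μ, ∀ j, g j x ≤ eLpNorm (g j) ∞ μ := by
      rw [ae_all_iff]
      intro j
      rw [eLpNorm_exponent_top]
      filter_upwards [enorm_ae_le_eLpNormEssSup (g j) μ] with x hx using by simpa using hx
    filter_upwards [h] with x hx
    simpa using ENNReal.tsum_le_tsum hx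
  have hr0 : r ≠ 0 := (zero_lt_one.trans_le hr).ne'
  have hrp : 0 < r.toReal := ENNReal.toReal_pos hr0 hrt
  have hfin : ∀ s : Finset ι, (∫⁻ x, (∑ j ∈ s, g j x) ^ r.toReal ∂μ) ≤
      (∑' j, eLpNorm (g j) r μ) ^ r.toReal := by
    intro s
    have h1 : eLpNorm (∑ j ∈ s, g j) r μ ≤ ∑ j ∈ s, eLpNorm (g j) r μ :=
      eLpNorm_sum_le (fun j _ => (hg j).aestronglyMeasurable) hr
    rw [eLpNorm_eq_lintegral_rpow_enorm_toReal hr0 hrt] at h1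
    have h2 := ENNReal.rpow_le_rpow (h1.trans (ENNReal.sum_le_tsum s)) hrp.le
    rw [← ENNReal.rpow_mul, one_div_mul_cancel hrp.ne', ENNReal.rpow_one] at h2
    simpa using h2
  rw [eLpNorm_eq_lintegral_rpow_enorm_toReal hr0 hrt]
  -- Monotone convergence along the directed family of finite subsets. This family is countable
  -- because the index type is.
  have hsup : (∫⁻ x, ‖∑' j, g j x‖ₑ ^ r.toReal ∂μ) =
      ⨆ s : Finset ι, ∫⁻ x, (∑ j ∈ s, g j x) ^ r.toReal ∂μ := by
    rw [← lintegral_iSup_directed]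
    · refine lintegral_congr fun x => ?_
      rw [enorm_eq_self, ENNReal.tsum_eq_iSup_sum]
      exact (ENNReal.orderIsoRpow _ hrp).map_iSup _
    · intro s
      exact (Finset.aemeasurable_fun_sum s fun j _ => hg j).pow_const _
    · refine Monotone.directed_le fun s t hst x => ?_
      exact ENNReal.rpow_le_rpow (Finset.sum_le_sum_of_subset hst) hrp.le
  rw [hsup, one_div, ENNReal.rpow_inv_le_iff hrp]
  exact iSup_le hfin

theorem lqNorm_eq_tsum {q : ℝ≥0∞} (hq : q ≠ ∞) (a : ι → ℝ≥0∞) :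
    lqNorm q a = (∑' i, a i ^ q.toReal) ^ (1 / q.toReal) := if_neg hq

theorem lqNorm_top (a : ι → ℝ≥0∞) : lqNorm ∞ a = ⨆ i, a i := if_pos rfl

/-- Minkowski's inequality for mixed quasi-norms. -/
theorem eLpNorm_lqNorm_le [Countable ι] {k r : ℝ≥0∞} (hk : k ≠ 0) (hkt : k ≠ ∞) (hkr : k ≤ r)
    {g : ι → α → ℝ≥0∞} (hg : ∀ j, AEMeasurable (g j) μ) :
    eLpNorm (fun x => lqNorm k fun j => g j x) r μ ≤ lqNorm k fun j => eLpNorm (g j) r μ := by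
  have hkp : 0 < k.toReal := ENNReal.toReal_pos hk hkt
  have hkr' : ENNReal.ofReal k.toReal = k := ENNReal.ofReal_toReal hkt
  have hinv : ENNReal.ofReal (1 / k.toReal) = k⁻¹ := by
    rw [one_div, ENNReal.ofReal_inv_of_pos hkp, hkr']
  simp only [lqNorm_eq_tsum hkt]
  -- Taking `k`-th powers replaces the exponent `r` by `r / k ≥ 1`, where the ordinary Minkowski
  -- inequality holds.
  have h1 := eLpNorm_enorm_rpow (p := r) (μ := μ) (fun x => ∑' j, g j x ^ k.toReal)
    (one_div_pos.2 hkp)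
  simp only [enorm_eq_self, hinv] at h1
  rw [h1]
  refine ENNReal.rpow_le_rpow ?_ (by positivity)
  refine (eLpNorm_tsum_le ?_ fun j => (hg j).pow_const _).trans ?_
  · rw [← ENNReal.mul_inv_cancel hk hkt]; gcongr
  · refine ENNReal.tsum_le_tsum fun j => ?_
    have h2 := eLpNorm_enorm_rpow (p := r * k⁻¹) (μ := μ) (g j) hkp
    simp only [enorm_eq_self, hkr'] at h2
    rw [h2, mul_assoc, ENNReal.inv_mul_cancel hk hkt, mul_one]

/-- Counting measure makes families a special case of functions, so inequalities for integrals apply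
to families without a second proof. -/
theorem lqNorm_eq_eLpNorm_count [MeasurableSpace ι] [DiscreteMeasurableSpace ι] {q : ℝ≥0∞}
    (hq : q ≠ 0) (a : ι → ℝ≥0∞) : lqNorm q a = eLpNorm a q Measure.count := by
  rcases eq_or_ne q ∞ with rfl | hqt
  · rw [lqNorm_top, eLpNorm_exponent_top, eLpNormEssSup, essSup_eq_iSup]
    · simp
    · intro i; simp
  · rw [lqNorm_eq_tsum hqt, eLpNorm_eq_lintegral_rpow_enorm_toReal hq hqt, lintegral_count]
    simp

theorem lqNorm_lqNorm_le [Countable ι] {k r : ℝ≥0∞} (hk : k ≠ 0) (hkt : k ≠ ∞) (hkr : k ≤ r)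
    (g : ι → κ → ℝ≥0∞) :
    (lqNorm r fun x => lqNorm k fun j => g j x) ≤ lqNorm k fun j => lqNorm r (g j) := by
  have hr : r ≠ 0 := (hk.bot_lt.trans_le hkr).ne'
  let _ : MeasurableSpace κ := ⊤
  have : DiscreteMeasurableSpace κ := ⟨fun _ => trivial⟩
  simp only [lqNorm_eq_eLpNorm_count (ι := κ) hr]
  exact eLpNorm_lqNorm_le hk hkt hkr fun j => (Measurable.of_discrete (f := g j)).aemeasurable

theorem lqNorm_mono {q : ℝ≥0∞} {a b : ι → ℝ≥0∞} (h : ∀ i, a i ≤ b i) :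
    lqNorm q a ≤ lqNorm q b := by
  rcases eq_or_ne q ∞ with rfl | hqt
  · simp only [lqNorm_top]; exact iSup_mono h
  · simp only [lqNorm_eq_tsum hqt]
    gcongr with i
    exact h i

theorem lqNorm_const_mul {q : ℝ≥0∞} (hq : q ≠ 0) (c : ℝ≥0∞) (a : ι → ℝ≥0∞) :
    (lqNorm q fun i => c * a i) = c * lqNorm q a := by
  rcases eq_or_ne q ∞ with rfl | hqt
  · simp only [lqNorm_top, ENNReal.mul_iSup]
  · have hqp : 0 < q.toReal := ENNReal.toReal_pos hq hqt
    simp only [lqNorm_eq_tsum hqt]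
    simp_rw [ENNReal.mul_rpow_of_nonneg _ _ hqp.le]
    rw [ENNReal.tsum_mul_left, ENNReal.mul_rpow_of_nonneg _ _ (by positivity),
      ← ENNReal.rpow_mul, mul_one_div_cancel hqp.ne', ENNReal.rpow_one]

theorem le_lqNorm {q : ℝ≥0∞} (hq : q ≠ 0) (a : ι → ℝ≥0∞) (i : ι) : a i ≤ lqNorm q a := by
  rcases eq_or_ne q ∞ with rfl | hqt
  · rw [lqNorm_top]; exact le_iSup a i
  · have hqp : 0 < q.toReal := ENNReal.toReal_pos hq hqt
    rw [lqNorm_eq_tsum hqt, one_div, ENNReal.le_rpow_inv_iff hqp]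
    exact ENNReal.le_tsum (f := fun i => a i ^ q.toReal) i

theorem lqNorm_comp_le {q : ℝ≥0∞} {e : κ → ι} (he : Function.Injective e) (a : ι → ℝ≥0∞) :
    (lqNorm q fun i => a (e i)) ≤ lqNorm q a := by
  rcases eq_or_ne q ∞ with rfl | hqt
  · simp only [lqNorm_top]; exact iSup_comp_le a e
  · simp only [lqNorm_eq_tsum hqt]
    gcongr
    exact ENNReal.tsum_comp_le_tsum_of_injective he fun i => a i ^ q.toReal

/-- Split `a ^ q = a ^ p * a ^ (q - p)` and bound the second factor by the `l_p` quasi-norm. -/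
theorem lqNorm_anti {p q : ℝ≥0∞} (hp : p ≠ 0) (hpq : p ≤ q) (a : ι → ℝ≥0∞) :
    lqNorm q a ≤ lqNorm p a := by
  have hq : q ≠ 0 := (hp.bot_lt.trans_le hpq).ne'
  rcases eq_or_ne q ∞ with rfl | hqt
  · rw [lqNorm_top]; exact iSup_le fun i => le_lqNorm hp a i
  have hpt : p ≠ ∞ := (hpq.trans_lt hqt.lt_top).ne
  have hpp : 0 < p.toReal := ENNReal.toReal_pos hp hpt
  have hqp : 0 < q.toReal := ENNReal.toReal_pos hq hqt
  have hle : p.toReal ≤ q.toReal := ENNReal.toReal_mono hqt hpq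
  rw [lqNorm_eq_tsum hqt, one_div, ENNReal.rpow_inv_le_iff hqp]
  have hsplit : q.toReal = p.toReal + (q.toReal - p.toReal) := by ring
  set S := lqNorm p a with hS
  have hS' : S ^ p.toReal = ∑' i, a i ^ p.toReal := by
    rw [hS, lqNorm_eq_tsum hpt, ← ENNReal.rpow_mul, one_div_mul_cancel hpp.ne', ENNReal.rpow_one]
  calc ∑' i, a i ^ q.toReal
      ≤ ∑' i, a i ^ p.toReal * S ^ (q.toReal - p.toReal) := by
        refine ENNReal.tsum_le_tsum fun i => ?_
        conv_lhs => rw [hsplit]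
        rw [ENNReal.rpow_add_of_nonneg _ _ hpp.le (by linarith)]
        gcongr
        exact le_lqNorm hp a i
    _ = S ^ q.toReal := by
        rw [ENNReal.tsum_mul_right, ← hS', ← ENNReal.rpow_add_of_nonneg _ _ hpp.le (by linarith)]
        congr 1; ring

theorem sum_le_lqNorm {k : ℝ≥0∞} (hk : k ≠ 0) (hk1 : k ≤ 1) (a : ι → ℝ≥0∞) :
    ∑' i, a i ≤ lqNorm k a := by
  have := lqNorm_anti hk hk1 a
  simpa [lqNorm_eq_tsum] using this

theorem lqNorm_fintype_le [Fintype ι] {k : ℝ≥0∞} (hk : k ≠ 0) (a : ι → ℝ≥0∞) {c : ℝ≥0∞}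
    (h : ∀ i, a i ≤ c) : lqNorm k a ≤ (Fintype.card ι : ℝ≥0∞) ^ (k⁻¹).toReal * c := by
  rcases eq_or_ne k ∞ with rfl | hkt
  · rw [lqNorm_top]; simpa using h
  · have hkp : 0 < k.toReal := ENNReal.toReal_pos hk hkt
    rw [lqNorm_eq_tsum hkt, tsum_fintype, ENNReal.toReal_inv, one_div]
    calc (∑ i, a i ^ k.toReal) ^ k.toReal⁻¹ ≤ (∑ _i : ι, c ^ k.toReal) ^ k.toReal⁻¹ := by
          gcongr with i; exact h i
      _ = _ := by
          rw [Finset.sum_const, nsmul_eq_mul, ENNReal.mul_rpow_of_nonneg _ _ (by positivity),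
            ← ENNReal.rpow_mul, mul_inv_cancel₀ hkp.ne', ENNReal.rpow_one]; rfl

theorem lqNorm_congr_equiv {q : ℝ≥0∞} (e : κ ≃ ι) (a : ι → ℝ≥0∞) :
    (lqNorm q fun i => a (e i)) = lqNorm q a := by
  refine le_antisymm (lqNorm_comp_le e.injective a) ?_
  have := lqNorm_comp_le (q := q) e.symm.injective fun i => a (e i)
  simpa using this

/-- Used with the fibres of `parent d`: a quasi-norm over small cubes is computed by grouping them
according to their ancestors. -/
theorem lqNorm_fiberwise {q : ℝ≥0∞} (hq : q ≠ 0) (f : κ → ι) (a : κ → ℝ≥0∞) :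
    (lqNorm q fun i => lqNorm q fun x : {x // f x = i} => a x) = lqNorm q a := by
  rw [← lqNorm_congr_equiv (Equiv.sigmaFiberEquiv f) a]
  rcases eq_or_ne q ∞ with rfl | hqt
  · simp only [lqNorm_top, iSup_sigma]; rfl
  · have hqp : 0 < q.toReal := ENNReal.toReal_pos hq hqt
    simp only [lqNorm_eq_tsum hqt, ← ENNReal.rpow_mul, one_div_mul_cancel hqp.ne',
      ENNReal.rpow_one]
    rw [ENNReal.tsum_sigma']; rfl

/-- Quasi-triangle inequality for finite sums. -/
theorem exists_eLpNorm_sum_le [Fintype ι] {r : ℝ≥0∞} (hr : r ≠ 0) :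
    ∃ C : ℝ≥0∞, C ≠ ∞ ∧ ∀ {β : Type} [MeasurableSpace β] (ν : Measure β) (g : ι → β → ℝ≥0∞),
      (∀ j, AEMeasurable (g j) ν) →
      eLpNorm (fun x => ∑ j, g j x) r ν ≤ C * ∑ j, eLpNorm (g j) r ν := by
  -- With this exponent the sum is at most the `l_k` quasi-norm and Minkowski's inequality applies.
  -- Replacing the finitely many terms by their sum costs the cardinality to the power `1/k`.
  set k := min 1 r with hkd
  have hk : k ≠ 0 := by
    rw [hkd]; exact (lt_min zero_lt_one hr.bot_lt).ne'
  have hk1 : k ≤ 1 := min_le_left _ _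
  have hkt : k ≠ ∞ := (hk1.trans_lt ENNReal.one_lt_top).ne
  refine ⟨(Fintype.card ι : ℝ≥0∞) ^ (k⁻¹).toReal, by finiteness, fun ν g hg => ?_⟩
  calc eLpNorm (fun x => ∑ j, g j x) r ν ≤ eLpNorm (fun x => lqNorm k fun j => g j x) r ν := by
        refine eLpNorm_mono_enorm fun x => ?_
        simp only [enorm_eq_self]
        have := sum_le_lqNorm hk hk1 fun j => g j x
        rwa [tsum_fintype] at this
    _ ≤ lqNorm k fun j => eLpNorm (g j) r ν := eLpNorm_lqNorm_le hk hkt (min_le_right _ _) hg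
    _ ≤ _ := lqNorm_fintype_le hk _ fun j =>
        Finset.single_le_sum (f := fun j => eLpNorm (g j) r ν) (fun _ _ => bot_le)
          (Finset.mem_univ j)

theorem exists_lqNorm_sum_le [Fintype ι] {r : ℝ≥0∞} (hr : r ≠ 0) :
    ∃ C : ℝ≥0∞, C ≠ ∞ ∧ ∀ {κ : Type} (g : ι → κ → ℝ≥0∞),
      (lqNorm r fun x => ∑ j, g j x) ≤ C * ∑ j, lqNorm r (g j) := by
  obtain ⟨C, hC, h⟩ := exists_eLpNorm_sum_le (ι := ι) hr
  refine ⟨C, hC, fun {κ} g => ?_⟩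
  let _ : MeasurableSpace κ := ⊤
  have : DiscreteMeasurableSpace κ := ⟨fun _ => trivial⟩
  simp only [lqNorm_eq_eLpNorm_count (ι := κ) hr]
  exact h _ g fun j => (Measurable.of_discrete (f := g j)).aemeasurable

/-- Decomposition of an `L_r` quasi-norm along a countable measurable partition; no measurability
of the function is needed. -/
theorem eLpNorm_eq_lqNorm_restrict [Countable ι] {E : Type*} [ENorm E] {r : ℝ≥0∞} (hr : r ≠ 0)
    (g : α → E) {A : ι → Set α} (hA : ∀ i, MeasurableSet (A i))
    (hd : Pairwise fun i j => Disjoint (A i) (A j)) {S : Set α} (hS : S = ⋃ i, A i) :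
    eLpNorm g r (μ.restrict S) = lqNorm r fun i => eLpNorm g r (μ.restrict (A i)) := by
  subst hS
  rcases eq_or_ne r ∞ with rfl | hrt
  · simp only [lqNorm_top, eLpNorm_exponent_top]
    refine le_antisymm ?_ (iSup_le fun i => ?_)
    · refine essSup_le_of_ae_le _ ?_
      rw [Filter.EventuallyLE, ae_restrict_iUnion_iff]
      intro i
      filter_upwards [enorm_ae_le_eLpNormEssSup g (μ.restrict (A i))] with x hx
      exact hx.trans (le_iSup (fun i => eLpNormEssSup g (μ.restrict (A i))) i)
    · exact essSup_mono_measure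
        (Measure.restrict_mono (Set.subset_iUnion A i) le_rfl).absolutelyContinuous
  · have hrp : 0 < r.toReal := ENNReal.toReal_pos hr hrt
    simp only [lqNorm_eq_tsum hrt, eLpNorm_eq_lintegral_rpow_enorm_toReal hr hrt,
      ← ENNReal.rpow_mul, one_div_mul_cancel hrp.ne', ENNReal.rpow_one]
    rw [lintegral_iUnion hA hd]

/-- Subadditivity of the integral over a finite cover. Overlaps are harmless, and neither the sets
nor the function have to be measurable. -/
theorem exists_eLpNorm_restrict_iUnion_le [Fintype ι] {r : ℝ≥0∞} (hr : r ≠ 0) :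
    ∃ C : ℝ≥0∞, C ≠ ∞ ∧ ∀ {β : Type} [MeasurableSpace β] (ν : Measure β) {E : Type} [ENorm E]
      (g : β → E) (A : ι → Set β) (S : Set β), S ⊆ ⋃ i, A i →
      eLpNorm g r (ν.restrict S) ≤ C * ∑ i, eLpNorm g r (ν.restrict (A i)) := by
  refine ⟨(Fintype.card ι : ℝ≥0∞) ^ (r⁻¹).toReal, by finiteness, fun ν E _ g A S hS => ?_⟩
  refine le_trans ?_ (lqNorm_fintype_le hr _ fun j =>
        Finset.single_le_sum (f := fun j => eLpNorm g r (ν.restrict (A j)))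
          (fun _ _ => bot_le) (Finset.mem_univ j))
  rcases eq_or_ne r ∞ with rfl | hrt
  · simp only [lqNorm_top, eLpNorm_exponent_top]
    refine essSup_le_of_ae_le _ (ae_restrict_of_ae_restrict_of_subset hS ?_)
    rw [ae_restrict_iUnion_iff]
    intro i
    filter_upwards [enorm_ae_le_eLpNormEssSup g (ν.restrict (A i))] with x hx
    exact hx.trans (le_iSup (fun i => eLpNormEssSup g (ν.restrict (A i))) i)
  · have hrp : 0 < r.toReal := ENNReal.toReal_pos hr hrt
    simp only [lqNorm_eq_tsum hrt, eLpNorm_eq_lintegral_rpow_enorm_toReal hr hrt,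
      ← ENNReal.rpow_mul, one_div_mul_cancel hrp.ne', ENNReal.rpow_one]
    gcongr
    exact (lintegral_mono_set hS).trans (lintegral_iUnion_le _ _)

/-- Hölder's inequality for counting measure. If one of the exponents on the right is infinite, that
factor is simply replaced by its supremum. -/
theorem lqNorm_mul_le {p q r : ℝ≥0∞} (hp : p ≠ 0) (hq : q ≠ 0) (hr : r ≠ 0)
    (h : r⁻¹ = p⁻¹ + q⁻¹) (a b : ι → ℝ≥0∞) :
    (lqNorm r fun i => a i * b i) ≤ lqNorm p a * lqNorm q b := by
  rcases eq_or_ne p ∞ with rfl | hpt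
  · have : r = q := by simpa using h
    subst this
    rw [← lqNorm_const_mul hr]
    exact lqNorm_mono fun i => by gcongr; exact le_lqNorm (by simp) a i
  rcases eq_or_ne q ∞ with rfl | hqt
  · have : r = p := by simpa using h
    subst this
    rw [mul_comm, ← lqNorm_const_mul hr]
    exact lqNorm_mono fun i => by rw [mul_comm]; gcongr; exact le_lqNorm (by simp) b i
  have hrt : r ≠ ∞ := by
    rintro rfl
    simp only [ENNReal.inv_top] at h
    exact hpt (by simpa using (add_eq_zero.1 h.symm).1)
  have hpp : 0 < p.toReal := ENNReal.toReal_pos hp hpt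
  have hqp : 0 < q.toReal := ENNReal.toReal_pos hq hqt
  have hrp : 0 < r.toReal := ENNReal.toReal_pos hr hrt
  have h' : 1 / r.toReal = 1 / p.toReal + 1 / q.toReal := by
    have := congrArg ENNReal.toReal h
    rwa [ENNReal.toReal_add (by simpa) (by simpa), ENNReal.toReal_inv, ENNReal.toReal_inv,
      ENNReal.toReal_inv, ← one_div, ← one_div, ← one_div] at this
  let _ : MeasurableSpace ι := ⊤
  have := ENNReal.lintegral_Lp_mul_le_Lq_mul_Lr (p := r.toReal) (q := p.toReal) (r := q.toReal) hrp
    (by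
      rw [← one_div_lt_one_div hpp hrp, h']
      have : 0 < 1 / q.toReal := by positivity
      linarith) h' (@Measure.count ι ⊤)
    (measurable_from_top (f := a)).aemeasurable (measurable_from_top (f := b)).aemeasurable
  simpa [lintegral_count, lqNorm_eq_tsum, hpt, hqt, hrt] using this

end Norms

/-! ### Geometric weights and Hardy's condition -/

section Hardy

variable {ι κ : Type}

theorem lqNorm_geometric_ne_top {k ρ : ℝ≥0∞} (hk : k ≠ 0) (hkt : k ≠ ∞) (hρ : ρ < 1) :
    (lqNorm k fun d : ℤ => ρ ^ d.natAbs) ≠ ∞ := by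
  have hkp : 0 < k.toReal := ENNReal.toReal_pos hk hkt
  have hlt : ρ ^ k.toReal < 1 := ENNReal.rpow_lt_one hρ hkp
  obtain ⟨s, hs⟩ : ∃ s : ℝ≥0, (s : ℝ≥0∞) = ρ ^ k.toReal :=
    ⟨_, ENNReal.coe_toNNReal (hlt.trans ENNReal.one_lt_top).ne⟩
  have hs1 : s < 1 := by rw [← hs] at hlt; exact_mod_cast hlt
  rw [lqNorm_eq_tsum hkt]
  refine ENNReal.rpow_ne_top_of_nonneg (by positivity) ?_
  have : ∀ d : ℤ, (ρ ^ d.natAbs) ^ k.toReal = ((s ^ d.natAbs : ℝ≥0) : ℝ≥0∞) := by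
    intro d
    rw [← ENNReal.rpow_natCast, ← ENNReal.rpow_mul, mul_comm, ENNReal.rpow_mul, ← hs,
      ENNReal.rpow_natCast, ENNReal.coe_pow]
  simp_rw [this]
  rw [ENNReal.tsum_coe_ne_top_iff_summable, ← NNReal.summable_coe]
  push_cast
  refine Summable.of_nat_of_neg ?_ ?_ <;>
  simpa using (NNReal.summable_coe.2 (NNReal.summable_geometric hs1))

/-- Discrete convolution with a geometric kernel. -/
theorem lqNorm_le_of_geometric {k q ρ : ℝ≥0∞} (hk : k ≠ 0) (hkt : k ≠ ∞) (hkq : k ≤ q)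
    {A X : ℕ → ℝ≥0∞} {K : ℝ≥0∞}
    (h : ∀ i, X i ≤ K * lqNorm k fun j : ℕ => ρ ^ ((j : ℤ) - i).natAbs * A j) :
    lqNorm q X ≤ K * ((lqNorm k fun d : ℤ => ρ ^ d.natAbs) * lqNorm q A) := by
  have hq : q ≠ 0 := (hk.bot_lt.trans_le hkq).ne'
  -- Extension by zero to all integers turns the sum into a genuine convolution over shifts `d`.
  -- Minkowski's inequality then moves the outer quasi-norm inside the sum over `d`, where shifting
  -- does not increase it.
  set A' : ℤ → ℝ≥0∞ := fun j => if 0 ≤ j then A j.toNat else 0 with hA'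
  have hA0 : ∀ j : ℕ, A' j = A j := fun j => by simp [hA']
  have hAle : ∀ d : ℤ, (lqNorm q fun i : ℕ => A' (d + i)) ≤ lqNorm q A := by
    intro d
    have h1 : (lqNorm q fun i : ℕ => A' (d + i)) ≤ lqNorm q A' :=
      lqNorm_comp_le (e := fun i : ℕ => d + (i : ℤ)) (fun a b hab => by simpa using hab) A'
    refine h1.trans ?_
    rcases eq_or_ne q ∞ with rfl | hqt
    · simp only [lqNorm_top]
      refine iSup_le fun j => ?_
      simp only [hA']
      split_ifs
      · exact le_iSup A _
      · exact bot_le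
    · have hqp : 0 < q.toReal := ENNReal.toReal_pos hq hqt
      simp only [lqNorm_eq_tsum hqt]
      gcongr
      refine le_of_eq ?_
      rw [← Function.Injective.tsum_eq (g := fun j : ℕ => (j : ℤ)) Nat.cast_injective]
      · simp [hA0]
      · intro j hj
        have : 0 ≤ j := by
          by_contra hneg
          simp [hA', hneg, hqp] at hj
        exact ⟨j.toNat, by simp [this]⟩
  calc lqNorm q X
      ≤ lqNorm q fun i : ℕ => K * lqNorm k fun d : ℤ => ρ ^ d.natAbs * A' (d + i) := by
        refine lqNorm_mono fun i => (h i).trans ?_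
        gcongr
        have := lqNorm_comp_le (q := k) (e := fun j : ℕ => (j : ℤ) - i)
          (fun a b hab => by simpa using hab) fun d : ℤ => ρ ^ d.natAbs * A' (d + i)
        simpa [hA0] using this
    _ = K * lqNorm q fun i : ℕ => lqNorm k fun d : ℤ => ρ ^ d.natAbs * A' (d + i) :=
        lqNorm_const_mul hq _ _
    _ ≤ K * lqNorm k fun d : ℤ => lqNorm q fun i : ℕ => ρ ^ d.natAbs * A' (d + i) := by
        gcongr; exact lqNorm_lqNorm_le hk hkt hkq _
    _ ≤ K * lqNorm k fun d : ℤ => lqNorm q A * ρ ^ d.natAbs := by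
        gcongr
        refine lqNorm_mono fun d => ?_
        rw [lqNorm_const_mul hq, mul_comm]
        gcongr
        exact hAle d
    _ = _ := by rw [lqNorm_const_mul hk, mul_comm (lqNorm q A)]

/-- The partial sums satisfy `T (N + 1) ≤ (M + 1) * b (N + 1)`, so dropping the last term shrinks
them by the factor `1 - 1 / (M + 1)`; iterate. Enlarging `M` to `M + 1` keeps this ratio positive.
-/
theorem exists_geometric_of_head_sum {b : ℕ → ℝ} (hb : ∀ k, 0 < b k) {M : ℝ}
    (h : ∀ N, ∑ k ∈ Finset.range (N + 1), b k ≤ M * b N) :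
    ∃ C ρ : ℝ, 0 < C ∧ 0 < ρ ∧ ρ < 1 ∧ ∀ j d, b j ≤ C * ρ ^ d * b (j + d) := by
  have hM : 1 ≤ M := by
    have := h 0
    simp only [zero_add, Finset.sum_range_one] at this
    nlinarith [hb 0]
  have hK : (0 : ℝ) < M + 1 := by linarith
  set ρ := 1 - 1 / (M + 1) with hρ
  have hρ0 : 0 < ρ := by
    have : 1 / (M + 1) < 1 := by rw [div_lt_one hK]; linarith
    linarith
  have hρ1 : ρ < 1 := by
    have : 0 < 1 / (M + 1) := by positivity
    linarith
  set T : ℕ → ℝ := fun N => ∑ k ∈ Finset.range (N + 1), b k with hT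
  have hstep : ∀ N, T N ≤ ρ * T (N + 1) := by
    intro N
    have h1 : T (N + 1) = T N + b (N + 1) := Finset.sum_range_succ _ _
    have h2 : T (N + 1) ≤ (M + 1) * b (N + 1) := by
      have := h (N + 1); have := hb (N + 1); simp only [hT]; nlinarith
    have h3 : 1 / (M + 1) * T (N + 1) ≤ b (N + 1) := by
      rw [one_div, inv_mul_le_iff₀ hK]; exact h2
    rw [hρ]; nlinarith
  have hiter : ∀ j d, T j ≤ ρ ^ d * T (j + d) := by
    intro j d
    induction d with
    | zero => simp
    | succ d ih =>
      refine ih.trans ?_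
      rw [pow_succ, mul_assoc]
      gcongr
      exact hstep (j + d)
  refine ⟨M, ρ, by linarith, hρ0, hρ1, fun j d => ?_⟩
  calc b j ≤ T j := Finset.single_le_sum (f := b) (fun k _ => (hb k).le) (by simp)
    _ ≤ ρ ^ d * T (j + d) := hiter j d
    _ ≤ ρ ^ d * (M * b (j + d)) := by gcongr; exact h _
    _ = _ := by ring

/-- The mirror image of the previous argument: here it is the tails of the series that shrink by a
fixed factor when their first term is removed. The uniform bound on finite sums provides
convergence. -/
theorem exists_geometric_of_tail_sum {u : ℕ → ℝ} (hu : ∀ k, 0 < u k) {M : ℝ}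
    (h : ∀ N L, ∑ k ∈ Finset.range L, u (N + k) ≤ M * u N) :
    ∃ C ρ : ℝ, 0 < C ∧ 0 < ρ ∧ ρ < 1 ∧ ∀ j d, u (j + d) ≤ C * ρ ^ d * u j := by
  have hM : 1 ≤ M := by
    have := h 0 1
    simp only [zero_add, Finset.sum_range_one] at this
    nlinarith [hu 0]
  have hK : (0 : ℝ) < M + 1 := by linarith
  set ρ := 1 - 1 / (M + 1) with hρ
  have hρ0 : 0 < ρ := by
    have : 1 / (M + 1) < 1 := by rw [div_lt_one hK]; linarith
    linarith
  have hρ1 : ρ < 1 := by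
    have : 0 < 1 / (M + 1) := by positivity
    linarith
  have hs : ∀ N, Summable fun k => u (N + k) := fun N =>
    summable_of_sum_range_le (fun k => (hu _).le) (h N)
  set T : ℕ → ℝ := fun N => ∑' k, u (N + k) with hT
  have hTle : ∀ N, T N ≤ M * u N := fun N =>
    Real.tsum_le_of_sum_range_le (fun k => (hu _).le) (h N)
  have huT : ∀ N, u N ≤ T N := fun N => by
    simpa using (hs N).le_tsum 0 fun k _ => (hu _).le
  have hstep : ∀ N, T (N + 1) ≤ ρ * T N := by
    intro N
    have h1 : T N = u N + T (N + 1) := by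
      simp only [hT]
      rw [(hs N).tsum_eq_zero_add]
      simp only [add_zero]
      congr 1
      exact tsum_congr fun k => by congr 1; ring
    have h2 : T N ≤ (M + 1) * u N := by
      have := hTle N; have := hu N; nlinarith
    have h3 : 1 / (M + 1) * T N ≤ u N := by
      rw [one_div, inv_mul_le_iff₀ hK]; exact h2
    rw [hρ]; nlinarith
  have hiter : ∀ j d, T (j + d) ≤ ρ ^ d * T j := by
    intro j d
    induction d with
    | zero => simp
    | succ d ih =>
      calc T (j + (d + 1)) ≤ ρ * T (j + d) := hstep (j + d)
        _ ≤ ρ * (ρ ^ d * T j) := by gcongr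
        _ = _ := by ring
  refine ⟨M, ρ, by linarith, hρ0, hρ1, fun j d => ?_⟩
  calc u (j + d) ≤ T (j + d) := huT _
    _ ≤ ρ ^ d * T j := hiter j d
    _ ≤ ρ ^ d * (M * u j) := by gcongr; exact hTle j
    _ = _ := by ring

/-- Hardy's condition forces geometric growth. -/
theorem exists_geometric_of_hardy {s s' : ℝ≥0∞} (hs : s ≠ 0) (hs' : s' ≠ 0) (hss : s = ∞ → s' ≠ ∞)
    {b : ℕ → ℝ} (hb : ∀ k, 0 < b k)
    (h : (⨆ N : ℕ, lqNorm s (fun k : Set.Iic N => ENNReal.ofReal (b k)) *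
      lqNorm s' (fun k : Set.Ici N => ENNReal.ofReal (b k)⁻¹)) < ∞) :
    ∃ C ρ : ℝ, 0 < C ∧ 0 < ρ ∧ ρ < 1 ∧ ∀ j d, b j ≤ C * ρ ^ d * b (j + d) := by
  obtain ⟨M, hM⟩ : ∃ M : ℝ≥0, (M : ℝ≥0∞) = _ := ⟨_, ENNReal.coe_toNNReal h.ne⟩
  have hN : ∀ N : ℕ, lqNorm s (fun k : Set.Iic N => ENNReal.ofReal (b k)) *
      lqNorm s' (fun k : Set.Ici N => ENNReal.ofReal (b k)⁻¹) ≤ M := fun N => by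
    rw [hM]; exact le_iSup (fun N : ℕ => lqNorm s (fun k : Set.Iic N => ENNReal.ofReal (b k)) *
      lqNorm s' (fun k : Set.Ici N => ENNReal.ofReal (b k)⁻¹)) N
  have hmul : ∀ N, ENNReal.ofReal (b N) * ENNReal.ofReal (b N)⁻¹ = 1 := fun N => by
    rw [← ENNReal.ofReal_mul (hb N).le, mul_inv_cancel₀ (hb N).ne', ENNReal.ofReal_one]
  -- Only one of the two sums is needed; the other is bounded below by its term with index `N`,
  -- which belongs to both ranges. If `s'` is infinite, then `s` is finite and the sums of `b ^ s`
  -- over `k ≤ N` are used, otherwise the sums of `b ^ (-s')` over `k ≥ N`.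
  by_cases hst : s' = ∞
  · have hst' : s ≠ ∞ := fun h0 => hss h0 hst
    have hsp : 0 < s.toReal := ENNReal.toReal_pos hs hst'
    have key : ∀ N, ∑ k ∈ Finset.range (N + 1), b k ^ s.toReal ≤
        (M : ℝ) ^ s.toReal * b N ^ s.toReal := by
      intro N
      have h1 : lqNorm s (fun k : Set.Iic N => ENNReal.ofReal (b k)) ≤
          M * ENNReal.ofReal (b N) := by
        calc lqNorm s (fun k : Set.Iic N => ENNReal.ofReal (b k))
            = lqNorm s (fun k : Set.Iic N => ENNReal.ofReal (b k)) *
              (ENNReal.ofReal (b N) * ENNReal.ofReal (b N)⁻¹) := by rw [hmul, mul_one]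
          _ = lqNorm s (fun k : Set.Iic N => ENNReal.ofReal (b k)) *
              ENNReal.ofReal (b N)⁻¹ * ENNReal.ofReal (b N) := by ring
          _ ≤ _ := by
            gcongr
            refine le_trans ?_ (hN N)
            gcongr
            exact le_lqNorm hs' (fun k : Set.Ici N => ENNReal.ofReal (b k)⁻¹) ⟨N, Set.mem_Ici.2 le_rfl⟩
      rw [lqNorm_eq_tsum hst', one_div, ENNReal.rpow_inv_le_iff hsp] at h1
      have h2 : ∑' k : Set.Iic N, ENNReal.ofReal (b k) ^ s.toReal =
          ENNReal.ofReal (∑ k ∈ Finset.range (N + 1), b k ^ s.toReal) := by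
        have : (Set.Iic N : Set ℕ) = ↑(Finset.range (N + 1)) := by ext; simp
        rw [this, Finset.tsum_subtype' (Finset.range (N + 1)) fun k => ENNReal.ofReal (b k) ^ s.toReal,
          ENNReal.ofReal_sum_of_nonneg fun k _ => (Real.rpow_nonneg (hb k).le _)]
        exact Finset.sum_congr rfl fun k _ => ENNReal.ofReal_rpow_of_pos (hb k)
      rw [h2, ← ENNReal.ofReal_coe_nnreal, ← ENNReal.ofReal_mul (by positivity),
        ENNReal.ofReal_rpow_of_nonneg (by have := (hb N).le; positivity) hsp.le,
        ENNReal.ofReal_le_ofReal_iff (by have := (hb N).le; positivity),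
        Real.mul_rpow (by positivity) (hb N).le] at h1
      exact h1
    obtain ⟨C, ρ, hC, h0, h1, hg⟩ := exists_geometric_of_head_sum
      (fun k => Real.rpow_pos_of_pos (hb k) s.toReal) key
    refine ⟨C ^ s.toReal⁻¹, ρ ^ s.toReal⁻¹, by positivity, by positivity,
      Real.rpow_lt_one h0.le h1 (by positivity), fun j d => ?_⟩
    have := Real.rpow_le_rpow (by have := (hb j).le; positivity) (hg j d)
      (inv_nonneg.2 hsp.le)
    rwa [Real.rpow_rpow_inv (hb j).le hsp.ne', Real.mul_rpow (by positivity)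
      (by have := (hb (j + d)).le; positivity), Real.rpow_rpow_inv (hb _).le hsp.ne',
      Real.mul_rpow hC.le (by positivity), ← Real.rpow_natCast, ← Real.rpow_mul h0.le,
      mul_comm (d : ℝ), Real.rpow_mul h0.le, Real.rpow_natCast] at this
  · have hsp : 0 < s'.toReal := ENNReal.toReal_pos hs' hst
    have key : ∀ N L, ∑ k ∈ Finset.range L, (b (N + k))⁻¹ ^ s'.toReal ≤
        (M : ℝ) ^ s'.toReal * (b N)⁻¹ ^ s'.toReal := by
      intro N L
      have h1 : lqNorm s' (fun k : Set.Ici N => ENNReal.ofReal (b k)⁻¹) ≤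
          M * ENNReal.ofReal (b N)⁻¹ := by
        calc lqNorm s' (fun k : Set.Ici N => ENNReal.ofReal (b k)⁻¹)
            = lqNorm s' (fun k : Set.Ici N => ENNReal.ofReal (b k)⁻¹) *
              (ENNReal.ofReal (b N) * ENNReal.ofReal (b N)⁻¹) := by rw [hmul, mul_one]
          _ = (ENNReal.ofReal (b N) * lqNorm s' (fun k : Set.Ici N => ENNReal.ofReal (b k)⁻¹)) *
              ENNReal.ofReal (b N)⁻¹ := by ring
          _ ≤ _ := by
            gcongr
            refine le_trans ?_ (hN N)
            gcongr
            exact le_lqNorm hs (fun k : Set.Iic N => ENNReal.ofReal (b k)) ⟨N, Set.mem_Iic.2 le_rfl⟩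
      rw [lqNorm_eq_tsum hst, one_div, ENNReal.rpow_inv_le_iff hsp] at h1
      have h2 : ENNReal.ofReal (∑ k ∈ Finset.range L, (b (N + k))⁻¹ ^ s'.toReal) ≤
          ∑' k : Set.Ici N, ENNReal.ofReal (b k)⁻¹ ^ s'.toReal := by
        rw [ENNReal.ofReal_sum_of_nonneg fun k _ => (Real.rpow_nonneg (inv_pos.2 (hb _)).le _)]
        calc ∑ k ∈ Finset.range L, ENNReal.ofReal ((b (N + k))⁻¹ ^ s'.toReal)
            ≤ ∑' k, ENNReal.ofReal ((b (N + k))⁻¹ ^ s'.toReal) := ENNReal.sum_le_tsum _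
          _ = ∑' k, ENNReal.ofReal (b (N + k))⁻¹ ^ s'.toReal :=
            tsum_congr fun k => (ENNReal.ofReal_rpow_of_pos (inv_pos.2 (hb _))).symm
          _ ≤ _ := ENNReal.tsum_comp_le_tsum_of_injective
            (f := fun k : ℕ => (⟨N + k, by simp⟩ : Set.Ici N))
            (fun a c hac => by simpa using hac)
            fun k : Set.Ici N => ENNReal.ofReal (b k)⁻¹ ^ s'.toReal
      have h3 := h2.trans h1
      have hbi : 0 ≤ (b N)⁻¹ := (inv_pos.2 (hb N)).le
      rwa [← ENNReal.ofReal_coe_nnreal, ← ENNReal.ofReal_mul (by positivity),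
        ENNReal.ofReal_rpow_of_nonneg (by positivity) hsp.le,
        ENNReal.ofReal_le_ofReal_iff (by positivity),
        Real.mul_rpow (by positivity) hbi] at h3
    obtain ⟨C, ρ, hC, h0, h1, hg⟩ := exists_geometric_of_tail_sum
      (fun k => Real.rpow_pos_of_pos (inv_pos.2 (hb k)) s'.toReal) key
    refine ⟨C ^ s'.toReal⁻¹, ρ ^ s'.toReal⁻¹, by positivity, by positivity,
      Real.rpow_lt_one h0.le h1 (by positivity), fun j d => ?_⟩
    have hbj : 0 ≤ (b j)⁻¹ := (inv_pos.2 (hb j)).le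
    have hbd : 0 ≤ (b (j + d))⁻¹ := (inv_pos.2 (hb (j + d))).le
    have := Real.rpow_le_rpow (by positivity) (hg j d) (inv_nonneg.2 hsp.le)
    rw [Real.rpow_rpow_inv hbd hsp.ne', Real.mul_rpow (by positivity)
      (by positivity), Real.rpow_rpow_inv hbj hsp.ne',
      Real.mul_rpow hC.le (by positivity), ← Real.rpow_natCast, ← Real.rpow_mul h0.le,
      mul_comm (d : ℝ), Real.rpow_mul h0.le, Real.rpow_natCast, ← div_eq_mul_inv,
      inv_le_comm₀ (hb _) (by have := hb j; positivity), inv_div, div_le_iff₀ (by positivity)] at this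
    linarith

theorem HardyTail.exists_geometric {s : ℝ≥0∞} (hs : 1 ≤ s) {b : ℕ → ℝ} (hb : ∀ k, 0 < b k)
    (h : HardyTail s b) :
    ∃ C ρ : ℝ, 0 < C ∧ 0 < ρ ∧ ρ < 1 ∧ ∀ j d, b j ≤ C * ρ ^ d * b (j + d) := by
  refine exists_geometric_of_hardy (s' := s.conjExponent) (zero_lt_one.trans_le hs).ne' ?_ ?_ hb h
  · simp [ENNReal.conjExponent]
  · rintro rfl; simp [ENNReal.conjExponent]

/-- Passing to reciprocals exchanges the two sums, so this is the same fact for `1 / b` with the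
exponents swapped. -/
theorem HardyHead.exists_geometric {s : ℝ≥0∞} (hs : 1 ≤ s) {b : ℕ → ℝ} (hb : ∀ k, 0 < b k)
    (h : HardyHead s b) :
    ∃ C ρ : ℝ, 0 < C ∧ 0 < ρ ∧ ρ < 1 ∧ ∀ j d, b (j + d) ≤ C * ρ ^ d * b j := by
  obtain ⟨C, ρ, hC, h0, h1, hg⟩ := exists_geometric_of_hardy (s := s.conjExponent) (s' := s)
    (b := fun k => (b k)⁻¹) (by simp [ENNReal.conjExponent]) (zero_lt_one.trans_le hs).ne'
    (by
      intro h0 h1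
      rw [h1] at h0
      simp [ENNReal.conjExponent] at h0)
    (fun k => inv_pos.2 (hb k)) (by
      simp only [inv_inv]
      simpa only [HardyHead, mul_comm] using h)
  refine ⟨C, ρ, hC, h0, h1, fun j d => ?_⟩
  have := hg j d
  have h2 := hb j
  have h3 := hb (j + d)
  rw [← div_eq_mul_inv, inv_le_comm₀ h2 (by positivity), inv_div, div_le_iff₀ (by positivity)] at this
  linarith

end Hardy

/-! ### Cardinal B-splines -/

section CardinalBSpline

theorem cardinalBSpline_zero_apply (x : ℝ) :
    cardinalBSpline 0 x = if 0 ≤ x ∧ x < 1 then 1 else 0 := by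
  simp [cardinalBSpline, Set.indicator_apply]

theorem cardinalBSpline_succ (l : ℕ) (x : ℝ) :
    cardinalBSpline (l + 1) x = x / (l + 1) * cardinalBSpline l x +
      ((l : ℝ) + 2 - x) / (l + 1) * cardinalBSpline l (x - 1) := rfl

theorem cardinalBSpline_eq_zero {l : ℕ} {x : ℝ} (h : x < 0 ∨ (l : ℝ) + 1 ≤ x) :
    cardinalBSpline l x = 0 := by
  induction l generalizing x with
  | zero =>
    rw [cardinalBSpline_zero_apply, if_neg]
    rintro ⟨h0, h1⟩
    simp only [Nat.cast_zero] at h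
    rcases h with h | h <;> linarith
  | succ l ih =>
    push_cast at h
    rw [cardinalBSpline_succ, ih, ih]
    · simp
    · rcases h with h | h
      · left; linarith
      · right; linarith
    · rcases h with h | h
      · left; linarith
      · right; linarith

/-- A crude bound is enough. In the recursion each linear factor lies in `[0, 1]` wherever the
spline that it multiplies is nonzero, so the bound at most doubles with the degree. -/
theorem abs_cardinalBSpline_le (l : ℕ) (x : ℝ) : |cardinalBSpline l x| ≤ 2 ^ l := by
  induction l generalizing x with
  | zero => rw [cardinalBSpline_zero_apply]; split_ifs <;> simp
  | succ l ih =>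
    by_cases h : x < 0 ∨ ((l + 1 : ℕ) : ℝ) + 1 ≤ x
    · rw [cardinalBSpline_eq_zero h]; simp
    push Not at h
    push_cast at h
    have hl : (0 : ℝ) < l + 1 := by positivity
    have h1 : |x / (l + 1) * cardinalBSpline l x| ≤ 2 ^ l := by
      by_cases hx : (l : ℝ) + 1 ≤ x
      · rw [cardinalBSpline_eq_zero (Or.inr hx)]; simp
      · push Not at hx
        rw [abs_mul, abs_of_nonneg (div_nonneg h.1 hl.le)]
        have := mul_le_mul ((div_le_one hl).2 hx.le) (ih x) (abs_nonneg _) zero_le_one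
        rwa [one_mul] at this
    have h2 : |((l : ℝ) + 2 - x) / (l + 1) * cardinalBSpline l (x - 1)| ≤ 2 ^ l := by
      by_cases hx : x - 1 < 0
      · rw [cardinalBSpline_eq_zero (Or.inl hx)]; simp
      · push Not at hx
        rw [abs_mul, abs_of_nonneg (div_nonneg (by linarith) hl.le)]
        have := mul_le_mul ((div_le_one hl).2 (by linarith : (l : ℝ) + 2 - x ≤ l + 1))
          (ih (x - 1)) (abs_nonneg _) zero_le_one
        rwa [one_mul] at this
    rw [cardinalBSpline_succ, pow_succ]
    exact (abs_add_le _ _).trans (by linarith)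

theorem measurable_cardinalBSpline (l : ℕ) : Measurable (cardinalBSpline l) := by
  induction l with
  | zero => exact measurable_const.indicator measurableSet_Ico
  | succ l ih =>
    exact ((measurable_id.div_const _).mul ih).add (((measurable_const.sub measurable_id).div_const
      _).mul (ih.comp (measurable_id.sub_const 1)))

theorem continuous_cardinalBSpline (l : ℕ) : Continuous (cardinalBSpline (l + 1)) := by
  induction l with
  | zero =>
    -- Degree zero has jumps, so the recursion gives continuity only once degree one has been
    -- recognized as the hat function.
    have : cardinalBSpline (0 + 1) = fun x => max 0 (min x (2 - x)) := by
      ext x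
      simp only [cardinalBSpline_succ, cardinalBSpline_zero_apply]
      by_cases h0 : x < 0
      · rw [if_neg (by intro h; linarith [h.1]), if_neg (by intro h; linarith [h.1]),
          max_eq_left ((min_le_left _ _).trans h0.le)]; simp
      by_cases h1 : x < 1
      · push Not at h0
        rw [if_pos ⟨h0, h1⟩, if_neg (by intro h; linarith [h.1]), min_eq_left (by linarith),
          max_eq_right h0]; simp
      by_cases h2 : x < 2
      · push Not at h1
        rw [if_neg (by intro h; linarith [h.2]), if_pos (by constructor <;> linarith),
          min_eq_right (by linarith), max_eq_right (by linarith)]; simp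
      · push Not at h2
        rw [if_neg (by intro h; linarith [h.2]), if_neg (by intro h; linarith [h.2]),
          max_eq_left ((min_le_right _ _).trans (by linarith))]; simp
    rw [this]
    fun_prop
  | succ l ih =>
    exact ((continuous_id.div_const _).mul ih).add (((continuous_const.sub continuous_id).div_const
      _).mul (ih.comp (continuous_id.sub continuous_const)))

theorem HasDerivWithinAt.comp_sub_const_Ici {f : ℝ → ℝ} {f' x : ℝ} (c : ℝ)
    (hf : HasDerivWithinAt f f' (Set.Ici (x - c)) (x - c)) :
    HasDerivWithinAt (fun y => f (y - c)) f' (Set.Ici x) x := by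
  have h1 : HasDerivWithinAt (fun y : ℝ => y - c) 1 (Set.Ici x) x :=
    (hasDerivWithinAt_id x _).sub_const c
  have := HasDerivWithinAt.comp (h₂ := f) x hf h1 fun y (hy : x ≤ y) => by
    simpa using hy
  exact this.congr_deriv (mul_one _)

/-- The half-open interval makes the spline of degree zero constant immediately to the right of
every point. Right derivatives therefore exist everywhere, and the inductions on the degree need no
exceptional set of knots. -/
theorem hasDerivWithinAt_cardinalBSpline_zero (x : ℝ) :
    HasDerivWithinAt (cardinalBSpline 0) 0 (Set.Ici x) x := by
  refine (hasDerivWithinAt_const x (Set.Ici x) (cardinalBSpline 0 x)).congr_of_eventuallyEq ?_ rfl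
  have key : ∃ y, x < y ∧ ∀ z, x ≤ z → z < y → cardinalBSpline 0 z = cardinalBSpline 0 x := by
    simp only [cardinalBSpline_zero_apply]
    by_cases h0 : x < 0
    · exact ⟨0, h0, fun z _ h => by
        rw [if_neg fun h' => by linarith [h'.1], if_neg fun h' => by linarith [h'.1]]⟩
    push Not at h0
    by_cases h1 : x < 1
    · exact ⟨1, h1, fun z hz h => by rw [if_pos ⟨by linarith, h⟩, if_pos ⟨h0, h1⟩]⟩
    push Not at h1
    exact ⟨x + 1, by linarith, fun z hz h => by
        rw [if_neg fun h' => by linarith [h'.2], if_neg fun h' => by linarith [h'.2]]⟩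
  obtain ⟨y, hxy, hy⟩ := key
  filter_upwards [self_mem_nhdsWithin, mem_nhdsWithin_of_mem_nhds (Iio_mem_nhds hxy)] with z h1 h2
  exact hy z h1 h2

/-- The right derivative of a cardinal B-spline. -/
theorem hasDerivWithinAt_cardinalBSpline (l : ℕ) (x : ℝ) :
    HasDerivWithinAt (cardinalBSpline (l + 1)) (cardinalBSpline l x - cardinalBSpline l (x - 1))
      (Set.Ici x) x := by
  have step : ∀ (l : ℕ) (D : ℝ → ℝ) (x : ℝ),
      (∀ x, HasDerivWithinAt (cardinalBSpline l) (D x) (Set.Ici x) x) →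
      HasDerivWithinAt (cardinalBSpline (l + 1))
        (1 / (l + 1) * cardinalBSpline l x + x / (l + 1) * D x +
          (-1 / (l + 1) * cardinalBSpline l (x - 1) + ((l : ℝ) + 2 - x) / (l + 1) * D (x - 1)))
        (Set.Ici x) x := by
    intro l D x hD
    have h1 : HasDerivWithinAt (fun y : ℝ => y / ((l : ℝ) + 1)) (1 / (l + 1)) (Set.Ici x) x :=
      (hasDerivWithinAt_id x _).div_const _
    have h2 : HasDerivWithinAt (fun y : ℝ => ((l : ℝ) + 2 - y) / (l + 1)) (-1 / (l + 1))
        (Set.Ici x) x :=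
      ((hasDerivWithinAt_id x _).const_sub _).div_const _
    exact (h1.mul (hD x)).add (h2.mul (HasDerivWithinAt.comp_sub_const_Ici 1 (hD (x - 1))))
  induction l generalizing x with
  | zero =>
    have := step 0 (fun _ => 0) x hasDerivWithinAt_cardinalBSpline_zero
    refine this.congr_deriv ?_
    simp; ring
  | succ l ih =>
    have := step (l + 1) _ x ih
    refine this.congr_deriv ?_
    have hl : (l : ℝ) + 1 ≠ 0 := by positivity
    have hl2 : (l : ℝ) + 1 + 1 ≠ 0 := by positivity
    have e2 : x - 1 - 1 = x - 2 := by ring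
    rw [cardinalBSpline_succ, cardinalBSpline_succ, e2]
    push_cast
    field_simp
    ring

/-! #### Linear combinations of integer translates -/

theorem support_mul_cardinalBSpline_subset (l : ℕ) (c : ℤ → ℝ) (x : ℝ) :
    Function.support (fun m : ℤ => c m * cardinalBSpline l (x - m)) ⊆
      ↑(Finset.Icc (⌊x⌋ - l) ⌊x⌋) := by
  intro m hm
  rw [Function.mem_support] at hm
  have h : ¬ (x - m < 0 ∨ (l : ℝ) + 1 ≤ x - m) := fun h => hm (by
    rw [cardinalBSpline_eq_zero h, mul_zero])
  push Not at h
  rw [Finset.mem_coe, Finset.mem_Icc]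
  refine ⟨?_, Int.le_floor.2 (by linarith)⟩
  have : (⌊x⌋ : ℝ) < m + l + 1 := (Int.floor_le x).trans_lt (by linarith)
  have : ⌊x⌋ < m + l + 1 := by exact_mod_cast this
  linarith

theorem summable_mul_cardinalBSpline (l : ℕ) (c : ℤ → ℝ) (x : ℝ) :
    Summable fun m : ℤ => c m * cardinalBSpline l (x - m) :=
  summable_of_hasFiniteSupport ((Finset.finite_toSet _).subset
    (support_mul_cardinalBSpline_subset l c x))

theorem tsum_mul_cardinalBSpline_eq_sum (l : ℕ) (c : ℤ → ℝ) (x : ℝ) :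
    ∑' m : ℤ, c m * cardinalBSpline l (x - m) =
      ∑ m ∈ Finset.Icc (⌊x⌋ - l) ⌊x⌋, c m * cardinalBSpline l (x - m) :=
  tsum_eq_sum' (support_mul_cardinalBSpline_subset l c x)

theorem tsum_shift_cardinalBSpline (l : ℕ) (c : ℤ → ℝ) (x : ℝ) :
    ∑' m : ℤ, c m * cardinalBSpline l (x - 1 - m) =
      ∑' m : ℤ, c (m - 1) * cardinalBSpline l (x - m) := by
  rw [← (Equiv.addRight (1 : ℤ)).tsum_eq fun m : ℤ => c (m - 1) * cardinalBSpline l (x - m)]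
  refine tsum_congr fun m => ?_
  simp only [Equiv.coe_addRight]
  rw [add_sub_cancel_right, show x - 1 - (m : ℝ) = x - ((m + 1 : ℤ) : ℝ) by push_cast; ring]

/-- One step of the recursion transferred to the coefficients by shifting the second sum. The
partition of unity and Marsden's identity follow from it by induction on the degree. -/
theorem tsum_mul_cardinalBSpline_succ (l : ℕ) (c : ℤ → ℝ) (x : ℝ) :
    ∑' m : ℤ, c m * cardinalBSpline (l + 1) (x - m) =
      ∑' m : ℤ, (c m * ((x - m) / (l + 1)) + c (m - 1) * ((m + l + 1 - x) / (l + 1))) *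
        cardinalBSpline l (x - m) := by
  have e : ∀ m : ℤ, c m * cardinalBSpline (l + 1) (x - m) =
      c m * ((x - m) / (l + 1)) * cardinalBSpline l (x - m) +
      c m * ((((l : ℝ) + 2 - (x - m)) / (l + 1))) * cardinalBSpline l (x - 1 - m) := by
    intro m
    rw [cardinalBSpline_succ, show x - (m : ℝ) - 1 = x - 1 - m by ring]; ring
  simp_rw [e]
  rw [(summable_mul_cardinalBSpline l _ x).tsum_add (summable_mul_cardinalBSpline l _ (x - 1)),
    tsum_shift_cardinalBSpline l (fun m : ℤ => c m * ((((l : ℝ) + 2 - (x - m)) / (l + 1)))),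
    ← (summable_mul_cardinalBSpline l _ x).tsum_add (summable_mul_cardinalBSpline l _ x)]
  refine tsum_congr fun m => ?_
  push_cast
  ring

theorem tsum_cardinalBSpline (l : ℕ) (x : ℝ) : ∑' m : ℤ, cardinalBSpline l (x - m) = 1 := by
  induction l with
  | zero =>
    have := tsum_mul_cardinalBSpline_eq_sum 0 (fun _ => 1) x
    simp only [one_mul, Nat.cast_zero, sub_zero, Finset.Icc_self, Finset.sum_singleton] at this
    rw [this, cardinalBSpline_zero_apply, if_pos]
    exact ⟨by linarith [Int.floor_le x], by linarith [Int.lt_floor_add_one x]⟩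
  | succ l ih =>
    have := tsum_mul_cardinalBSpline_succ l (fun _ => 1) x
    simp only [one_mul] at this
    rw [this, ← ih]
    refine tsum_congr fun m => ?_
    have hl : (l : ℝ) + 1 ≠ 0 := by positivity
    field_simp
    ring

/-- Marsden's identity. -/
theorem tsum_marsden (l : ℕ) (x y : ℝ) :
    ∑' m : ℤ, (∏ i ∈ Finset.range l, (y - m - (i + 1))) * cardinalBSpline l (x - m) =
      (y - x) ^ l := by
  induction l with
  | zero => simpa using tsum_cardinalBSpline 0 x
  | succ l ih =>
    rw [tsum_mul_cardinalBSpline_succ l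
      (fun m : ℤ => ∏ i ∈ Finset.range (l + 1), (y - m - ((i : ℝ) + 1))), pow_succ, ← ih,
      ← tsum_mul_right]
    refine tsum_congr fun m => ?_
    have hl : (l : ℝ) + 1 ≠ 0 := by positivity
    -- The product for `m` gives up its last factor and the product for `m - 1` its first. The
    -- remaining factors agree, and the two separated ones combine with the recursion weights to `y
    -- - x`.
    rw [Finset.prod_range_succ, Finset.prod_range_succ']
    have : ∏ k ∈ Finset.range l, (y - ((m - 1 : ℤ) : ℝ) - (((k + 1 : ℕ) : ℝ) + 1)) =
        ∏ k ∈ Finset.range l, (y - m - ((k : ℝ) + 1)) :=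
      Finset.prod_congr rfl fun k _ => by push_cast; ring
    rw [this]
    push_cast
    field_simp
    ring

/-- Integer translates of a cardinal B-spline are linearly independent. -/
theorem eq_zero_of_tsum_cardinalBSpline_eq_zero (l : ℕ) (d : ℤ → ℝ)
    (h : ∀ x : ℝ, ∑' m : ℤ, d m * cardinalBSpline l (x - m) = 0) (m : ℤ) : d m = 0 := by
  induction l generalizing d m with
  | zero =>
    have := h m
    rw [tsum_mul_cardinalBSpline_eq_sum] at this
    simpa [cardinalBSpline_zero_apply] using this
  | succ l ih =>
    -- Right differentiation of the vanishing series gives a vanishing series of lower degree whose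
    -- coefficients are the increments of `d`. By induction `d` is constant, and the partition of
    -- unity makes the constant zero.
    have hder : ∀ x : ℝ, ∑' m : ℤ, (d m - d (m - 1)) * cardinalBSpline l (x - m) = 0 := by
      intro x
      -- Between `x` and the next integer the set of possibly nonzero terms does not change, so only
      -- a finite sum is differentiated.
      set S := Finset.Icc (⌊x⌋ - (l + 1 : ℕ)) ⌊x⌋ with hS
      have h1 : HasDerivWithinAt (fun y : ℝ => ∑ m ∈ S, d m * cardinalBSpline (l + 1) (y - m))
          (∑ m ∈ S, d m * (cardinalBSpline l (x - m) - cardinalBSpline l (x - m - 1)))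
          (Set.Ici x) x :=
        HasDerivWithinAt.fun_sum fun m _ => (HasDerivWithinAt.comp_sub_const_Ici _
          (hasDerivWithinAt_cardinalBSpline l _)).const_mul _
      have h2 : HasDerivWithinAt (fun y : ℝ => ∑ m ∈ S, d m * cardinalBSpline (l + 1) (y - m))
          0 (Set.Ici x) x := by
        have hmem : ∀ y, x ≤ y → y < ⌊x⌋ + 1 →
            ∑ m ∈ S, d m * cardinalBSpline (l + 1) (y - m) = 0 := by
          intro y hy1 hy2
          have : ⌊y⌋ = ⌊x⌋ := Int.floor_eq_iff.2 ⟨(Int.floor_le x).trans hy1, hy2⟩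
          rw [← h y, tsum_mul_cardinalBSpline_eq_sum, this]
        refine (hasDerivWithinAt_const x (Set.Ici x) (0 : ℝ)).congr_of_eventuallyEq ?_ ?_
        · filter_upwards [self_mem_nhdsWithin, mem_nhdsWithin_of_mem_nhds
            (Iio_mem_nhds (Int.lt_floor_add_one x))] with y hy1 hy2 using hmem y hy1 hy2
        · exact hmem x le_rfl (Int.lt_floor_add_one x)
      have h3 := (uniqueDiffOn_Ici x x Set.self_mem_Ici).eq_deriv _ h1 h2
      have hsub : ∀ m ∉ S, d m * (cardinalBSpline l (x - m) - cardinalBSpline l (x - m - 1)) = 0 := by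
        intro m hm
        have hm' : m < ⌊x⌋ - (l + 1 : ℕ) ∨ ⌊x⌋ < m := by
          by_contra hcon
          push Not at hcon
          exact hm (Finset.mem_Icc.2 hcon)
        rw [cardinalBSpline_eq_zero, cardinalBSpline_eq_zero]
        · simp
        · rcases hm' with hm' | hm'
          · right
            have : (m : ℝ) + 1 ≤ ⌊x⌋ - (l + 1 : ℕ) := by exact_mod_cast hm'
            push_cast at this
            linarith [Int.floor_le x]
          · left
            have : (⌊x⌋ : ℝ) + 1 ≤ m := by exact_mod_cast hm'
            linarith [Int.lt_floor_add_one x]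
        · rcases hm' with hm' | hm'
          · right
            have : (m : ℝ) + 1 ≤ ⌊x⌋ - (l + 1 : ℕ) := by exact_mod_cast hm'
            push_cast at this
            linarith [Int.floor_le x]
          · left
            have : (⌊x⌋ : ℝ) + 1 ≤ m := by exact_mod_cast hm'
            linarith [Int.lt_floor_add_one x]
      rw [← tsum_eq_sum (L := .unconditional ℤ) hsub] at h3
      rw [← h3]
      have e : ∀ m : ℤ, d m * (cardinalBSpline l (x - m) - cardinalBSpline l (x - m - 1)) =
          d m * cardinalBSpline l (x - m) - d m * cardinalBSpline l (x - 1 - m) := by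
        intro m; rw [show x - (m : ℝ) - 1 = x - 1 - m by ring]; ring
      simp_rw [e]
      rw [(summable_mul_cardinalBSpline l _ x).tsum_sub (summable_mul_cardinalBSpline l _ (x - 1)),
        tsum_shift_cardinalBSpline, ← (summable_mul_cardinalBSpline l _ x).tsum_sub
          (summable_mul_cardinalBSpline l _ x)]
      exact tsum_congr fun m => by ring
    have hconst : ∀ m, d m = d (m - 1) := fun m => by
      have := ih _ hder m; linarith
    have hall : ∀ m, d m = d 0 := by
      intro m
      induction m using Int.induction_on with
      | zero => rfl
      | succ i hi => rw [hconst, add_sub_cancel_right, hi]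
      | pred i hi => rw [← hconst, hi]
    have h0 := h 0
    simp_rw [hall] at h0
    rw [tsum_mul_left, tsum_cardinalBSpline, mul_one] at h0
    rw [hall, h0]

theorem eq_of_tsum_cardinalBSpline_eq (l : ℕ) {c d : ℤ → ℝ}
    (h : ∀ x : ℝ, ∑' m : ℤ, c m * cardinalBSpline l (x - m) =
      ∑' m : ℤ, d m * cardinalBSpline l (x - m)) : c = d := by
  ext m
  refine sub_eq_zero.1 (eq_zero_of_tsum_cardinalBSpline_eq_zero l (fun m => c m - d m) ?_ m)
  intro x
  simp_rw [sub_mul]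
  rw [(summable_mul_cardinalBSpline l _ x).tsum_sub (summable_mul_cardinalBSpline l _ x), h, sub_self]

/-! #### The two-scale relation -/

theorem sum_choose_succ_mul (n : ℕ) (a : ℕ → ℝ) :
    ∑ i ∈ Finset.range (n + 2), ((n + 1).choose i : ℝ) * a i =
      ∑ i ∈ Finset.range (n + 1), (n.choose i : ℝ) * (a i + a (i + 1)) := by
  rw [Finset.sum_range_succ']
  simp_rw [Nat.choose_succ_succ, Nat.cast_add, add_mul, mul_add]
  rw [Finset.sum_add_distrib, Finset.sum_add_distrib, Finset.sum_range_succ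
    (fun i => (n.choose (i + 1) : ℝ) * a (i + 1)), Finset.sum_range_succ'
    (fun i => (n.choose i : ℝ) * a i)]
  simp
  ring

/-- By the relation in lower degree and Pascal's rule, the difference of both sides has right
derivative zero. It is continuous in positive degree and vanishes to the left of the support, so it
is zero. Degree zero is checked directly. -/
theorem cardinalBSpline_two_scale (l : ℕ) (x : ℝ) :
    cardinalBSpline l x = ∑ i ∈ Finset.range (l + 2),
      (2 ^ l : ℝ)⁻¹ * ((l + 1).choose i : ℝ) * cardinalBSpline l (2 * x - i) := by
  induction l generalizing x with
  | zero =>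
    simp only [Finset.sum_range_succ, Finset.sum_range_zero, cardinalBSpline_zero_apply]
    norm_num
    by_cases h0 : 0 ≤ x
    · by_cases h1 : x < 1
      · by_cases h2 : 2 * x < 1
        · rw [if_pos ⟨h0, h1⟩, if_pos ⟨h0, h2⟩, if_neg fun h => by linarith [h.1]]; simp
        · rw [if_pos ⟨h0, h1⟩, if_neg fun h => h2 h.2, if_pos ⟨by linarith, by linarith⟩]; simp
      · rw [if_neg fun h => h1 h.2, if_neg fun h => by linarith [h.2],
          if_neg fun h => by linarith [h.2]]; simp
    · rw [if_neg fun h => h0 h.1, if_neg fun h => h0 h.1, if_neg fun h => by linarith [h.1]]; simp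
  | succ l ih =>
    set G : ℝ → ℝ := fun x => cardinalBSpline (l + 1) x - ∑ i ∈ Finset.range (l + 1 + 2),
      (2 ^ (l + 1) : ℝ)⁻¹ * ((l + 1 + 1).choose i : ℝ) * cardinalBSpline (l + 1) (2 * x - i) with hG
    have hcont : Continuous G := (continuous_cardinalBSpline l).sub (continuous_finsetSum _
      fun i _ => continuous_const.mul ((continuous_cardinalBSpline l).comp
        ((continuous_const.mul continuous_id).sub continuous_const)))
    have hder : ∀ x, HasDerivWithinAt G 0 (Set.Ici x) x := by
      intro x
      have h1 : ∀ i : ℕ, HasDerivWithinAt (fun y : ℝ => cardinalBSpline (l + 1) (2 * y - i))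
          ((cardinalBSpline l (2 * x - i) - cardinalBSpline l (2 * x - i - 1)) * 2)
          (Set.Ici x) x := by
        intro i
        have h2 : HasDerivWithinAt (fun y : ℝ => 2 * y - i) 2 (Set.Ici x) x := by
          simpa using ((hasDerivWithinAt_id x (Set.Ici x)).const_mul 2).sub_const (i : ℝ)
        exact HasDerivWithinAt.comp (h₂ := cardinalBSpline (l + 1)) x
          (hasDerivWithinAt_cardinalBSpline l _) h2 fun y (hy : x ≤ y) => by
            simpa using hy
      have h3 := (hasDerivWithinAt_cardinalBSpline l x).sub (HasDerivWithinAt.fun_sum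
        (u := Finset.range (l + 1 + 2)) fun i _ => (h1 i).const_mul
          ((2 ^ (l + 1) : ℝ)⁻¹ * ((l + 1 + 1).choose i : ℝ)))
      refine h3.congr_deriv ?_
      rw [ih x, ih (x - 1), sub_eq_zero]
      have e1 := sum_choose_succ_mul (l + 1) fun i => (2 ^ l : ℝ)⁻¹ *
        (cardinalBSpline l (2 * x - i) - cardinalBSpline l (2 * x - i - 1))
      rw [← Finset.sum_sub_distrib]
      have e2 : ∑ i ∈ Finset.range (l + 1 + 2), (2 ^ (l + 1) : ℝ)⁻¹ * ((l + 1 + 1).choose i : ℝ) *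
          ((cardinalBSpline l (2 * x - i) - cardinalBSpline l (2 * x - i - 1)) * 2) =
          ∑ i ∈ Finset.range (l + 1 + 2), ((l + 1 + 1).choose i : ℝ) * ((2 ^ l : ℝ)⁻¹ *
        (cardinalBSpline l (2 * x - i) - cardinalBSpline l (2 * x - i - 1))) :=
        Finset.sum_congr rfl fun i _ => by rw [pow_succ]; field_simp
      rw [e2, e1]
      refine Finset.sum_congr rfl fun i _ => ?_
      rw [show 2 * (x - 1) - (i : ℝ) = 2 * x - i - 2 by ring]
      push_cast
      rw [show 2 * x - ((i : ℝ) + 1) = 2 * x - i - 1 by ring,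
        show 2 * x - (i : ℝ) - 1 - 1 = 2 * x - i - 2 by ring]
      ring
    set a : ℝ := min x 0 - 1 with ha
    have hax : a ≤ x := by have := min_le_left x 0; linarith
    have ha0 : a < 0 := by have := min_le_right x 0; linarith
    have hGa : G a = 0 := by
      simp only [hG]
      rw [cardinalBSpline_eq_zero (Or.inl ha0), Finset.sum_eq_zero, sub_zero]
      intro i _
      rw [cardinalBSpline_eq_zero (Or.inl _), mul_zero]
      have : (0 : ℝ) ≤ i := Nat.cast_nonneg i
      linarith
    have := constant_of_has_deriv_right_zero (a := a) (b := x) hcont.continuousOn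
      (fun y _ => hder y) x ⟨hax, le_rfl⟩
    rw [hGa] at this
    exact sub_eq_zero.1 this

end CardinalBSpline

/-! ### Finite differences -/

section Differences

open fwdDiff

variable {M : Type*} [AddCommGroup M]

theorem diffOp_eq_fwdDiff {n : ℕ} (l : ℕ) (h : Fin n → ℝ) (f : (Fin n → ℝ) → ℝ) (x : Fin n → ℝ) :
    diffOp l h f x = (fwdDiff h)^[l] f x := by
  rw [fwdDiff_iter_eq_sum_shift, diffOp]
  refine Finset.sum_congr rfl fun i hi => ?_
  have hil : i ≤ l := Nat.lt_succ_iff.1 (Finset.mem_range.1 hi)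
  have : (-1 : ℝ) ^ (l + i) = (-1) ^ (l - i) := by
    obtain ⟨d, rfl⟩ := Nat.exists_eq_add_of_le hil
    rw [show i + d + i = 2 * i + d by ring, pow_add, pow_mul]; simp
  rw [this, zsmul_eq_mul]
  push_cast
  rw [Nat.cast_smul_eq_nsmul]

/-- The Leibniz rule `Δ(f g) = Δf · g + f(· + h) · Δg` and induction; each step produces two terms,
whence the power of two. -/
theorem abs_fwdDiff_iter_mul_le (h : M) {C D ε : ℝ} (j : ℕ) {f g : M → ℝ}
    (hf : ∀ i ≤ j, ∀ x, |(fwdDiff h)^[i] f x| ≤ C * ε ^ i)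
    (hg : ∀ i ≤ j, ∀ x, |(fwdDiff h)^[i] g x| ≤ D * ε ^ i) (x : M) :
    |(fwdDiff h)^[j] (fun y => f y * g y) x| ≤ 2 ^ j * C * D * ε ^ j := by
  induction j generalizing f g C D x with
  | zero =>
    have h1 := hf 0 le_rfl x
    have h2 := hg 0 le_rfl x
    simp only [Function.iterate_zero, id, pow_zero, mul_one] at h1 h2 ⊢
    rw [abs_mul, one_mul]
    exact mul_le_mul h1 h2 (abs_nonneg _) ((abs_nonneg _).trans h1)
  | succ j ih =>
    have e : fwdDiff h (fun y => f y * g y) =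
        (fun y => fwdDiff h f y * g y) + fun y => f (y + h) * fwdDiff h g y := by
      ext y; simp only [fwdDiff, Pi.add_apply]; ring
    rw [Function.iterate_succ_apply, e, fwdDiff_iter_add]
    have h1 := ih (C := C * ε) (D := D) (f := fwdDiff h f) (g := g)
      (fun i hi x => by
        have := hf (i + 1) (by omega) x
        rw [Function.iterate_succ_apply] at this
        rw [mul_assoc, ← pow_succ']; exact this)
      (fun i hi x => hg i (by omega) x) x
    have h2 := ih (C := C) (D := D * ε) (f := fun y => f (y + h)) (g := fwdDiff h g)
      (fun i hi x => by rw [fwdDiff_iter_comp_add]; exact hf i (by omega) _)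
      (fun i hi x => by
        have := hg (i + 1) (by omega) x
        rw [Function.iterate_succ_apply] at this
        rw [mul_assoc, ← pow_succ']; exact this) x
    calc _ ≤ _ := abs_add_le _ _
      _ ≤ _ := add_le_add h1 h2
      _ = _ := by ring

theorem exists_abs_fwdDiff_iter_prod_le (l : ℕ) (C : ℝ) (n : ℕ) :
    ∃ D : ℝ, 0 < D ∧ ∀ (h : M) (ε : ℝ), 0 ≤ ε → ∀ f : Fin n → M → ℝ,
      (∀ i, ∀ j ≤ l, ∀ x, |(fwdDiff h)^[j] (f i) x| ≤ C * ε ^ j) →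
      ∀ j ≤ l, ∀ x, |(fwdDiff h)^[j] (fun y => ∏ i, f i y) x| ≤ D * ε ^ j := by
  induction n with
  | zero =>
    refine ⟨1, one_pos, fun h ε hε f _ j _ x => ?_⟩
    simp only [Finset.univ_eq_empty, Finset.prod_empty, one_mul]
    rcases j with - | j
    · simp
    · have : fwdDiff h (fun _ : M => (1 : ℝ)) = fun _ => 0 := by ext; simp [fwdDiff]
      have h0 : ∀ j, (fwdDiff h)^[j] (fun _ : M => (0 : ℝ)) = fun _ => 0 := fun j =>
        Function.iterate_fixed (by ext; simp [fwdDiff]) j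
      rw [Function.iterate_succ_apply, this, h0]
      simpa using pow_nonneg hε _
  | succ n ih =>
    obtain ⟨D, hD, H⟩ := ih
    refine ⟨2 ^ l * (|C| + 1) * D, by positivity, fun h ε hε f hf j hj x => ?_⟩
    simp_rw [Fin.prod_univ_succ]
    have h1 := abs_fwdDiff_iter_mul_le h (C := |C| + 1) (D := D) (ε := ε) j (f := f 0)
      (g := fun y => ∏ i : Fin n, f i.succ y)
      (fun i hi x => (hf 0 i (hi.trans hj) x).trans (by
        have := le_abs_self C
        gcongr; linarith))
      (fun i hi x => H h ε hε _ (fun i => hf i.succ) i (hi.trans hj) x) x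
    refine h1.trans ?_
    gcongr
    · norm_num

theorem abs_sub_le_of_hasDerivWithinAt_Ici {G G' : ℝ → ℝ} (hG : Continuous G)
    (hd : ∀ x, HasDerivWithinAt G (G' x) (Set.Ici x) x) {B : ℝ} (hB : ∀ x, |G' x| ≤ B) (x h : ℝ) :
    |G (x + h) - G x| ≤ B * |h| := by
  have key : ∀ a b, a ≤ b → |G b - G a| ≤ B * (b - a) := fun a b hab => by
    have := norm_image_sub_le_of_norm_deriv_right_le_segment (f := G) (f' := G') (C := B)
      (a := a) (b := b) hG.continuousOn (fun y _ => hd y) (fun y _ => hB y) b ⟨hab, le_rfl⟩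
    exact this
  rcases le_total 0 h with h0 | h0
  · have := key x (x + h) (by linarith)
    rwa [add_sub_cancel_left, show B * h = B * |h| by rw [abs_of_nonneg h0]] at this
  · have := key (x + h) x (by linarith)
    rw [abs_sub_comm, abs_of_nonpos h0]
    convert this using 2
    ring

/-- Every further difference is paid for by one degree: the right derivative of `Δʲ N` is a
difference of two translates of `Δʲ` of the spline of lower degree, and the mean value inequality
yields a factor `2 |h|`. The case `j = l` is reached although the spline of degree `l` is not `l`
times differentiable. -/
theorem abs_fwdDiff_iter_cardinalBSpline_le {l j : ℕ} (hj : j ≤ l) (h x : ℝ) :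
    |(fwdDiff h)^[j] (cardinalBSpline l) x| ≤ 2 ^ l * |h| ^ j := by
  obtain ⟨L, rfl⟩ := Nat.exists_eq_add_of_le hj
  clear hj
  induction j generalizing x with
  | zero => simpa using abs_cardinalBSpline_le L x
  | succ j ih =>
    rw [show j + 1 + L = (j + L) + 1 by ring, Function.iterate_succ_apply']
    set G := (fwdDiff h)^[j] (cardinalBSpline (j + L + 1)) with hG
    have e : G = fun x => ∑ i ∈ Finset.range (j + 1), ((-1 : ℤ) ^ (j - i) * j.choose i) •
        cardinalBSpline (j + L + 1) (x + i • h) := by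
      ext y; rw [hG, fwdDiff_iter_eq_sum_shift]
    have hcont : Continuous G := by
      rw [e]
      simp only [zsmul_eq_mul]
      exact continuous_finsetSum _ fun i _ => continuous_const.mul
        ((continuous_cardinalBSpline (j + L)).comp (continuous_add_const (i • h)))
    have hd : ∀ x, HasDerivWithinAt G ((fwdDiff h)^[j] (cardinalBSpline (j + L)) x -
        (fwdDiff h)^[j] (cardinalBSpline (j + L)) (x - 1)) (Set.Ici x) x := by
      intro x
      rw [e]
      have h1 : ∀ i : ℕ, HasDerivWithinAt (fun y => cardinalBSpline (j + L + 1) (y + i • h))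
          (cardinalBSpline (j + L) (x + i • h) - cardinalBSpline (j + L) (x + i • h - 1))
          (Set.Ici x) x := by
        intro i
        have := HasDerivWithinAt.comp_sub_const_Ici (-(i • h))
          (hasDerivWithinAt_cardinalBSpline (j + L) (x - -(i • h)))
        simpa only [sub_neg_eq_add] using this
      have h2 := HasDerivWithinAt.fun_sum (u := Finset.range (j + 1)) fun i _ =>
        (h1 i).const_mul (((-1 : ℤ) ^ (j - i) * j.choose i : ℤ) : ℝ)
      simp only [← zsmul_eq_mul] at h2
      refine h2.congr_deriv ?_
      rw [fwdDiff_iter_eq_sum_shift, fwdDiff_iter_eq_sum_shift, ← Finset.sum_sub_distrib]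
      refine Finset.sum_congr rfl fun i _ => ?_
      rw [smul_sub, sub_add_eq_add_sub]
    have := abs_sub_le_of_hasDerivWithinAt_Ici hcont hd (B := 2 * (2 ^ (j + L) * |h| ^ j))
      (fun x => (abs_sub _ _).trans (by linarith [ih x, ih (x - 1)])) x h
    calc |fwdDiff h G x| = |G (x + h) - G x| := rfl
      _ ≤ _ := this
      _ = _ := by ring

end Differences

/-! ### Quasi-interpolation weights -/

section Weights

open Polynomial

/-- A moment problem with nodes `0, …, l`. It is solvable because the Vandermonde matrix of distinct
nodes is invertible. -/
theorem exists_sum_pow_eq (l : ℕ) (ξ : ℕ → ℝ) :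
    ∃ w : ℕ → ℝ, ∀ j ≤ l, ∑ ν ∈ Finset.range (l + 1), w ν * (ν : ℝ) ^ j = ξ j := by
  set V := Matrix.vandermonde fun i : Fin (l + 1) => ((i : ℕ) : ℝ) with hV
  have hdet : IsUnit V.det := by
    rw [isUnit_iff_ne_zero, hV, Matrix.det_vandermonde_ne_zero_iff]
    intro a b hab
    exact Fin.ext (Nat.cast_injective hab)
  set u : Fin (l + 1) → ℝ := Matrix.vecMul (fun i : Fin (l + 1) => ξ i) V⁻¹ with hu
  have h1 : Matrix.vecMul u V = fun i : Fin (l + 1) => ξ i := by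
    rw [hu, Matrix.vecMul_vecMul, Matrix.nonsing_inv_mul _ hdet, Matrix.vecMul_one]
  refine ⟨fun ν => if h : ν < l + 1 then u ⟨ν, h⟩ else 0, fun j hj => ?_⟩
  have h2 := congrFun h1 ⟨j, by omega⟩
  simp only [Matrix.vecMul, dotProduct, hV, Matrix.vandermonde_apply] at h2
  rw [← h2, Finset.sum_range]
  exact Finset.sum_congr rfl fun i _ => by
    simp only [dif_pos i.2]

/-- In the binomial expansion the coefficient of `y ^ (l - j)` is the `j`-th moment of the weights
up to a nonzero factor, so prescribing moments prescribes the polynomial. -/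
theorem exists_sum_sub_pow_eq (l : ℕ) (p : ℝ[X]) (hp : p.natDegree ≤ l) :
    ∃ w : ℕ → ℝ, ∀ y : ℝ, ∑ ν ∈ Finset.range (l + 1), w ν * (y - ν) ^ l = p.eval y := by
  obtain ⟨w, hw⟩ := exists_sum_pow_eq l fun j => (-1) ^ j * p.coeff (l - j) / (l.choose j : ℝ)
  refine ⟨w, fun y => ?_⟩
  have e : ∀ ν : ℕ, (y - ν) ^ l = ∑ j ∈ Finset.range (l + 1),
      (-1) ^ j * (l.choose j : ℝ) * y ^ (l - j) * (ν : ℝ) ^ j := by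
    intro ν
    rw [sub_eq_neg_add, add_pow]
    exact Finset.sum_congr rfl fun j _ => by rw [neg_pow]; ring
  simp_rw [e, Finset.mul_sum]
  rw [Finset.sum_comm, eval_eq_sum_range' (Nat.lt_succ_of_le hp), ← Finset.sum_range_reflect (fun i => p.coeff i * y ^ i)]
  refine Finset.sum_congr rfl fun j hj => ?_
  have hjl : j ≤ l := Nat.lt_succ_iff.1 (Finset.mem_range.1 hj)
  have hc : (l.choose j : ℝ) ≠ 0 := by exact_mod_cast (Nat.choose_pos hjl).ne'
  have : ∀ ν : ℕ, w ν * ((-1) ^ j * (l.choose j : ℝ) * y ^ (l - j) * (ν : ℝ) ^ j) =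
      ((-1) ^ j * (l.choose j : ℝ) * y ^ (l - j)) * (w ν * (ν : ℝ) ^ j) := fun ν => by ring
  simp_rw [this]
  rw [← Finset.mul_sum, hw j hjl]
  have h1 : ((-1 : ℝ) ^ j) * (-1) ^ j = 1 := by rw [← mul_pow]; simp
  rw [Nat.succ_sub_one]
  field_simp
  linear_combination (y ^ (l - j) * p.coeff (l - j)) * h1

/-- Coefficients of a sampled quasi-interpolant. -/
def sampleSum (w : ℕ → ℝ) (l : ℕ) (q : ℝ → ℝ) (m : ℤ) : ℝ :=
  ∑ ν ∈ Finset.range (l + 1), w ν * q (m + ν)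

/-- Marsden's identity expands `(y - x) ^ l` with coefficients `∏ (y - m - (i + 1))`. The weights
are chosen so that sampling `(y - ·) ^ l` at the points `m + ν` returns exactly these numbers. The
error functional `H` thus vanishes on all `(y - X) ^ l`, and these span the polynomials of degree at
most `l`. -/
theorem exists_sampleSum_reproduces (l : ℕ) :
    ∃ w : ℕ → ℝ, ∀ q : ℝ[X], q.natDegree ≤ l → ∀ x : ℝ,
      ∑' m : ℤ, sampleSum w l (fun y => q.eval y) m * cardinalBSpline l (x - m) = q.eval x := by
  obtain ⟨w, hw⟩ := exists_sum_sub_pow_eq l (∏ i ∈ Finset.range l, (X - C ((i : ℝ) + 1)))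
    (by rw [natDegree_finsetProd_X_sub_C_eq_card]; simp)
  refine ⟨w, fun q hq x => ?_⟩
  simp_rw [eval_prod, eval_sub, eval_X, eval_C] at hw
  set H : ℝ[X] →ₗ[ℝ] ℝ := leval x - ∑ m ∈ Finset.Icc (⌊x⌋ - l) ⌊x⌋,
    cardinalBSpline l (x - m) • ∑ ν ∈ Finset.range (l + 1), w ν • leval ((m : ℝ) + ν) with hH
  have hHq : ∀ q : ℝ[X], H q = q.eval x -
      ∑' m : ℤ, sampleSum w l (fun y => q.eval y) m * cardinalBSpline l (x - m) := by
    intro q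
    rw [tsum_mul_cardinalBSpline_eq_sum]
    simp [hH, sampleSum, leval_apply, LinearMap.sum_apply, mul_comm]
  have hpow : ∀ y : ℝ, H ((C y - X) ^ l) = 0 := by
    intro y
    rw [hHq, ← sub_self ((y - x) ^ l)]
    congr 1
    · simp
    · rw [← tsum_marsden l x y]
      refine tsum_congr fun m => ?_
      congr 1
      rw [← hw, sampleSum]
      exact Finset.sum_congr rfl fun ν _ => by simp; left; congr 1; ring
  -- As a function of `y`, the value of `H` at `(y - X) ^ l` is the zero polynomial. Its
  -- coefficients are, up to signs and binomial coefficients, the values of `H` at monomials.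
  have hmono : ∀ j ≤ l, H (X ^ j) = 0 := by
    set R : ℝ[X] := ∑ j ∈ Finset.range (l + 1),
      C ((-1) ^ j * (l.choose j : ℝ) * H (X ^ j)) * X ^ (l - j) with hR
    have hR0 : R = 0 := by
      refine Polynomial.funext fun y => ?_
      rw [eval_zero, ← hpow y, sub_eq_neg_add, add_pow, map_sum, hR, eval_finsetSum]
      refine Finset.sum_congr rfl fun j _ => ?_
      have : (-X : ℝ[X]) ^ j * C y ^ (l - j) * ((l.choose j : ℕ) : ℝ[X]) =
          ((-1) ^ j * y ^ (l - j) * (l.choose j : ℝ)) • X ^ j := by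
        rw [smul_eq_C_mul, neg_pow]
        simp only [map_mul, map_pow, map_neg, map_one, map_natCast]
        ring
      rw [this, map_smul]
      simp
      ring
    intro j hj
    have := congrArg (fun p : ℝ[X] => p.coeff (l - j)) hR0
    simp only [hR, finsetSum_coeff, coeff_C_mul_X_pow, coeff_zero] at this
    rw [Finset.sum_eq_single j] at this
    · have hc : (l.choose j : ℝ) ≠ 0 := by exact_mod_cast (Nat.choose_pos hj).ne'
      simpa [hc] using this
    · intro i hi hij
      have := Nat.lt_succ_iff.1 (Finset.mem_range.1 hi)
      rw [if_neg (by omega)]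
    · intro h; exact absurd (Finset.mem_range.2 (by omega)) h
  have : H q = 0 := by
    rw [q.as_sum_range' (l + 1) (Nat.lt_succ_of_le hq), map_sum]
    refine Finset.sum_eq_zero fun j hj => ?_
    rw [← C_mul_X_pow_eq_monomial, ← smul_eq_C_mul, map_smul,
      hmono j (Nat.lt_succ_iff.1 (Finset.mem_range.1 hj)), smul_zero]
  rw [hHq] at this
  linarith

/-- Coefficients of the two-scale relation. -/
noncomputable def maskCoef (l i : ℕ) : ℝ := (2 ^ l : ℝ)⁻¹ * ((l + 1).choose i : ℝ)

theorem tsum_dite_even (l : ℕ) (c : ℤ → ℝ) (i : ℕ) (x : ℝ) :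
    ∑' m : ℤ, (if (2 : ℤ) ∣ m - i then maskCoef l i * c ((m - i) / 2) else 0) *
      cardinalBSpline l (x - m) =
    ∑' m : ℤ, maskCoef l i * c m * cardinalBSpline l (x - i - 2 * m) := by
  have hinj : Function.Injective fun m : ℤ => 2 * m + i := fun a b h => by
    simp only at h; omega
  rw [← hinj.tsum_eq]
  · refine tsum_congr fun m => ?_
    rw [if_pos (by simp), add_sub_cancel_right, Int.mul_ediv_cancel_left _ two_ne_zero]
    congr 2; push_cast; ring
  · intro m hm
    by_cases h : (2 : ℤ) ∣ m - i
    · obtain ⟨a, ha⟩ := h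
      exact ⟨a, by simp only; omega⟩
    · simp [h] at hm

/-- Compatibility of the quasi-interpolation coefficients with the two-scale relation. -/
theorem sampleSum_half {l : ℕ} {w : ℕ → ℝ}
    (hw : ∀ q : ℝ[X], q.natDegree ≤ l → ∀ x : ℝ,
      ∑' m : ℤ, sampleSum w l (fun y => q.eval y) m * cardinalBSpline l (x - m) = q.eval x)
    {q : ℝ[X]} (hq : q.natDegree ≤ l) (m : ℤ) :
    sampleSum w l (fun y => q.eval (y / 2)) m = ∑ i ∈ Finset.range (l + 2),
      if (2 : ℤ) ∣ m - i then maskCoef l i * sampleSum w l (fun y => q.eval y) ((m - i) / 2)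
        else 0 := by
  -- Both sequences are coefficients of `q (x / 2)`: one by reproduction, the other by inserting the
  -- two-scale relation into the series of `q` at `x / 2`. Linear independence of the translates
  -- identifies them.
  refine congrFun (eq_of_tsum_cardinalBSpline_eq l (d := fun m => ∑ i ∈ Finset.range (l + 2),
      if (2 : ℤ) ∣ m - i then maskCoef l i * sampleSum w l (fun y => q.eval y) ((m - i) / 2)
        else 0) fun x => ?_) m
  have h1 := hw (q.comp (C (2⁻¹ : ℝ) * X)) (by
    rw [natDegree_comp]
    refine (Nat.mul_le_mul le_rfl (natDegree_C_mul_le _ _)).trans (by simpa using hq)) x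
  have h2 : (fun y : ℝ => (q.comp (C (2⁻¹ : ℝ) * X)).eval y) = fun y => q.eval (y / 2) := by
    ext y; rw [eval_comp]; simp [div_eq_inv_mul]
  have h3 := congrFun h2 x
  rw [h2, h3] at h1
  rw [h1, ← hw q hq (x / 2)]
  simp_rw [Finset.sum_mul]
  rw [Summable.tsum_finsetSum fun i _ => summable_mul_cardinalBSpline l _ x]
  simp_rw [tsum_dite_even l (fun m => sampleSum w l (fun y => q.eval y) m)]
  rw [← Summable.tsum_finsetSum]
  · refine tsum_congr fun m => ?_
    rw [cardinalBSpline_two_scale, Finset.mul_sum]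
    refine Finset.sum_congr rfl fun i _ => ?_
    rw [maskCoef, show 2 * (x / 2 - (m : ℝ)) - i = x - i - 2 * m by ring]
    ring
  · intro i _
    refine summable_of_hasFiniteSupport ?_
    have hinj : Function.Injective fun m : ℤ => 2 * m := fun a b h => by simpa using h
    refine (((Finset.finite_toSet (Finset.Icc (⌊x - i⌋ - l) ⌊x - i⌋)).preimage
      hinj.injOn)).subset fun m hm => ?_
    refine support_mul_cardinalBSpline_subset l (fun _ => 1) (x - i) ?_
    simp only [Function.mem_support] at hm ⊢
    intro h0
    apply hm
    push_cast at h0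
    rw [one_mul] at h0
    rw [h0, mul_zero]

end Weights

/-! ### Tensor product splines -/

section Spline

variable {n : ℕ}

/-- The index of the half-open dyadic cube of level `k` containing `x`. -/
noncomputable def cellIndex (k : ℕ) (x : Fin n → ℝ) : Fin n → ℤ := fun i => ⌊(2 : ℝ) ^ k * x i⌋

theorem mem_dyadicCubeIco {k : ℕ} {m : Fin n → ℤ} {x : Fin n → ℝ} :
    x ∈ dyadicCubeIco k m ↔ cellIndex k x = m := by
  simp only [dyadicCubeIco, Set.mem_univ_pi, Set.mem_Ico, funext_iff, cellIndex, Int.floor_eq_iff]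
  refine forall_congr' fun i => ?_
  have h2 : (0 : ℝ) < 2 ^ k := by positivity
  rw [div_le_iff₀ h2, lt_div_iff₀ h2, mul_comm (x i)]

/-- The integer cube `[-R, R]ⁿ`. -/
noncomputable def nbrs (n R : ℕ) : Finset (Fin n → ℤ) := Fintype.piFinset fun _ => Finset.Icc (-(R : ℤ)) R

theorem mem_nbrs {R : ℕ} {ν : Fin n → ℤ} : ν ∈ nbrs n R ↔ ∀ i, |ν i| ≤ R := by
  simp [nbrs, Fintype.mem_piFinset, abs_le]

/-- The spline of level `k` with coefficients `c`. -/
noncomputable def splineOf (l k : ℕ) (c : (Fin n → ℤ) → ℝ) (x : Fin n → ℝ) : ℝ :=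
  ∑' m : Fin n → ℤ, c m * dyadicBSpline l k m x

theorem dyadicBSpline_ne_zero {l k : ℕ} {m : Fin n → ℤ} {x : Fin n → ℝ}
    (h : dyadicBSpline l k m x ≠ 0) (i : Fin n) :
    cellIndex k x i - l ≤ m i ∧ m i ≤ cellIndex k x i := by
  have h1 := Finset.prod_ne_zero_iff.1 h i (Finset.mem_univ i)
  have := support_mul_cardinalBSpline_subset l (fun _ => 1) ((2 : ℝ) ^ k * x i)
    (a := m i) (by simpa using h1)
  simpa [cellIndex] using this

theorem abs_dyadicBSpline_le (l k : ℕ) (m : Fin n → ℤ) (x : Fin n → ℝ) :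
    |dyadicBSpline l k m x| ≤ (2 ^ l) ^ n := by
  rw [dyadicBSpline, Finset.abs_prod]
  calc _ ≤ ∏ _i : Fin n, (2 : ℝ) ^ l :=
        Finset.prod_le_prod (fun _ _ => abs_nonneg _) fun i _ => abs_cardinalBSpline_le l _
    _ = _ := by simp

theorem measurable_dyadicBSpline (l k : ℕ) (m : Fin n → ℤ) : Measurable (dyadicBSpline l k m) :=
  Finset.measurable_fun_prod _ fun i _ => (measurable_cardinalBSpline l).comp
    (((measurable_pi_apply i).const_mul _).sub_const _)

theorem support_mul_dyadicBSpline_subset (l k : ℕ) (c : (Fin n → ℤ) → ℝ) (x : Fin n → ℝ) :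
    Function.support (fun m : Fin n → ℤ => c m * dyadicBSpline l k m x) ⊆
      ↑(Fintype.piFinset fun i => Finset.Icc (cellIndex k x i - l) (cellIndex k x i)) := by
  intro m hm
  rw [Finset.mem_coe, Fintype.mem_piFinset]
  intro i
  rw [Finset.mem_Icc]
  exact dyadicBSpline_ne_zero (right_ne_zero_of_mul hm) i

theorem summable_mul_dyadicBSpline (l k : ℕ) (c : (Fin n → ℤ) → ℝ) (x : Fin n → ℝ) :
    Summable fun m : Fin n → ℤ => c m * dyadicBSpline l k m x :=
  summable_of_hasFiniteSupport ((Finset.finite_toSet _).subset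
    (support_mul_dyadicBSpline_subset l k c x))

/-- The window need not be centred at the cell of `x`. This freedom allows one window to serve all
points that occur in a difference. -/
theorem splineOf_eq_sum {l k R : ℕ} (c : (Fin n → ℤ) → ℝ) {x : Fin n → ℝ} {m₀ : Fin n → ℤ}
    (h : ∀ i, m₀ i - R ≤ cellIndex k x i - l ∧ cellIndex k x i ≤ m₀ i + R) :
    splineOf l k c x = ∑ ν ∈ nbrs n R, c (m₀ + ν) * dyadicBSpline l k (m₀ + ν) x := by
  rw [splineOf, ← (Equiv.addLeft m₀).tsum_eq]
  refine tsum_eq_sum fun ν hν => ?_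
  simp only [Equiv.coe_addLeft]
  by_contra hne
  refine hν (mem_nbrs.2 fun i => ?_)
  have h1 := dyadicBSpline_ne_zero (right_ne_zero_of_mul hne) i
  have h2 := h i
  simp only [Pi.add_apply] at h1
  rw [abs_le]
  constructor <;> linarith

theorem splineOf_eq_sum_cellIndex (l k : ℕ) (c : (Fin n → ℤ) → ℝ) (x : Fin n → ℝ) :
    splineOf l k c x = ∑ ν ∈ nbrs n l, c (cellIndex k x + ν) *
      dyadicBSpline l k (cellIndex k x + ν) x :=
  splineOf_eq_sum c fun i => ⟨le_rfl, by simp⟩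

theorem measurable_cellIndex (k : ℕ) : Measurable (cellIndex (n := n) k) :=
  measurable_pi_lambda _ fun i => Int.measurable_floor.comp ((measurable_pi_apply i).const_mul _)

theorem measurable_splineOf (l k : ℕ) (c : (Fin n → ℤ) → ℝ) : Measurable (splineOf l k c) := by
  have : splineOf l k c = fun x => ∑ ν ∈ nbrs n l, c (cellIndex k x + ν) *
      dyadicBSpline l k (cellIndex k x + ν) x := by
    ext x; exact splineOf_eq_sum_cellIndex l k c x
  rw [this]
  refine Finset.measurable_fun_sum _ fun ν _ => ?_
  have h1 : Measurable fun p : (Fin n → ℤ) × (Fin n → ℝ) =>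
      c (p.1 + ν) * dyadicBSpline l k (p.1 + ν) p.2 :=
    measurable_from_prod_countable_right fun m =>
      (measurable_dyadicBSpline l k (m + ν)).const_mul (c (m + ν))
  exact h1.comp ((measurable_cellIndex k).prodMk measurable_id)

theorem enorm_splineOf_le (l k : ℕ) (c : (Fin n → ℤ) → ℝ) (x : Fin n → ℝ) :
    ‖splineOf l k c x‖ₑ ≤
      ENNReal.ofReal ((2 ^ l) ^ n) * ∑ ν ∈ nbrs n l, ‖c (cellIndex k x + ν)‖ₑ := by
  rw [splineOf_eq_sum_cellIndex, Finset.mul_sum]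
  refine (enorm_sum_le _ _).trans (Finset.sum_le_sum fun ν _ => ?_)
  rw [enorm_mul, mul_comm]
  gcongr
  rw [Real.enorm_eq_ofReal_abs]
  exact ENNReal.ofReal_le_ofReal (abs_dyadicBSpline_le l k _ x)

theorem splineOf_add (l k : ℕ) (c d : (Fin n → ℤ) → ℝ) (x : Fin n → ℝ) :
    splineOf l k (c + d) x = splineOf l k c x + splineOf l k d x := by
  simp only [splineOf_eq_sum_cellIndex, Pi.add_apply, add_mul, Finset.sum_add_distrib]

theorem splineOf_sub (l k : ℕ) (c d : (Fin n → ℤ) → ℝ) (x : Fin n → ℝ) :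
    splineOf l k (c - d) x = splineOf l k c x - splineOf l k d x := by
  simp only [splineOf_eq_sum_cellIndex, Pi.sub_apply, sub_mul, Finset.sum_sub_distrib]

theorem splineOf_smul (l k : ℕ) (a : ℝ) (c : (Fin n → ℤ) → ℝ) (x : Fin n → ℝ) :
    splineOf l k (a • c) x = a * splineOf l k c x := by
  simp only [splineOf_eq_sum_cellIndex, Pi.smul_apply, smul_eq_mul, mul_assoc, Finset.mul_sum]

/-! #### Differences of splines -/

theorem exists_abs_diffOp_dyadicBSpline_le (n l : ℕ) :
    ∃ D : ℝ, 0 < D ∧ ∀ (k : ℕ) (m : Fin n → ℤ) (h x : Fin n → ℝ) (ε : ℝ), 0 ≤ ε →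
      (∀ i, |2 ^ k * h i| ≤ ε) → |diffOp l h (dyadicBSpline l k m) x| ≤ D * ε ^ l := by
  obtain ⟨D, hD, H⟩ := exists_abs_fwdDiff_iter_prod_le (M := Fin n → ℝ) l (2 ^ l) n
  refine ⟨D, hD, fun k m h x ε hε hh => ?_⟩
  rw [diffOp_eq_fwdDiff]
  refine H h ε hε (fun i y => cardinalBSpline l ((2 : ℝ) ^ k * y i - m i)) (fun i j hj y => ?_)
    l le_rfl x
  have e : (fwdDiff h)^[j] (fun y : Fin n → ℝ => cardinalBSpline l ((2 : ℝ) ^ k * y i - m i)) y =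
      (fwdDiff ((2 : ℝ) ^ k * h i))^[j] (cardinalBSpline l) ((2 : ℝ) ^ k * y i - m i) := by
    simp only [fwdDiff_iter_eq_sum_shift]
    refine Finset.sum_congr rfl fun a _ => ?_
    congr 2
    simp
    ring
  rw [e]
  refine (abs_fwdDiff_iter_cardinalBSpline_le hj _ _).trans ?_
  gcongr
  exact hh i

theorem diffOp_finset_sum {ι : Type*} (l : ℕ) (h : Fin n → ℝ) (s : Finset ι)
    (F : ι → (Fin n → ℝ) → ℝ) (c : ι → ℝ) (x : Fin n → ℝ) :
    diffOp l h (fun y => ∑ j ∈ s, c j * F j y) x = ∑ j ∈ s, c j * diffOp l h (F j) x := by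
  simp only [diffOp, Finset.mul_sum]
  rw [Finset.sum_comm]
  exact Finset.sum_congr rfl fun j _ => Finset.sum_congr rfl fun i _ => by ring

theorem diffOp_congr {l : ℕ} {h : Fin n → ℝ} {f g : (Fin n → ℝ) → ℝ} {x : Fin n → ℝ}
    (H : ∀ i ≤ l, f (x + (i : ℝ) • h) = g (x + (i : ℝ) • h)) : diffOp l h f x = diffOp l h g x :=
  Finset.sum_congr rfl fun i hi => by rw [H i (Nat.lt_succ_iff.1 (Finset.mem_range.1 hi))]

/-- The radius `2 * l` is made up of `l` cells for the supports of the B-splines and `l` further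
cells for the points `x + j h`, which with `ε ≤ 1` leave the cell of `x` by at most `l` cells. The
common window reduces the claim to single B-splines. -/
theorem exists_enorm_diffOp_splineOf_le (n l : ℕ) :
    ∃ D : ℝ, 0 < D ∧ ∀ (k : ℕ) (c : (Fin n → ℤ) → ℝ) (h x : Fin n → ℝ) (ε : ℝ), 0 ≤ ε → ε ≤ 1 →
      (∀ i, |2 ^ k * h i| ≤ ε) → ‖diffOp l h (splineOf l k c) x‖ₑ ≤
        ENNReal.ofReal (D * ε ^ l) * ∑ ν ∈ nbrs n (2 * l), ‖c (cellIndex k x + ν)‖ₑ := by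
  obtain ⟨D, hD, H⟩ := exists_abs_diffOp_dyadicBSpline_le n l
  refine ⟨D, hD, fun k c h x ε hε hε1 hh => ?_⟩
  have e : diffOp l h (splineOf l k c) x = diffOp l h (fun y => ∑ ν ∈ nbrs n (2 * l),
      c (cellIndex k x + ν) * dyadicBSpline l k (cellIndex k x + ν) y) x := by
    refine diffOp_congr fun j hj => splineOf_eq_sum c fun i => ?_
    have h1 : |2 ^ k * ((j : ℝ) * h i)| ≤ l := by
      rw [show (2 : ℝ) ^ k * ((j : ℝ) * h i) = j * (2 ^ k * h i) by ring, abs_mul, Nat.abs_cast]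
      calc (j : ℝ) * |2 ^ k * h i| ≤ l * 1 := by
            gcongr
            exact (hh i).trans hε1
        _ = l := mul_one _
    obtain ⟨h2, h3⟩ := abs_le.1 h1
    have e1 : cellIndex k (x + (j : ℝ) • h) i = ⌊2 ^ k * x i + 2 ^ k * ((j : ℝ) * h i)⌋ := by
      simp [cellIndex, mul_add]
    have h4 : cellIndex k (x + (j : ℝ) • h) i ≤ cellIndex k x i + l := by
      rw [e1, cellIndex, ← Int.floor_add_natCast]
      exact Int.floor_le_floor (by linarith)
    have h5 : cellIndex k x i - l ≤ cellIndex k (x + (j : ℝ) • h) i := by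
      rw [e1, cellIndex, ← Int.floor_sub_natCast]
      exact Int.floor_le_floor (by linarith)
    push_cast
    constructor <;> linarith
  rw [e, diffOp_finset_sum, Finset.mul_sum]
  refine (enorm_sum_le _ _).trans (Finset.sum_le_sum fun ν _ => ?_)
  rw [enorm_mul, mul_comm]
  gcongr
  rw [Real.enorm_eq_ofReal_abs]
  exact ENNReal.ofReal_le_ofReal (H k _ h x ε hε hh)

/-! #### Refinement -/

/-- Coefficients of a spline of level `k` with respect to the B-splines of level `k + 1`. -/
noncomputable def refineCoef (l : ℕ) (c : (Fin n → ℤ) → ℝ) (m : Fin n → ℤ) : ℝ :=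
  ∑ ν ∈ Fintype.piFinset fun _ : Fin n => Finset.range (l + 2),
    if ∀ i, (2 : ℤ) ∣ m i - ν i then (∏ i, maskCoef l (ν i)) * c (fun i => (m i - ν i) / 2) else 0

/-- The two-scale relation in each coordinate writes a B-spline through those of the next level with
indices `2 m + ν`. Collecting terms by index gives `refineCoef`, whose divisibility test picks out
the indices of this form. -/
theorem splineOf_refineCoef (l k : ℕ) (c : (Fin n → ℤ) → ℝ) (x : Fin n → ℝ) :
    splineOf l (k + 1) (refineCoef l c) x = splineOf l k c x := by
  set S := Fintype.piFinset fun _ : Fin n => Finset.range (l + 2) with hS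
  have h1 : ∀ m : Fin n → ℤ, c m * dyadicBSpline l k m x = ∑ ν ∈ S,
      (∏ i, maskCoef l (ν i)) * c m * dyadicBSpline l (k + 1) (fun i => 2 * m i + ν i) x := by
    intro m
    have : dyadicBSpline l k m x = ∏ i, ∑ j ∈ Finset.range (l + 2),
        maskCoef l j * cardinalBSpline l ((2 : ℝ) ^ (k + 1) * x i - (2 * m i + j : ℤ)) := by
      refine Finset.prod_congr rfl fun i _ => ?_
      rw [cardinalBSpline_two_scale]
      refine Finset.sum_congr rfl fun j _ => ?_
      rw [maskCoef]
      congr 2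
      push_cast
      ring
    rw [this, Finset.prod_univ_sum, Finset.mul_sum]
    refine Finset.sum_congr rfl fun ν _ => ?_
    rw [Finset.prod_mul_distrib, dyadicBSpline]
    push_cast
    ring
  have hinj : ∀ ν : Fin n → ℕ, Function.Injective fun (m : Fin n → ℤ) i => 2 * m i + (ν i : ℤ) := by
    intro ν a b hab
    ext i
    have := congrFun hab i
    simp only at this
    omega
  have hsum : ∀ ν ∈ S, Summable fun m : Fin n → ℤ => (∏ i, maskCoef l (ν i)) * c m *
      dyadicBSpline l (k + 1) (fun i => 2 * m i + ν i) x := by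
    intro ν _
    refine summable_of_hasFiniteSupport (((Finset.finite_toSet (Fintype.piFinset fun i =>
      Finset.Icc (cellIndex (k + 1) x i - l) (cellIndex (k + 1) x i))).preimage
      (hinj ν).injOn).subset fun m hm => ?_)
    exact support_mul_dyadicBSpline_subset l (k + 1) (fun _ => 1) x
      (by simpa using right_ne_zero_of_mul hm)
  rw [splineOf, splineOf]
  simp_rw [h1]
  rw [Summable.tsum_finsetSum hsum]
  simp_rw [refineCoef, Finset.sum_mul]
  rw [Summable.tsum_finsetSum fun ν _ => summable_mul_dyadicBSpline l (k + 1) _ x]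
  refine Finset.sum_congr rfl fun ν _ => ?_
  rw [← (hinj ν).tsum_eq]
  · refine tsum_congr fun m => ?_
    rw [if_pos fun i => by simp]
    congr 3
    ext i
    rw [add_sub_cancel_right, Int.mul_ediv_cancel_left _ two_ne_zero]
  · intro m hm
    by_cases h : ∀ i, (2 : ℤ) ∣ m i - ν i
    · choose a ha using h
      refine ⟨a, ?_⟩
      ext i
      have := ha i
      simp only
      omega
    · simp [h] at hm

/-! #### Reproduction of polynomials -/

open Polynomial in
/-- Polynomials of degree less than `l` in each variable. -/
def polySpace (n l : ℕ) : Submodule ℝ ((Fin n → ℝ) → ℝ) :=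
  Submodule.span ℝ {P | ∃ q : Fin n → ℝ[X], (∀ i, (q i).natDegree < l) ∧
    P = fun x => ∏ i, (q i).eval (x i)}

/-- Quasi-interpolation coefficients of a function. -/
noncomputable def sampleCoef (w : ℕ → ℝ) (l k : ℕ) (F : (Fin n → ℝ) → ℝ) (m : Fin n → ℤ) : ℝ :=
  ∑ ν ∈ Fintype.piFinset fun _ : Fin n => Finset.range (l + 1),
    (∏ i, w (ν i)) * F (fun i => ((m i : ℝ) + ν i) / 2 ^ k)

theorem sampleCoef_add (w : ℕ → ℝ) (l k : ℕ) (F G : (Fin n → ℝ) → ℝ) :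
    sampleCoef w l k (F + G) = sampleCoef w l k F + sampleCoef w l k G := by
  ext m; simp [sampleCoef, mul_add, Finset.sum_add_distrib]

theorem sampleCoef_smul (w : ℕ → ℝ) (l k : ℕ) (a : ℝ) (F : (Fin n → ℝ) → ℝ) :
    sampleCoef w l k (a • F) = a • sampleCoef w l k F := by
  ext m; simp only [sampleCoef, Pi.smul_apply, smul_eq_mul, Finset.mul_sum]
  exact Finset.sum_congr rfl fun _ _ => by ring

theorem sampleCoef_sub (w : ℕ → ℝ) (l k : ℕ) (F G : (Fin n → ℝ) → ℝ) :
    sampleCoef w l k (F - G) = sampleCoef w l k F - sampleCoef w l k G := by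
  ext m; simp [sampleCoef, mul_sub, Finset.sum_sub_distrib]

theorem sampleCoef_prod (w : ℕ → ℝ) (l k : ℕ) (g : Fin n → ℝ → ℝ) (m : Fin n → ℤ) :
    sampleCoef w l k (fun x => ∏ i, g i (x i)) m =
      ∏ i, sampleSum w l (fun y => g i (y / 2 ^ k)) (m i) := by
  simp_rw [sampleCoef, sampleSum]
  rw [Finset.prod_univ_sum]
  exact Finset.sum_congr rfl fun ν _ => by rw [Finset.prod_mul_distrib]

theorem refineCoef_add (l : ℕ) (c d : (Fin n → ℤ) → ℝ) : refineCoef l (c + d) = refineCoef l c + refineCoef l d := by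
  ext m
  simp only [refineCoef, Pi.add_apply, mul_add, ← Finset.sum_add_distrib]
  exact Finset.sum_congr rfl fun _ _ => by split_ifs <;> simp

theorem refineCoef_smul (l : ℕ) (a : ℝ) (c : (Fin n → ℤ) → ℝ) : refineCoef l (a • c) = a • refineCoef l c := by
  ext m
  simp only [refineCoef, Pi.smul_apply, smul_eq_mul, Finset.mul_sum]
  exact Finset.sum_congr rfl fun _ _ => by split_ifs <;> ring

theorem refineCoef_prod (l : ℕ) (c : Fin n → ℤ → ℝ) (m : Fin n → ℤ) :
    refineCoef l (fun m => ∏ i, c i (m i)) m = ∏ i, ∑ j ∈ Finset.range (l + 2),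
      if (2 : ℤ) ∣ m i - j then maskCoef l j * c i ((m i - j) / 2) else 0 := by
  rw [refineCoef, Finset.prod_univ_sum]
  refine Finset.sum_congr rfl fun ν _ => ?_
  split_ifs with h
  · rw [← Finset.prod_mul_distrib]
    exact Finset.prod_congr rfl fun i _ => by rw [if_pos (h i)]
  · push Not at h
    obtain ⟨i, hi⟩ := h
    rw [Finset.prod_eq_zero (Finset.mem_univ i) (if_neg hi)]

open Polynomial in
theorem natDegree_comp_C_mul_X_le (q : ℝ[X]) (a : ℝ) : (q.comp (C a * X)).natDegree ≤ q.natDegree := by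
  rw [natDegree_comp]
  exact (Nat.mul_le_mul le_rfl (natDegree_C_mul_le _ _)).trans (by simp)

open Polynomial in
/-- Weights for which quasi-interpolation reproduces polynomials, compatibly with refinement. -/
theorem exists_weights (n l : ℕ) :
    ∃ w : ℕ → ℝ, ∀ P ∈ polySpace n l, (∀ k, splineOf l k (sampleCoef w l k P) = P) ∧
      ∀ k, refineCoef l (sampleCoef w l k P) = sampleCoef w l (k + 1) P := by
  obtain ⟨w, hw⟩ := exists_sampleSum_reproduces l
  refine ⟨w, fun P hP => ?_⟩
  -- By linearity only products of univariate polynomials matter, and for them sampling, spline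
  -- series and refinement all factor over the coordinates.
  induction hP using Submodule.span_induction with
  | mem P h =>
    obtain ⟨q, hq, rfl⟩ := h
    have hscale : ∀ (k : ℕ) (i : Fin n), ∃ p : ℝ[X], p.natDegree ≤ l ∧
        ∀ y : ℝ, p.eval y = (q i).eval (y / 2 ^ k) := fun k i =>
      ⟨(q i).comp (C ((2 : ℝ) ^ k)⁻¹ * X), (natDegree_comp_C_mul_X_le _ _).trans (hq i).le,
        fun y => by rw [eval_comp]; simp [div_eq_inv_mul]⟩
    refine ⟨fun k => ?_, fun k => ?_⟩
    · ext x
      rw [splineOf, tsum_eq_sum' (support_mul_dyadicBSpline_subset l k _ x)]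
      have : ∀ m : Fin n → ℤ, sampleCoef w l k (fun x => ∏ i, (q i).eval (x i)) m *
          dyadicBSpline l k m x = ∏ i, sampleSum w l (fun y => (q i).eval (y / 2 ^ k)) (m i) *
            cardinalBSpline l (2 ^ k * x i - m i) := by
        intro m
        rw [sampleCoef_prod w l k (fun i y => (q i).eval y), dyadicBSpline,
          Finset.prod_mul_distrib]
      simp_rw [this]
      rw [← Finset.prod_univ_sum (fun i => Finset.Icc (cellIndex k x i - l) (cellIndex k x i))
        fun i j => sampleSum w l (fun y => (q i).eval (y / 2 ^ k)) j *
            cardinalBSpline l (2 ^ k * x i - j)]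
      refine Finset.prod_congr rfl fun i _ => ?_
      obtain ⟨p, hp, hpe⟩ := hscale k i
      have h1 := hw p hp (2 ^ k * x i)
      rw [tsum_mul_cardinalBSpline_eq_sum] at h1
      simp only [hpe] at h1
      rw [mul_div_cancel_left₀ _ (by positivity)] at h1
      exact h1
    · ext m
      have e : sampleCoef w l k (fun x : Fin n → ℝ => ∏ i, (q i).eval (x i)) = fun m =>
          ∏ i, sampleSum w l (fun y => (q i).eval (y / 2 ^ k)) (m i) := by
        ext m; exact sampleCoef_prod w l k (fun i y => (q i).eval y) m
      rw [e, refineCoef_prod l fun i => sampleSum w l fun y => (q i).eval (y / 2 ^ k),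
        sampleCoef_prod w l (k + 1) (fun i y => (q i).eval y)]
      refine Finset.prod_congr rfl fun i _ => ?_
      obtain ⟨p, hp, hpe⟩ := hscale k i
      have h1 := sampleSum_half hw hp (m i)
      simp only [hpe] at h1
      rw [← h1]
      congr 1
      ext y
      rw [pow_succ, div_div, mul_comm]
  | zero =>
    have h0 : ∀ k, sampleCoef w l k (0 : (Fin n → ℝ) → ℝ) = 0 := fun k => by
      ext m; simp [sampleCoef]
    refine ⟨fun k => ?_, fun k => ?_⟩
    · ext x; simp [h0, splineOf]
    · ext m; simp [h0, refineCoef]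
  | add P Q _ _ hP hQ =>
    refine ⟨fun k => ?_, fun k => ?_⟩
    · ext x; rw [sampleCoef_add, splineOf_add, hP.1, hQ.1]; rfl
    · rw [sampleCoef_add, refineCoef_add, hP.2, hQ.2, sampleCoef_add]
  | smul a P _ hP =>
    refine ⟨fun k => ?_, fun k => ?_⟩
    · ext x; rw [sampleCoef_smul, splineOf_smul, hP.1]; rfl
    · rw [sampleCoef_smul, refineCoef_smul, hP.2, sampleCoef_smul]

end Spline

/-! ### Dyadic cubes and weights -/

section Cubes

variable {n : ℕ}

/-- The factor `2^{kn/r}`. -/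
noncomputable def scale (r : ℝ≥0∞) (n k : ℕ) : ℝ≥0∞ := ((2 : ℝ≥0∞) ^ (k * n)) ^ (r⁻¹).toReal

theorem scale_ne_zero (r : ℝ≥0∞) (n k : ℕ) : scale r n k ≠ 0 := by
  simp [scale, ENNReal.rpow_eq_zero_iff]

theorem scale_ne_top (r : ℝ≥0∞) (n k : ℕ) : scale r n k ≠ ∞ :=
  ENNReal.rpow_ne_top_of_nonneg (by positivity) (by finiteness)

theorem scale_add (r : ℝ≥0∞) (n k d : ℕ) : scale r n (k + d) = scale r n k * scale r n d := by
  rw [scale, add_mul, pow_add, ENNReal.mul_rpow_of_nonneg _ _ (by positivity)]; rfl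

theorem scale_zero (r : ℝ≥0∞) (n : ℕ) : scale r n 0 = 1 := by simp [scale]

theorem scale_eq_ofReal (r : ℝ≥0∞) (n k : ℕ) :
    scale r n k = ENNReal.ofReal ((2 : ℝ) ^ ((k : ℝ) * n * (r⁻¹).toReal)) := by
  rw [← ENNReal.ofReal_rpow_of_pos two_pos, ENNReal.rpow_mul, scale]
  congr 1
  rw [← Nat.cast_mul, ENNReal.rpow_natCast]
  norm_num

theorem scale_mul_scale {p s θ : ℝ≥0∞} (hp : p ≠ 0) (hs : s ≠ 0) (h : θ⁻¹ = p⁻¹ + s⁻¹) (n k : ℕ) :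
    scale p n k * scale s n k = scale θ n k := by
  rw [scale, scale, scale, ← ENNReal.rpow_add_of_nonneg _ _ (by positivity) (by positivity), h,
    ENNReal.toReal_add (by simpa) (by simpa)]

theorem measurableSet_dyadicCubeIco (k : ℕ) (m : Fin n → ℤ) : MeasurableSet (dyadicCubeIco k m) :=
  MeasurableSet.univ_pi fun _ => measurableSet_Ico

/-- The weight coefficients are defined with open cubes, but only half-open cubes partition the
space. The difference is a null set. -/
theorem dyadicCube_ae_eq (k : ℕ) (m : Fin n → ℤ) :
    dyadicCube k m =ᵐ[volume] dyadicCubeIco k m :=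
  (Measure.univ_pi_Ioo_ae_eq_Icc (μ := fun _ : Fin n => (volume : Measure ℝ))).trans
    (Measure.univ_pi_Ico_ae_eq_Icc (μ := fun _ : Fin n => (volume : Measure ℝ))).symm

theorem restrict_dyadicCube (k : ℕ) (m : Fin n → ℤ) :
    (volume : Measure (Fin n → ℝ)).restrict (dyadicCube k m) =
      volume.restrict (dyadicCubeIco k m) :=
  Measure.restrict_congr_set (dyadicCube_ae_eq k m)

theorem volume_dyadicCubeIco (k : ℕ) (m : Fin n → ℤ) :
    volume (dyadicCubeIco k m) = ((2 : ℝ≥0∞) ^ (k * n))⁻¹ := by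
  rw [dyadicCubeIco, Real.volume_pi_Ico]
  have : ∀ i : Fin n, ENNReal.ofReal (((m i : ℝ) + 1) / 2 ^ k - (m i : ℝ) / 2 ^ k) =
      ((2 : ℝ≥0∞) ^ k)⁻¹ := by
    intro i
    rw [← sub_div, add_sub_cancel_left, one_div, ENNReal.ofReal_inv_of_pos (by positivity),
      ENNReal.ofReal_pow (by norm_num)]
    norm_num
  simp [this, pow_mul, ENNReal.inv_pow]

theorem eLpNorm_const_dyadicCubeIco {r : ℝ≥0∞} (hr : r ≠ 0) (c : ℝ≥0∞) (k : ℕ) (m : Fin n → ℤ) :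
    eLpNorm (fun _ : Fin n → ℝ => c) r (volume.restrict (dyadicCubeIco k m)) =
      c * (scale r n k)⁻¹ := by
  rw [eLpNorm_const c hr]
  · rw [Measure.restrict_apply_univ, volume_dyadicCubeIco, scale, enorm_eq_self,
      ENNReal.inv_rpow, one_div, ENNReal.toReal_inv]
  · rw [Ne, Measure.restrict_eq_zero, volume_dyadicCubeIco]
    simp only [ENNReal.inv_eq_zero]
    finiteness

/-- The index of the dyadic cube `d` levels above. -/
def parent (d : ℕ) (m : Fin n → ℤ) : Fin n → ℤ := fun i => m i / 2 ^ d

theorem parent_cellIndex (k d : ℕ) (x : Fin n → ℝ) :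
    parent d (cellIndex (k + d) x) = cellIndex k x := by
  ext i
  have := Int.floor_div_natCast ((2 : ℝ) ^ (k + d) * x i) (2 ^ d)
  push_cast at this
  rw [parent, cellIndex, cellIndex, ← this, pow_add]
  congr 1
  field_simp

theorem dyadicCubeIco_eq_iUnion (k d : ℕ) (m : Fin n → ℤ) :
    dyadicCubeIco k m = ⋃ m' : {m' // parent d m' = m}, dyadicCubeIco (k + d) (m' : Fin n → ℤ) := by
  ext x
  simp only [Set.mem_iUnion, mem_dyadicCubeIco, Subtype.exists, exists_prop, exists_eq_right']
  rw [parent_cellIndex]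

theorem disjoint_dyadicCubeIco {k : ℕ} {m m' : Fin n → ℤ} (h : m ≠ m') :
    Disjoint (dyadicCubeIco k m) (dyadicCubeIco k m') :=
  Set.disjoint_left.2 fun _ h1 h2 =>
    h ((mem_dyadicCubeIco.1 h1).symm.trans (mem_dyadicCubeIco.1 h2))

theorem eLpNorm_dyadicCubeIco {E : Type*} [ENorm E] {r : ℝ≥0∞} (hr : r ≠ 0)
    (g : (Fin n → ℝ) → E) (k d : ℕ) (m : Fin n → ℤ) :
    eLpNorm g r (volume.restrict (dyadicCubeIco k m)) =
      lqNorm r fun m' : {m' // parent d m' = m} =>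
        eLpNorm g r (volume.restrict (dyadicCubeIco (k + d) (m' : Fin n → ℤ))) :=
  eLpNorm_eq_lqNorm_restrict hr g (fun _ => measurableSet_dyadicCubeIco _ _)
    (fun _ _ hij => disjoint_dyadicCubeIco fun h => hij (Subtype.ext h))
    (dyadicCubeIco_eq_iUnion k d m)

theorem eLpNorm_eq_lqNorm_dyadicCubeIco {E : Type*} [ENorm E] {r : ℝ≥0∞} (hr : r ≠ 0)
    (g : (Fin n → ℝ) → E) (k : ℕ) :
    eLpNorm g r volume =
      lqNorm r fun m : Fin n → ℤ => eLpNorm g r (volume.restrict (dyadicCubeIco k m)) := by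
  rw [← Measure.restrict_univ (μ := (volume : Measure (Fin n → ℝ)))]
  simp only [Measure.restrict_univ]
  conv_lhs => rw [← Measure.restrict_univ (μ := (volume : Measure (Fin n → ℝ)))]
  refine eLpNorm_eq_lqNorm_restrict hr g (fun _ => measurableSet_dyadicCubeIco _ _)
    (fun _ _ hij => disjoint_dyadicCubeIco hij) ?_
  ext x
  simp [mem_dyadicCubeIco]

theorem cubeMean_eq (s : ℝ≥0∞) (g : (Fin n → ℝ) → ℝ) (k : ℕ) (m : Fin n → ℤ) :
    cubeMean s g k m = scale s n k * eLpNorm g s (volume.restrict (dyadicCubeIco k m)) := by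
  rw [cubeMean, restrict_dyadicCube, scale]

/-- Properties of the numbers `t_{k,m}` that govern the spline representation. -/
structure CoefWeight (p r : ℝ≥0∞) (l : ℕ) (ρ : ℝ≥0∞) (τ : ℕ → (Fin n → ℤ) → ℝ≥0∞) : Prop where
  ne_zero : ∀ k m, τ k m ≠ 0
  ne_top : ∀ k m, τ k m ≠ ∞
  neighbour : ∃ C : ℝ≥0∞, C ≠ ∞ ∧ ∀ k m m', (∀ i, |m i - m' i| ≤ 1) → τ k m ≤ C * τ k m'
  fine : ∃ C : ℝ≥0∞, C ≠ ∞ ∧ ∀ k d m (b : (Fin n → ℤ) → ℝ≥0∞),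
    τ k m * (lqNorm r fun m' : {m' // parent d m' = m} => b m') ≤
      C * ρ ^ d * scale r n d * lqNorm p fun m' : {m' // parent d m' = m} => τ (k + d) m' * b m'
  coarse : ∃ C : ℝ≥0∞, C ≠ ∞ ∧ ∀ k d m,
    (lqNorm p fun m' : {m' // parent d m' = m} => τ (k + d) m') ≤ C * ρ ^ d * 2 ^ (l * d) * τ k m

/-- The exponent relation that makes Hölder's inequality applicable with `p` and `σ₁`. The
convention at `p = θ` gives `σ₁ = ∞` also when both exponents are infinite. -/
theorem ratioExp_inv {p θ : ℝ≥0∞} (hθ : 0 < θ) (hθp : θ ≤ p) :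
    θ⁻¹ = p⁻¹ + (θ * (ratioExp p θ).conjExponent)⁻¹ := by
  unfold ratioExp
  split_ifs with h
  · subst h
    have : (1 : ℝ≥0∞).conjExponent = ∞ := by simp [ENNReal.conjExponent]
    rw [this, ENNReal.mul_top hθ.ne']; simp
  have hlt : θ < p := lt_of_le_of_ne hθp (Ne.symm h)
  have hθt : θ ≠ ∞ := hlt.ne_top
  have hone : 1 ≤ p / θ := by
    rw [ENNReal.le_div_iff_mul_le (Or.inl hθ.ne') (Or.inl hθt), one_mul]; exact hθp
  have hc : (p / θ)⁻¹ + (p / θ).conjExponent⁻¹ = 1 := by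
    have : ENNReal.HolderConjugate (p / θ) (p / θ).conjExponent :=
      ENNReal.HolderConjugate.conjExponent hone
    exact ENNReal.HolderConjugate.inv_add_inv_eq_one _ _
  have h1 : p⁻¹ = θ⁻¹ * (p / θ)⁻¹ := by
    rw [ENNReal.inv_div (Or.inl hθt) (Or.inl hθ.ne'), div_eq_mul_inv, ← mul_assoc,
      ENNReal.inv_mul_cancel hθ.ne' hθt, one_mul]
  have h2 : (θ * (p / θ).conjExponent)⁻¹ = θ⁻¹ * ((p / θ).conjExponent)⁻¹ :=
    ENNReal.mul_inv (Or.inl hθ.ne') (Or.inl hθt)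
  rw [h1, h2, ← mul_add, hc, mul_one]

theorem avgWeight_apply (p : ℝ≥0∞) (t : ℕ → (Fin n → ℝ) → ℝ) {k : ℕ} {m : Fin n → ℤ}
    {x : Fin n → ℝ} (hx : x ∈ dyadicCubeIco k m) :
    avgWeight p t k x = (2 : ℝ) ^ ((k : ℝ) * n * (p⁻¹).toReal) * (weightCoef p t k m).toReal := by
  rw [avgWeight, tsum_eq_single m, Set.indicator_of_mem hx]
  intro m' hm'
  refine Set.indicator_of_notMem (fun h => hm' ?_) _
  exact (mem_dyadicCubeIco.1 h).symm.trans (mem_dyadicCubeIco.1 hx)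

theorem dyadicCubeIco_subset_Icc (k : ℕ) (m : Fin n → ℤ) :
    dyadicCubeIco k m ⊆ Set.Icc (fun i => (m i : ℝ) / 2 ^ k) (fun i => ((m i : ℝ) + 1) / 2 ^ k) := by
  intro x hx
  rw [dyadicCubeIco, Set.mem_univ_pi] at hx
  exact ⟨fun i => (hx i).1, fun i => (hx i).2.le⟩

theorem MemLpLoc.eLpNorm_dyadicCubeIco_ne_top {f : (Fin n → ℝ) → ℝ} {p : ℝ≥0∞} (hf : MemLpLoc f p)
    (k : ℕ) (m : Fin n → ℤ) : eLpNorm f p (volume.restrict (dyadicCubeIco k m)) ≠ ∞ := by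
  have h := (hf _ (isCompact_Icc (a := fun i => (m i : ℝ) / 2 ^ k)
    (b := fun i => ((m i : ℝ) + 1) / 2 ^ k))).2
  exact ((eLpNorm_mono_measure f (Measure.restrict_mono (dyadicCubeIco_subset_Icc k m) le_rfl)).trans_lt
    h).ne

/-- The averaged weight is constant on each cube, so the means in the weight class become discrete
quasi-norms over descendants. The first condition controls the `l_σ` quasi-norm of the reciprocals,
and together with Hölder's inequality and the first Hardy condition gives `fine`. The second
condition and the second Hardy condition give `coarse`. -/
theorem exists_coefWeight {l : ℕ} {p q r θ : ℝ≥0∞} (hp : 0 < p) (hθ : 0 < θ)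
    (hθpr : θ ≤ min p r) {α₃ : ℝ} {α₁ α₂ : ℕ → ℝ} (hα₁ : ∀ k, 0 < α₁ k) (hα₂ : ∀ k, 0 < α₂ k)
    {μ : ℝ≥0} (hμ : 0 < μ) (hμq : (μ : ℝ≥0∞) ≤ q)
    (hHardy₁ : HardyTail (q / μ)
      (fun k => (α₁ k / (2 : ℝ) ^ ((k : ℝ) * n * ((θ⁻¹).toReal - (r⁻¹).toReal))) ^ (μ : ℝ)))
    (hHardy₂ : HardyHead (q / μ)
      (fun k => ((2 : ℝ) ^ (-((k : ℝ) * l)) * α₂ k) ^ (μ : ℝ)))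
    {t : ℕ → (Fin n → ℝ) → ℝ} (ht : Admissible p t)
    (htX : WeightClass α₁ α₂ α₃ (θ * (ratioExp p θ).conjExponent) p p (avgWeight p t)) :
    ∃ ρ : ℝ≥0∞, ρ < 1 ∧ CoefWeight p r l ρ (weightCoef p t) := by
  have hθp : θ ≤ p := hθpr.trans (min_le_left _ _)
  have hθr : θ ≤ r := hθpr.trans (min_le_right _ _)
  set σ := θ * (ratioExp p θ).conjExponent with hσ
  have hinv : θ⁻¹ = p⁻¹ + σ⁻¹ := ratioExp_inv hθ hθp
  have hσ0 : σ ≠ 0 := by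
    refine mul_ne_zero hθ.ne' ?_
    simp [ENNReal.conjExponent]
  have hs : 1 ≤ q / μ := by
    rw [ENNReal.le_div_iff_mul_le (Or.inl (by simpa using hμ.ne')) (Or.inl (by simp)), one_mul]
    exact hμq
  have hμ' : (0 : ℝ) < μ := hμ
  -- Hardy's conditions are imposed on `μ`-th powers; extracting the root preserves geometric growth
  -- and changes only the constant and the ratio.
  have hroot : ∀ {a b C ρ : ℝ} (d : ℕ), 0 < a → 0 < b → 0 < C → 0 < ρ →
      a ^ (μ : ℝ) ≤ C * ρ ^ d * b ^ (μ : ℝ) →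
      a ≤ C ^ (μ : ℝ)⁻¹ * (ρ ^ (μ : ℝ)⁻¹) ^ d * b := by
    intro a b C ρ d ha hb hC hρ h
    have := Real.rpow_le_rpow (by positivity) h (inv_nonneg.2 hμ'.le)
    rwa [Real.rpow_rpow_inv ha.le hμ'.ne', Real.mul_rpow (by positivity) (by positivity),
      Real.rpow_rpow_inv hb.le hμ'.ne', Real.mul_rpow hC.le (by positivity),
      ← Real.rpow_natCast, ← Real.rpow_mul hρ.le, mul_comm (d : ℝ), Real.rpow_mul hρ.le,
      Real.rpow_natCast] at this
  obtain ⟨C₁, ρ₁, hC₁, hρ₁, hρ₁', hg₁⟩ := hHardy₁.exists_geometric hs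
    (fun k => Real.rpow_pos_of_pos (div_pos (hα₁ k) (by positivity)) _)
  obtain ⟨C₂, ρ₂, hC₂, hρ₂, hρ₂', hg₂⟩ := hHardy₂.exists_geometric hs
    (fun k => Real.rpow_pos_of_pos (mul_pos (by positivity) (hα₂ k)) _)
  set τ := weightCoef p t with hτ
  have hτtop : ∀ k m, τ k m ≠ ∞ := fun k m => by
    rw [hτ, weightCoef, restrict_dyadicCube]
    exact (ht k).1.eLpNorm_dyadicCubeIco_ne_top k m
  have havg : ∀ k m x, x ∈ dyadicCubeIco k m → ‖avgWeight p t k x‖ₑ = scale p n k * τ k m := by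
    intro k m x hx
    rw [avgWeight_apply p t hx, enorm_mul, Real.enorm_of_nonneg (by positivity),
      Real.enorm_of_nonneg ENNReal.toReal_nonneg, ENNReal.ofReal_toReal (hτtop k m),
      scale_eq_ofReal]
  have hcell : ∀ (s : ℝ≥0∞), s ≠ 0 → ∀ k m (F : (Fin n → ℝ) → ℝ) (c : ℝ≥0∞),
      (∀ x ∈ dyadicCubeIco k m, ‖F x‖ₑ = c) →
      eLpNorm F s (volume.restrict (dyadicCubeIco k m)) = c * (scale s n k)⁻¹ := by
    intro s hs k m F c hF
    rw [← eLpNorm_const_dyadicCubeIco hs]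
    refine eLpNorm_congr_enorm_ae ?_
    filter_upwards [ae_restrict_mem (measurableSet_dyadicCubeIco k m)] with x hx
    rw [hF x hx, enorm_eq_self]
  -- Averaging does not alter the coefficients, so the neighbour condition on the averaged weights
  -- is a condition on `τ`.
  have hwc : ∀ k m, weightCoef p (avgWeight p t) k m = τ k m := by
    intro k m
    rw [weightCoef, restrict_dyadicCube, hcell p hp.ne' k m _ _ (havg k m), mul_comm (scale p n k),
      mul_assoc, ENNReal.mul_inv_cancel (scale_ne_zero _ _ _) (scale_ne_top _ _ _), mul_one]
  have hτ0 : ∀ k m, τ k m ≠ 0 := fun k m => by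
    have := (htX.neighbours k m m (by simp)).1
    rw [hwc] at this
    exact this.ne'
  set ρ := max (ρ₁ ^ (μ : ℝ)⁻¹) (ρ₂ ^ (μ : ℝ)⁻¹) with hρ
  have hρ0 : 0 < ρ := lt_max_of_lt_left (by positivity)
  have hρ1 : ρ < 1 := max_lt (Real.rpow_lt_one hρ₁.le hρ₁' (by positivity))
    (Real.rpow_lt_one hρ₂.le hρ₂' (by positivity))
  refine ⟨ENNReal.ofReal ρ, by simpa using hρ1, hτ0, hτtop, ?_, ?_, ?_⟩
  · refine ⟨ENNReal.ofReal ((2 : ℝ) ^ α₃), by finiteness, fun k m m' h => ?_⟩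
    have := (htX.neighbours k m m' h).2
    rwa [hwc, hwc] at this
  · obtain ⟨C, hC, hlow⟩ := htX.lower
    refine ⟨ENNReal.ofReal (C * C₁ ^ (μ : ℝ)⁻¹), by finiteness, fun k d m b => ?_⟩
    have h1 := hlow k (k + d) (Nat.le_add_right k d) m
    have hmean1 : cubeMean p (avgWeight p t k) k m = scale p n k * τ k m := by
      rw [cubeMean_eq, hcell p hp.ne' k m _ _ (havg k m), mul_comm, mul_assoc,
        ENNReal.inv_mul_cancel (scale_ne_zero _ _ _) (scale_ne_top _ _ _), mul_one]
    have hmean2 : cubeMean σ (fun x => (avgWeight p t (k + d) x)⁻¹) k m =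
        scale σ n k * ((scale p n (k + d))⁻¹ * (scale σ n (k + d))⁻¹ *
          lqNorm σ fun m' : {m' // parent d m' = m} => (τ (k + d) m')⁻¹) := by
      rw [cubeMean_eq, eLpNorm_dyadicCubeIco hσ0 _ k d,
        ← lqNorm_const_mul hσ0 ((scale p n (k + d))⁻¹ * (scale σ n (k + d))⁻¹)]
      refine congrArg _ (congrArg _ (funext fun m' => ?_))
      rw [hcell σ hσ0 (k + d) m' _ ((scale p n (k + d) * τ (k + d) m')⁻¹), ENNReal.mul_inv]
      · ring
      · exact Or.inl (scale_ne_zero _ _ _)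
      · exact Or.inl (scale_ne_top _ _ _)
      · intro x hx
        rw [enorm_inv, havg _ _ _ hx]
        have h2 := havg _ _ _ hx
        intro h3
        rw [h3] at h2
        simp [scale_ne_zero, hτ0] at h2
    rw [hmean1, hmean2] at h1
    have hsc : ∀ j, scale p n j * scale σ n j = scale θ n j :=
      scale_mul_scale hp.ne' hσ0 hinv n
    have h2 : τ k m * (lqNorm σ fun m' : {m' // parent d m' = m} => (τ (k + d) m')⁻¹) ≤
        scale θ n d * ENNReal.ofReal (C * (α₁ k / α₁ (k + d))) := by
      have e1 : scale p n k * τ k m * (scale σ n k * ((scale p n (k + d))⁻¹ *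
          (scale σ n (k + d))⁻¹ * lqNorm σ fun m' : {m' // parent d m' = m} =>
            (τ (k + d) m')⁻¹)) = (scale θ n d)⁻¹ *
          (τ k m * (lqNorm σ fun m' : {m' // parent d m' = m} => (τ (k + d) m')⁻¹)) := by
        rw [← ENNReal.mul_inv (Or.inl (scale_ne_zero _ _ _)) (Or.inl (scale_ne_top _ _ _)), hsc,
          scale_add θ, ENNReal.mul_inv (Or.inl (scale_ne_zero _ _ _))
          (Or.inl (scale_ne_top _ _ _))]
        calc _ = (scale p n k * scale σ n k) * (scale θ n k)⁻¹ * ((scale θ n d)⁻¹ *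
          (τ k m * (lqNorm σ fun m' : {m' // parent d m' = m} => (τ (k + d) m')⁻¹))) := by ring
          _ = _ := by
            rw [hsc, ENNReal.mul_inv_cancel (scale_ne_zero _ _ _) (scale_ne_top _ _ _), one_mul]
      rw [e1, ENNReal.inv_mul_le_iff (scale_ne_zero _ _ _) (scale_ne_top _ _ _)] at h1
      exact h1
    -- The growth of `α₁ k * 2 ^ (-k n (1/θ - 1/r))` exchanges the factor `2 ^ (d n / θ)` for `ρ ^ d
    -- * 2 ^ (d n / r)`.
    have h3 : scale θ n d * ENNReal.ofReal (C * (α₁ k / α₁ (k + d))) ≤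
        ENNReal.ofReal (C * C₁ ^ (μ : ℝ)⁻¹) * ENNReal.ofReal ρ ^ d * scale r n d := by
      rw [scale_eq_ofReal, scale_eq_ofReal, ← ENNReal.ofReal_mul (by positivity),
        ← ENNReal.ofReal_pow hρ0.le, ← ENNReal.ofReal_mul (by positivity),
        ← ENNReal.ofReal_mul (by positivity)]
      refine ENNReal.ofReal_le_ofReal ?_
      have h4 := hroot d (div_pos (hα₁ k) (by positivity)) (div_pos (hα₁ (k + d)) (by positivity))
        hC₁ hρ₁ (hg₁ k d)
      set x := (θ⁻¹).toReal
      set y := (r⁻¹).toReal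
      have e2 : (2 : ℝ) ^ (((k + d : ℕ) : ℝ) * n * (x - y)) =
          2 ^ ((k : ℝ) * n * (x - y)) * (2 ^ ((d : ℝ) * n * x) / 2 ^ ((d : ℝ) * n * y)) := by
        rw [← Real.rpow_sub two_pos, ← Real.rpow_add two_pos]
        congr 1; push_cast; ring
      rw [e2] at h4
      have hA := hα₁ (k + d)
      have hB := hα₁ k
      have h5 : (2 : ℝ) ^ ((d : ℝ) * n * x) * (α₁ k / α₁ (k + d)) ≤
          C₁ ^ (μ : ℝ)⁻¹ * (ρ₁ ^ (μ : ℝ)⁻¹) ^ d * 2 ^ ((d : ℝ) * n * y) := by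
        rw [div_le_iff₀ (by positivity)] at h4
        rw [← mul_div_assoc, div_le_iff₀ hA, mul_comm, ← le_div_iff₀ (by positivity)]
        refine h4.trans (le_of_eq ?_)
        have : (2 : ℝ) ^ ((k : ℝ) * n * (x - y)) ≠ 0 := by positivity
        have : (2 : ℝ) ^ ((d : ℝ) * n * x) ≠ 0 := by positivity
        have : (2 : ℝ) ^ ((d : ℝ) * n * y) ≠ 0 := by positivity
        field_simp
      calc (2 : ℝ) ^ ((d : ℝ) * n * x) * (C * (α₁ k / α₁ (k + d)))
          = C * (2 ^ ((d : ℝ) * n * x) * (α₁ k / α₁ (k + d))) := by ring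
        _ ≤ C * (C₁ ^ (μ : ℝ)⁻¹ * (ρ₁ ^ (μ : ℝ)⁻¹) ^ d * 2 ^ ((d : ℝ) * n * y)) := by gcongr
        _ ≤ C * (C₁ ^ (μ : ℝ)⁻¹ * ρ ^ d * 2 ^ ((d : ℝ) * n * y)) := by
            gcongr; exact le_max_left _ _
        _ = _ := by ring
    -- First `l_r` is bounded by `l_θ`, since `θ ≤ r`. Then `b` is written as `(τ b) τ⁻¹` and
    -- Hölder's inequality is applied with `1/θ = 1/p + 1/σ`.
    calc τ k m * (lqNorm r fun m' : {m' // parent d m' = m} => b m')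
        ≤ τ k m * (lqNorm θ fun m' : {m' // parent d m' = m} =>
            (τ (k + d) m' * b m') * (τ (k + d) m')⁻¹) := by
          gcongr
          refine (lqNorm_anti hθ.ne' hθr _).trans (le_of_eq ?_)
          congr 1
          ext m'
          rw [mul_comm (τ (k + d) m'), mul_assoc, ENNReal.mul_inv_cancel (hτ0 _ _) (hτtop _ _),
            mul_one]
      _ ≤ τ k m * ((lqNorm p fun m' : {m' // parent d m' = m} => τ (k + d) m' * b m') *
            (lqNorm σ fun m' : {m' // parent d m' = m} => (τ (k + d) m')⁻¹)) := by
          gcongr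
          exact lqNorm_mul_le hp.ne' hσ0 hθ.ne' hinv _ _
      _ = (τ k m * (lqNorm σ fun m' : {m' // parent d m' = m} => (τ (k + d) m')⁻¹)) *
            (lqNorm p fun m' : {m' // parent d m' = m} => τ (k + d) m' * b m') := by ring
      _ ≤ _ := mul_le_mul' (h2.trans h3) le_rfl
  · obtain ⟨C, hC, hup⟩ := htX.upper
    refine ⟨ENNReal.ofReal (C * C₂ ^ (μ : ℝ)⁻¹), by finiteness, fun k d m => ?_⟩
    have h1 := hup k (k + d) (Nat.le_add_right k d) m
    have hmean1 : cubeMean p (avgWeight p t k) k m = scale p n k * τ k m := by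
      rw [cubeMean_eq, hcell p hp.ne' k m _ _ (havg k m), mul_comm, mul_assoc,
        ENNReal.inv_mul_cancel (scale_ne_zero _ _ _) (scale_ne_top _ _ _), mul_one]
    have hmean2 : cubeMean p (avgWeight p t (k + d)) k m =
        scale p n k * lqNorm p fun m' : {m' // parent d m' = m} => τ (k + d) m' := by
      rw [cubeMean_eq, eLpNorm_dyadicCubeIco hp.ne' _ k d]
      congr 2
      ext m'
      rw [hcell p hp.ne' (k + d) m' _ _ (havg _ _), mul_comm (scale p n (k + d)), mul_assoc,
        ENNReal.mul_inv_cancel (scale_ne_zero _ _ _) (scale_ne_top _ _ _), mul_one]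
    rw [hmean1, hmean2, ENNReal.mul_inv (Or.inl (scale_ne_zero _ _ _))
      (Or.inl (scale_ne_top _ _ _))] at h1
    have h2 : (lqNorm p fun m' : {m' // parent d m' = m} => τ (k + d) m') ≤
        τ k m * ENNReal.ofReal (C * (α₂ (k + d) / α₂ k)) := by
      rw [← ENNReal.inv_mul_le_iff (hτ0 _ _) (hτtop _ _)]
      refine le_trans (le_of_eq ?_) h1
      calc _ = (scale p n k)⁻¹ * scale p n k * ((τ k m)⁻¹ *
            lqNorm p fun m' : {m' // parent d m' = m} => τ (k + d) m') := by
            rw [ENNReal.inv_mul_cancel (scale_ne_zero _ _ _) (scale_ne_top _ _ _), one_mul]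
        _ = _ := by ring
    refine h2.trans ?_
    rw [mul_comm]
    gcongr
    have h4 := hroot d (mul_pos (by positivity) (hα₂ (k + d))) (mul_pos (by positivity) (hα₂ k))
        hC₂ hρ₂ (hg₂ k d)
    have e2 : (2 : ℝ) ^ (-(((k + d : ℕ) : ℝ) * l)) = 2 ^ (-((k : ℝ) * l)) * (2 ^ (l * d))⁻¹ := by
      rw [← Real.rpow_natCast, ← Real.rpow_neg two_pos.le, ← Real.rpow_add two_pos]
      congr 1; push_cast; ring
    rw [e2] at h4
    have hA := hα₂ (k + d)
    have hB := hα₂ k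
    -- This is the decay of `2 ^ (-k l) * α₂ k` solved for the quotient of the `α₂`.
    have h5 : α₂ (k + d) / α₂ k ≤ C₂ ^ (μ : ℝ)⁻¹ * (ρ₂ ^ (μ : ℝ)⁻¹) ^ d * 2 ^ (l * d) := by
      rw [div_le_iff₀ hB]
      have hP : (0 : ℝ) < 2 ^ (-((k : ℝ) * l)) := by positivity
      have hQ : (0 : ℝ) < 2 ^ (l * d) := by positivity
      have h6 : 2 ^ (-((k : ℝ) * l)) * (α₂ (k + d) * (2 ^ (l * d))⁻¹) ≤ 2 ^ (-((k : ℝ) * l)) *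
          (C₂ ^ (μ : ℝ)⁻¹ * (ρ₂ ^ (μ : ℝ)⁻¹) ^ d * α₂ k) := by
        refine le_trans (le_of_eq ?_) (h4.trans (le_of_eq ?_)) <;> ring
      have h7 := le_of_mul_le_mul_left h6 hP
      rw [← div_eq_mul_inv, div_le_iff₀ hQ] at h7
      exact h7.trans (le_of_eq (by ring))
    have e3 : ENNReal.ofReal (C * C₂ ^ (μ : ℝ)⁻¹) * ENNReal.ofReal ρ ^ d * 2 ^ (l * d) =
        ENNReal.ofReal (C * C₂ ^ (μ : ℝ)⁻¹ * ρ ^ d * 2 ^ (l * d)) := by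
      rw [← ENNReal.ofReal_pow hρ0.le, show (2 : ℝ≥0∞) ^ (l * d) = ENNReal.ofReal (2 ^ (l * d)) by
        rw [ENNReal.ofReal_pow (by norm_num)]; norm_num, ← ENNReal.ofReal_mul (by positivity),
        ← ENNReal.ofReal_mul (by positivity)]
    rw [e3]
    refine ENNReal.ofReal_le_ofReal ?_
    calc C * (α₂ (k + d) / α₂ k)
        ≤ C * (C₂ ^ (μ : ℝ)⁻¹ * (ρ₂ ^ (μ : ℝ)⁻¹) ^ d * 2 ^ (l * d)) := by gcongr
      _ ≤ C * (C₂ ^ (μ : ℝ)⁻¹ * ρ ^ d * 2 ^ (l * d)) := by gcongr; exact le_max_right _ _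
      _ = _ := by ring

end Cubes

/-! ### Mixed norms -/

section Fubini

theorem essSup_le_iff_ae {α : Type*} [MeasurableSpace α] {μ : Measure α} {f : α → ℝ≥0∞}
    {c : ℝ≥0∞} : essSup f μ ≤ c ↔ ∀ᵐ x ∂μ, f x ≤ c :=
  ⟨fun h => (ENNReal.ae_le_essSup f).mono fun _ hx => hx.trans h, essSup_le_of_ae_le c⟩

/-- Tonelli's theorem for finite exponents. For `r = ∞` both sides have the same upper bounds,
because the two almost-everywhere quantifiers may be interchanged. -/
theorem eLpNorm_prod_eq {α β : Type*} [MeasurableSpace α] [MeasurableSpace β] {μ : Measure α}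
    {ν : Measure β} [SFinite μ] [SFinite ν] {r : ℝ≥0∞} (hr : r ≠ 0) {g : α × β → ℝ≥0∞}
    (hg : Measurable g) :
    eLpNorm (fun y => eLpNorm (fun x => g (x, y)) r μ) r ν = eLpNorm g r (μ.prod ν) := by
  rcases eq_or_ne r ∞ with rfl | hrt
  · simp only [eLpNorm_exponent_top, eLpNormEssSup, enorm_eq_self]
    refine eq_of_forall_ge_iff fun c => ?_
    simp only [essSup_le_iff_ae]
    have hm : MeasurableSet {z : α × β | g z ≤ c} := measurableSet_le hg measurable_const
    rw [Measure.ae_prod_iff_ae_ae hm, Measure.ae_ae_comm (p := fun x y => g (x, y) ≤ c) hm]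
  · have hr0 : 0 < r.toReal := ENNReal.toReal_pos hr hrt
    simp only [eLpNorm_eq_lintegral_rpow_enorm_toReal hr hrt, enorm_eq_self, ← ENNReal.rpow_mul,
      one_div_mul_cancel hr0.ne', ENNReal.rpow_one]
    rw [lintegral_prod_symm' _ (hg.pow_const _)]

theorem eLpNorm_le_mul_eLpNorm {α E F : Type*} [MeasurableSpace α] {μ : Measure α}
    [TopologicalSpace E] [ContinuousENorm E] [TopologicalSpace F] [ContinuousENorm F]
    {g : α → E} {g' : α → F} {c r : ℝ≥0∞} (hc : c ≠ ∞) (h : ∀ᵐ x ∂μ, ‖g x‖ₑ ≤ c * ‖g' x‖ₑ) :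
    eLpNorm g r μ ≤ c * eLpNorm g' r μ := by
  obtain ⟨s, rfl⟩ : ∃ s : ℝ≥0, (s : ℝ≥0∞) = c := ⟨_, ENNReal.coe_toNNReal hc⟩
  simpa [ENNReal.smul_def] using eLpNorm_le_nnreal_smul_eLpNorm_of_ae_le_mul' h r

theorem eLpNorm_prod_le_of_forall {α β : Type*} [MeasurableSpace α] [MeasurableSpace β]
    {μ : Measure α} {ν : Measure β} [SFinite μ] [SFinite ν] {r : ℝ≥0∞} (hr : r ≠ 0)
    {g : α × β → ℝ≥0∞} (hg : Measurable g) {B : ℝ≥0∞}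
    (h : ∀ᵐ y ∂ν, eLpNorm (fun x => g (x, y)) r μ ≤ B) :
    eLpNorm g r (μ.prod ν) ≤ B * ν Set.univ ^ (r⁻¹).toReal := by
  rw [← eLpNorm_prod_eq hr hg]
  rcases eq_or_ne ν 0 with rfl | hν
  · simp
  calc _ ≤ eLpNorm (fun _ : β => B) r ν := by
        refine eLpNorm_mono_enorm_ae (h.mono fun y hy => ?_)
        simpa using hy
    _ = _ := by rw [eLpNorm_const _ hr hν, enorm_eq_self, one_div, ENNReal.toReal_inv]

/-- Almost everywhere properties hold at all the points used by a difference of a function. -/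
theorem ae_prod_add_smul {n : ℕ} {P : (Fin n → ℝ) → Prop} (hP : ∀ᵐ x, P x) :
    ∀ᵐ z ∂((volume : Measure (Fin n → ℝ)).prod (volume : Measure (Fin n → ℝ))),
      ∀ i : ℕ, P (z.1 + (i : ℝ) • z.2) := by
  rw [ae_all_iff]
  intro i
  obtain ⟨s, hs, hsm, hs0⟩ := exists_measurable_superset_of_null (ae_iff.1 hP)
  have h1 : ∀ᵐ z ∂((volume : Measure (Fin n → ℝ)).prod (volume : Measure (Fin n → ℝ))),
      z.1 + (i : ℝ) • z.2 ∈ sᶜ := by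
    have hm : MeasurableSet {z : (Fin n → ℝ) × (Fin n → ℝ) | z.1 + (i : ℝ) • z.2 ∈ sᶜ} :=
      hsm.compl.preimage (by fun_prop)
    rw [Measure.ae_prod_iff_ae_ae hm,
      Measure.ae_ae_comm (p := fun x y => x + (i : ℝ) • y ∈ sᶜ) hm]
    refine ae_of_all _ fun h => ?_
    have : ∀ᵐ x : Fin n → ℝ, x ∈ sᶜ := by
      rw [ae_iff]; simpa using hs0
    exact (measurePreserving_add_right volume ((i : ℝ) • h)).quasiMeasurePreserving.ae this
  filter_upwards [h1] with z hz
  by_contra hc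
  exact hz (hs hc)

theorem eLpNorm_translate {n : ℕ} {E : Type*} [TopologicalSpace E] [ContinuousENorm E]
    (g : (Fin n → ℝ) → E) (r : ℝ≥0∞) (a : Fin n → ℝ) (S : Set (Fin n → ℝ)) :
    eLpNorm (fun x => g (x + a)) r (volume.restrict ((fun x => x + a) ⁻¹' S)) =
      eLpNorm g r (volume.restrict S) := by
  have he : MeasurableEmbedding fun x : Fin n → ℝ => x + a := measurableEmbedding_addRight a
  have h := (measurePreserving_add_right volume a).restrict_preimage_emb he S
  rw [← h.map_eq, he.eLpNorm_map_measure]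
  rfl

end Fubini

/-! ### Weighted norms over dyadic cubes -/

section Weighted

variable {n : ℕ} {p r ρ : ℝ≥0∞} {l : ℕ}

/-- On each cube the second factor is bounded by a constant, and what remains is the quasi-norm of
the weight. This lemma and its converse below translate between norms over `ℝⁿ` and sequence norms;
no measurability of `G` is needed. -/
theorem eLpNorm_weight_mul_le (hp : p ≠ 0) {t : ℕ → (Fin n → ℝ) → ℝ} {k : ℕ}
    (h0 : ∀ m, weightCoef p t k m ≠ 0) {G : (Fin n → ℝ) → ℝ≥0∞} {b : (Fin n → ℤ) → ℝ≥0∞}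
    (hG : ∀ x, G x ≤ b (cellIndex k x)) :
    eLpNorm (fun x => ‖t k x‖ₑ * G x) p volume ≤ lqNorm p fun m => weightCoef p t k m * b m := by
  rw [eLpNorm_eq_lqNorm_dyadicCubeIco hp _ k]
  refine lqNorm_mono fun m => ?_
  rcases eq_or_ne (b m) ∞ with hb | hb
  · rw [hb, ENNReal.mul_top (h0 m)]; exact le_top
  rw [mul_comm, weightCoef, restrict_dyadicCube]
  refine eLpNorm_le_mul_eLpNorm hb ?_
  filter_upwards [ae_restrict_mem (measurableSet_dyadicCubeIco k m)] with x hx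
  rw [enorm_eq_self, mul_comm]
  gcongr
  exact (hG x).trans (by rw [mem_dyadicCubeIco.1 hx])

theorem le_eLpNorm_weight_mul (hp : p ≠ 0) {t : ℕ → (Fin n → ℝ) → ℝ} {k : ℕ}
    {G : (Fin n → ℝ) → ℝ≥0∞} {b : (Fin n → ℤ) → ℝ≥0∞}
    (hG : ∀ x, b (cellIndex k x) ≤ G x) :
    (lqNorm p fun m => weightCoef p t k m * b m) ≤ eLpNorm (fun x => ‖t k x‖ₑ * G x) p volume := by
  rw [eLpNorm_eq_lqNorm_dyadicCubeIco hp _ k]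
  refine lqNorm_mono fun m => ?_
  rw [mul_comm, weightCoef, restrict_dyadicCube]
  -- The constant `b m` may be infinite and then cannot be moved out of the quasi-norm. Every `c < b
  -- m` is finite and can be, by division.
  refine ENNReal.mul_le_of_forall_lt fun c hc d hd => ?_
  have hct : c ≠ ∞ := hc.ne_top
  rcases eq_or_ne c 0 with rfl | hc0
  · simp
  have : d ≤ c⁻¹ * eLpNorm (fun x => ‖t k x‖ₑ * G x) p (volume.restrict (dyadicCubeIco k m)) := by
    refine hd.le.trans (eLpNorm_le_mul_eLpNorm (ENNReal.inv_ne_top.2 hc0) ?_)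
    filter_upwards [ae_restrict_mem (measurableSet_dyadicCubeIco k m)] with x hx
    rw [enorm_eq_self]
    calc ‖t k x‖ₑ = c⁻¹ * (‖t k x‖ₑ * c) := by
          rw [mul_comm, mul_assoc, ENNReal.mul_inv_cancel hc0 hct, mul_one]
      _ ≤ _ := by
          gcongr
          refine hc.le.trans ?_
          have := hG x
          rwa [mem_dyadicCubeIco.1 hx] at this
  calc c * d ≤ c * (c⁻¹ * _) := by gcongr
    _ = _ := by rw [← mul_assoc, ENNReal.mul_inv_cancel hc0 hct, one_mul]

theorem CoefWeight.exists_le {τ : ℕ → (Fin n → ℤ) → ℝ≥0∞} (hτ : CoefWeight p r l ρ τ) (R : ℕ) :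
    ∃ C : ℝ≥0∞, C ≠ ∞ ∧ ∀ k (m m' : Fin n → ℤ), (∀ i, |m i - m' i| ≤ R) → τ k m ≤ C * τ k m' := by
  obtain ⟨C, hC, h⟩ := hτ.neighbour
  induction R with
  | zero =>
    refine ⟨1, by simp, fun k m m' hm => ?_⟩
    have : m = m' := by
      ext i
      have := hm i
      simpa [sub_eq_zero] using this
    simp [this]
  | succ R ih =>
    obtain ⟨D, hD, h'⟩ := ih
    refine ⟨D * C, by finiteness, fun k m m' hm => ?_⟩
    -- The intermediate index is `m'` clamped to distance `R` from `m`; it differs from `m'` by at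
    -- most one in each coordinate.
    have := h' k m (fun i => m i + max (-(R : ℤ)) (min (R : ℤ) (m' i - m i))) fun i => by
      rw [abs_le]; constructor <;> omega
    refine this.trans ?_
    rw [mul_assoc]
    gcongr
    refine h _ _ _ fun i => ?_
    have := hm i
    rw [abs_le] at this ⊢
    push_cast at this
    constructor <;> omega

theorem CoefWeight.exists_lqNorm_nbrs_le {τ : ℕ → (Fin n → ℤ) → ℝ≥0∞} (hτ : CoefWeight p r l ρ τ)
    (hp : p ≠ 0) (R : ℕ) : ∃ C : ℝ≥0∞, C ≠ ∞ ∧ ∀ k (b : (Fin n → ℤ) → ℝ≥0∞),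
      (lqNorm p fun m => τ k m * ∑ ν ∈ nbrs n R, b (m + ν)) ≤ C * lqNorm p fun m => τ k m * b m := by
  obtain ⟨C, hC, h⟩ := hτ.exists_le R
  obtain ⟨D, hD, h'⟩ := exists_lqNorm_sum_le (ι := nbrs n R) hp
  refine ⟨D * ((nbrs n R).card * C), by finiteness, fun k b => ?_⟩
  calc _ = lqNorm p fun m => ∑ ν : nbrs n R, τ k m * b (m + ν) := by
        congr 1; ext m
        rw [Finset.mul_sum, ← Finset.sum_coe_sort]
    _ ≤ D * ∑ ν : nbrs n R, lqNorm p fun m => τ k m * b (m + ν) :=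
        h' fun (ν : nbrs n R) m => τ k m * b (m + ν)
    _ ≤ D * ∑ _ν : nbrs n R, C * lqNorm p fun m => τ k m * b m := by
        gcongr with ν
        rw [← lqNorm_const_mul hp]
        refine le_trans (lqNorm_mono (b := fun m => C * (τ k (m + ν) * b (m + ν))) fun m => ?_) ?_
        · rw [← mul_assoc]
          gcongr
          refine h _ _ _ fun i => ?_
          simpa using mem_nbrs.1 ν.2 i
        · exact lqNorm_comp_le (e := fun m : Fin n → ℤ => m + ν) (add_left_injective _)
            fun m => C * (τ k m * b m)
    _ = _ := by
        rw [Finset.sum_const, Finset.card_univ, Fintype.card_coe, nsmul_eq_mul]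
        ring

end Weighted

/-! ### Differences on dyadic cubes -/

section CubeDiff

variable {n : ℕ} {p r ρ : ℝ≥0∞} {l : ℕ}

/-- The mean of the differences of `f` over the dyadic cube with index `(j, m)`. -/
noncomputable def cubeDiff (l : ℕ) (r : ℝ≥0∞) (j : ℕ) (m : Fin n → ℤ) (f : (Fin n → ℝ) → ℝ) : ℝ≥0∞ :=
  scale r n j * scale r n j * eLpNorm (fun z : (Fin n → ℝ) × (Fin n → ℝ) => diffOp l z.2 f z.1) r
    ((volume.restrict (dyadicCubeIco j m)).prod (volume.restrict (cubeAt 0 ((2 : ℝ) ^ j)⁻¹)))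

theorem localDiff_eq (l : ℕ) (r : ℝ≥0∞) (j : ℕ) (f : (Fin n → ℝ) → ℝ) (x : Fin n → ℝ) :
    localDiff l r j f x = scale r n j * scale r n j *
      eLpNorm (fun z : (Fin n → ℝ) × (Fin n → ℝ) => diffOp l z.2 f z.1) r
        ((volume.restrict (cubeAt x ((2 : ℝ) ^ j)⁻¹)).prod
          (volume.restrict (cubeAt 0 ((2 : ℝ) ^ j)⁻¹))) := by
  rw [localDiff, scale, ← ENNReal.mul_rpow_of_nonneg _ _ (by positivity), ← pow_add]
  congr 4
  ring

theorem abs_cellIndex_sub_le {j R : ℕ} {x y : Fin n → ℝ} (h : ∀ i, |y i - x i| ≤ R * (2 ^ j)⁻¹)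
    (i : Fin n) : |cellIndex j y i - cellIndex j x i| ≤ R := by
  have h1 : |2 ^ j * y i - 2 ^ j * x i| ≤ R := by
    rw [← mul_sub, abs_mul, abs_of_pos (by positivity : (0 : ℝ) < 2 ^ j)]
    calc _ ≤ (2 : ℝ) ^ j * (R * (2 ^ j)⁻¹) := by gcongr; exact h i
      _ = R := by field_simp
  rw [abs_le] at h1 ⊢
  unfold cellIndex
  constructor
  · have : ⌊(2 : ℝ) ^ j * x i⌋ ≤ ⌊(2 : ℝ) ^ j * y i + (R : ℤ)⌋ :=
      Int.floor_le_floor (by push_cast; linarith)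
    rw [Int.floor_add_intCast] at this
    omega
  · have : ⌊(2 : ℝ) ^ j * y i⌋ ≤ ⌊(2 : ℝ) ^ j * x i + (R : ℤ)⌋ :=
      Int.floor_le_floor (by push_cast; linarith)
    rw [Int.floor_add_intCast] at this
    omega

theorem mem_iUnion_nbrs {j R : ℕ} {x y : Fin n → ℝ} (h : ∀ i, |y i - x i| ≤ R * (2 ^ j)⁻¹) :
    y ∈ ⋃ ν : nbrs n R, dyadicCubeIco j (cellIndex j x + (ν : Fin n → ℤ)) := by
  refine Set.mem_iUnion.2 ⟨⟨cellIndex j y - cellIndex j x, mem_nbrs.2 fun i => ?_⟩, ?_⟩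
  · exact abs_cellIndex_sub_le h i
  · rw [mem_dyadicCubeIco]; simp

theorem mem_cubeAt {x y : Fin n → ℝ} {a : ℝ} : y ∈ cubeAt x a ↔ ∀ i, |y i - x i| < a := by
  simp only [cubeAt, Set.mem_univ_pi, Set.mem_Ioo, abs_lt]
  exact forall_congr' fun i => ⟨fun h => ⟨by linarith [h.1], by linarith [h.2]⟩,
    fun h => ⟨by linarith [h.1], by linarith [h.2]⟩⟩

theorem cubeAt_subset (j : ℕ) (x : Fin n → ℝ) :
    cubeAt x ((2 : ℝ) ^ j)⁻¹ ⊆ ⋃ ν : nbrs n 1, dyadicCubeIco j (cellIndex j x + (ν : Fin n → ℤ)) :=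
  fun y hy => mem_iUnion_nbrs fun i => by simpa using ((mem_cubeAt.1 hy) i).le

theorem dyadicCubeIco_subset_cubeAt (j : ℕ) (x : Fin n → ℝ) :
    dyadicCubeIco j (cellIndex j x) ⊆ cubeAt x ((2 : ℝ) ^ j)⁻¹ := by
  intro y hy
  have hx : x ∈ dyadicCubeIco j (cellIndex j x) := mem_dyadicCubeIco.2 rfl
  rw [dyadicCubeIco, Set.mem_univ_pi] at hx hy
  refine mem_cubeAt.2 fun i => ?_
  have h1 := hx i
  have h2 := hy i
  rw [add_div, one_div] at h1 h2
  rw [abs_lt]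
  constructor <;> linarith [h1.1, h1.2, h2.1, h2.2]

/-- A cube of radius `2⁻ʲ` about `x` meets only the dyadic cube of `x` and its neighbours. Together
with `cubeDiff_le_localDiff` this allows differences to be indexed by dyadic cubes instead of
points. -/
theorem exists_localDiff_le (n l : ℕ) {r : ℝ≥0∞} (hr : r ≠ 0) : ∃ C : ℝ≥0∞, C ≠ ∞ ∧
    ∀ j (f : (Fin n → ℝ) → ℝ) x, localDiff l r j f x ≤
      C * ∑ ν ∈ nbrs n 1, cubeDiff l r j (cellIndex j x + ν) f := by
  obtain ⟨C, hC, h⟩ := exists_eLpNorm_restrict_iUnion_le (ι := nbrs n 1) hr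
  refine ⟨C, hC, fun j f x => ?_⟩
  rw [localDiff_eq, Measure.prod_restrict]
  have hsub : cubeAt x ((2 : ℝ) ^ j)⁻¹ ×ˢ cubeAt (0 : Fin n → ℝ) ((2 : ℝ) ^ j)⁻¹ ⊆
      ⋃ ν : nbrs n 1, dyadicCubeIco j (cellIndex j x + (ν : Fin n → ℤ)) ×ˢ
        cubeAt (0 : Fin n → ℝ) ((2 : ℝ) ^ j)⁻¹ := by
    rw [← Set.iUnion_prod_const]
    exact Set.prod_mono (cubeAt_subset j x) le_rfl
  refine (mul_le_mul' le_rfl (h _ _ _ _ hsub)).trans (le_of_eq ?_)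
  rw [← Finset.sum_coe_sort (nbrs n 1)]
  simp only [cubeDiff, ← Finset.mul_sum, Measure.prod_restrict]
  ring

theorem cubeDiff_le_localDiff (l : ℕ) (r : ℝ≥0∞) (j : ℕ) (f : (Fin n → ℝ) → ℝ) (x : Fin n → ℝ) :
    cubeDiff l r j (cellIndex j x) f ≤ localDiff l r j f x := by
  rw [localDiff_eq, cubeDiff]
  refine mul_le_mul' le_rfl (eLpNorm_mono_measure _ ?_)
  rw [Measure.prod_restrict, Measure.prod_restrict]
  exact Measure.restrict_mono (Set.prod_mono (dyadicCubeIco_subset_cubeAt j x) le_rfl) le_rfl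

theorem volume_cubeAt_rpow (r : ℝ≥0∞) (j : ℕ) (x : Fin n → ℝ) :
    volume (cubeAt x ((2 : ℝ) ^ j)⁻¹) ^ (r⁻¹).toReal = scale r n 1 * (scale r n j)⁻¹ := by
  have : volume (cubeAt x ((2 : ℝ) ^ j)⁻¹) = 2 ^ (1 * n) * ((2 : ℝ≥0∞) ^ (j * n))⁻¹ := by
    rw [cubeAt, Real.volume_pi_Ioo]
    have : ∀ i : Fin n, ENNReal.ofReal (x i + ((2 : ℝ) ^ j)⁻¹ - (x i - ((2 : ℝ) ^ j)⁻¹)) =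
        2 * ((2 : ℝ≥0∞) ^ j)⁻¹ := by
      intro i
      rw [show x i + ((2 : ℝ) ^ j)⁻¹ - (x i - ((2 : ℝ) ^ j)⁻¹) = 2 * ((2 : ℝ) ^ j)⁻¹ by ring,
        ENNReal.ofReal_mul (by norm_num), ENNReal.ofReal_inv_of_pos (by positivity),
        ENNReal.ofReal_pow (by norm_num)]
      norm_num
    rw [Finset.prod_congr rfl fun i _ => this i, Finset.prod_const, Finset.card_univ,
      Fintype.card_fin, mul_pow, one_mul]
    simp only [pow_mul, ENNReal.inv_pow]
  rw [this, ENNReal.mul_rpow_of_nonneg _ _ (by positivity), ENNReal.inv_rpow, scale, scale]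

theorem measurable_diffOp (l : ℕ) {g : (Fin n → ℝ) → ℝ} (hg : Measurable g) :
    Measurable fun z : (Fin n → ℝ) × (Fin n → ℝ) => diffOp l z.2 g z.1 := by
  unfold diffOp
  fun_prop

theorem enorm_diffOp_le (l : ℕ) (h : Fin n → ℝ) (g : (Fin n → ℝ) → ℝ) (x : Fin n → ℝ) :
    ‖diffOp l h g x‖ₑ ≤ 2 ^ l * ∑ i : Fin (l + 1), ‖g (x + (i : ℕ) • h)‖ₑ := by
  unfold diffOp
  refine (enorm_sum_le _ _).trans ?_
  rw [← Fin.sum_univ_eq_sum_range (fun i => ‖(-1 : ℝ) ^ (l + i) * (l.choose i : ℝ) *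
    g (x + (i : ℝ) • h)‖ₑ), Finset.mul_sum]
  refine Finset.sum_le_sum fun i _ => ?_
  rw [enorm_mul, enorm_mul, enorm_pow, enorm_neg, enorm_one, one_pow, one_mul, Nat.cast_smul_eq_nsmul]
  gcongr
  rw [Real.enorm_natCast]
  exact_mod_cast Nat.choose_le_two_pow l i

/-- For fixed `h` the difference is a combination of translates of `g` that stay within `l` cubes of
the original one. The bound is uniform in `h`, and the measure of the cube of steps cancels one of
the two normalizing factors. -/
theorem exists_cubeDiff_le (n l : ℕ) {r : ℝ≥0∞} (hr : r ≠ 0) : ∃ C : ℝ≥0∞, C ≠ ∞ ∧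
    ∀ j m (g : (Fin n → ℝ) → ℝ), Measurable g → cubeDiff l r j m g ≤
      C * ∑ ν ∈ nbrs n l, scale r n j * eLpNorm g r (volume.restrict (dyadicCubeIco j (m + ν))) := by
  obtain ⟨C, hC, hU⟩ := exists_eLpNorm_restrict_iUnion_le (ι := nbrs n l) hr
  obtain ⟨D, hD, hS⟩ := exists_eLpNorm_sum_le (ι := Fin (l + 1)) hr
  refine ⟨2 ^ l * (D * ((l + 1 : ℕ) * C)) * scale r n 1,
    ENNReal.mul_ne_top (by finiteness) (scale_ne_top _ _ _), fun j m g hg => ?_⟩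
  set S := ∑ ν ∈ nbrs n l, eLpNorm g r (volume.restrict (dyadicCubeIco j (m + ν))) with hSdef
  have hm : Measurable fun z : (Fin n → ℝ) × (Fin n → ℝ) => ‖diffOp l z.2 g z.1‖ₑ :=
    (measurable_diffOp l hg).enorm
  have key : ∀ᵐ h ∂(volume.restrict (cubeAt (0 : Fin n → ℝ) ((2 : ℝ) ^ j)⁻¹)),
      eLpNorm (fun x => ‖diffOp l h g x‖ₑ) r (volume.restrict (dyadicCubeIco j m)) ≤
        2 ^ l * (D * ((l + 1 : ℕ) * C)) * S := by
    filter_upwards [ae_restrict_mem (MeasurableSet.univ_pi fun _ => measurableSet_Ioo)] with h hh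
    have hh' := mem_cubeAt.1 hh
    have htr : ∀ i : Fin (l + 1), eLpNorm (fun x => ‖g (x + (i : ℕ) • h)‖ₑ) r
        (volume.restrict (dyadicCubeIco j m)) ≤ C * S := by
      intro i
      have hsub : dyadicCubeIco j m ⊆ (fun x => x + (i : ℕ) • h) ⁻¹'
          ⋃ ν : nbrs n l, dyadicCubeIco j (m + (ν : Fin n → ℤ)) := by
        intro x hx
        rw [Set.mem_preimage, ← mem_dyadicCubeIco.1 hx]
        refine mem_iUnion_nbrs fun a => ?_
        have h1 := (hh' a).le
        simp only [Pi.zero_apply, sub_zero] at h1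
        simp only [Pi.add_apply, Pi.smul_apply, add_sub_cancel_left]
        rw [nsmul_eq_mul, abs_mul, Nat.abs_cast]
        gcongr
        exact Fin.is_le i
      refine (eLpNorm_mono_measure _ (Measure.restrict_mono hsub le_rfl)).trans ?_
      rw [eLpNorm_translate (fun y => ‖g y‖ₑ), eLpNorm_enorm, hSdef, ← Finset.sum_coe_sort]
      exact hU _ _ _ _ le_rfl
    calc _ ≤ 2 ^ l * eLpNorm (fun x => ∑ i : Fin (l + 1), ‖g (x + (i : ℕ) • h)‖ₑ) r
          (volume.restrict (dyadicCubeIco j m)) :=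
          eLpNorm_le_mul_eLpNorm (by finiteness) (ae_of_all _ fun x => by
            simpa using enorm_diffOp_le l h g x)
      _ ≤ 2 ^ l * (D * ∑ i : Fin (l + 1), eLpNorm (fun x => ‖g (x + (i : ℕ) • h)‖ₑ) r
          (volume.restrict (dyadicCubeIco j m))) := by
          gcongr
          refine hS _ _ fun i => ?_
          fun_prop
      _ ≤ 2 ^ l * (D * ∑ _i : Fin (l + 1), C * S) := by
          gcongr with i
          exact htr i
      _ = _ := by
          rw [Finset.sum_const, Finset.card_univ, Fintype.card_fin, nsmul_eq_mul]; ring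
  have := eLpNorm_prod_le_of_forall hr hm key
  rw [Measure.restrict_apply_univ, volume_cubeAt_rpow] at this
  rw [cubeDiff, ← eLpNorm_enorm, ← Finset.mul_sum]
  refine (mul_le_mul' le_rfl this).trans (le_of_eq ?_)
  calc _ = 2 ^ l * (D * ((l + 1 : ℕ) * C)) * scale r n 1 * (scale r n j * S) *
        (scale r n j * (scale r n j)⁻¹) := by ring
    _ = _ := by
      rw [ENNReal.mul_inv_cancel (scale_ne_zero _ _ _) (scale_ne_top _ _ _), mul_one]

end CubeDiff

/-! ### Estimates for spline levels -/

section Levels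

variable {n : ℕ} {p r ρ : ℝ≥0∞} {l : ℕ} {τ : ℕ → (Fin n → ℤ) → ℝ≥0∞}

theorem eLpNorm_splineOf_le (hr : r ≠ 0) (l k : ℕ) (c : (Fin n → ℤ) → ℝ) (m : Fin n → ℤ) :
    eLpNorm (splineOf l k c) r (volume.restrict (dyadicCubeIco k m)) ≤
      ENNReal.ofReal ((2 ^ l) ^ n) * (scale r n k)⁻¹ * ∑ ν ∈ nbrs n l, ‖c (m + ν)‖ₑ := by
  calc _ ≤ ENNReal.ofReal ((2 ^ l) ^ n) * eLpNorm (fun _ : Fin n → ℝ => ∑ ν ∈ nbrs n l, ‖c (m + ν)‖ₑ) r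
        (volume.restrict (dyadicCubeIco k m)) := by
        refine eLpNorm_le_mul_eLpNorm (by finiteness) ?_
        filter_upwards [ae_restrict_mem (measurableSet_dyadicCubeIco k m)] with x hx
        have := enorm_splineOf_le l k c x
        rwa [mem_dyadicCubeIco.1 hx] at this
    _ = _ := by rw [eLpNorm_const_dyadicCubeIco hr]; ring

/-- On cubes of its own level a spline is bounded by its coefficients. Summation over the
descendants of a cube of level `j` is the property `fine`, and the powers of two cancel, so that
only `ρ ^ d` is left. -/
theorem CoefWeight.exists_eLpNorm_splineOf_le (hτ : CoefWeight p r l ρ τ) (hp : p ≠ 0)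
    (hr : r ≠ 0) : ∃ C : ℝ≥0∞, C ≠ ∞ ∧ ∀ j d (c : (Fin n → ℤ) → ℝ),
      (lqNorm p fun m => τ j m * (scale r n j * eLpNorm (splineOf l (j + d) c) r
        (volume.restrict (dyadicCubeIco j m)))) ≤
        C * ρ ^ d * lqNorm p fun m => τ (j + d) m * ‖c m‖ₑ := by
  obtain ⟨C, hC, hfine⟩ := hτ.fine
  obtain ⟨D, hD, hn⟩ := hτ.exists_lqNorm_nbrs_le hp l
  refine ⟨ENNReal.ofReal ((2 ^ l) ^ n) * C * D, by finiteness, fun j d c => ?_⟩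
  set E := ENNReal.ofReal ((2 ^ l) ^ n)
  set b : (Fin n → ℤ) → ℝ≥0∞ := fun m => ∑ ν ∈ nbrs n l, ‖c (m + ν)‖ₑ with hb
  have h1 : ∀ m, τ j m * (scale r n j * eLpNorm (splineOf l (j + d) c) r
        (volume.restrict (dyadicCubeIco j m))) ≤
      E * C * ρ ^ d * lqNorm p fun m' : {m' // parent d m' = m} => τ (j + d) m' * b m' := by
    intro m
    rw [eLpNorm_dyadicCubeIco hr _ j d m]
    calc _ ≤ τ j m * (scale r n j * (E * (scale r n (j + d))⁻¹ *
          lqNorm r fun m' : {m' // parent d m' = m} => b m')) := by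
          gcongr
          rw [← lqNorm_const_mul hr]
          exact lqNorm_mono fun m' => eLpNorm_splineOf_le hr l (j + d) c m'
      _ = E * (scale r n j * (scale r n (j + d))⁻¹) *
          (τ j m * lqNorm r fun m' : {m' // parent d m' = m} => b m') := by ring
      _ ≤ E * (scale r n j * (scale r n (j + d))⁻¹) * (C * ρ ^ d * scale r n d *
          lqNorm p fun m' : {m' // parent d m' = m} => τ (j + d) m' * b m') := by
          exact mul_le_mul' le_rfl (hfine j d m b)
      _ = E * C * ρ ^ d * (scale r n j * scale r n d * (scale r n (j + d))⁻¹) *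
          lqNorm p fun m' : {m' // parent d m' = m} => τ (j + d) m' * b m' := by ring
      _ = _ := by
          rw [← scale_add, ENNReal.mul_inv_cancel (scale_ne_zero _ _ _) (scale_ne_top _ _ _),
            mul_one]
  calc _ ≤ lqNorm p fun m => E * C * ρ ^ d *
        lqNorm p fun m' : {m' // parent d m' = m} => τ (j + d) m' * b m' := lqNorm_mono h1
    _ = E * C * ρ ^ d * lqNorm p fun m => τ (j + d) m * b m := by
        rw [lqNorm_const_mul hp, lqNorm_fiberwise hp (parent d) fun m => τ (j + d) m * b m]
    _ ≤ E * C * ρ ^ d * (D * lqNorm p fun m => τ (j + d) m * ‖c m‖ₑ) := by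
        gcongr
        exact hn (j + d) fun m => ‖c m‖ₑ
    _ = _ := by ring

/-- For `j ≤ k` the differences are bounded by the function and the decay comes from `fine`. For `j
> k` the step is short compared with the mesh, the difference gains `2 ^ (-l d)`, and this cancels
the factor `2 ^ (l * d)` in `coarse`. -/
theorem CoefWeight.exists_cubeDiff_splineOf_le (hτ : CoefWeight p r l ρ τ) (hp : p ≠ 0)
    (hr : r ≠ 0) : ∃ C : ℝ≥0∞, C ≠ ∞ ∧ ∀ (j k : ℕ) (c : (Fin n → ℤ) → ℝ),
      (lqNorm p fun m => τ j m * cubeDiff l r j m (splineOf l k c)) ≤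
        C * ρ ^ ((k : ℤ) - j).natAbs * lqNorm p fun m => τ k m * ‖c m‖ₑ := by
  obtain ⟨C₁, hC₁, h₁⟩ := hτ.exists_eLpNorm_splineOf_le hp hr
  obtain ⟨C₂, hC₂, h₂⟩ := exists_cubeDiff_le n l hr
  obtain ⟨C₃, hC₃, h₃⟩ := hτ.exists_lqNorm_nbrs_le hp l
  obtain ⟨D, hD, hΔ⟩ := exists_enorm_diffOp_splineOf_le n l
  obtain ⟨C₄, hC₄, h₄⟩ := hτ.coarse
  obtain ⟨C₅, hC₅, h₅⟩ := hτ.exists_lqNorm_nbrs_le hp (2 * l)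
  refine ⟨C₂ * C₃ * C₁ + ENNReal.ofReal D * scale r n 1 * C₄ * C₅,
    by have := scale_ne_top r n 1; finiteness, fun j k c => ?_⟩
  rcases le_or_gt j k with hjk | hjk
  · obtain ⟨d, rfl⟩ := Nat.exists_eq_add_of_le hjk
    rw [show (((j + d : ℕ) : ℤ) - j).natAbs = d by omega]
    calc _ ≤ lqNorm p fun m => C₂ * (τ j m * ∑ ν ∈ nbrs n l, scale r n j *
          eLpNorm (splineOf l (j + d) c) r (volume.restrict (dyadicCubeIco j (m + ν)))) := by
          refine lqNorm_mono fun m => ?_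
          rw [mul_left_comm C₂]
          gcongr
          exact h₂ j m _ (measurable_splineOf _ _ _)
      _ ≤ C₂ * (C₃ * (C₁ * ρ ^ d * lqNorm p fun m => τ (j + d) m * ‖c m‖ₑ)) := by
          rw [lqNorm_const_mul hp]
          gcongr
          refine (h₃ j fun m => scale r n j *
            eLpNorm (splineOf l (j + d) c) r (volume.restrict (dyadicCubeIco j m))).trans ?_
          gcongr
          exact h₁ j d c
      _ = C₂ * C₃ * C₁ * ρ ^ d * lqNorm p fun m => τ (j + d) m * ‖c m‖ₑ := by ring
      _ ≤ _ := by gcongr; exact le_self_add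
  · obtain ⟨d, rfl⟩ := Nat.exists_eq_add_of_le hjk.le
    rw [show ((k : ℤ) - ((k + d : ℕ) : ℤ)).natAbs = d by omega]
    set b : (Fin n → ℤ) → ℝ≥0∞ := fun m => ∑ ν ∈ nbrs n (2 * l), ‖c (m + ν)‖ₑ with hb
    -- Steps shorter than `2 ^ (-(k + d))` are at most `ε = 2 ^ (-d)` relative to the mesh of level
    -- `k`, which gives the factor `ε ^ l`.
    set K : ℝ≥0∞ := ENNReal.ofReal (D * (((2 : ℝ) ^ d)⁻¹) ^ l) with hK
    have hpt : ∀ m, cubeDiff l r (k + d) m (splineOf l k c) ≤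
        K * scale r n 1 * b (parent d m) := by
      intro m
      have hae : ∀ᵐ z ∂((volume.restrict (dyadicCubeIco (k + d) m)).prod
          (volume.restrict (cubeAt 0 ((2 : ℝ) ^ (k + d))⁻¹))),
          ‖diffOp l z.2 (splineOf l k c) z.1‖ₑ ≤ K * ‖b (parent d m)‖ₑ := by
        rw [Measure.prod_restrict]
        filter_upwards [ae_restrict_mem ((measurableSet_dyadicCubeIco (k + d) m).prod
          (MeasurableSet.univ_pi fun _ => measurableSet_Ioo))] with z hz
        have h0 := hΔ k c z.2 z.1 (((2 : ℝ) ^ d)⁻¹) (by positivity)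
          (inv_le_one_of_one_le₀ (one_le_pow₀ (by norm_num))) fun i => by
            have := (mem_cubeAt.1 hz.2 i).le
            simp only [Pi.zero_apply, sub_zero] at this
            rw [abs_mul, abs_of_pos (by positivity : (0 : ℝ) < 2 ^ k)]
            calc _ ≤ (2 : ℝ) ^ k * ((2 : ℝ) ^ (k + d))⁻¹ := by gcongr
              _ = _ := by rw [pow_add]; field_simp
        rw [← parent_cellIndex k d, mem_dyadicCubeIco.1 hz.1] at h0
        rwa [enorm_eq_self]
      rw [cubeDiff]
      calc _ ≤ scale r n (k + d) * scale r n (k + d) * (K * eLpNorm (fun _ => b (parent d m)) r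
            ((volume.restrict (dyadicCubeIco (k + d) m)).prod
              (volume.restrict (cubeAt 0 ((2 : ℝ) ^ (k + d))⁻¹)))) := by
            gcongr
            exact eLpNorm_le_mul_eLpNorm (by finiteness) hae
        _ ≤ scale r n (k + d) * scale r n (k + d) * (K * (b (parent d m) *
            ((scale r n (k + d))⁻¹ * (scale r n 1 * (scale r n (k + d))⁻¹)))) := by
            gcongr
            refine (eLpNorm_prod_le_of_forall hr measurable_const (B := b (parent d m) *
              (scale r n (k + d))⁻¹) (ae_of_all _ fun h => ?_)).trans (le_of_eq ?_)
            · rw [eLpNorm_const_dyadicCubeIco hr]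
            · rw [Measure.restrict_apply_univ, volume_cubeAt_rpow]; ring
        _ = K * scale r n 1 * b (parent d m) * (scale r n (k + d) * (scale r n (k + d))⁻¹) *
            (scale r n (k + d) * (scale r n (k + d))⁻¹) := by ring
        _ = _ := by
            rw [ENNReal.mul_inv_cancel (scale_ne_zero _ _ _) (scale_ne_top _ _ _), mul_one, mul_one]
    have hKe : K * 2 ^ (l * d) = ENNReal.ofReal D := by
      rw [hK, show (2 : ℝ≥0∞) ^ (l * d) = ENNReal.ofReal (2 ^ (l * d)) by
        rw [ENNReal.ofReal_pow (by norm_num)]; norm_num, ← ENNReal.ofReal_mul (by positivity)]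
      congr 1
      rw [inv_pow, ← pow_mul, mul_comm d l]
      field_simp
    calc _ ≤ lqNorm p fun m => K * scale r n 1 * (τ (k + d) m * b (parent d m)) := by
          refine lqNorm_mono fun m => ?_
          rw [mul_left_comm (K * scale r n 1)]
          gcongr
          exact hpt m
      _ = K * scale r n 1 * lqNorm p fun m => lqNorm p fun m' : {m' // parent d m' = m} =>
            b m * τ (k + d) m' := by
          rw [lqNorm_const_mul hp, ← lqNorm_fiberwise hp (parent d)]
          congr 2
          ext m
          congr 1
          ext m'
          rw [m'.2, mul_comm]
      _ ≤ K * scale r n 1 * lqNorm p fun m => C₄ * ρ ^ d * 2 ^ (l * d) * (τ k m * b m) := by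
          gcongr
          refine lqNorm_mono fun m => ?_
          rw [lqNorm_const_mul hp]
          calc _ ≤ b m * (C₄ * ρ ^ d * 2 ^ (l * d) * τ k m) := by gcongr; exact h₄ k d m
            _ = _ := by ring
      _ ≤ K * scale r n 1 * (C₄ * ρ ^ d * 2 ^ (l * d) *
            (C₅ * lqNorm p fun m => τ k m * ‖c m‖ₑ)) := by
          rw [lqNorm_const_mul hp]
          gcongr
          exact h₅ k fun m => ‖c m‖ₑ
      _ = (K * 2 ^ (l * d)) * scale r n 1 * C₄ * C₅ * ρ ^ d *
            lqNorm p fun m => τ k m * ‖c m‖ₑ := by ring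
      _ ≤ _ := by
          rw [hKe]
          gcongr
          exact le_add_self

end Levels

/-! ### Sums of spline series -/

section Series

variable {n : ℕ} {p q r ρ : ℝ≥0∞} {l : ℕ}

theorem ae_ne_top_of_eLpNorm_ne_top {α : Type*} [MeasurableSpace α] {μ : Measure α} (hr : r ≠ 0)
    {g : α → ℝ≥0∞} (hg : Measurable g) (h : eLpNorm g r μ ≠ ∞) : ∀ᵐ x ∂μ, g x ≠ ∞ := by
  rcases eq_or_ne r ∞ with rfl | hrt
  · rw [eLpNorm_exponent_top] at h
    filter_upwards [ENNReal.ae_le_essSup (μ := μ) fun x => ‖g x‖ₑ] with x hx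
    exact (lt_of_le_of_lt hx (lt_top_iff_ne_top.2 h)).ne
  · have hr0 : 0 < r.toReal := ENNReal.toReal_pos hr hrt
    rw [eLpNorm_eq_lintegral_rpow_enorm_toReal hr hrt] at h
    have h1 : ∫⁻ x, ‖g x‖ₑ ^ r.toReal ∂μ ≠ ∞ := by
      intro h2
      rw [h2, ENNReal.top_rpow_of_pos (by positivity)] at h
      exact h rfl
    filter_upwards [ae_lt_top (hg.enorm.pow_const _) h1] with x hx h3
    simp [h3, hr0] at hx

theorem lqNorm_pow_ne_top {k : ℝ≥0∞} (hk : k ≠ 0) (hkt : k ≠ ∞) (hρ : ρ < 1) :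
    (lqNorm k fun d : ℕ => ρ ^ d) ≠ ∞ := by
  refine ne_top_of_le_ne_top (lqNorm_geometric_ne_top hk hkt hρ) ?_
  exact lqNorm_comp_le (e := fun d : ℕ => (d : ℤ)) Nat.cast_injective fun d : ℤ => ρ ^ d.natAbs

theorem exists_subset_iUnion_nbrs {K : Set (Fin n → ℝ)} (hK : IsCompact K) (k : ℕ) :
    ∃ R : ℕ, K ⊆ ⋃ m : nbrs n R, dyadicCubeIco k (m : Fin n → ℤ) := by
  obtain ⟨M, hM⟩ := hK.isBounded.exists_norm_le
  obtain ⟨R, hR⟩ := exists_nat_ge (2 ^ k * M)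
  refine ⟨R, fun x hx => ?_⟩
  have := mem_iUnion_nbrs (j := k) (R := R) (x := 0) (y := x) fun i => by
    have h1 := (norm_le_pi_norm x i).trans (hM x hx)
    rw [Real.norm_eq_abs] at h1
    simp only [Pi.zero_apply, sub_zero]
    rw [← div_eq_mul_inv, le_div_iff₀ (by positivity)]
    calc _ ≤ M * 2 ^ k := by gcongr
      _ ≤ R := by rwa [mul_comm]
  have h0 : cellIndex k (0 : Fin n → ℝ) = 0 := by ext i; simp [cellIndex]
  simpa [h0] using this

theorem summable_of_tsum_enorm_ne_top {ι : Type*} {a : ι → ℝ} (h : ∑' i, ‖a i‖ₑ ≠ ∞) : Summable a := by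
  refine Summable.of_nnnorm ?_
  exact ENNReal.tsum_coe_ne_top_iff_summable.1 h

theorem measurable_lqNorm {α ι : Type} [MeasurableSpace α] [Countable ι] {k : ℝ≥0∞} {g : ι → α → ℝ≥0∞}
    (hg : ∀ i, Measurable (g i)) : Measurable fun x => lqNorm k fun i => g i x := by
  unfold lqNorm
  split_ifs
  · exact Measurable.iSup hg
  · exact (Measurable.tsum fun i => (hg i).pow_const _).pow_const _

/-- For almost every pair of point and step, a difference avoids a given null set. The quasi-norm
therefore depends only on the class of `f`, and representatives may be changed freely. -/
theorem besovNorm_congr (l : ℕ) (p q r : ℝ≥0∞) (t : ℕ → (Fin n → ℝ) → ℝ) {f g : (Fin n → ℝ) → ℝ}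
    (h : f =ᵐ[volume] g) : besovNorm l p q r t f = besovNorm l p q r t g := by
  have h1 : ∀ k x, localDiff l r k f x = localDiff l r k g x := by
    intro k x
    rw [localDiff_eq, localDiff_eq, Measure.prod_restrict]
    congr 1
    refine eLpNorm_congr_ae (ae_restrict_of_ae ?_)
    filter_upwards [ae_prod_add_smul h] with z hz
    exact diffOp_congr fun i _ => hz i
  have h2 : ∀ x, eLpNorm f r (volume.restrict (cubeAt x 1)) =
      eLpNorm g r (volume.restrict (cubeAt x 1)) :=
    fun x => eLpNorm_congr_ae (ae_restrict_of_ae h)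
  simp only [besovNorm, h1, h2]

/-- Two limits are compared with the same partial sums by the quasi-triangle inequality. This is
what lets one sum be estimated through any of its representations. -/
theorem SplineSeriesTendsto.ae_eq {β : ℕ → (Fin n → ℤ) → ℝ} {f g : (Fin n → ℝ) → ℝ} (hr : r ≠ 0)
    (hf : SplineSeriesTendsto l r β f) (hg : SplineSeriesTendsto l r β g)
    (hfm : MemLpLoc f r) (hgm : MemLpLoc g r) : f =ᵐ[volume] g := by
  obtain ⟨C, hC, hsum⟩ := exists_eLpNorm_sum_le (ι := Fin 2) hr
  have key : ∀ m : Fin n → ℤ, ∀ᵐ x, x ∈ dyadicCubeIco 0 m → f x = g x := by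
    intro m
    rw [← ae_restrict_iff' (measurableSet_dyadicCubeIco 0 m)]
    set K := Set.Icc (fun i => (m i : ℝ) / 2 ^ 0) (fun i => ((m i : ℝ) + 1) / 2 ^ 0)
    have hK : IsCompact K := isCompact_Icc
    refine ae_restrict_of_ae_restrict_of_subset (dyadicCubeIco_subset_Icc 0 m) ?_
    have hfK := (hfm K hK).1
    have hgK := (hgm K hK).1
    have h0 : eLpNorm (fun x => f x - g x) r (volume.restrict K) = 0 := by
      refine le_antisymm ?_ bot_le
      have hlim : Tendsto (fun J : ℕ => C *
          (eLpNorm (fun x => f x - ∑ k ∈ Finset.range J, splineLevel l β k x) r (volume.restrict K) +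
          eLpNorm (fun x => g x - ∑ k ∈ Finset.range J, splineLevel l β k x) r
            (volume.restrict K))) atTop (𝓝 (C * (0 + 0))) :=
        ENNReal.Tendsto.const_mul ((hf K hK).add (hg K hK)) (Or.inr hC)
      rw [add_zero, mul_zero] at hlim
      refine ge_of_tendsto' hlim fun J => ?_
      have hSm : Measurable fun x => ∑ k ∈ Finset.range J, splineLevel l β k x :=
        Finset.measurable_sum _ fun k _ => measurable_splineOf l k (β k)
      set S := fun x => ∑ k ∈ Finset.range J, splineLevel l β k x
      have := hsum (volume.restrict K) ![fun x => ‖f x - S x‖ₑ, fun x => ‖g x - S x‖ₑ] fun j => by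
        fin_cases j
        · exact (hfK.sub hSm.aestronglyMeasurable).enorm
        · exact (hgK.sub hSm.aestronglyMeasurable).enorm
      simp only [Fin.sum_univ_two, Matrix.cons_val_zero, Matrix.cons_val_one, eLpNorm_enorm] at this
      refine le_trans (eLpNorm_mono_enorm fun x => ?_) this
      rw [enorm_eq_self, show f x - g x = (f x - S x) - (g x - S x) by ring]
      exact enorm_sub_le
    replace h0 := (eLpNorm_eq_zero_iff (hfK.sub hgK) hr).1 h0
    filter_upwards [h0] with x hx
    simpa [sub_eq_zero] using hx
  have := ae_all_iff.2 key
  filter_upwards [this] with x hx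
  exact hx (cellIndex 0 x) (mem_dyadicCubeIco.2 rfl)

/-- On each unit cube the levels decay geometrically in `L_r`, so the series converges absolutely
almost everywhere and its pointwise sum serves as `f`. All sums over levels are taken in `l_κ`,
which lies above the plain sum and commutes with the outer quasi-norms by Minkowski's inequality. -/
theorem exists_splineSeries_besovNorm_le (hp : p ≠ 0) (hr : r ≠ 0) {κ : ℝ≥0∞} (hκ : κ ≠ 0)
    (hκ1 : κ ≤ 1) (hκp : κ ≤ p) (hκr : κ ≤ r) (hκq : κ ≤ q) {t : ℕ → (Fin n → ℝ) → ℝ} (hρ : ρ < 1)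
    (hτ : CoefWeight p r l ρ (weightCoef p t)) :
    ∃ C : ℝ≥0∞, C ≠ ∞ ∧ ∀ β : ℕ → (Fin n → ℤ) → ℝ, coefNorm p q t β < ∞ →
      ∃ f : (Fin n → ℝ) → ℝ, SplineSeriesTendsto l r β f ∧ MemLpLoc f r ∧
        besovNorm l p q r t f ≤ C * coefNorm p q t β := by
  have hκt : κ ≠ ∞ := ne_top_of_le_ne_top ENNReal.one_ne_top hκ1
  have hq : q ≠ 0 := (hκ.bot_lt.trans_le hκq).ne'
  have hG := lqNorm_pow_ne_top hκ hκt hρ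
  have hG' := lqNorm_geometric_ne_top hκ hκt hρ
  set G := lqNorm κ fun d : ℕ => ρ ^ d with hGdef
  set G' := lqNorm κ fun d : ℤ => ρ ^ d.natAbs with hGdef'
  set τ := weightCoef p t with hτdef
  obtain ⟨C₁, hC₁, h₁⟩ := hτ.exists_eLpNorm_splineOf_le hp hr
  obtain ⟨C₂, hC₂, h₂⟩ := hτ.exists_cubeDiff_splineOf_le hp hr
  obtain ⟨C₃, hC₃, h₃⟩ := exists_localDiff_le n l hr
  obtain ⟨C₄, hC₄, h₄⟩ := hτ.exists_lqNorm_nbrs_le hp 1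
  obtain ⟨C₅, hC₅, h₅⟩ := exists_eLpNorm_restrict_iUnion_le (ι := nbrs n 1) hr
  refine ⟨C₃ * C₄ * C₂ * G' + C₅ * C₄ * C₁ * G, by finiteness, fun β hβ => ?_⟩
  set v : ℕ → (Fin n → ℝ) → ℝ := fun k => splineOf l k (β k) with hv
  have hvm : ∀ k, Measurable (v k) := fun k => measurable_splineOf l k (β k)
  set c : ℕ → ℝ≥0∞ := fun k => lqNorm p fun m => τ k m * ‖β k m‖ₑ with hc
  have hcM : ∀ k, c k ≤ coefNorm p q t β := fun k => le_lqNorm hq c k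
  set M := coefNorm p q t β with hM
  -- A pointwise majorant of the tail from level `J` on. Its `L_r` quasi-norm over a unit cube is of
  -- order `ρ ^ J`.
  set W : ℕ → (Fin n → ℝ) → ℝ≥0∞ := fun J x => lqNorm κ fun k => ‖v (k + J) x‖ₑ with hW
  have hWm : ∀ J, Measurable (W J) := fun J => measurable_lqNorm fun k => (hvm _).enorm
  have hloc : ∀ k m, τ 0 m * eLpNorm (v k) r (volume.restrict (dyadicCubeIco 0 m)) ≤
      C₁ * ρ ^ k * c k := by
    intro k m
    have := h₁ 0 k (β k)
    simp only [scale_zero, one_mul, zero_add] at this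
    exact (le_lqNorm hp (fun m => τ 0 m * eLpNorm (v k) r (volume.restrict (dyadicCubeIco 0 m)))
      m).trans this
  have hWnorm : ∀ J m, eLpNorm (W J) r (volume.restrict (dyadicCubeIco 0 m)) ≤
      (τ 0 m)⁻¹ * C₁ * M * G * ρ ^ J := by
    intro J m
    refine (eLpNorm_lqNorm_le hκ hκt hκr fun k => (hvm _).enorm.aemeasurable).trans ?_
    calc _ ≤ lqNorm κ fun k => (τ 0 m)⁻¹ * C₁ * M * ρ ^ J * ρ ^ k := by
          refine lqNorm_mono fun k => ?_
          rw [eLpNorm_enorm]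
          calc _ = (τ 0 m)⁻¹ * (τ 0 m * eLpNorm (v (k + J)) r
                (volume.restrict (dyadicCubeIco 0 m))) := by
                rw [← mul_assoc, ENNReal.inv_mul_cancel (hτ.ne_zero _ _) (hτ.ne_top _ _), one_mul]
            _ ≤ (τ 0 m)⁻¹ * (C₁ * ρ ^ (k + J) * M) := by
                refine mul_le_mul' le_rfl ((hloc _ _).trans ?_)
                gcongr
                exact hcM _
            _ = _ := by rw [pow_add]; ring
      _ = _ := by rw [lqNorm_const_mul hκ]; ring
  have hfin : ∀ m, (τ 0 m)⁻¹ * C₁ * M * G ≠ ∞ := fun m => by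
    have := ENNReal.inv_ne_top.2 (hτ.ne_zero 0 m)
    have := hβ.ne
    finiteness
  have hWfin : ∀ J m, eLpNorm (W J) r (volume.restrict (dyadicCubeIco 0 m)) ≠ ∞ := fun J m =>
    ne_top_of_le_ne_top (ENNReal.mul_ne_top (hfin m)
      (ENNReal.pow_ne_top (ne_top_of_lt hρ))) (hWnorm J m)
  have hae : ∀ᵐ x, W 0 x ≠ ∞ := by
    have : ∀ m : Fin n → ℤ, ∀ᵐ x, x ∈ dyadicCubeIco 0 m → W 0 x ≠ ∞ := fun m => by
      rw [← ae_restrict_iff' (measurableSet_dyadicCubeIco 0 m)]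
      exact ae_ne_top_of_eLpNorm_ne_top hr (hWm 0) (hWfin 0 m)
    filter_upwards [ae_all_iff.2 this] with x hx
    exact hx (cellIndex 0 x) (mem_dyadicCubeIco.2 rfl)
  have hsum : ∀ x, W 0 x ≠ ∞ → Summable fun k => v k x := fun x hx =>
    summable_of_tsum_enorm_ne_top (ne_top_of_le_ne_top hx (sum_le_lqNorm hκ hκ1 _))
  set f : (Fin n → ℝ) → ℝ := fun x => ∑' k, v k x with hf
  have htail : ∀ J x, W 0 x ≠ ∞ → ‖f x - ∑ k ∈ Finset.range J, v k x‖ₑ ≤ W J x := by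
    intro J x hx
    have h := (hsum x hx).sum_add_tsum_nat_add J
    rw [show f x = _ from h.symm, add_sub_cancel_left]
    exact enorm_tsum_le_tsum_enorm.trans (sum_le_lqNorm hκ hκ1 _)
  have hfm : AEStronglyMeasurable f volume := by
    refine aestronglyMeasurable_of_tendsto_ae atTop
      (f := fun J x => ∑ k ∈ Finset.range J, v k x)
      (fun J => (Finset.measurable_sum _ fun k _ => hvm k).aestronglyMeasurable) ?_
    filter_upwards [hae] with x hx
    exact (hsum x hx).hasSum.tendsto_sum_nat
  have hcubes : ∀ K : Set (Fin n → ℝ), IsCompact K → ∃ R : ℕ, ∃ C : ℝ≥0∞, C ≠ ∞ ∧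
      ∀ J, eLpNorm (fun x => f x - ∑ k ∈ Finset.range J, v k x) r (volume.restrict K) ≤
        C * ∑ m : nbrs n R, eLpNorm (W J) r (volume.restrict (dyadicCubeIco 0 (m : Fin n → ℤ))) := by
    intro K hK
    obtain ⟨R, hR⟩ := exists_subset_iUnion_nbrs hK 0
    obtain ⟨C, hC, hU⟩ := exists_eLpNorm_restrict_iUnion_le (ι := nbrs n R) hr
    refine ⟨R, C, hC, fun J => le_trans ?_ (hU volume (W J) _ K hR)⟩
    refine eLpNorm_mono_enorm_ae (ae_restrict_of_ae ?_)
    filter_upwards [hae] with x hx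
    simpa using htail J x hx
  refine ⟨f, fun K hK => ?_, fun K hK => ⟨hfm.restrict, ?_⟩, ?_⟩
  · obtain ⟨R, C, hC, hU⟩ := hcubes K hK
    have hlim : Tendsto (fun J : ℕ => C * ∑ m : nbrs n R, (τ 0 m)⁻¹ * C₁ * M * G * ρ ^ J) atTop
        (𝓝 0) := by
      have h0 : Tendsto (fun J : ℕ => ρ ^ J) atTop (𝓝 0) :=
        ENNReal.tendsto_pow_atTop_nhds_zero_of_lt_one hρ
      have h1 : Tendsto (fun J : ℕ => ∑ m : nbrs n R, (τ 0 m)⁻¹ * C₁ * M * G * ρ ^ J) atTop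
          (𝓝 (∑ m : nbrs n R, (τ 0 m)⁻¹ * C₁ * M * G * 0)) :=
        tendsto_finsetSum _ fun m _ => ENNReal.Tendsto.const_mul h0 (Or.inr (hfin m))
      simpa using ENNReal.Tendsto.const_mul h1 (Or.inr hC)
    refine tendsto_of_tendsto_of_tendsto_of_le_of_le tendsto_const_nhds hlim (fun _ => bot_le)
      fun J => (hU J).trans ?_
    gcongr with m
    exact hWnorm J m
  · obtain ⟨R, C, hC, hU⟩ := hcubes K hK
    have := hU 0
    simp only [Finset.range_zero, Finset.sum_empty, sub_zero] at this
    refine this.trans_lt (lt_top_iff_ne_top.2 (ENNReal.mul_ne_top hC ?_))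
    exact ENNReal.sum_ne_top.2 fun m _ => hWfin 0 m
  · rw [besovNorm, add_mul]
    refine add_le_add ?_ ?_
    · have hj : ∀ j, eLpNorm (fun x => ‖t j x‖ₑ * localDiff l r j f x) p volume ≤
          C₃ * C₄ * C₂ * lqNorm κ fun k : ℕ => ρ ^ ((k : ℤ) - j).natAbs * c k := by
        intro j
        have hd : ∀ m, cubeDiff l r j m f ≤ lqNorm κ fun k => cubeDiff l r j m (v k) := by
          intro m
          simp only [cubeDiff]
          rw [lqNorm_const_mul hκ]
          refine mul_le_mul' le_rfl ?_
          refine le_trans ?_ ((eLpNorm_lqNorm_le hκ hκt hκr fun k =>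
            (measurable_diffOp l (hvm k)).enorm.aemeasurable).trans
              (lqNorm_mono fun k => (eLpNorm_enorm _).le))
          rw [Measure.prod_restrict]
          refine eLpNorm_mono_enorm_ae (ae_restrict_of_ae ?_)
          filter_upwards [ae_prod_add_smul hae] with z hz
          -- For almost every point and step the series converges at all the points that the
          -- difference uses, so the difference may be taken term by term.
          have hs : HasSum (fun k => diffOp l z.2 (v k) z.1) (diffOp l z.2 f z.1) := by
            unfold diffOp
            exact hasSum_sum fun i _ => ((hsum _ (hz i)).hasSum).mul_left _
          rw [enorm_eq_self, ← hs.tsum_eq]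
          exact enorm_tsum_le_tsum_enorm.trans (sum_le_lqNorm hκ hκ1 _)
        calc _ ≤ lqNorm p fun m => τ j m * (C₃ * ∑ ν ∈ nbrs n 1, cubeDiff l r j (m + ν) f) :=
              eLpNorm_weight_mul_le hp (hτ.ne_zero j) fun x => h₃ j f x
          _ = C₃ * lqNorm p fun m => τ j m * ∑ ν ∈ nbrs n 1, cubeDiff l r j (m + ν) f := by
              rw [← lqNorm_const_mul hp]
              simp only [mul_left_comm C₃]
          _ ≤ C₃ * (C₄ * lqNorm p fun m => τ j m * cubeDiff l r j m f) := by
              gcongr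
              exact h₄ j fun m => cubeDiff l r j m f
          _ ≤ C₃ * (C₄ * lqNorm p fun m => lqNorm κ fun k => τ j m * cubeDiff l r j m (v k)) := by
              gcongr
              refine lqNorm_mono fun m => ?_
              rw [lqNorm_const_mul hκ]
              gcongr
              exact hd m
          _ ≤ C₃ * (C₄ * lqNorm κ fun k => lqNorm p fun m => τ j m * cubeDiff l r j m (v k)) := by
              gcongr
              exact lqNorm_lqNorm_le hκ hκt hκp fun k m => τ j m * cubeDiff l r j m (v k)
          _ ≤ C₃ * (C₄ * lqNorm κ fun k : ℕ => C₂ * (ρ ^ ((k : ℤ) - j).natAbs * c k)) := by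
              gcongr
              refine lqNorm_mono fun k => ?_
              rw [← mul_assoc]
              exact h₂ j k (β k)
          _ = _ := by rw [lqNorm_const_mul hκ]; ring
      refine (lqNorm_le_of_geometric hκ hκt hκq hj).trans (le_of_eq ?_)
      rw [← mul_assoc]
      rfl
    · calc _ ≤ lqNorm p fun m => τ 0 m * (C₅ * ∑ ν ∈ nbrs n 1,
            eLpNorm f r (volume.restrict (dyadicCubeIco 0 (m + ν)))) := by
            refine eLpNorm_weight_mul_le hp (hτ.ne_zero 0) fun x => ?_
            have := cubeAt_subset 0 x
            rw [pow_zero, inv_one] at this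
            rw [← Finset.sum_coe_sort (nbrs n 1)]
            exact h₅ _ _ _ _ this
        _ = C₅ * lqNorm p fun m => τ 0 m * ∑ ν ∈ nbrs n 1,
            eLpNorm f r (volume.restrict (dyadicCubeIco 0 (m + ν))) := by
            rw [← lqNorm_const_mul hp]
            simp only [mul_left_comm C₅]
        _ ≤ C₅ * (C₄ * lqNorm p fun m => τ 0 m *
            eLpNorm f r (volume.restrict (dyadicCubeIco 0 m))) := by
            gcongr
            exact h₄ 0 fun m => eLpNorm f r (volume.restrict (dyadicCubeIco 0 m))
        _ ≤ C₅ * (C₄ * lqNorm p fun m => lqNorm κ fun k => τ 0 m *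
            eLpNorm (v k) r (volume.restrict (dyadicCubeIco 0 m))) := by
            gcongr
            refine lqNorm_mono fun m => ?_
            rw [lqNorm_const_mul hκ]
            gcongr
            refine le_trans ?_ ((eLpNorm_lqNorm_le hκ hκt hκr fun k =>
              (hvm k).enorm.aemeasurable).trans (lqNorm_mono fun k => (eLpNorm_enorm _).le))
            refine eLpNorm_mono_enorm_ae (ae_restrict_of_ae ?_)
            filter_upwards [hae] with x hx
            have h0 := htail 0 x hx
            rw [Finset.range_zero, Finset.sum_empty, sub_zero] at h0
            exact h0
        _ ≤ C₅ * (C₄ * lqNorm κ fun k => lqNorm p fun m => τ 0 m *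
            eLpNorm (v k) r (volume.restrict (dyadicCubeIco 0 m))) := by
            gcongr
            exact lqNorm_lqNorm_le hκ hκt hκp fun k m => τ 0 m *
              eLpNorm (v k) r (volume.restrict (dyadicCubeIco 0 m))
        _ ≤ C₅ * (C₄ * lqNorm κ fun k => C₁ * M * ρ ^ k) := by
            gcongr
            refine lqNorm_mono fun k => ?_
            have := h₁ 0 k (β k)
            simp only [scale_zero, one_mul, zero_add] at this
            refine this.trans ?_
            rw [mul_right_comm]
            gcongr
            exact hcM k
        _ = _ := by rw [lqNorm_const_mul hκ]; ring

end Series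

/-! ### Affine changes of variables -/

section Affine

variable {n : ℕ}

theorem map_affine_volume {a : ℝ} (ha : 0 < a) (c : Fin n → ℝ) :
    Measure.map (fun s : Fin n → ℝ => c + a • s) volume =
      ENNReal.ofReal (a ^ n)⁻¹ • (volume : Measure (Fin n → ℝ)) := by
  have h1 := Measure.map_addHaar_smul (volume : Measure (Fin n → ℝ)) ha.ne'
  rw [Module.finrank_fin_fun, abs_of_pos (by positivity)] at h1
  have h2 : (fun s : Fin n → ℝ => c + a • s) = (fun s => c + s) ∘ fun s => a • s := rfl
  rw [h2, ← Measure.map_map (by fun_prop) (by fun_prop)]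
  change Measure.map _ (Measure.map (fun s => a • s) volume) = _
  rw [h1, Measure.map_smul, (measurePreserving_add_left volume c).map_eq]

theorem measurableEmbedding_affine {a : ℝ} (ha : 0 < a) (c : Fin n → ℝ) :
    MeasurableEmbedding fun s : Fin n → ℝ => c + a • s :=
  (measurableEmbedding_addLeft c).comp (measurableEmbedding_const_smul₀ ha.ne')

theorem eLpNorm_comp_affine {E : Type*} [TopologicalSpace E] [ContinuousENorm E] {a : ℝ}
    (ha : 0 < a) (c : Fin n → ℝ) (G : (Fin n → ℝ) → E) (r : ℝ≥0∞) (T : Set (Fin n → ℝ)) :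
    eLpNorm (fun s => G (c + a • s)) r (volume.restrict ((fun s => c + a • s) ⁻¹' T)) =
      ENNReal.ofReal (a ^ n)⁻¹ ^ (r⁻¹).toReal * eLpNorm G r (volume.restrict T) := by
  have he := measurableEmbedding_affine ha c
  have h1 : Measure.map (fun s : Fin n → ℝ => c + a • s)
      (volume.restrict ((fun s => c + a • s) ⁻¹' T)) =
      ENNReal.ofReal (a ^ n)⁻¹ • (volume.restrict T) := by
    rw [← he.restrict_map, map_affine_volume ha, Measure.restrict_smul]
  have h2 := he.eLpNorm_map_measure (p := r) (g := G)
    (μ := volume.restrict ((fun s => c + a • s) ⁻¹' T))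
  rw [h1, eLpNorm_smul_measure_of_ne_zero (by simpa using by positivity)] at h2
  rw [smul_eq_mul, one_div] at h2
  exact h2.symm

theorem eLpNorm_comp_affine_le {E : Type*} [TopologicalSpace E] [ContinuousENorm E] {a : ℝ}
    (ha : 1 ≤ a) (c : Fin n → ℝ) (G : (Fin n → ℝ) → E) (r : ℝ≥0∞) {S T : Set (Fin n → ℝ)}
    (h : ∀ s ∈ S, c + a • s ∈ T) :
    eLpNorm (fun s => G (c + a • s)) r (volume.restrict S) ≤ eLpNorm G r (volume.restrict T) := by
  refine (eLpNorm_mono_measure _ (Measure.restrict_mono (show S ⊆ (fun s => c + a • s) ⁻¹' T from h)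
    le_rfl)).trans ?_
  rw [eLpNorm_comp_affine (by positivity)]
  refine mul_le_of_le_one_left' ?_
  refine ENNReal.rpow_le_one ?_ (by positivity)
  rw [ENNReal.ofReal_le_one]
  exact inv_le_one_of_one_le₀ (one_le_pow₀ ha)

theorem measurable_eLpNorm_prod {α β : Type*} [MeasurableSpace α] [MeasurableSpace β]
    {μ : Measure α} [SFinite μ] {r : ℝ≥0∞} (hr : r ≠ 0) {g : α × β → ℝ≥0∞} (hg : Measurable g) :
    Measurable fun y => eLpNorm (fun x => g (x, y)) r μ := by
  rcases eq_or_ne r ∞ with rfl | hrt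
  · refine measurable_of_Iic fun c => ?_
    -- An essential supremum is at most `c` exactly when the section of `{g > c}` is null, and the
    -- measure of sections is a measurable function.
    have : (fun y => eLpNorm (fun x => g (x, y)) ∞ μ) ⁻¹' Set.Iic c =
        (fun y => μ ((fun x => (x, y)) ⁻¹' {z | ¬ g z ≤ c})) ⁻¹' {0} := by
      ext y
      simp only [Set.mem_preimage, Set.mem_Iic, Set.mem_singleton_iff, eLpNorm_exponent_top,
        eLpNormEssSup, enorm_eq_self, essSup_le_iff_ae, ae_iff]
      rfl
    rw [this]
    exact measurable_measure_prodMk_right (measurableSet_le hg measurable_const).compl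
      (measurableSet_singleton 0)
  · simp only [eLpNorm_eq_lintegral_rpow_enorm_toReal hr hrt, enorm_eq_self]
    exact (Measurable.lintegral_prod_left' (hg.pow_const _)).pow_const _

end Affine

/-! ### Differences with a fixed step -/

section FixedStep

variable {n : ℕ}

theorem diffOp_zero_step {l : ℕ} (hl : l ≠ 0) (f : (Fin n → ℝ) → ℝ) (x : Fin n → ℝ) :
    diffOp l 0 f x = 0 := by
  unfold diffOp
  simp only [smul_zero, add_zero]
  have h := (Commute.all (1 : ℝ) (-1)).add_pow l
  rw [add_neg_cancel, zero_pow hl] at h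
  rw [← Finset.sum_mul]
  have : ∑ i ∈ Finset.range (l + 1), (-1 : ℝ) ^ (l + i) * (l.choose i : ℝ) = 0 := by
    rw [h]
    refine Finset.sum_congr rfl fun i hi => ?_
    rw [one_pow, one_mul]
    congr 1
    have : i ≤ l := by simpa [Nat.lt_succ_iff] using hi
    rw [show l + i = (l - i) + 2 * i by omega, pow_add, pow_mul]
    simp
  rw [this, zero_mul]

/-- Differences with a fixed step in terms of differences with averaged steps. -/
theorem diffOp_eq_sum_diffOp {l : ℕ} (hl : l ≠ 0) (h s : Fin n → ℝ) (f : (Fin n → ℝ) → ℝ)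
    (x : Fin n → ℝ) :
    diffOp l h f x = ∑ i ∈ Finset.range l, (-1 : ℝ) ^ (i + 1) * (l.choose (i + 1) : ℝ) *
      (diffOp l (((i + 1 : ℕ) : ℝ) • s) f (x + ((i + 1 : ℕ) : ℝ) • h) -
        diffOp l (h + ((i + 1 : ℕ) : ℝ) • s) f x) := by
  -- The double sum over `i` and `j` is symmetric: moving by `i h` and then by `j` steps `i s` is
  -- the same as moving by `i` steps `h + j s`. The term with `i = 0` is minus the difference with
  -- step `h`, and solving for it gives the identity.
  have key : ∑ i ∈ Finset.range (l + 1), (-1 : ℝ) ^ i * (l.choose i : ℝ) *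
      (diffOp l ((i : ℝ) • s) f (x + (i : ℝ) • h) - diffOp l (h + (i : ℝ) • s) f x) = 0 := by
    simp only [mul_sub, Finset.sum_sub_distrib, sub_eq_zero]
    unfold diffOp
    simp only [Finset.mul_sum]
    rw [Finset.sum_comm]
    refine Finset.sum_congr rfl fun i _ => Finset.sum_congr rfl fun j _ => ?_
    rw [show x + (j : ℝ) • h + (i : ℝ) • (j : ℝ) • s = x + (j : ℝ) • (h + (i : ℝ) • s) by
      rw [smul_add, smul_smul, smul_smul, mul_comm, add_assoc], pow_add, pow_add]
    ring
  rw [Finset.sum_range_succ'] at key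
  simp only [pow_zero, Nat.choose_zero_right, Nat.cast_one, Nat.cast_zero, zero_smul, add_zero,
    diffOp_zero_step hl, one_mul, zero_sub] at key
  linarith

/-- The identity in quasi-norm form. The translates by multiples of `h` are absorbed by enlarging
the cube to its neighbours, so only norms over one fixed set remain, as a function `H` of the step.
-/
theorem exists_eLpNorm_diffOp_le_sum (n : ℕ) {l : ℕ} (hl : l ≠ 0) {r : ℝ≥0∞} (hr : r ≠ 0) :
    ∃ C : ℝ≥0∞, C ≠ ∞ ∧ ∀ j (m : Fin n → ℤ) (f : (Fin n → ℝ) → ℝ) (h s : Fin n → ℝ),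
      Measurable f → (∀ i, |h i| ≤ ((2 : ℝ) ^ (j + 1))⁻¹) → ∀ H : (Fin n → ℝ) → ℝ≥0∞,
      (∀ h', H h' = eLpNorm (fun x => ‖diffOp l h' f x‖ₑ) r
        (volume.restrict (⋃ ν : nbrs n l, dyadicCubeIco j (m + (ν : Fin n → ℤ))))) →
      eLpNorm (fun x => ‖diffOp l h f x‖ₑ) r (volume.restrict (dyadicCubeIco j m)) ≤
        C * ∑ i : Fin l × Fin 2, (if i.2 = 0 then H (((i.1 + 1 : ℕ) : ℝ) • s) else
          H (h + ((i.1 + 1 : ℕ) : ℝ) • s)) := by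
  obtain ⟨C₁, hC₁, hS₁⟩ := exists_eLpNorm_sum_le (ι := Fin l × Fin 2) hr
  refine ⟨C₁ * 2 ^ l, by finiteness, fun j m f h s hf hh H hH => ?_⟩
  set B : Set (Fin n → ℝ) := ⋃ ν : nbrs n l, dyadicCubeIco j (m + (ν : Fin n → ℤ)) with hB
  have htr : ∀ i : Fin l, dyadicCubeIco j m ⊆ (fun x => x + ((i + 1 : ℕ) : ℝ) • h) ⁻¹' B := by
    intro i x hx
    rw [Set.mem_preimage, hB, ← mem_dyadicCubeIco.1 hx]
    refine mem_iUnion_nbrs fun a => ?_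
    simp only [Pi.add_apply, Pi.smul_apply, add_sub_cancel_left, smul_eq_mul]
    rw [abs_mul, Nat.abs_cast]
    have : ((i + 1 : ℕ) : ℝ) ≤ l := by exact_mod_cast i.2
    gcongr
    refine (hh a).trans ?_
    gcongr
    · norm_num
    · omega
  have hIB : dyadicCubeIco j m ⊆ B := by
    intro x hx
    refine Set.mem_iUnion.2 ⟨⟨0, mem_nbrs.2 fun i => by simp⟩, ?_⟩
    simpa using hx
  have h1 := hS₁ (volume.restrict (dyadicCubeIco j m)) (fun i x => 2 ^ l * if i.2 = 0 then
    ‖diffOp l (((i.1 + 1 : ℕ) : ℝ) • s) f (x + ((i.1 + 1 : ℕ) : ℝ) • h)‖ₑ else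
    ‖diffOp l (h + ((i.1 + 1 : ℕ) : ℝ) • s) f x‖ₑ) fun i => by
      have hm1 : ∀ h', Measurable (diffOp l h' f) := fun h' =>
        (measurable_diffOp l hf).comp (measurable_id.prodMk measurable_const)
      refine Measurable.aemeasurable (Measurable.const_mul ?_ _)
      split_ifs
      · exact ((hm1 _).comp (measurable_id.add_const _)).enorm
      · exact (hm1 _).enorm
  refine (le_trans (eLpNorm_mono_enorm fun x => ?_) h1).trans ?_
  · rw [enorm_eq_self, enorm_eq_self, diffOp_eq_sum_diffOp hl h s f x, Fintype.sum_prod_type]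
    refine (enorm_sum_le _ _).trans ?_
    rw [← Fin.sum_univ_eq_sum_range (fun i => ‖(-1 : ℝ) ^ (i + 1) * (l.choose (i + 1) : ℝ) *
      (diffOp l (((i + 1 : ℕ) : ℝ) • s) f (x + ((i + 1 : ℕ) : ℝ) • h) -
      diffOp l (h + ((i + 1 : ℕ) : ℝ) • s) f x)‖ₑ)]
    refine Finset.sum_le_sum fun i _ => ?_
    rw [Fin.sum_univ_two, if_pos rfl, if_neg (by norm_num), ← mul_add, enorm_mul, enorm_mul,
      enorm_pow, enorm_neg, enorm_one, one_pow, one_mul]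
    refine mul_le_mul' ?_ enorm_sub_le
    rw [Real.enorm_natCast]
    exact_mod_cast Nat.choose_le_two_pow l _
  · rw [mul_assoc]
    refine mul_le_mul' le_rfl ?_
    rw [Finset.mul_sum]
    refine Finset.sum_le_sum fun i _ => ?_
    refine (eLpNorm_le_mul_eLpNorm (g' := fun x => if i.2 = 0 then
      ‖diffOp l (((i.1 + 1 : ℕ) : ℝ) • s) f (x + ((i.1 + 1 : ℕ) : ℝ) • h)‖ₑ else
      ‖diffOp l (h + ((i.1 + 1 : ℕ) : ℝ) • s) f x‖ₑ) (c := 2 ^ l) (by finiteness)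
      (ae_of_all _ fun x => by simp)).trans (mul_le_mul' le_rfl ?_)
    split_ifs
    · rw [hH]
      refine (eLpNorm_mono_measure _ (Measure.restrict_mono (htr i.1) le_rfl)).trans ?_
      rw [eLpNorm_translate (fun y => ‖diffOp l (((i.1 + 1 : ℕ) : ℝ) • s) f y‖ₑ)]
    · rw [hH]
      exact eLpNorm_mono_measure _ (Measure.restrict_mono hIB le_rfl)

/-- The left side does not depend on `s`, so the inequality is averaged over a small cube of `s`.
Radius `2 ^ (-(j + 1 + l))` is small enough that `(i + 1) s`, and `h + (i + 1) s` too, stay in the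
cube of radius `2⁻ʲ`, because `i + 1 ≤ l < 2 ^ l`. -/
theorem exists_eLpNorm_const_le_of_sum (n l : ℕ) {r : ℝ≥0∞} (hr : r ≠ 0) :
    ∃ C : ℝ≥0∞, C ≠ ∞ ∧ ∀ j (h : Fin n → ℝ) (H : (Fin n → ℝ) → ℝ≥0∞) (X : ℝ≥0∞), Measurable H →
      (∀ i, |h i| ≤ ((2 : ℝ) ^ (j + 1))⁻¹) →
      (∀ s, X ≤ ∑ i : Fin l × Fin 2, (if i.2 = 0 then H (((i.1 + 1 : ℕ) : ℝ) • s) else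
        H (h + ((i.1 + 1 : ℕ) : ℝ) • s))) →
      X ≤ C * scale r n j * eLpNorm H r (volume.restrict (cubeAt 0 ((2 : ℝ) ^ j)⁻¹)) := by
  obtain ⟨C₁, hC₁, hS₁⟩ := exists_eLpNorm_sum_le (ι := Fin l × Fin 2) hr
  refine ⟨scale r n (1 + l) * (scale r n 1)⁻¹ * (C₁ * (l * 2)), ?_, fun j h H X hHm hh hpt => ?_⟩
  · have := scale_ne_top r n (1 + l)
    have := ENNReal.inv_ne_top.2 (scale_ne_zero r n 1)
    finiteness
  set S : Set (Fin n → ℝ) := cubeAt 0 ((2 : ℝ) ^ (j + (1 + l)))⁻¹ with hS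
  set T : Set (Fin n → ℝ) := cubeAt 0 ((2 : ℝ) ^ j)⁻¹ with hT
  have hsmall : ∀ i : Fin l, ∀ s ∈ S, ∀ a, |((i + 1 : ℕ) : ℝ) * s a| < ((2 : ℝ) ^ (j + 1))⁻¹ := by
    intro i s hs a
    have h1 := mem_cubeAt.1 hs a
    simp only [Pi.zero_apply, sub_zero] at h1
    have h2 : ((i + 1 : ℕ) : ℝ) ≤ 2 ^ l := by
      exact_mod_cast (show (i : ℕ) + 1 ≤ l from i.2).trans Nat.lt_two_pow_self.le
    rw [abs_mul, Nat.abs_cast]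
    calc ((i + 1 : ℕ) : ℝ) * |s a| < ((i + 1 : ℕ) : ℝ) * ((2 : ℝ) ^ (j + (1 + l)))⁻¹ := by
          gcongr
      _ ≤ 2 ^ l * ((2 : ℝ) ^ (j + (1 + l)))⁻¹ := by gcongr
      _ = _ := by rw [← add_assoc, pow_add]; field_simp
  have hhalf : ((2 : ℝ) ^ (j + 1))⁻¹ + ((2 : ℝ) ^ (j + 1))⁻¹ = ((2 : ℝ) ^ j)⁻¹ := by
    rw [pow_succ]; field_simp; norm_num
  have hpos : 0 < ((2 : ℝ) ^ (j + 1))⁻¹ := by positivity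
  have hterm : ∀ i : Fin l × Fin 2, eLpNorm (fun s => if i.2 = 0 then H (((i.1 + 1 : ℕ) : ℝ) • s)
      else H (h + ((i.1 + 1 : ℕ) : ℝ) • s)) r (volume.restrict S) ≤
      eLpNorm H r (volume.restrict T) := by
    intro i
    have h1 : (1 : ℝ) ≤ ((i.1 + 1 : ℕ) : ℝ) := by exact_mod_cast Nat.le_add_left 1 _
    split_ifs
    · have := eLpNorm_comp_affine_le h1 0 H r (S := S) (T := T) fun s hs => by
        refine mem_cubeAt.2 fun a => ?_
        have := hsmall i.1 s hs a
        simp only [Pi.add_apply, Pi.smul_apply, smul_eq_mul, Pi.zero_apply, zero_add, sub_zero]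
        linarith
      simpa using this
    · refine eLpNorm_comp_affine_le h1 h H r (S := S) (T := T) fun s hs => ?_
      refine mem_cubeAt.2 fun a => ?_
      have h2 := hsmall i.1 s hs a
      simp only [Pi.add_apply, Pi.smul_apply, smul_eq_mul, Pi.zero_apply, sub_zero]
      have := abs_add_le (h a) (((i.1 + 1 : ℕ) : ℝ) * s a)
      linarith [hh a]
  have hXS : X * (scale r n 1 * (scale r n (j + (1 + l)))⁻¹) ≤
      C₁ * (l * 2) * eLpNorm H r (volume.restrict T) := by
    rw [← volume_cubeAt_rpow r (j + (1 + l)) (0 : Fin n → ℝ)]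
    have hS0 : (volume.restrict S) ≠ 0 := by
      rw [Ne, Measure.restrict_eq_zero]
      exact ((isOpen_set_pi Set.finite_univ fun _ _ => isOpen_Ioo).measure_pos volume
        ⟨0, mem_cubeAt.2 fun i => by simp⟩).ne'
    have h0 : eLpNorm (fun _ : Fin n → ℝ => X) r (volume.restrict S) =
        X * volume S ^ (r⁻¹).toReal := by
      rw [eLpNorm_const _ hr hS0, enorm_eq_self, Measure.restrict_apply_univ, one_div,
        ENNReal.toReal_inv]
    rw [← h0]
    refine (eLpNorm_mono_enorm (g := fun s => ∑ i : Fin l × Fin 2,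
      (if i.2 = 0 then H (((i.1 + 1 : ℕ) : ℝ) • s) else H (h + ((i.1 + 1 : ℕ) : ℝ) • s)))
      fun s => ?_).trans ((hS₁ _ _ fun i => ?_).trans ?_)
    · rw [enorm_eq_self, enorm_eq_self]
      exact hpt s
    · split_ifs <;> exact (hHm.comp (by fun_prop)).aemeasurable
    · rw [mul_assoc C₁]
      refine mul_le_mul' le_rfl ((Finset.sum_le_sum fun i _ => hterm i).trans (le_of_eq ?_))
      simp
  have hs1 := ENNReal.mul_inv_cancel (scale_ne_zero r n 1) (scale_ne_top r n 1)
  have hs2 := ENNReal.mul_inv_cancel (scale_ne_zero r n (j + (1 + l))) (scale_ne_top r n _)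
  calc X = (X * (scale r n 1 * (scale r n (j + (1 + l)))⁻¹)) *
        (scale r n 1)⁻¹ * scale r n (j + (1 + l)) := by
        calc _ = X * (scale r n 1 * (scale r n 1)⁻¹) *
              (scale r n (j + (1 + l)) * (scale r n (j + (1 + l)))⁻¹) := by
              rw [hs1, hs2, mul_one, mul_one]
          _ = _ := by ring
    _ ≤ C₁ * (l * 2) * eLpNorm H r (volume.restrict T) *
        (scale r n 1)⁻¹ * scale r n (j + (1 + l)) := by gcongr
    _ = _ := by rw [scale_add r n j]; ring

/-- Differences with a fixed step of length at most `2^{-j-1}` are controlled by the mean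
differences at level `j`. -/
theorem exists_eLpNorm_diffOp_le (n : ℕ) {l : ℕ} (hl : l ≠ 0) {r : ℝ≥0∞} (hr : r ≠ 0) :
    ∃ C : ℝ≥0∞, C ≠ ∞ ∧ ∀ j (m : Fin n → ℤ) (f : (Fin n → ℝ) → ℝ) (h : Fin n → ℝ), Measurable f →
      (∀ i, |h i| ≤ ((2 : ℝ) ^ (j + 1))⁻¹) →
      scale r n j * eLpNorm (diffOp l h f) r (volume.restrict (dyadicCubeIco j m)) ≤
        C * ∑ ν ∈ nbrs n l, cubeDiff l r j (m + ν) f := by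
  obtain ⟨C₁, hC₁, h₁⟩ := exists_eLpNorm_diffOp_le_sum n hl hr
  obtain ⟨C₂, hC₂, hU⟩ := exists_eLpNorm_restrict_iUnion_le (ι := nbrs n l) hr
  obtain ⟨C₃, hC₃, h₃⟩ := exists_eLpNorm_const_le_of_sum n l hr
  refine ⟨C₃ * C₁ * C₂, by finiteness, fun j m f h hf hh => ?_⟩
  obtain ⟨T, hT⟩ : ∃ T : Set (Fin n → ℝ), T = cubeAt 0 ((2 : ℝ) ^ j)⁻¹ := ⟨_, rfl⟩
  obtain ⟨H, hH⟩ : ∃ H : (Fin n → ℝ) → ℝ≥0∞, H = fun h' => eLpNorm (fun x => ‖diffOp l h' f x‖ₑ) r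
    (volume.restrict (⋃ ν : nbrs n l, dyadicCubeIco j (m + (ν : Fin n → ℤ)))) := ⟨_, rfl⟩
  have hgm : Measurable fun z : (Fin n → ℝ) × (Fin n → ℝ) => ‖diffOp l z.2 f z.1‖ₑ :=
    (measurable_diffOp l hf).enorm
  have hHm : Measurable H := by 
    have h0 := measurable_eLpNorm_prod (r := r) hr hgm
      (μ := volume.restrict (⋃ ν : nbrs n l, dyadicCubeIco j (m + (ν : Fin n → ℤ))))
    rwa [hH]
  have hX : eLpNorm (diffOp l h f) r (volume.restrict (dyadicCubeIco j m)) ≤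
      C₃ * scale r n j * eLpNorm (fun s => C₁ * H s) r (volume.restrict T) := by
    rw [hT]
    refine h₃ j h (fun s => C₁ * H s) _ (hHm.const_mul _) hh fun s => ?_
    have h0 := h₁ j m f h s hf hh H fun h' => by rw [hH]
    rw [eLpNorm_enorm, Finset.mul_sum] at h0
    refine h0.trans (Finset.sum_le_sum fun i _ => ?_)
    split_ifs <;> exact le_rfl
  have hHT : eLpNorm H r (volume.restrict T) ≤ C₂ * ∑ ν : nbrs n l,
      eLpNorm (fun z : (Fin n → ℝ) × (Fin n → ℝ) => diffOp l z.2 f z.1) r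
        ((volume.restrict (dyadicCubeIco j (m + (ν : Fin n → ℤ)))).prod (volume.restrict T)) := by
    have h0 := eLpNorm_prod_eq (r := r) hr hgm
      (μ := volume.restrict (⋃ ν : nbrs n l, dyadicCubeIco j (m + (ν : Fin n → ℤ))))
      (ν := volume.restrict T)
    rw [hH, h0, Measure.prod_restrict, eLpNorm_enorm]
    simp only [Measure.prod_restrict]
    refine hU _ _ _ _ ?_
    rw [← Set.iUnion_prod_const]
  have hHT' := (eLpNorm_le_mul_eLpNorm (g := fun s => C₁ * H s) (g' := H) (r := r) hC₁
    (ae_of_all (volume.restrict T) fun s => le_rfl)).trans (mul_le_mul' le_rfl hHT)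
  refine (mul_le_mul' le_rfl (hX.trans (mul_le_mul' le_rfl hHT'))).trans (le_of_eq ?_)
  rw [← Finset.sum_coe_sort (nbrs n l)]
  simp only [cubeDiff, ← Finset.mul_sum, hT]
  ring

end FixedStep

/-! ### Tensor product Lagrange interpolation -/

section Lagrange

variable {n l : ℕ}

theorem nodes_injOn (l : ℕ) : Set.InjOn (fun i : ℕ => (i : ℝ)) (Finset.range l : Finset ℕ) :=
  Nat.cast_injective.injOn

open Polynomial in
/-- Lagrange basis polynomials for the nodes `0, …, l - 1`. -/
noncomputable def nodeBasis (l j : ℕ) : ℝ[X] := _root_.Lagrange.basis (Finset.range l) (fun i : ℕ => (i : ℝ)) j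

theorem natDegree_nodeBasis_lt {l j : ℕ} (hj : j < l) : (nodeBasis l j).natDegree < l := by
  rw [nodeBasis, _root_.Lagrange.natDegree_basis (nodes_injOn l) (Finset.mem_range.2 hj),
    Finset.card_range]
  omega

open Polynomial in
theorem sum_eval_mul_nodeBasis {l : ℕ} {q : ℝ[X]} (hq : q.natDegree < l) (x : ℝ) :
    ∑ j : Fin l, q.eval (j : ℝ) * (nodeBasis l j).eval x = q.eval x := by
  have hd : q.degree < (Finset.range l).card := by
    rw [Finset.card_range]
    exact degree_le_natDegree.trans_lt (by exact_mod_cast hq)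
  conv_rhs => rw [_root_.Lagrange.eq_interpolate (nodes_injOn l) hd]
  rw [_root_.Lagrange.interpolate_apply, eval_finsetSum,
    Fin.sum_univ_eq_sum_range (fun j => q.eval (j : ℝ) * (nodeBasis l j).eval x)]
  exact Finset.sum_congr rfl fun j _ => by rw [eval_mul, eval_C, nodeBasis]

/-- The weight of the node `ν` in tensor product Lagrange interpolation at `x`. -/
noncomputable def nodeWeight (l : ℕ) (ν : Fin n → Fin l) (x : Fin n → ℝ) : ℝ :=
  ∏ i, (nodeBasis l (ν i)).eval (x i)

/-- Tensor product Lagrange interpolation of `F` at the nodes `{0, …, l - 1}ⁿ`. -/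
noncomputable def lagrangeInterp (l : ℕ) (F : (Fin n → ℝ) → ℝ) (x : Fin n → ℝ) : ℝ :=
  ∑ ν : Fin n → Fin l, F (fun i => (ν i : ℝ)) * nodeWeight l ν x

theorem lagrangeInterp_mem (l : ℕ) (F : (Fin n → ℝ) → ℝ) : lagrangeInterp l F ∈ polySpace n l := by
  have : lagrangeInterp l F = ∑ ν : Fin n → Fin l, F (fun i => (ν i : ℝ)) • nodeWeight l ν := by
    ext x; simp [lagrangeInterp]
  rw [this]
  refine Submodule.sum_mem _ fun ν _ => Submodule.smul_mem _ _ (Submodule.subset_span ?_)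
  exact ⟨fun i => nodeBasis l (ν i), fun i => natDegree_nodeBasis_lt (ν i).2, rfl⟩

theorem lagrangeInterp_of_mem {P : (Fin n → ℝ) → ℝ} (hP : P ∈ polySpace n l) :
    lagrangeInterp l P = P := by
  ext x
  induction hP using Submodule.span_induction with
  | mem P h =>
    obtain ⟨q, hq, rfl⟩ := h
    simp only [lagrangeInterp, nodeWeight, ← Finset.prod_mul_distrib]
    rw [← Fintype.prod_sum fun i (j : Fin l) => (q i).eval (j : ℝ) * (nodeBasis l j).eval (x i)]
    exact Finset.prod_congr rfl fun i _ => sum_eval_mul_nodeBasis (hq i) (x i)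
  | zero => simp [lagrangeInterp]
  | add P Q _ _ hP hQ =>
    rw [Pi.add_apply, ← hP, ← hQ]
    simp [lagrangeInterp, add_mul, Finset.sum_add_distrib]
  | smul a P _ hP =>
    rw [Pi.smul_apply, ← hP, smul_eq_mul, lagrangeInterp, lagrangeInterp, Finset.mul_sum]
    exact Finset.sum_congr rfl fun ν _ => by simp [mul_assoc]

theorem lagrangeInterp_sub (l : ℕ) (F G : (Fin n → ℝ) → ℝ) (x : Fin n → ℝ) :
    lagrangeInterp l (fun y => F y - G y) x = lagrangeInterp l F x - lagrangeInterp l G x := by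
  simp [lagrangeInterp, sub_mul, Finset.sum_sub_distrib]

theorem lagrangeInterp_node (F : (Fin n → ℝ) → ℝ) (ν : Fin n → Fin l) :
    lagrangeInterp l F (fun i => (ν i : ℝ)) = F fun i => (ν i : ℝ) := by
  rw [lagrangeInterp, Finset.sum_eq_single ν]
  · have : nodeWeight l ν (fun i => (ν i : ℝ)) = 1 := by
      refine Finset.prod_eq_one fun i _ => ?_
      exact _root_.Lagrange.eval_basis_self (nodes_injOn l) (Finset.mem_range.2 (ν i).2)
    rw [this, mul_one]
  · intro ν' _ hne
    obtain ⟨i, hi⟩ := Function.ne_iff.1 hne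
    rw [nodeWeight, Finset.prod_eq_zero (Finset.mem_univ i), mul_zero]
    exact _root_.Lagrange.eval_basis_of_ne (v := fun i : ℕ => (i : ℝ)) (Fin.val_ne_of_ne hi)
      (Finset.mem_range.2 (ν i).2)
  · simp

theorem exists_abs_nodeWeight_le (n l : ℕ) (R : ℝ) : ∃ C : ℝ, 0 < C ∧
    ∀ (ν : Fin n → Fin l) (x : Fin n → ℝ), (∀ i, |x i| ≤ R) → |nodeWeight l ν x| ≤ C := by
  have h1 : ∀ j : Fin l, ∃ C : ℝ, ∀ x ∈ Set.Icc (-R) R, ‖(nodeBasis l j).eval x‖ ≤ C := fun j =>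
    isCompact_Icc.exists_bound_of_continuousOn (nodeBasis l j).continuous.continuousOn
  choose C hC using h1
  set D := 1 + ∑ j, |C j| with hD
  have hD1 : 1 ≤ D := le_add_of_nonneg_right (Finset.sum_nonneg fun _ _ => abs_nonneg _)
  refine ⟨D ^ n, by positivity, fun ν x hx => ?_⟩
  rw [nodeWeight, Finset.abs_prod]
  calc _ ≤ ∏ _i : Fin n, D := by
        refine Finset.prod_le_prod (fun _ _ => abs_nonneg _) fun i _ => ?_
        refine (hC (ν i) (x i) (abs_le.1 (hx i))).trans ((le_abs_self _).trans ?_)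
        have := Finset.single_le_sum (f := fun j => |C j|) (fun _ _ => abs_nonneg _)
          (Finset.mem_univ (ν i))
        linarith
    _ = _ := by simp

theorem sum_nodeWeight (hl : 0 < l) (x : Fin n → ℝ) : ∑ ν : Fin n → Fin l, nodeWeight l ν x = 1 := by
  have h1 : (fun _ => 1 : (Fin n → ℝ) → ℝ) ∈ polySpace n l :=
    Submodule.subset_span ⟨fun _ => 1, fun _ => by simpa using hl, by simp⟩
  have := congrFun (lagrangeInterp_of_mem h1) x
  simpa [lagrangeInterp] using this

open Polynomial in
theorem comp_affine_mem_polySpace {P : (Fin n → ℝ) → ℝ} (hP : P ∈ polySpace n l) (a : ℝ)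
    (c : Fin n → ℝ) : (fun x => P (c + a • x)) ∈ polySpace n l := by
  induction hP using Submodule.span_induction with
  | mem P h =>
    obtain ⟨q, hq, rfl⟩ := h
    refine Submodule.subset_span ⟨fun i => (q i).comp (C a * X + C (c i)), fun i => ?_, ?_⟩
    · refine lt_of_le_of_lt ?_ (hq i)
      rw [natDegree_comp]
      exact (Nat.mul_le_mul le_rfl natDegree_linear_le).trans (by simp)
    · ext x
      refine Finset.prod_congr rfl fun i _ => ?_
      simp [eval_comp, add_comm]
  | zero => exact Submodule.zero_mem _
  | add P Q _ _ hP hQ => exact Submodule.add_mem _ hP hQ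
  | smul a P _ hP => exact Submodule.smul_mem _ a hP

/-! #### Differences along the coordinate axes -/

open Polynomial in
theorem sum_choose_eval_eq_zero {q : ℝ[X]} (hq : q.natDegree < l) (y : ℝ) :
    ∑ k ∈ Finset.range (l + 1), (-1 : ℝ) ^ (l + k) * (l.choose k : ℝ) * q.eval (y + k) = 0 := by
  have h := congrFun (Polynomial.fwdDiff_iter_eq_zero_of_degree_lt hq) y
  rw [fwdDiff_iter_eq_sum_shift] at h
  rw [Pi.zero_apply] at h
  rw [← h]
  refine Finset.sum_congr rfl fun k hk => ?_
  have hk' : k ≤ l := by simpa [Nat.lt_succ_iff] using hk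
  rw [show l + k = (l - k) + 2 * k by omega, pow_add, pow_mul]
  simp

theorem diffOp_single_of_mem {P : (Fin n → ℝ) → ℝ} (hP : P ∈ polySpace n l) (i : Fin n)
    (x : Fin n → ℝ) : diffOp l (Pi.single i 1) P x = 0 := by
  induction hP using Submodule.span_induction with
  | mem P h =>
    obtain ⟨q, hq, rfl⟩ := h
    have h1 : ∀ k : ℕ, ∏ j, (q j).eval ((x + (k : ℝ) • (Pi.single i 1 : Fin n → ℝ)) j) =
        (q i).eval (x i + k) * ∏ j ∈ Finset.univ.erase i, (q j).eval (x j) := by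
      intro k
      rw [← Finset.mul_prod_erase _ _ (Finset.mem_univ i)]
      congr 1
      · simp
      · refine Finset.prod_congr rfl fun j hj => ?_
        simp [Finset.ne_of_mem_erase hj]
    simp only [diffOp, h1, ← mul_assoc, ← Finset.sum_mul]
    rw [sum_choose_eval_eq_zero (hq i), zero_mul]
  | zero => simp [diffOp]
  | add P Q _ _ hP hQ =>
    have : diffOp l (Pi.single i 1) (P + Q) x =
        diffOp l (Pi.single i 1) P x + diffOp l (Pi.single i 1) Q x := by
      simp [diffOp, mul_add, Finset.sum_add_distrib]
    rw [this, hP, hQ, add_zero]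
  | smul a P _ hP =>
    have : diffOp l (Pi.single i 1) (a • P) x = a * diffOp l (Pi.single i 1) P x := by
      simp only [diffOp, Pi.smul_apply, smul_eq_mul, Finset.mul_sum]
      exact Finset.sum_congr rfl fun _ _ => by ring
    rw [this, hP, mul_zero]

/-- A sequence with small differences of order `l` that is small at `l` consecutive integers is
small. -/
theorem abs_le_of_abs_sum_choose_le {g : ℤ → ℝ} {M : ℝ} {R : ℕ}
    (h0 : ∀ a : ℤ, 0 ≤ a → a < l → |g a| ≤ M)
    (h1 : ∀ a : ℤ, |a| ≤ R →
      |∑ k ∈ Finset.range (l + 1), (-1 : ℝ) ^ (l + k) * (l.choose k : ℝ) * g (a + k)| ≤ M) :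
    ∀ N ≤ R, ∀ a : ℤ, -(N : ℤ) ≤ a → a < l + N → |g a| ≤ (2 ^ l + 1) ^ N * M := by
  intro N
  induction N with
  | zero => intro _ a ha ha'; simpa using h0 a (by simpa using ha) (by simpa using ha')
  | succ N ih =>
    intro hN a ha ha'
    have ih' := ih (by omega)
    have hM : 0 ≤ M := (abs_nonneg _).trans (h1 0 (by simp))
    set B := (2 ^ l + 1) ^ N * M with hB
    have hMB : M ≤ B := le_mul_of_one_le_left hM (one_le_pow₀ (by linarith [pow_pos (two_pos (α := ℝ)) l]))
    have hBB : (2 ^ l + 1) ^ (N + 1) * M = 2 ^ l * B + B := by rw [hB]; ring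
    have hsum : ∀ (s : Finset ℕ) (f : ℕ → ℝ), s ⊆ Finset.range (l + 1) → (∀ k ∈ s, |f k| ≤ B) →
        |∑ k ∈ s, (-1 : ℝ) ^ (l + k) * (l.choose k : ℝ) * f k| ≤ 2 ^ l * B := by
      intro s f hs hf
      refine (Finset.abs_sum_le_sum_abs _ _).trans ?_
      calc _ ≤ ∑ k ∈ s, (l.choose k : ℝ) * B := by
            refine Finset.sum_le_sum fun k hk => ?_
            rw [abs_mul, abs_mul, abs_pow, abs_neg, abs_one, one_pow, one_mul, Nat.abs_cast]
            gcongr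
            exact hf k hk
        _ ≤ ∑ k ∈ Finset.range (l + 1), (l.choose k : ℝ) * B :=
            Finset.sum_le_sum_of_subset_of_nonneg hs fun _ _ _ => by positivity
        _ = _ := by
            rw [← Finset.sum_mul]
            congr 1
            exact_mod_cast Nat.sum_range_choose l
    rw [hBB]
    -- A new point lies directly to the left or to the right of the controlled range. It is the
    -- first or last node of a difference whose other nodes are controlled, and its coefficient
    -- there is `±1`.
    rcases lt_or_ge a (-(N : ℤ)) with h2 | h2
    · have h3 := h1 a (by rw [abs_le]; constructor <;> omega)
      rw [Finset.sum_range_succ'] at h3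
      simp only [add_zero, Nat.choose_zero_right, Nat.cast_one, mul_one, Nat.cast_zero] at h3
      have h4 : |∑ k ∈ Finset.range l, (-1 : ℝ) ^ (l + (k + 1)) * (l.choose (k + 1) : ℝ) *
          g (a + (k + 1 : ℕ))| ≤ 2 ^ l * B := by
        have := hsum ((Finset.range l).image (· + 1)) (fun k => g (a + k))
          (fun k hk => by simp at hk ⊢; omega) fun k hk => by
            simp only [Finset.mem_image, Finset.mem_range] at hk
            exact ih' _ (by omega) (by omega)
        rwa [Finset.sum_image (by simp)] at this
      have h5 : |g a| = |(-1 : ℝ) ^ l * g a| := by rw [abs_mul, abs_pow, abs_neg, abs_one, one_pow, one_mul]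
      rw [h5]
      rw [abs_le] at *
      constructor <;> linarith [h3.1, h3.2, h4.1, h4.2]
    · rcases lt_or_ge a ((l : ℤ) + N) with h3 | h3
      · have := ih' a h2 h3
        have : 0 ≤ 2 ^ l * B := by positivity
        linarith
      · have h4 := h1 (a - l) (by rw [abs_le]; constructor <;> omega)
        rw [Finset.sum_range_succ] at h4
        rw [sub_add_cancel, Nat.choose_self, Nat.cast_one, mul_one, ← two_mul, pow_mul] at h4
        norm_num at h4
        have h5 := hsum (Finset.range l) (fun k => g (a - l + k))
          (Finset.range_subset_range.2 (by omega)) fun k hk => by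
            have := Finset.mem_range.1 hk
            exact ih' _ (by omega) (by omega)
        rw [abs_le] at *
        constructor <;> linarith [h4.1, h4.2, h5.1, h5.2]

/-- The error of interpolation vanishes at the nodes and has the same coordinate differences as `F`,
since differences of order `l` annihilate the interpolant. Smallness spreads from the nodes to the
larger grid along one coordinate at a time. -/
theorem exists_abs_sub_lagrangeInterp_le (n R : ℕ) {l : ℕ} (hl : 0 < l) : ∃ C : ℝ, 0 < C ∧
    ∀ (F : (Fin n → ℝ) → ℝ) (z : Fin n → ℤ), z ∈ nbrs n R →
      |F (fun i => (z i : ℝ)) - lagrangeInterp l F fun i => (z i : ℝ)| ≤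
        C * ∑ i, ∑ y ∈ nbrs n (R + l), |diffOp l (Pi.single i 1) F fun i => (y i : ℝ)| := by
  -- Induction on the set of coordinates that may leave the range of the nodes; the others stay in
  -- `0, …, l - 1`.
  have key : ∀ s : Finset (Fin n), ∃ C : ℝ, 0 < C ∧ ∀ (G : (Fin n → ℝ) → ℝ) (M : ℝ), 0 ≤ M →
      (∀ ν : Fin n → Fin l, |G fun i => (ν i : ℝ)| ≤ M) →
      (∀ i, ∀ y ∈ nbrs n (R + l), |diffOp l (Pi.single i 1) G fun i => (y i : ℝ)| ≤ M) →
      ∀ z : Fin n → ℤ, (∀ i ∈ s, |z i| ≤ R) → (∀ i ∉ s, 0 ≤ z i ∧ z i < l) →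
        |G fun i => (z i : ℝ)| ≤ C * M := by
    intro s
    induction s using Finset.induction_on with
    | empty =>
      refine ⟨1, one_pos, fun G M _ h0 _ z _ hz => ?_⟩
      have h1 := h0 fun i => ⟨(z i).toNat, by have := hz i (by simp); omega⟩
      have h2 : ∀ i, (((z i).toNat : ℕ) : ℝ) = (z i : ℝ) := fun i => by
        have := Int.toNat_of_nonneg (hz i (by simp)).1
        exact_mod_cast this
      simpa [h2] using h1
    | insert i s his ih =>
      obtain ⟨C, hC, h⟩ := ih
      refine ⟨(2 ^ l + 1) ^ R * (C + 1), by positivity, fun G M hM h0 h1 z hz hz' => ?_⟩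
      set g : ℤ → ℝ := fun a => G fun j => ((Function.update z i a) j : ℝ) with hg
      have hzl : ∀ j, j ≠ i → |z j| ≤ R + l := by
        intro j hj
        by_cases hjs : j ∈ s
        · have := hz j (Finset.mem_insert_of_mem hjs); omega
        · have := hz' j (by simp [hj, hjs])
          rw [abs_le]; constructor <;> omega
      have h2 : ∀ a : ℤ, 0 ≤ a → a < l → |g a| ≤ (C + 1) * M := by
        intro a ha ha'
        refine (h G M hM h0 h1 _ (fun j hj => ?_) fun j hj => ?_).trans
          (by nlinarith)
        · have : j ≠ i := fun e => his (e ▸ hj)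
          rw [Function.update_of_ne this]
          exact hz j (Finset.mem_insert_of_mem hj)
        · rcases eq_or_ne j i with rfl | hji
          · simp [ha, ha']
          · rw [Function.update_of_ne hji]
            exact hz' j (by simp [hji, hj])
      have h3 : ∀ a : ℤ, |a| ≤ R → |∑ k ∈ Finset.range (l + 1), (-1 : ℝ) ^ (l + k) *
          (l.choose k : ℝ) * g (a + k)| ≤ (C + 1) * M := by
        intro a ha
        have h4 := h1 i (Function.update z i a) (mem_nbrs.2 fun j => by
          rcases eq_or_ne j i with rfl | hji
          · rw [Function.update_self]; push_cast; omega
          · rw [Function.update_of_ne hji]; exact_mod_cast hzl j hji)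
        have h5 : diffOp l (Pi.single i 1) G (fun j => ((Function.update z i a) j : ℝ)) =
            ∑ k ∈ Finset.range (l + 1), (-1 : ℝ) ^ (l + k) * (l.choose k : ℝ) * g (a + k) := by
          refine Finset.sum_congr rfl fun k _ => ?_
          rw [hg]
          congr 2
          ext j
          rcases eq_or_ne j i with rfl | hji
          · simp
          · simp [hji]
        rw [← h5]
        refine h4.trans ?_
        nlinarith
      have h4 := abs_le_of_abs_sum_choose_le h2 h3 R le_rfl (z i)
        (abs_le.1 (hz i (by simp))).1
      have h5 := h4 (by have := (abs_le.1 (hz i (by simp))).2; omega)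
      rw [hg] at h5
      simp only [Function.update_eq_self] at h5
      rwa [mul_assoc]
  obtain ⟨C, hC, h⟩ := key Finset.univ
  refine ⟨C, hC, fun F z hz => ?_⟩
  refine h (fun y => F y - lagrangeInterp l F y) _ ?_ (fun ν => ?_) (fun i y hy => ?_) z
    (fun i _ => mem_nbrs.1 hz i) (by simp)
  · exact Finset.sum_nonneg fun _ _ => Finset.sum_nonneg fun _ _ => abs_nonneg _
  · rw [lagrangeInterp_node, sub_self, abs_zero]
    exact Finset.sum_nonneg fun _ _ => Finset.sum_nonneg fun _ _ => abs_nonneg _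
  · have : diffOp l (Pi.single i 1) (fun y => F y - lagrangeInterp l F y) (fun i => (y i : ℝ)) =
        diffOp l (Pi.single i 1) F fun i => (y i : ℝ) := by
      have h1 := diffOp_single_of_mem (lagrangeInterp_mem l F) i fun i => (y i : ℝ)
      rw [← sub_zero (diffOp l (Pi.single i 1) F _), ← h1]
      simp [diffOp, mul_sub, Finset.sum_sub_distrib]
    rw [this]
    refine le_trans ?_ (Finset.single_le_sum (f := fun i => ∑ y ∈ nbrs n (R + l),
      |diffOp l (Pi.single i 1) F fun i => (y i : ℝ)|)
      (fun _ _ => Finset.sum_nonneg fun _ _ => abs_nonneg _) (Finset.mem_univ i))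
    exact Finset.single_le_sum (f := fun y : Fin n → ℤ =>
      |diffOp l (Pi.single i 1) F fun i => (y i : ℝ)|) (fun _ _ => abs_nonneg _) hy

theorem continuous_of_mem_polySpace {P : (Fin n → ℝ) → ℝ} (hP : P ∈ polySpace n l) :
    Continuous P := by
  induction hP using Submodule.span_induction with
  | mem P h =>
    obtain ⟨q, hq, rfl⟩ := h
    exact continuous_finsetProd _ fun i _ => (q i).continuous.comp (continuous_apply i)
  | zero => exact continuous_zero
  | add P Q _ _ hP hQ => exact hP.add hQ
  | smul a P _ hP => exact hP.const_smul a

theorem mem_dyadicCubeIco_zero {k : ℕ} {x : Fin n → ℝ} :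
    x ∈ dyadicCubeIco k 0 ↔ ∀ i, 0 ≤ x i ∧ x i < ((2 : ℝ) ^ k)⁻¹ := by
  simp [dyadicCubeIco]

/-- The polynomial is recovered by interpolation from its values at the shifted nodes `a + 2⁻ˡ ν`,
which all lie in the unit cube for `a` in the cube of side `2⁻ˡ`. Averaging over `a` gives the
bound, for `r < 1` as well. -/
theorem exists_enorm_le_eLpNorm_of_mem_polySpace (n l R : ℕ) {r : ℝ≥0∞} (hr : r ≠ 0) :
    ∃ C : ℝ≥0∞, C ≠ ∞ ∧ ∀ P ∈ polySpace n l, ∀ y : Fin n → ℝ, (∀ i, |y i| ≤ R) →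
      ‖P y‖ₑ ≤ C * eLpNorm P r (volume.restrict (dyadicCubeIco 0 0)) := by
  obtain ⟨D, hD, hw⟩ := exists_abs_nodeWeight_le n l (2 ^ l * R + 1)
  obtain ⟨C, hC, hS⟩ := exists_eLpNorm_sum_le (ι := Fin n → Fin l) hr
  refine ⟨scale r n l * (ENNReal.ofReal D * (C * (l ^ n : ℕ))),
    by have := scale_ne_top r n l; finiteness, fun P hP y hy => ?_⟩
  have hPm : Measurable P := (continuous_of_mem_polySpace hP).measurable
  set pt : (Fin n → Fin l) → Fin n → ℝ := fun ν i => ((2 : ℝ) ^ l)⁻¹ * (ν i : ℝ) with hpt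
  have hpow : (0 : ℝ) < 2 ^ l := by positivity
  have h1 : ∀ a ∈ dyadicCubeIco l (0 : Fin n → ℤ),
      ‖P y‖ₑ ≤ ENNReal.ofReal D * ∑ ν : Fin n → Fin l, ‖P (a + pt ν)‖ₑ := by
    intro a ha
    rw [mem_dyadicCubeIco_zero] at ha
    have h2 := congrFun (lagrangeInterp_of_mem (comp_affine_mem_polySpace hP ((2 : ℝ) ^ l)⁻¹ a))
      ((2 : ℝ) ^ l • (y - a))
    rw [smul_smul, inv_mul_cancel₀ hpow.ne', one_smul, add_sub_cancel] at h2
    rw [← h2, lagrangeInterp, Finset.mul_sum]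
    refine (enorm_sum_le _ _).trans (Finset.sum_le_sum fun ν _ => ?_)
    rw [enorm_mul, mul_comm]
    refine mul_le_mul' ?_ le_rfl
    rw [Real.enorm_eq_ofReal_abs]
    refine ENNReal.ofReal_le_ofReal (hw ν _ fun i => ?_)
    have h3 := hy i
    have h4 := ha i
    simp only [Pi.smul_apply, Pi.sub_apply, smul_eq_mul]
    rw [abs_mul, abs_of_pos hpow]
    have h5 : |y i - a i| ≤ R + ((2 : ℝ) ^ l)⁻¹ :=
      (abs_sub _ _).trans (add_le_add h3 (by rw [abs_of_nonneg h4.1]; exact h4.2.le))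
    calc _ ≤ (2 : ℝ) ^ l * (R + ((2 : ℝ) ^ l)⁻¹) := by gcongr
      _ = _ := by field_simp
  have h6 : ∀ ν : Fin n → Fin l, eLpNorm (fun a => ‖P (a + pt ν)‖ₑ) r
      (volume.restrict (dyadicCubeIco l 0)) ≤ eLpNorm P r (volume.restrict (dyadicCubeIco 0 0)) := by
    intro ν
    rw [eLpNorm_enorm, ← eLpNorm_translate P r (pt ν)]
    refine eLpNorm_mono_measure _ (Measure.restrict_mono (fun a ha => ?_) le_rfl)
    rw [mem_dyadicCubeIco_zero] at ha
    rw [Set.mem_preimage, mem_dyadicCubeIco_zero]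
    intro i
    have h7 : ((ν i : ℕ) : ℝ) + 1 ≤ 2 ^ l := by
      exact_mod_cast (show (ν i : ℕ) + 1 ≤ l from (ν i).2).trans Nat.lt_two_pow_self.le
    have h8 := ha i
    simp only [Pi.add_apply, hpt, pow_zero, inv_one]
    refine ⟨add_nonneg h8.1 (by positivity), ?_⟩
    calc _ < ((2 : ℝ) ^ l)⁻¹ + ((2 : ℝ) ^ l)⁻¹ * (ν i : ℝ) := by linarith [h8.2]
      _ = ((2 : ℝ) ^ l)⁻¹ * ((ν i : ℝ) + 1) := by ring
      _ ≤ ((2 : ℝ) ^ l)⁻¹ * 2 ^ l := by gcongr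
      _ = 1 := inv_mul_cancel₀ hpow.ne'
  have h9 : ‖P y‖ₑ * (scale r n l)⁻¹ ≤ ENNReal.ofReal D * (C * ((l ^ n : ℕ) *
      eLpNorm P r (volume.restrict (dyadicCubeIco 0 0)))) := by
    rw [← eLpNorm_const_dyadicCubeIco hr _ l 0]
    refine (eLpNorm_le_mul_eLpNorm (c := ENNReal.ofReal D) (by finiteness)
      (g' := fun a => ∑ ν : Fin n → Fin l, ‖P (a + pt ν)‖ₑ) ?_).trans
      (mul_le_mul' le_rfl ((hS _ _ fun ν => ?_).trans (mul_le_mul' le_rfl ?_)))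
    · filter_upwards [ae_restrict_mem (measurableSet_dyadicCubeIco l 0)] with a ha
      simpa using h1 a ha
    · exact (hPm.comp (measurable_id.add_const _)).enorm.aemeasurable
    · refine (Finset.sum_le_sum fun ν _ => h6 ν).trans (le_of_eq ?_)
      simp
  calc ‖P y‖ₑ = scale r n l * (‖P y‖ₑ * (scale r n l)⁻¹) := by
        rw [mul_left_comm, ENNReal.mul_inv_cancel (scale_ne_zero _ _ _) (scale_ne_top _ _ _),
          mul_one]
    _ ≤ scale r n l * _ := mul_le_mul' le_rfl h9
    _ = _ := by ring

end Lagrange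

/-! ### Rescaling of dyadic cubes -/

section Rescale

variable {n l : ℕ}

/-- The affine map that takes the unit cube to the dyadic cube with index `(k, m)`. -/
noncomputable def dyadicMap (k : ℕ) (m : Fin n → ℤ) (x : Fin n → ℝ) : Fin n → ℝ :=
  (fun i => (m i : ℝ) / 2 ^ k) + ((2 : ℝ) ^ k)⁻¹ • x

theorem cellIndex_dyadicMap (k j : ℕ) (m : Fin n → ℤ) (x : Fin n → ℝ) :
    cellIndex (k + j) (dyadicMap k m x) = fun i => 2 ^ j * m i + cellIndex j x i := by
  ext i
  have : (2 : ℝ) ^ (k + j) * dyadicMap k m x i = 2 ^ j * x i + ((2 ^ j * m i : ℤ) : ℝ) := by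
    simp only [dyadicMap, Pi.add_apply, Pi.smul_apply, smul_eq_mul, pow_add]
    push_cast
    field_simp
    ring
  rw [cellIndex, this, Int.floor_add_intCast, cellIndex, add_comm]

theorem eLpNorm_comp_dyadicMap {E : Type*} [TopologicalSpace E] [ContinuousENorm E]
    (g : (Fin n → ℝ) → E) (r : ℝ≥0∞) (k : ℕ) (m ν : Fin n → ℤ) :
    eLpNorm (fun x => g (dyadicMap k m x)) r (volume.restrict (dyadicCubeIco 0 ν)) =
      scale r n k * eLpNorm g r (volume.restrict (dyadicCubeIco k (m + ν))) := by
  have h := eLpNorm_comp_affine (a := ((2 : ℝ) ^ k)⁻¹) (by positivity)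
    (fun i => (m i : ℝ) / 2 ^ k) g r (dyadicCubeIco k (m + ν))
  have h1 : (fun s : Fin n → ℝ => (fun i => (m i : ℝ) / 2 ^ k) + ((2 : ℝ) ^ k)⁻¹ • s) ⁻¹'
      dyadicCubeIco k (m + ν) = dyadicCubeIco 0 ν := by
    ext x
    have := cellIndex_dyadicMap k 0 m x
    simp only [add_zero, pow_zero, one_mul] at this
    change dyadicMap k m x ∈ dyadicCubeIco k (m + ν) ↔ _
    rw [mem_dyadicCubeIco, mem_dyadicCubeIco, this]
    constructor
    · intro h
      ext i
      simpa using congrFun h i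
    · rintro rfl
      rfl
  have h2 : ENNReal.ofReal ((((2 : ℝ) ^ k)⁻¹) ^ n)⁻¹ ^ (r⁻¹).toReal = scale r n k := by
    rw [scale, inv_pow, inv_inv, ← pow_mul, ENNReal.ofReal_pow (by norm_num)]
    norm_num
  rw [h1, h2] at h
  exact h

theorem comp_dyadicMap_mem {P : (Fin n → ℝ) → ℝ} (hP : P ∈ polySpace n l) (k : ℕ)
    (m : Fin n → ℤ) : (fun x => P (dyadicMap k m x)) ∈ polySpace n l :=
  comp_affine_mem_polySpace hP _ _

theorem exists_dyadicMap_eq (k : ℕ) (m : Fin n → ℤ) (y : Fin n → ℝ) :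
    dyadicMap k m ((2 : ℝ) ^ k • y - fun i => (m i : ℝ)) = y := by
  ext i
  simp only [dyadicMap, Pi.add_apply, Pi.smul_apply, Pi.sub_apply, smul_eq_mul]
  field_simp
  ring

theorem exists_comp_dyadicMap_eq {P : (Fin n → ℝ) → ℝ} (hP : P ∈ polySpace n l) (k : ℕ)
    (m : Fin n → ℤ) : ∃ Q ∈ polySpace n l, ∀ x, Q (dyadicMap k m x) = P x := by
  refine ⟨fun y => P ((fun i => -(m i : ℝ)) + (2 : ℝ) ^ k • y),
    comp_affine_mem_polySpace hP _ _, fun x => ?_⟩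
  simp only
  congr 1
  ext i
  simp only [dyadicMap, Pi.add_apply, Pi.smul_apply, smul_eq_mul]
  field_simp
  ring

theorem exists_enorm_le_scale_mul_eLpNorm (n l R : ℕ) {r : ℝ≥0∞} (hr : r ≠ 0) :
    ∃ C : ℝ≥0∞, C ≠ ∞ ∧ ∀ P ∈ polySpace n l, ∀ k (m : Fin n → ℤ) (y : Fin n → ℝ),
      (∀ i, |(2 : ℝ) ^ k * y i - m i| ≤ R) →
      ‖P y‖ₑ ≤ C * (scale r n k * eLpNorm P r (volume.restrict (dyadicCubeIco k m))) := by
  obtain ⟨C, hC, h⟩ := exists_enorm_le_eLpNorm_of_mem_polySpace n l R hr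
  refine ⟨C, hC, fun P hP k m y hy => ?_⟩
  have h1 := h _ (comp_dyadicMap_mem hP k m) ((2 : ℝ) ^ k • y - fun i => (m i : ℝ)) hy
  rwa [exists_dyadicMap_eq, eLpNorm_comp_dyadicMap, add_zero] at h1

end Rescale

/-! ### Sampling on randomly shifted lattices -/

section Shear

variable {n : ℕ}

/-- The cube `[-R, R + 1)ⁿ`, a union of unit cubes. -/
def unitBox (n R : ℕ) : Set (Fin n → ℝ) := ⋃ ν : nbrs n R, dyadicCubeIco 0 (ν : Fin n → ℤ)

theorem mem_unitBox {R : ℕ} {x : Fin n → ℝ} : x ∈ unitBox n R ↔ ∀ i, -(R : ℝ) ≤ x i ∧ x i < R + 1 := by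
  have h1 : x ∈ unitBox n R ↔ cellIndex 0 x ∈ nbrs n R := by
    simp only [unitBox, Set.mem_iUnion, mem_dyadicCubeIco]
    exact ⟨fun ⟨ν, hν⟩ => hν ▸ ν.2, fun h => ⟨⟨_, h⟩, rfl⟩⟩
  rw [h1, mem_nbrs]
  refine forall_congr' fun i => ?_
  rw [abs_le, Int.le_iff_lt_add_one (b := (R : ℤ)), cellIndex, Int.le_floor, Int.floor_lt]
  simp

theorem measurableSet_unitBox (n R : ℕ) : MeasurableSet (unitBox n R) :=
  MeasurableSet.iUnion fun _ => measurableSet_dyadicCubeIco _ _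

theorem volume_unitBox_ne_top (n R : ℕ) : volume (unitBox n R) ≠ ∞ := by
  have : unitBox n R ⊆ Set.Icc (fun _ => -(R : ℝ)) (fun _ => (R : ℝ) + 1) := fun x hx =>
    ⟨fun i => (mem_unitBox.1 hx i).1, fun i => (mem_unitBox.1 hx i).2.le⟩
  exact ((measure_mono this).trans_lt isCompact_Icc.measure_lt_top).ne

theorem unitBox_zero (n : ℕ) : unitBox n 0 = dyadicCubeIco 0 0 := by
  ext x
  rw [mem_unitBox, mem_dyadicCubeIco_zero]
  simp

theorem abs_sub_le_of_mem_unitBox {R : ℕ} {x a : Fin n → ℝ} (hx : x ∈ unitBox n R)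
    (ha : a ∈ unitBox n 0) (i : Fin n) : |x i - a i| ≤ R + 1 := by
  have h1 := mem_unitBox.1 hx i
  have h2 := mem_unitBox.1 ha i
  norm_num at h2
  rw [abs_le]
  constructor <;> linarith

theorem add_mem_unitBox {R : ℕ} {a c : Fin n → ℝ} (ha : a ∈ unitBox n 0) (hc : ∀ i, |c i| ≤ R) :
    a + c ∈ unitBox n R := by
  refine mem_unitBox.2 fun i => ?_
  have h2 := mem_unitBox.1 ha i
  have h3 := abs_le.1 (hc i)
  norm_num at h2
  rw [Pi.add_apply]
  constructor <;> linarith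

/-- The map `(x, a) ↦ (a, x - a)` preserves measure. For a fixed value of `x - a` the point at which
`g` is evaluated is a translate of `a`, so nothing but measurability and boundedness is required of
`c`. -/
theorem exists_eLpNorm_shear_le (n R R' : ℕ) {r : ℝ≥0∞} (hr : r ≠ 0) : ∃ C : ℝ≥0∞, C ≠ ∞ ∧
    ∀ (g : (Fin n → ℝ) → ℝ≥0∞) (c : (Fin n → ℝ) → Fin n → ℝ), Measurable g → Measurable c →
      (∀ b, (∀ i, |b i| ≤ (R + 2 : ℝ)) → ∀ i, |c b i| ≤ (R' : ℝ)) →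
      eLpNorm (fun z : (Fin n → ℝ) × (Fin n → ℝ) => g (z.2 + c (z.1 - z.2))) r
        ((volume.restrict (unitBox n R)).prod (volume.restrict (unitBox n 0))) ≤
        C * eLpNorm g r (volume.restrict (unitBox n R')) := by
  refine ⟨volume (unitBox n (R + 1)) ^ (r⁻¹).toReal,
    ENNReal.rpow_ne_top_of_nonneg (by positivity) (volume_unitBox_ne_top _ _),
    fun g c hg hc hcb => ?_⟩
  set G : (Fin n → ℝ) × (Fin n → ℝ) → ℝ≥0∞ := fun w => g (w.1 + c w.2) with hG
  have hGm : Measurable G := hg.comp (measurable_fst.add (hc.comp measurable_snd))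
  have hS := (measurePreserving_prod_sub_swap (volume : Measure (Fin n → ℝ))
    (volume : Measure (Fin n → ℝ))).restrict_preimage
    ((measurableSet_unitBox n 0).prod (measurableSet_unitBox n (R + 1)))
  have hsub : unitBox n R ×ˢ unitBox n 0 ⊆ (fun z : (Fin n → ℝ) × (Fin n → ℝ) =>
      (z.2, z.1 - z.2)) ⁻¹' (unitBox n 0 ×ˢ unitBox n (R + 1)) := by
    rintro ⟨x, a⟩ ⟨hx, ha⟩
    refine ⟨ha, mem_unitBox.2 fun i => ?_⟩
    have := abs_le.1 (abs_sub_le_of_mem_unitBox hx ha i)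
    simp only [Pi.sub_apply]
    push_cast
    constructor <;> linarith
  calc _ ≤ eLpNorm (fun z : (Fin n → ℝ) × (Fin n → ℝ) => G (z.2, z.1 - z.2)) r
        ((volume.prod volume).restrict ((fun z : (Fin n → ℝ) × (Fin n → ℝ) =>
          (z.2, z.1 - z.2)) ⁻¹' (unitBox n 0 ×ˢ unitBox n (R + 1)))) := by
        rw [Measure.prod_restrict]
        exact eLpNorm_mono_measure _ (Measure.restrict_mono hsub le_rfl)
    _ = eLpNorm G r ((volume.restrict (unitBox n 0)).prod
          (volume.restrict (unitBox n (R + 1)))) := by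
        rw [Measure.prod_restrict]
        exact eLpNorm_comp_measurePreserving (g := G) hGm.aestronglyMeasurable hS
    _ ≤ eLpNorm g r (volume.restrict (unitBox n R')) *
          (volume.restrict (unitBox n (R + 1))) Set.univ ^ (r⁻¹).toReal := by
        refine eLpNorm_prod_le_of_forall hr hGm ?_
        filter_upwards [ae_restrict_mem (measurableSet_unitBox n (R + 1))] with b hb
        have hb' : ∀ i, |b i| ≤ (R + 2 : ℝ) := fun i => by
          have := mem_unitBox.1 hb i
          push_cast at this
          rw [abs_le]
          constructor <;> linarith
        have hcb' := hcb b hb'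
        rw [← eLpNorm_translate g r (c b)]
        refine eLpNorm_mono_measure _ (Measure.restrict_mono (fun a ha => ?_) le_rfl)
        exact add_mem_unitBox ha hcb'
    _ = _ := by rw [Measure.restrict_apply_univ, mul_comm]

theorem tendsto_zero_of_forall_le {X : ℕ → ℝ≥0∞} {M : ℝ≥0∞} (hM : M ≠ ∞)
    (h : ∀ ε : ℝ, 0 < ε → ∀ᶠ j in atTop, X j ≤ M * ENNReal.ofReal ε) : Tendsto X atTop (𝓝 0) := by
  rw [ENNReal.tendsto_nhds_zero]
  intro e he
  have h1 : Tendsto (fun ε : ℝ => M * ENNReal.ofReal ε) (𝓝[>] 0) (𝓝 (M * ENNReal.ofReal 0)) :=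
    ENNReal.Tendsto.const_mul ((ENNReal.continuous_ofReal.tendsto 0).mono_left
      nhdsWithin_le_nhds) (Or.inr hM)
  rw [ENNReal.ofReal_zero, mul_zero] at h1
  obtain ⟨ε, hε, hε0⟩ := ((ENNReal.tendsto_nhds_zero.1 h1 e he).and self_mem_nhdsWithin).exists
  exact (h ε hε0).mono fun j hj => hj.trans hε

/-- Values of a measurable function at randomly shifted points that approach `x` converge to the
value at `x`, along a subsequence. -/
theorem exists_seq_ae_tendsto_shear {ι : Type} [Fintype ι] {f : (Fin n → ℝ) → ℝ} (hf : Measurable f)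
    {R R' : ℕ} (hRR : R + 2 ≤ R') {c : ℕ → ι → (Fin n → ℝ) → Fin n → ℝ}
    (hc : ∀ j ν, Measurable (c j ν))
    (hcb : ∀ j ν b, (∀ i, |b i| ≤ (R + 2 : ℝ)) → ∀ i, |c j ν b i| ≤ (R' : ℝ))
    (hclim : ∀ δ : ℝ, 0 < δ → ∀ᶠ j in atTop, ∀ ν b, dist (c j ν b) b < δ) :
    ∃ ns : ℕ → ℕ, StrictMono ns ∧
      ∀ᵐ z ∂(((volume : Measure (Fin n → ℝ)).restrict (unitBox n R)).prod
        ((volume : Measure (Fin n → ℝ)).restrict (unitBox n 0))),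
        ∀ ν, Tendsto (fun i => f (z.2 + c (ns i) ν (z.1 - z.2))) atTop (𝓝 (f z.1)) := by
  obtain ⟨C, hC, hshear⟩ := exists_eLpNorm_shear_le n R R' one_ne_zero
  set π := ((volume : Measure (Fin n → ℝ)).restrict (unitBox n R)).prod
        ((volume : Measure (Fin n → ℝ)).restrict (unitBox n 0)) with hπ
  have hπfin : π Set.univ ≠ ∞ := by
    rw [hπ, Measure.prod_restrict, Measure.restrict_apply_univ, Measure.prod_prod]
    exact ENNReal.mul_ne_top (volume_unitBox_ne_top _ _) (volume_unitBox_ne_top _ _)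
  have : IsFiniteMeasure π := ⟨lt_top_iff_ne_top.2 hπfin⟩
  have hπmem : ∀ᵐ z ∂π, z.1 ∈ unitBox n R ∧ z.2 ∈ unitBox n 0 := by
    rw [hπ, Measure.prod_restrict]
    exact ae_restrict_mem ((measurableSet_unitBox n R).prod (measurableSet_unitBox n 0))
  -- The arctangent makes the function bounded, hence integrable on boxes, so convergence can be
  -- proved in `L_1` although `f` is only measurable.
  set h : (Fin n → ℝ) → ℝ := fun x => Real.arctan (f x) with hh
  have hhm : Measurable h := Real.measurable_arctan.comp hf
  set hU := (unitBox n R').indicator h with hhU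
  have hUm : Measurable hU := hhm.indicator (measurableSet_unitBox _ _)
  have hUL : MemLp hU 1 volume := by
    rw [hhU, memLp_indicator_iff_restrict (measurableSet_unitBox _ _)]
    have : IsFiniteMeasure ((volume : Measure (Fin n → ℝ)).restrict (unitBox n R')) :=
      ⟨by rw [Measure.restrict_apply_univ]; exact lt_top_iff_ne_top.2 (volume_unitBox_ne_top _ _)⟩
    refine MemLp.of_bound hhm.aestronglyMeasurable (Real.pi / 2) (ae_of_all _ fun x => ?_)
    rw [Real.norm_eq_abs, abs_le]
    exact ⟨(Real.neg_pi_div_two_lt_arctan _).le, (Real.arctan_lt_pi_div_two _).le⟩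
  set pt : ℕ → ι → (Fin n → ℝ) × (Fin n → ℝ) → Fin n → ℝ := fun j ν z => z.2 + c j ν (z.1 - z.2)
    with hpt
  have hptm : ∀ j ν, Measurable (pt j ν) := fun j ν =>
    measurable_snd.add ((hc j ν).comp (measurable_fst.sub measurable_snd))
  set Ψ : ℕ → (Fin n → ℝ) × (Fin n → ℝ) → ℝ := fun j z => ∑ ν, |h (pt j ν z) - h z.1| with hΨ
  have hΨm : ∀ j, Measurable (Ψ j) := fun j => Finset.measurable_sum _ fun ν _ =>
    ((hhm.comp (hptm j ν)).sub (hhm.comp measurable_fst)).abs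
  have hΨlim : Tendsto (fun j => eLpNorm (Ψ j) 1 π) atTop (𝓝 0) := by
    refine tendsto_zero_of_forall_le (M := Fintype.card ι * (C + π Set.univ + C)) (by finiteness)
      fun ε hε => ?_
    -- For a uniformly continuous approximant the convergence is evident. The error of approximation
    -- at the shifted points is controlled by the shear estimate, uniformly in `j`.
    obtain ⟨φ, hφs, hφ, hφc, -⟩ := hUL.exists_hasCompactSupport_eLpNorm_sub_le ENNReal.one_ne_top
      (ε := ENNReal.ofReal ε) (by simpa using hε)
    obtain ⟨δ, hδ, hunif⟩ := Metric.uniformContinuous_iff.1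
      (hφs.uniformContinuous_of_continuous hφc) ε hε
    set g : (Fin n → ℝ) → ℝ≥0∞ := fun x => ‖hU x - φ x‖ₑ with hg
    have hgm : Measurable g := (hUm.sub hφc.measurable).enorm
    have hgn : eLpNorm g 1 (volume.restrict (unitBox n R')) ≤ ENNReal.ofReal ε := by
      refine (eLpNorm_mono_measure _ Measure.restrict_le_self).trans ?_
      rw [hg, eLpNorm_enorm]
      exact hφ
    filter_upwards [hclim δ hδ] with j hj
    have hν : ∀ ν, eLpNorm (fun z => |h (pt j ν z) - h z.1|) 1 π ≤
        (C + π Set.univ + C) * ENNReal.ofReal ε := by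
      intro ν
      have h1 := hshear g (c j ν) hgm (hc j ν) (hcb j ν)
      have h2 := hshear g id hgm measurable_id fun b hb i => (hb i).trans (by exact_mod_cast hRR)
      simp only [id, add_sub_cancel] at h2
      calc _ ≤ eLpNorm (fun z => g (pt j ν z) + ENNReal.ofReal ε + g z.1) 1 π := by
            refine eLpNorm_mono_enorm_ae ?_
            filter_upwards [hπmem] with z hz
            have hb : ∀ i, |(z.1 - z.2) i| ≤ (R + 2 : ℝ) := fun i =>
              (abs_sub_le_of_mem_unitBox hz.1 hz.2 i).trans (by linarith)
            have e1 : hU (pt j ν z) = h (pt j ν z) :=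
              Set.indicator_of_mem (add_mem_unitBox hz.2 (hcb j ν _ hb)) _
            have e2 : hU z.1 = h z.1 := by
              refine Set.indicator_of_mem (mem_unitBox.2 fun i => ?_) _
              have := mem_unitBox.1 hz.1 i
              have : (R : ℝ) + 2 ≤ R' := by exact_mod_cast hRR
              constructor <;> linarith
            have e3 : dist (φ (pt j ν z)) (φ z.1) < ε := by
              refine hunif ?_
              have := hj ν (z.1 - z.2)
              rw [dist_eq_norm] at this ⊢
              rwa [hpt, show z.2 + c j ν (z.1 - z.2) - z.1 = c j ν (z.1 - z.2) - (z.1 - z.2) by abel]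
            rw [Real.enorm_eq_ofReal_abs, abs_abs, ← Real.enorm_eq_ofReal_abs, enorm_eq_self, ← e1, ← e2,
              show hU (pt j ν z) - hU z.1 = (hU (pt j ν z) - φ (pt j ν z)) +
                (φ (pt j ν z) - φ z.1) + -(hU z.1 - φ z.1) by ring]
            refine (enorm_add_le _ _).trans (add_le_add ((enorm_add_le _ _).trans
              (add_le_add le_rfl ?_)) (by rw [enorm_neg]))
            rw [Real.enorm_eq_ofReal_abs, ← Real.dist_eq]
            exact ENNReal.ofReal_le_ofReal e3.le
        _ = eLpNorm (fun z => g (pt j ν z)) 1 π + ENNReal.ofReal ε * π Set.univ +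
              eLpNorm (fun z => g z.1) 1 π := by
            simp only [eLpNorm_one_eq_lintegral_enorm, enorm_eq_self]
            rw [lintegral_add_left, lintegral_add_left, lintegral_const]
            · exact hgm.comp (hptm j ν)
            · exact (hgm.comp (hptm j ν)).add_const _
        _ ≤ C * ENNReal.ofReal ε + ENNReal.ofReal ε * π Set.univ + C * ENNReal.ofReal ε := by
            gcongr
            · exact h1.trans (mul_le_mul' le_rfl hgn)
            · exact h2.trans (mul_le_mul' le_rfl hgn)
        _ = _ := by ring
    calc _ ≤ ∑ ν, eLpNorm (fun z => |h (pt j ν z) - h z.1|) 1 π := by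
          simp only [eLpNorm_one_eq_lintegral_enorm]
          have hm : ∀ ν, Measurable fun z => ‖|h (pt j ν z) - h z.1|‖ₑ := fun ν =>
            (((hhm.comp (hptm j ν)).sub (hhm.comp measurable_fst)).abs).enorm
          rw [← lintegral_finsetSum _ fun ν _ => hm ν]
          exact lintegral_mono fun z => enorm_sum_le _ _
      _ ≤ ∑ _ν : ι, (C + π Set.univ + C) * ENNReal.ofReal ε := Finset.sum_le_sum fun ν _ => hν ν
      _ = _ := by rw [Finset.sum_const, Finset.card_univ, nsmul_eq_mul]; ring
  have hmeas : TendstoInMeasure π Ψ atTop (fun _ => (0 : ℝ)) :=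
    tendstoInMeasure_of_tendsto_eLpNorm one_ne_zero (fun j => (hΨm j).aestronglyMeasurable)
      aestronglyMeasurable_const (by
        have : ∀ j, Ψ j - (fun _ => (0 : ℝ)) = Ψ j := fun j => by ext z; simp
        simpa only [this] using hΨlim)
  obtain ⟨ns, hns, hlim⟩ := hmeas.exists_seq_tendsto_ae
  refine ⟨ns, hns, hlim.mono fun z hz ν => ?_⟩
  have h1 : Tendsto (fun i => |h (pt (ns i) ν z) - h z.1|) atTop (𝓝 0) :=
    tendsto_of_tendsto_of_tendsto_of_le_of_le tendsto_const_nhds hz (fun _ => abs_nonneg _)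
      fun i => Finset.single_le_sum (f := fun ν => |h (pt (ns i) ν z) - h z.1|)
        (fun _ _ => abs_nonneg _) (Finset.mem_univ ν)
  have h2 : Tendsto (fun i => h (pt (ns i) ν z)) atTop (𝓝 (h z.1)) := by
    rw [tendsto_iff_norm_sub_tendsto_zero]
    exact h1
  have h3 := ((Real.continuousAt_tan.2 (Real.cos_arctan_pos (f z.1)).ne').tendsto).comp h2
  simpa [hh, Function.comp_def, Real.tan_arctan] using h3

end Shear

/-! ### Whitney's estimate by multiscale interpolation -/

section Whitney

variable {n l : ℕ}

theorem sum_nbrs_add_le {M : Type*} [AddCommMonoid M] [PartialOrder M] [IsOrderedAddMonoid M]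
    {R S R' : ℕ} {z : Fin n → ℤ} (hz : ∀ i, |z i| ≤ S) (hR : R + S ≤ R') {g : (Fin n → ℤ) → M}
    (hg : ∀ y, 0 ≤ g y) : ∑ y ∈ nbrs n R, g (y + z) ≤ ∑ y ∈ nbrs n R', g y := by
  rw [← Finset.sum_image (f := g) (g := fun y => y + z) fun y _ y' _ hy => add_left_injective z hy]
  refine Finset.sum_le_sum_of_subset_of_nonneg (fun y hy => ?_) fun _ _ _ => hg _
  obtain ⟨y', hy', rfl⟩ := Finset.mem_image.1 hy
  refine mem_nbrs.2 fun i => ?_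
  have h2 := mem_nbrs.1 hy' i
  have h3 := abs_add_le (y' i) (z i)
  have h4 := hz i
  have h5 : (R : ℤ) + S ≤ R' := by exact_mod_cast hR
  rw [Pi.add_apply]
  linarith

/-- Interpolation of `F` on a coarser lattice agrees with interpolation on the integer lattice up to
differences of `F` at integer points. -/
theorem exists_abs_lagrangeInterp_sub_le (n R s : ℕ) (hl : 0 < l) : ∃ K : ℝ, 0 < K ∧
    ∀ (F : (Fin n → ℝ) → ℝ) (c : Fin n → ℤ) (u : Fin n → ℝ), (∀ i, |c i| + s * l ≤ R) →
      (∀ i, |u i| ≤ 1) →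
      |lagrangeInterp l (fun y => F ((fun i => (c i : ℝ)) + (s : ℝ) • y)) u -
        lagrangeInterp l F ((fun i => (c i : ℝ)) + (s : ℝ) • u)| ≤
        K * ∑ i, ∑ y ∈ nbrs n (R + l), |diffOp l (Pi.single i 1) F fun i => (y i : ℝ)| := by
  obtain ⟨C, hC, h⟩ := exists_abs_sub_lagrangeInterp_le n R hl
  obtain ⟨D, hD, hw⟩ := exists_abs_nodeWeight_le n l 1
  refine ⟨(Fintype.card (Fin n → Fin l) + 1) * (C * D), by positivity, fun F c u hc hu => ?_⟩
  set S := ∑ i, ∑ y ∈ nbrs n (R + l), |diffOp l (Pi.single i 1) F fun i => (y i : ℝ)| with hS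
  have hS0 : 0 ≤ S := Finset.sum_nonneg fun _ _ => Finset.sum_nonneg fun _ _ => abs_nonneg _
  have h1 := congrFun (lagrangeInterp_of_mem (comp_affine_mem_polySpace (lagrangeInterp_mem l F)
    (s : ℝ) fun i => (c i : ℝ))) u
  rw [← h1, ← lagrangeInterp_sub, lagrangeInterp]
  refine (Finset.abs_sum_le_sum_abs _ _).trans ?_
  have h2 : ∀ ν : Fin n → Fin l, |(F ((fun i => (c i : ℝ)) + (s : ℝ) • fun i => ((ν i : ℕ) : ℝ)) -
      lagrangeInterp l F ((fun i => (c i : ℝ)) + (s : ℝ) • fun i => ((ν i : ℕ) : ℝ))) *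
        nodeWeight l ν u| ≤ (C * D) * S := by
    intro ν
    have h3 : (fun i => (c i : ℝ)) + (s : ℝ) • (fun i => ((ν i : ℕ) : ℝ)) =
        fun i => ((c i + s * (ν i : ℕ) : ℤ) : ℝ) := by
      ext i; simp
    have h4 := h F (fun i => c i + s * (ν i : ℕ)) (mem_nbrs.2 fun i => ?_)
    · rw [h3, abs_mul, mul_right_comm]
      exact mul_le_mul h4 (hw ν u hu) (abs_nonneg _) (by positivity)
    · have h5 := hc i
      have h6 : (s : ℤ) * (ν i : ℕ) ≤ s * l := by
        gcongr
        exact (ν i).2.le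
      have h7 : (0 : ℤ) ≤ s * (ν i : ℕ) := by positivity
      calc |c i + s * (ν i : ℕ)| ≤ |c i| + |(s : ℤ) * (ν i : ℕ)| := abs_add_le _ _
        _ ≤ R := by rw [abs_of_nonneg h7]; linarith
  calc _ ≤ ∑ _ν : Fin n → Fin l, (C * D) * S := Finset.sum_le_sum fun ν _ => h2 ν
    _ = Fintype.card (Fin n → Fin l) * ((C * D) * S) := by
        rw [Finset.sum_const, Finset.card_univ, nsmul_eq_mul]
    _ ≤ (Fintype.card (Fin n → Fin l) + 1) * ((C * D) * S) := by gcongr; linarith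
    _ = _ := by ring

/-- The point `a + 2⁻ʲ (z + y)` where `2⁻ʲ z` is the lattice point next to `x - a`. -/
noncomputable def latticePoint (j : ℕ) (a x y : Fin n → ℝ) : Fin n → ℝ :=
  a + ((2 : ℝ) ^ j)⁻¹ • ((fun i => (cellIndex j (x - a) i : ℝ)) + y)

/-- The value at `x` of the polynomial that interpolates `f` near `x` on the lattice `a + 2⁻ʲ ℤⁿ`. -/
noncomputable def latticeInterp (l j : ℕ) (f : (Fin n → ℝ) → ℝ) (a x : Fin n → ℝ) : ℝ :=
  lagrangeInterp l (fun y => f (latticePoint j a x y))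
    ((2 : ℝ) ^ j • (x - a) - fun i => (cellIndex j (x - a) i : ℝ))

/-- The size of the differences of `f` along the lattice `a + 2⁻ʲ ℤⁿ` near `x`. -/
noncomputable def latticeDiff (l R j : ℕ) (f : (Fin n → ℝ) → ℝ) (a x : Fin n → ℝ) : ℝ :=
  ∑ i, ∑ y ∈ nbrs n R,
    |diffOp l (((2 : ℝ) ^ j)⁻¹ • Pi.single i 1) f (latticePoint j a x fun i => (y i : ℝ))|

theorem abs_sub_cellIndex_le (j : ℕ) (b : Fin n → ℝ) (i : Fin n) :
    |((2 : ℝ) ^ j • b - fun i => (cellIndex j b i : ℝ)) i| ≤ 1 := by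
  have h1 := Int.floor_le ((2 : ℝ) ^ j * b i)
  have h2 := Int.lt_floor_add_one ((2 : ℝ) ^ j * b i)
  simp only [Pi.sub_apply, Pi.smul_apply, smul_eq_mul, cellIndex]
  rw [abs_le]
  constructor <;> linarith

theorem diffOp_comp_latticePoint (l j : ℕ) (f : (Fin n → ℝ) → ℝ) (a x h y : Fin n → ℝ) :
    diffOp l h (fun y => f (latticePoint j a x y)) y =
      diffOp l (((2 : ℝ) ^ j)⁻¹ • h) f (latticePoint j a x y) := by
  refine Finset.sum_congr rfl fun i _ => ?_
  have : latticePoint j a x (y + (i : ℝ) • h) =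
      latticePoint j a x y + (i : ℝ) • ((2 : ℝ) ^ j)⁻¹ • h := by
    simp only [latticePoint]
    module
  simp only [this]

theorem latticeDiff_nonneg (l R j : ℕ) (f : (Fin n → ℝ) → ℝ) (a x : Fin n → ℝ) :
    0 ≤ latticeDiff l R j f a x :=
  Finset.sum_nonneg fun _ _ => Finset.sum_nonneg fun _ _ => abs_nonneg _

theorem latticeDiff_mono {R R' : ℕ} (h : R ≤ R') (l j : ℕ) (f : (Fin n → ℝ) → ℝ)
    (a x : Fin n → ℝ) : latticeDiff l R j f a x ≤ latticeDiff l R' j f a x :=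
  Finset.sum_le_sum fun i _ => Finset.sum_le_sum_of_subset_of_nonneg
    (fun y hy => mem_nbrs.2 fun i => (mem_nbrs.1 hy i).trans (by exact_mod_cast h))
    fun _ _ _ => abs_nonneg _

/-- The lattice of level `j` is contained in that of level `j + 1`, so this is interpolation on a
sublattice with ratio `s = 2`. The corners of the two cells of `x` differ by at most one fine step
in each coordinate. -/
theorem exists_abs_latticeInterp_succ_sub_le (n : ℕ) (hl : 0 < l) : ∃ K : ℝ, 0 < K ∧
    ∀ (f : (Fin n → ℝ) → ℝ) (j : ℕ) (a x : Fin n → ℝ),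
      |latticeInterp l j f a x - latticeInterp l (j + 1) f a x| ≤
        K * latticeDiff l (3 * l + 1) (j + 1) f a x := by
  obtain ⟨K, hK, h⟩ := exists_abs_lagrangeInterp_sub_le (l := l) n (2 * l + 1) 2 hl
  refine ⟨K, hK, fun f j a x => ?_⟩
  set z := cellIndex j (x - a) with hz
  set z' := cellIndex (j + 1) (x - a) with hz'
  have h1 := h (fun y => f (latticePoint (j + 1) a x y)) (fun i => 2 * z i - z' i)
    ((2 : ℝ) ^ j • (x - a) - fun i => (z i : ℝ)) (fun i => ?_) (abs_sub_cellIndex_le j _)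
  · have e1 : ∀ y, latticePoint (j + 1) a x ((fun i => ((2 * z i - z' i : ℤ) : ℝ)) +
        ((2 : ℕ) : ℝ) • y) = latticePoint j a x y := by
      intro y
      ext i
      simp only [latticePoint, Pi.add_apply, Pi.smul_apply, smul_eq_mul, ← hz, ← hz', pow_succ]
      push_cast
      field_simp
      ring
    have e2 : (fun i => ((2 * z i - z' i : ℤ) : ℝ)) + ((2 : ℕ) : ℝ) •
        ((2 : ℝ) ^ j • (x - a) - fun i => (z i : ℝ)) =
        (2 : ℝ) ^ (j + 1) • (x - a) - fun i => (z' i : ℝ) := by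
      ext i
      simp only [Pi.add_apply, Pi.smul_apply, Pi.sub_apply, smul_eq_mul, pow_succ]
      push_cast
      ring
    rw [e2] at h1
    simp only [e1, diffOp_comp_latticePoint] at h1
    have e3 : 2 * l + 1 + l = 3 * l + 1 := by ring
    rw [e3] at h1
    exact h1
  · have h2 : z' i / 2 ^ 1 = z i := congrFun (parent_cellIndex j 1 (x - a)) i
    have h3 : |2 * z i - z' i| ≤ 1 := by
      rw [abs_le]
      constructor <;> omega
    push_cast
    linarith

/-- At level zero the nodes near `x` are replaced by nodes at `a`. This is the comparison with `s =
1`, and it leaves a single polynomial for all `x`. -/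
theorem exists_abs_latticeInterp_zero_sub_le (n R : ℕ) (hl : 0 < l) : ∃ K : ℝ, 0 < K ∧
    ∀ (f : (Fin n → ℝ) → ℝ) (a x : Fin n → ℝ), (∀ i, |cellIndex 0 (x - a) i| ≤ R) →
      |latticeInterp l 0 f a x - lagrangeInterp l (fun y => f (a + y)) (x - a)| ≤
        K * latticeDiff l (2 * R + 2 * l) 0 f a x := by
  obtain ⟨K, hK, h⟩ := exists_abs_lagrangeInterp_sub_le (l := l) n (R + l) 1 hl
  refine ⟨K, hK, fun f a x hx => ?_⟩
  set z := cellIndex 0 (x - a) with hz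
  have h1 := h (fun y => f (a + y)) z
    ((2 : ℝ) ^ 0 • (x - a) - fun i => (z i : ℝ)) (fun i => ?_) (abs_sub_cellIndex_le 0 _)
  · have e1 : ∀ y, a + ((fun i => (z i : ℝ)) + ((1 : ℕ) : ℝ) • y) = latticePoint 0 a x y := by
      intro y
      simp [latticePoint, ← hz]
    have e2 : (fun i => (z i : ℝ)) + ((1 : ℕ) : ℝ) •
        ((2 : ℝ) ^ 0 • (x - a) - fun i => (z i : ℝ)) = x - a := by
      simp
    rw [e2] at h1
    simp only [e1] at h1
    refine h1.trans (mul_le_mul_of_nonneg_left (Finset.sum_le_sum fun i _ => ?_) hK.le)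
    have e3 : ∀ y : Fin n → ℤ, diffOp l (Pi.single i 1) (fun y => f (a + y)) (fun i => (y i : ℝ)) =
        diffOp l (((2 : ℝ) ^ 0)⁻¹ • Pi.single i 1) f
          (latticePoint 0 a x fun i => (((y - z) i : ℤ) : ℝ)) := by
      intro y
      refine Finset.sum_congr rfl fun k _ => ?_
      have : a + ((fun i => (y i : ℝ)) + (k : ℝ) • Pi.single i 1) =
          latticePoint 0 a x (fun i => (((y - z) i : ℤ) : ℝ)) +
            (k : ℝ) • (((2 : ℝ) ^ 0)⁻¹ • Pi.single i 1) := by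
        ext i
        simp [latticePoint, ← hz]
        ring
      simp only [this]
    simp only [e3]
    have h3 := sum_nbrs_add_le (R := R + l + l) (R' := 2 * R + 2 * l) (z := -z)
      (g := fun y : Fin n → ℤ => |diffOp l (((2 : ℝ) ^ 0)⁻¹ • Pi.single i 1) f
        (latticePoint 0 a x fun i => (y i : ℝ))|) (S := R) (fun i => by simpa using hx i) (by omega)
      fun _ => abs_nonneg _
    simpa only [← sub_eq_add_neg] using h3
  · have := hx i
    push_cast
    linarith

/-- Telescoping over the levels down to zero, where the comparison with the polynomial anchored at
`a` takes over. -/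
theorem exists_abs_latticeInterp_sub_le (n R : ℕ) (hl : 0 < l) : ∃ (K : ℝ) (R' : ℕ), 0 < K ∧
    ∀ (f : (Fin n → ℝ) → ℝ) (j : ℕ) (a x : Fin n → ℝ), (∀ i, |cellIndex 0 (x - a) i| ≤ R) →
      |latticeInterp l j f a x - lagrangeInterp l (fun y => f (a + y)) (x - a)| ≤
        K * ∑ k ∈ Finset.range (j + 1), latticeDiff l R' k f a x := by
  obtain ⟨K₁, hK₁, h₁⟩ := exists_abs_latticeInterp_succ_sub_le (l := l) n hl
  obtain ⟨K₀, hK₀, h₀⟩ := exists_abs_latticeInterp_zero_sub_le (l := l) n R hl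
  set R' := 3 * l + 1 + (2 * R + 2 * l) with hR'
  refine ⟨K₀ + K₁, R', by positivity, fun f j a x hx => ?_⟩
  induction j with
  | zero =>
    refine (h₀ f a x hx).trans ?_
    rw [zero_add, Finset.sum_range_one]
    exact mul_le_mul (by linarith) (latticeDiff_mono (by omega) _ _ _ _ _)
      (latticeDiff_nonneg _ _ _ _ _ _) (by positivity)
  | succ j ih =>
    rw [Finset.sum_range_succ, mul_add]
    have h2 : K₁ * latticeDiff l (3 * l + 1) (j + 1) f a x ≤
        (K₀ + K₁) * latticeDiff l R' (j + 1) f a x :=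
      mul_le_mul (by linarith) (latticeDiff_mono (by omega) _ _ _ _ _)
        (latticeDiff_nonneg _ _ _ _ _ _) (by positivity)
    have h3 := h₁ f j a x
    have h4 := abs_sub_le (latticeInterp l (j + 1) f a x) (latticeInterp l j f a x)
      (lagrangeInterp l (fun y => f (a + y)) (x - a))
    rw [abs_sub_comm (latticeInterp l (j + 1) f a x) (latticeInterp l j f a x)] at h4
    linarith

end Whitney

/-! ### Whitney's estimate, continued: the limit of fine lattices and the choice of the base point
-/

section Whitney

variable {n l : ℕ}

/-- The product of Lebesgue measures on `[-R, R + 1)ⁿ` and on the unit cube. -/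
noncomputable def boxMeasure (n R : ℕ) : Measure ((Fin n → ℝ) × (Fin n → ℝ)) :=
  ((volume : Measure (Fin n → ℝ)).restrict (unitBox n R)).prod
    ((volume : Measure (Fin n → ℝ)).restrict (unitBox n 0))

theorem ae_boxMeasure (n R : ℕ) : ∀ᵐ z ∂(boxMeasure n R), z.1 ∈ unitBox n R ∧ z.2 ∈ unitBox n 0 := by
  rw [boxMeasure, Measure.prod_restrict]
  exact ae_restrict_mem ((measurableSet_unitBox n R).prod (measurableSet_unitBox n 0))

theorem measurable_latticeShift (j : ℕ) (y : Fin n → ℝ) : Measurable fun b : Fin n → ℝ =>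
    ((2 : ℝ) ^ j)⁻¹ • ((fun i => (cellIndex j b i : ℝ)) + y) := by
  have h2 : Measurable fun b : Fin n → ℝ => fun i => (cellIndex j b i : ℝ) := by
    refine measurable_pi_lambda _ fun i => ?_
    have h1 : Measurable fun b : Fin n → ℝ => cellIndex j b i :=
      (measurable_pi_apply i).comp (measurable_cellIndex j)
    exact (measurable_from_top (f := fun k : ℤ => (k : ℝ))).comp h1
  exact Measurable.const_smul (h2.add_const y) ((2 : ℝ) ^ j)⁻¹

theorem abs_latticeShift_sub_le (j : ℕ) {M : ℝ} {b y : Fin n → ℝ} (hy : ∀ i, |y i| ≤ M) (i : Fin n) :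
    |(((2 : ℝ) ^ j)⁻¹ • ((fun i => (cellIndex j b i : ℝ)) + y)) i - b i| ≤
      ((2 : ℝ) ^ j)⁻¹ * (1 + M) := by
  have h1 := abs_sub_cellIndex_le j b i
  have h2 : (((2 : ℝ) ^ j)⁻¹ • ((fun i => (cellIndex j b i : ℝ)) + y)) i - b i =
      ((2 : ℝ) ^ j)⁻¹ * (y i - ((2 : ℝ) ^ j • b - fun i => (cellIndex j b i : ℝ)) i) := by
    simp only [Pi.smul_apply, Pi.add_apply, Pi.sub_apply, smul_eq_mul]
    field_simp
    ring
  rw [h2, abs_mul, abs_of_pos (by positivity : (0 : ℝ) < ((2 : ℝ) ^ j)⁻¹)]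
  gcongr
  refine (abs_sub _ _).trans ?_
  linarith [hy i]

theorem abs_latticeShift_le (j : ℕ) {M B : ℝ} {b y : Fin n → ℝ} (hy : ∀ i, |y i| ≤ M)
    (hM : 0 ≤ M) (hb : ∀ i, |b i| ≤ B) (i : Fin n) :
    |(((2 : ℝ) ^ j)⁻¹ • ((fun i => (cellIndex j b i : ℝ)) + y)) i| ≤ B + 1 + M := by
  have h1 := abs_latticeShift_sub_le j (b := b) hy i
  have h2 : ((2 : ℝ) ^ j)⁻¹ * (1 + M) ≤ 1 * (1 + M) := by
    gcongr
    exact inv_le_one_of_one_le₀ (one_le_pow₀ (by norm_num))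
  have h3 := abs_sub_abs_le_abs_sub ((((2 : ℝ) ^ j)⁻¹ • ((fun i => (cellIndex j b i : ℝ)) + y)) i) (b i)
  linarith [hb i]

/-- The values at the nodes tend to `f x` along a subsequence, and the interpolation weights are
bounded with sum one. -/
theorem exists_seq_ae_tendsto_latticeInterp {f : (Fin n → ℝ) → ℝ} (hf : Measurable f) (hl : 0 < l)
    (R : ℕ) : ∃ ns : ℕ → ℕ, ∀ᵐ z ∂(boxMeasure n R),
      Tendsto (fun i => latticeInterp l (ns i) f z.2 z.1) atTop (𝓝 (f z.1)) := by
  have hnode : ∀ (ν : Fin n → Fin l) i, |(((ν i : ℕ) : ℝ))| ≤ l := fun ν i => by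
    rw [abs_of_nonneg (Nat.cast_nonneg _)]
    exact_mod_cast (ν i).2.le
  obtain ⟨ns, -, h⟩ := exists_seq_ae_tendsto_shear (ι := Fin n → Fin l) hf (R := R)
    (R' := R + 3 + l) (by omega)
    (c := fun j ν b => ((2 : ℝ) ^ j)⁻¹ • ((fun i => (cellIndex j b i : ℝ)) + fun i => ((ν i : ℕ) : ℝ)))
    (fun j ν => measurable_latticeShift j _)
    (fun j ν b hb i => (abs_latticeShift_le j (hnode ν) (Nat.cast_nonneg l) hb i).trans
      (by push_cast; linarith))
    (fun δ hδ => by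
      have h1 : Tendsto (fun j : ℕ => ((2 : ℝ) ^ j)⁻¹ * (1 + l)) atTop (𝓝 (0 * (1 + l))) := by
        refine Tendsto.mul_const _ ?_
        simpa only [inv_pow] using tendsto_pow_atTop_nhds_zero_of_lt_one (r := (2 : ℝ)⁻¹)
          (by norm_num) (by norm_num)
      rw [zero_mul] at h1
      filter_upwards [h1.eventually_lt_const hδ] with j hj ν b
      refine lt_of_le_of_lt ((dist_pi_le_iff (by positivity)).2 fun i => ?_) hj
      rw [Real.dist_eq]
      exact abs_latticeShift_sub_le j (hnode ν) i)
  refine ⟨ns, h.mono fun z hz => ?_⟩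
  obtain ⟨D, hD, hw⟩ := exists_abs_nodeWeight_le n l 1
  rw [tendsto_iff_norm_sub_tendsto_zero]
  have h1 : Tendsto (fun i => ∑ ν : Fin n → Fin l,
      |f (latticePoint (ns i) z.2 z.1 fun i => ((ν i : ℕ) : ℝ)) - f z.1| * D) atTop (𝓝 0) := by
    have : (0 : ℝ) = ∑ _ν : Fin n → Fin l, 0 * D := by simp
    rw [this]
    refine tendsto_finsetSum _ fun ν _ => Tendsto.mul_const _ ?_
    exact tendsto_iff_norm_sub_tendsto_zero.1 (hz ν)
  refine squeeze_zero (fun _ => norm_nonneg _) (fun i => ?_) h1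
  obtain ⟨u, hu⟩ : ∃ u, u = (2 : ℝ) ^ (ns i) • (z.1 - z.2) -
    fun k => (cellIndex (ns i) (z.1 - z.2) k : ℝ) := ⟨_, rfl⟩
  have h2 : latticeInterp l (ns i) f z.2 z.1 - f z.1 = ∑ ν : Fin n → Fin l,
      (f (latticePoint (ns i) z.2 z.1 fun i => ((ν i : ℕ) : ℝ)) - f z.1) * nodeWeight l ν u := by
    simp only [sub_mul, Finset.sum_sub_distrib]
    rw [← Finset.mul_sum, sum_nodeWeight hl, mul_one, latticeInterp, lagrangeInterp, hu]
  rw [h2, Real.norm_eq_abs]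
  refine (Finset.abs_sum_le_sum_abs _ _).trans (Finset.sum_le_sum fun ν _ => ?_)
  rw [abs_mul]
  gcongr
  exact hw ν u fun k => hu ▸ abs_sub_cellIndex_le (ns i) _ k

theorem exists_ae_enorm_sub_le_tsum (n R : ℕ) (hl : 0 < l) : ∃ (K : ℝ) (R' : ℕ), 0 < K ∧
    ∀ f : (Fin n → ℝ) → ℝ, Measurable f → ∀ᵐ z ∂(boxMeasure n R),
      ‖f z.1 - lagrangeInterp l (fun y => f (z.2 + y)) (z.1 - z.2)‖ₑ ≤
        ENNReal.ofReal K * ∑' k, ENNReal.ofReal (latticeDiff l R' k f z.2 z.1) := by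
  obtain ⟨K, R', hK, h⟩ := exists_abs_latticeInterp_sub_le (l := l) n (R + 2) hl
  refine ⟨K, R', hK, fun f hf => ?_⟩
  obtain ⟨ns, hns⟩ := exists_seq_ae_tendsto_latticeInterp hf hl R
  filter_upwards [hns, ae_boxMeasure n R] with z hz hmem
  have hx : ∀ i, |cellIndex 0 (z.1 - z.2) i| ≤ (R + 2 : ℕ) := fun i => by
    have h1 := abs_le.1 (abs_sub_le_of_mem_unitBox hmem.1 hmem.2 i)
    have h2 : cellIndex 0 (z.1 - z.2) i = ⌊z.1 i - z.2 i⌋ := by simp [cellIndex]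
    rw [h2, abs_le]
    constructor
    · rw [Int.le_floor]; push_cast; linarith
    · rw [Int.floor_le_iff]; push_cast; linarith
  refine le_of_tendsto ((continuous_enorm.tendsto _).comp (hz.sub_const _))
    (Eventually.of_forall fun i => ?_)
  simp only [Function.comp]
  rw [Real.enorm_eq_ofReal_abs]
  calc _ ≤ ENNReal.ofReal (K * ∑ k ∈ Finset.range (ns i + 1), latticeDiff l R' k f z.2 z.1) :=
        ENNReal.ofReal_le_ofReal (h f (ns i) z.2 z.1 hx)
    _ = ENNReal.ofReal K * ∑ k ∈ Finset.range (ns i + 1),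
          ENNReal.ofReal (latticeDiff l R' k f z.2 z.1) := by
        rw [ENNReal.ofReal_mul hK.le, ENNReal.ofReal_sum_of_nonneg
          fun k _ => latticeDiff_nonneg _ _ _ _ _ _]
    _ ≤ _ := by
        gcongr
        exact ENNReal.sum_le_tsum _

theorem measurable_diffOp_const (l : ℕ) (h : Fin n → ℝ) {f : (Fin n → ℝ) → ℝ} (hf : Measurable f) :
    Measurable (diffOp l h f) :=
  (measurable_diffOp l hf).comp (measurable_id.prodMk measurable_const)

theorem measurable_latticePoint (j : ℕ) (y : Fin n → ℝ) :
    Measurable fun z : (Fin n → ℝ) × (Fin n → ℝ) => latticePoint j z.2 z.1 y :=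
  measurable_snd.add ((measurable_latticeShift j y).comp (measurable_fst.sub measurable_snd))

theorem measurable_latticeDiff (l R j : ℕ) {f : (Fin n → ℝ) → ℝ} (hf : Measurable f) :
    Measurable fun z : (Fin n → ℝ) × (Fin n → ℝ) => latticeDiff l R j f z.2 z.1 :=
  Finset.measurable_sum _ fun _ _ => Finset.measurable_sum _ fun _ _ =>
    ((measurable_diffOp_const l _ hf).comp (measurable_latticePoint j _)).abs

/-- Every term is a fixed-step difference evaluated at a randomly shifted point. The shear estimate
replaces it by the same difference over a box, with a constant independent of the level. -/
theorem exists_eLpNorm_latticeDiff_le (n l R R' : ℕ) {r : ℝ≥0∞} (hr : r ≠ 0) :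
    ∃ C : ℝ≥0∞, C ≠ ∞ ∧ ∀ (j : ℕ) (f : (Fin n → ℝ) → ℝ), Measurable f →
      eLpNorm (fun z : (Fin n → ℝ) × (Fin n → ℝ) => ENNReal.ofReal (latticeDiff l R' j f z.2 z.1)) r
        (boxMeasure n R) ≤ C * ∑ i, ∑ ν ∈ nbrs n (R + 3 + R'),
          eLpNorm (diffOp l (((2 : ℝ) ^ j)⁻¹ • Pi.single i 1) f) r
            (volume.restrict (dyadicCubeIco 0 ν)) := by
  obtain ⟨C₁, hC₁, h₁⟩ := exists_eLpNorm_sum_le (ι := Fin n × nbrs n R') hr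
  obtain ⟨C₂, hC₂, h₂⟩ := exists_eLpNorm_shear_le n R (R + 3 + R') hr
  obtain ⟨C₃, hC₃, h₃⟩ := exists_eLpNorm_restrict_iUnion_le (ι := nbrs n (R + 3 + R')) hr
  refine ⟨C₁ * ((nbrs n R').card * (C₂ * C₃)), by finiteness, fun j f hf => ?_⟩
  set D : Fin n → (Fin n → ℝ) → ℝ := fun i => diffOp l (((2 : ℝ) ^ j)⁻¹ • Pi.single i 1) f with hD
  have hDm : ∀ i, Measurable (D i) := fun i => measurable_diffOp_const l _ hf
  have hDm' : ∀ i, Measurable fun x => ‖D i x‖ₑ := fun i => (hDm i).enorm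
  have e1 : ∀ z : (Fin n → ℝ) × (Fin n → ℝ), ENNReal.ofReal (latticeDiff l R' j f z.2 z.1) =
      ∑ w : Fin n × nbrs n R', ‖D w.1 (latticePoint j z.2 z.1 fun i => ((w.2 : Fin n → ℤ) i : ℝ))‖ₑ := by
    intro z
    rw [latticeDiff, Fintype.sum_prod_type, ENNReal.ofReal_sum_of_nonneg
      fun _ _ => Finset.sum_nonneg fun _ _ => abs_nonneg _]
    refine Finset.sum_congr rfl fun i _ => ?_
    rw [ENNReal.ofReal_sum_of_nonneg fun _ _ => abs_nonneg _, ← Finset.sum_coe_sort]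
    exact Finset.sum_congr rfl fun y _ => (Real.enorm_eq_ofReal_abs _).symm
  simp only [e1]
  refine (h₁ _ _ fun w => ((hDm' w.1).comp (measurable_latticePoint j _)).aemeasurable).trans ?_
  rw [mul_assoc]
  refine mul_le_mul' le_rfl ?_
  have h4 : ∀ w : Fin n × nbrs n R', eLpNorm (fun z : (Fin n → ℝ) × (Fin n → ℝ) =>
      ‖D w.1 (latticePoint j z.2 z.1 fun i => ((w.2 : Fin n → ℤ) i : ℝ))‖ₑ) r (boxMeasure n R) ≤
      C₂ * C₃ * ∑ ν ∈ nbrs n (R + 3 + R'), eLpNorm (D w.1) r (volume.restrict (dyadicCubeIco 0 ν)) := by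
    intro w
    have hw : ∀ i, |((w.2 : Fin n → ℤ) i : ℝ)| ≤ (R' : ℝ) := fun i => by
      exact_mod_cast mem_nbrs.1 w.2.2 i
    have h5 := h₂ (fun x => ‖D w.1 x‖ₑ) (fun b => ((2 : ℝ) ^ j)⁻¹ •
      ((fun i => (cellIndex j b i : ℝ)) + fun i => ((w.2 : Fin n → ℤ) i : ℝ))) (hDm' w.1)
      (measurable_latticeShift j _) fun b hb i =>
        (abs_latticeShift_le j hw (Nat.cast_nonneg R') hb i).trans (by push_cast; linarith)
    have h6 := h₃ volume (D w.1) (fun ν => dyadicCubeIco 0 (ν : Fin n → ℤ)) (unitBox n (R + 3 + R'))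
      subset_rfl
    rw [eLpNorm_enorm] at h5
    refine h5.trans ?_
    rw [mul_assoc, ← Finset.sum_coe_sort]
    exact mul_le_mul' le_rfl h6
  calc _ ≤ ∑ w : Fin n × nbrs n R', C₂ * C₃ * ∑ ν ∈ nbrs n (R + 3 + R'),
        eLpNorm (D w.1) r (volume.restrict (dyadicCubeIco 0 ν)) := Finset.sum_le_sum fun w _ => h4 w
    _ = _ := by
        rw [Fintype.sum_prod_type]
        simp only [Finset.sum_const, Finset.card_univ, Fintype.card_coe, nsmul_eq_mul]
        rw [← Finset.mul_sum, ← Finset.mul_sum, ← mul_assoc]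

/-- On a probability space a function cannot exceed its own `L_r` quasi-norm everywhere. This
provides the base point of the lattice. -/
theorem exists_le_eLpNorm {β : Type*} [MeasurableSpace β] {ν : Measure β} [IsProbabilityMeasure ν]
    {r : ℝ≥0∞} (hr : r ≠ 0) {Φ : β → ℝ≥0∞} (hm : Measurable Φ) : ∃ y, Φ y ≤ eLpNorm Φ r ν := by
  rcases eq_or_ne r ∞ with rfl | hrt
  · rw [eLpNorm_exponent_top, eLpNormEssSup]
    simp only [enorm_eq_self]
    exact (essSup_le_iff_ae.1 le_rfl).exists
  · obtain ⟨y, hy⟩ := exists_le_lintegral (μ := ν) (hm.pow_const r.toReal).aemeasurable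
    have hr0 : 0 < r.toReal := ENNReal.toReal_pos hr hrt
    refine ⟨y, ?_⟩
    rw [eLpNorm_eq_lintegral_rpow_enorm_toReal hr hrt]
    simp only [enorm_eq_self]
    rwa [one_div, ENNReal.le_rpow_inv_iff hr0]

theorem exists_eLpNorm_le_prod {α β : Type*} [MeasurableSpace α] [MeasurableSpace β]
    {μ : Measure α} {ν : Measure β} [SFinite μ] [IsProbabilityMeasure ν] {r : ℝ≥0∞} (hr : r ≠ 0)
    {g : α × β → ℝ≥0∞} (hg : Measurable g) :
    ∃ y, eLpNorm (fun x => g (x, y)) r μ ≤ eLpNorm g r (μ.prod ν) := by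
  rw [← eLpNorm_prod_eq hr hg]
  have hm := measurable_eLpNorm_prod (μ := μ) hr hg
  exact exists_le_eLpNorm hr hm

/-- Whitney's estimate with differences in the coordinate directions only. -/
theorem exists_mem_polySpace_eLpNorm_sub_le (n R : ℕ) (hl : 0 < l) {κ r : ℝ≥0∞} (hr : r ≠ 0)
    (hκ : κ ≠ 0) (hκ1 : κ ≤ 1) (hκr : κ ≤ r) : ∃ (C : ℝ≥0∞) (R' : ℕ), C ≠ ∞ ∧
    ∀ f : (Fin n → ℝ) → ℝ, Measurable f → ∃ P ∈ polySpace n l,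
      eLpNorm (fun x => f x - P x) r (volume.restrict (unitBox n R)) ≤
        C * lqNorm κ fun j : ℕ => ∑ i, ∑ ν ∈ nbrs n R',
          eLpNorm (diffOp l (((2 : ℝ) ^ j)⁻¹ • Pi.single i 1) f) r
            (volume.restrict (dyadicCubeIco 0 ν)) := by
  obtain ⟨K, R', hK, h₁⟩ := exists_ae_enorm_sub_le_tsum (l := l) n R hl
  obtain ⟨C, hC, h₂⟩ := exists_eLpNorm_latticeDiff_le n l R R' hr
  have hκt : κ ≠ ∞ := (hκ1.trans_lt ENNReal.one_lt_top).ne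
  refine ⟨ENNReal.ofReal K * C, R + 3 + R', by finiteness, fun f hf => ?_⟩
  have hprob : IsProbabilityMeasure ((volume : Measure (Fin n → ℝ)).restrict (unitBox n 0)) :=
    ⟨by rw [Measure.restrict_apply_univ, unitBox_zero, volume_dyadicCubeIco]; simp⟩
  have hgm : Measurable fun z : (Fin n → ℝ) × (Fin n → ℝ) =>
      ‖f z.1 - lagrangeInterp l (fun y => f (z.2 + y)) (z.1 - z.2)‖ₑ := by
    refine Measurable.enorm ((hf.comp measurable_fst).sub
      (Finset.measurable_sum _ fun ν _ => Measurable.mul ?_ ?_))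
    · exact hf.comp (measurable_snd.add_const _)
    · exact Finset.measurable_prod _ fun i _ => (Polynomial.continuous _).measurable.comp
        ((measurable_pi_apply i).comp (measurable_fst.sub measurable_snd))
  -- The base point is fixed before the estimate over the product is evaluated. Once `a` is fixed,
  -- the interpolant is a polynomial in `x`.
  obtain ⟨a, ha⟩ := exists_eLpNorm_le_prod (μ := (volume : Measure (Fin n → ℝ)).restrict (unitBox n R))
    (ν := (volume : Measure (Fin n → ℝ)).restrict (unitBox n 0)) hr hgm
  refine ⟨fun x => lagrangeInterp l (fun y => f (a + y)) (x - a), ?_, ?_⟩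
  · have := comp_affine_mem_polySpace (lagrangeInterp_mem l fun y => f (a + y)) 1 (-a)
    simpa only [one_smul, neg_add_eq_sub] using this
  · rw [← eLpNorm_enorm]
    refine ha.trans ?_
    calc _ ≤ ENNReal.ofReal K * eLpNorm (fun z : (Fin n → ℝ) × (Fin n → ℝ) =>
          lqNorm κ fun k => ENNReal.ofReal (latticeDiff l R' k f z.2 z.1)) r (boxMeasure n R) := by
          refine eLpNorm_le_mul_eLpNorm ENNReal.ofReal_ne_top ?_
          filter_upwards [h₁ f hf] with z hz
          rw [enorm_eq_self, enorm_eq_self]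
          exact hz.trans (mul_le_mul' le_rfl (sum_le_lqNorm hκ hκ1 _))
      _ ≤ ENNReal.ofReal K * lqNorm κ fun k => eLpNorm (fun z : (Fin n → ℝ) × (Fin n → ℝ) =>
          ENNReal.ofReal (latticeDiff l R' k f z.2 z.1)) r (boxMeasure n R) :=
          mul_le_mul' le_rfl (eLpNorm_lqNorm_le hκ hκt hκr fun k =>
            (measurable_latticeDiff l R' k hf).ennreal_ofReal.aemeasurable)
      _ ≤ _ := by
          rw [mul_assoc, ← lqNorm_const_mul hκ C]
          exact mul_le_mul' le_rfl (lqNorm_mono fun k => h₂ k f hf)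

end Whitney

/-! ### Local polynomial approximation on all dyadic cubes -/

section Approximation

variable {n l : ℕ} {p q r ρ : ℝ≥0∞}

theorem diffOp_comp_dyadicMap (l k : ℕ) (m : Fin n → ℤ) (h : Fin n → ℝ) (f : (Fin n → ℝ) → ℝ)
    (x : Fin n → ℝ) : diffOp l h (fun y => f (dyadicMap k m y)) x =
      diffOp l (((2 : ℝ) ^ k)⁻¹ • h) f (dyadicMap k m x) := by
  refine Finset.sum_congr rfl fun i _ => ?_
  have : dyadicMap k m (x + (i : ℝ) • h) = dyadicMap k m x + (i : ℝ) • ((2 : ℝ) ^ k)⁻¹ • h := by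
    simp only [dyadicMap]
    module
  simp only [this]

theorem measurable_dyadicMap (k : ℕ) (m : Fin n → ℤ) : Measurable (dyadicMap k m) :=
  (measurable_const_smul (((2 : ℝ) ^ k)⁻¹)).const_add _

theorem one_le_scale (r : ℝ≥0∞) (n k : ℕ) : 1 ≤ scale r n k :=
  calc (1 : ℝ≥0∞) = 1 ^ (r⁻¹).toReal := (ENNReal.one_rpow _).symm
    _ ≤ _ := ENNReal.rpow_le_rpow (one_le_pow₀ one_le_two) ENNReal.toReal_nonneg

/-- The `L_r` distance of `f` and `P` near `Q_{k,m}`, normalized by the volume. -/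
noncomputable def approxErr (r : ℝ≥0∞) (R k : ℕ) (m : Fin n → ℤ) (f P : (Fin n → ℝ) → ℝ) : ℝ≥0∞ :=
  scale r n k * ∑ ν ∈ nbrs n R,
    eLpNorm (fun x => f x - P x) r (volume.restrict (dyadicCubeIco k (m + ν)))

/-- The `L_r` quasi-norm over `Q_{k,m}` of the local differences at level `k + d`, normalized by
the volume. -/
noncomputable def fineDiff (l : ℕ) (r : ℝ≥0∞) (k d : ℕ) (m : Fin n → ℤ) (f : (Fin n → ℝ) → ℝ) :
    ℝ≥0∞ :=
  scale r n k * lqNorm r fun m' : {m' // parent d m' = m} =>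
    (scale r n (k + d))⁻¹ * ∑ ν ∈ nbrs n l, cubeDiff l r (k + d) ((m' : Fin n → ℤ) + ν) f

/-- The cube is split into its descendants of level `k + d`, on each of which the estimate for fixed
steps applies. -/
theorem exists_eLpNorm_diffOp_le_fineDiff (n : ℕ) (hl : l ≠ 0) (hr : r ≠ 0) :
    ∃ C : ℝ≥0∞, C ≠ ∞ ∧ ∀ k d (m : Fin n → ℤ) (f : (Fin n → ℝ) → ℝ) (h : Fin n → ℝ), Measurable f →
      (∀ i, |h i| ≤ ((2 : ℝ) ^ (k + d + 1))⁻¹) →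
      scale r n k * eLpNorm (diffOp l h f) r (volume.restrict (dyadicCubeIco k m)) ≤
        C * fineDiff l r k d m f := by
  obtain ⟨C, hC, h₁⟩ := exists_eLpNorm_diffOp_le n hl hr
  refine ⟨C, hC, fun k d m f h hf hh => ?_⟩
  rw [fineDiff, mul_left_comm, ← lqNorm_const_mul hr C, eLpNorm_dyadicCubeIco hr _ k d m]
  refine mul_le_mul' le_rfl (lqNorm_mono fun m' => ?_)
  rw [mul_left_comm, ← ENNReal.inv_mul_le_iff (by simp [scale_ne_top]) (by simp [scale_ne_zero]),
    inv_inv]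
  exact h₁ (k + d) m' f h hf hh

/-- The rescaling uses cubes of level `k + 1` rather than `k`. Unit-scale steps `2⁻ᵈ` then become `2
^ (-(k + d + 1))`, exactly the length for which fixed steps are controlled by differences of level
`k + d`. -/
theorem exists_approxErr_le_eLpNorm_unitBox (n R : ℕ) (hr : r ≠ 0) : ∃ C : ℝ≥0∞, C ≠ ∞ ∧
    ∀ k (m : Fin n → ℤ) (f P : (Fin n → ℝ) → ℝ), approxErr r R k m f P ≤
      C * eLpNorm (fun x => f (dyadicMap (k + 1) (fun i => 2 * m i) x) -
        P (dyadicMap (k + 1) (fun i => 2 * m i) x)) r (volume.restrict (unitBox n (2 * R + 1))) := by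
  obtain ⟨C, hC, h⟩ := exists_eLpNorm_restrict_iUnion_le (ι := nbrs n (2 * R + 1)) hr
  refine ⟨(nbrs n R).card * (C * (nbrs n (2 * R + 1)).card), by finiteness, fun k m f P => ?_⟩
  set M : Fin n → ℤ := fun i => 2 * m i with hM
  set g : (Fin n → ℝ) → ℝ := fun x => f x - P x with hg
  set N := eLpNorm (fun x => g (dyadicMap (k + 1) M x)) r (volume.restrict (unitBox n (2 * R + 1)))
    with hN
  have h1 : ∀ ν' ∈ nbrs n (2 * R + 1), scale r n (k + 1) *
      eLpNorm g r (volume.restrict (dyadicCubeIco (k + 1) (M + ν'))) ≤ N := fun ν' hν' => by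
    rw [← eLpNorm_comp_dyadicMap]
    exact eLpNorm_mono_measure _ (Measure.restrict_mono
      (Set.subset_iUnion (fun ν : nbrs n (2 * R + 1) => dyadicCubeIco 0 (ν : Fin n → ℤ)) ⟨ν', hν'⟩)
      le_rfl)
  have h2 : ∀ ν ∈ nbrs n R, scale r n k *
      eLpNorm g r (volume.restrict (dyadicCubeIco k (m + ν))) ≤ C * (nbrs n (2 * R + 1)).card * N := by
    intro ν hν
    have h3 := h volume g (fun ν' => dyadicCubeIco (k + 1) (M + (ν' : Fin n → ℤ)))
      (dyadicCubeIco k (m + ν)) fun x hx => by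
        rw [mem_dyadicCubeIco] at hx
        have h4 : ∀ i, cellIndex (k + 1) x i / 2 ^ 1 = m i + ν i := fun i => by
          rw [← Pi.add_apply, ← hx]
          exact congrFun (parent_cellIndex k 1 x) i
        refine Set.mem_iUnion.2 ⟨⟨cellIndex (k + 1) x - M, mem_nbrs.2 fun i => ?_⟩, ?_⟩
        · have h5 := h4 i
          have h6 := abs_le.1 (mem_nbrs.1 hν i)
          simp only [Pi.sub_apply, hM]
          rw [abs_le]
          push_cast
          constructor <;> omega
        · rw [mem_dyadicCubeIco]
          simp
    have h7 : scale r n k ≤ scale r n (k + 1) := by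
      rw [scale_add]
      exact le_mul_of_one_le_right' (one_le_scale r n 1)
    calc _ ≤ scale r n (k + 1) * (C * ∑ ν' : nbrs n (2 * R + 1),
          eLpNorm g r (volume.restrict (dyadicCubeIco (k + 1) (M + (ν' : Fin n → ℤ))))) :=
          mul_le_mul' h7 h3
      _ = C * ∑ ν' : nbrs n (2 * R + 1), scale r n (k + 1) *
          eLpNorm g r (volume.restrict (dyadicCubeIco (k + 1) (M + (ν' : Fin n → ℤ)))) := by
          rw [mul_left_comm, Finset.mul_sum]
      _ ≤ C * ∑ _ν' : nbrs n (2 * R + 1), N :=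
          mul_le_mul' le_rfl (Finset.sum_le_sum fun ν' _ => h1 ν' ν'.2)
      _ = _ := by
          rw [Finset.sum_const, Finset.card_univ, Fintype.card_coe, nsmul_eq_mul, mul_assoc]
  rw [approxErr, Finset.mul_sum]
  calc _ ≤ ∑ _ν ∈ nbrs n R, C * (nbrs n (2 * R + 1)).card * N := Finset.sum_le_sum h2
    _ = _ := by rw [Finset.sum_const, nsmul_eq_mul, ← mul_assoc]

theorem exists_mem_polySpace_approxErr_le (n R : ℕ) (hl : 0 < l) {κ : ℝ≥0∞} (hr : r ≠ 0)
    (hκ : κ ≠ 0) (hκ1 : κ ≤ 1) (hκr : κ ≤ r) : ∃ (C : ℝ≥0∞) (R' : ℕ), C ≠ ∞ ∧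
    ∀ f : (Fin n → ℝ) → ℝ, Measurable f → ∀ k (m : Fin n → ℤ), ∃ P ∈ polySpace n l,
      approxErr r R k m f P ≤
        C * lqNorm κ fun d : ℕ => ∑ ν ∈ nbrs n R', fineDiff l r k d (m + ν) f := by
  obtain ⟨C₁, hC₁, h₁⟩ := exists_approxErr_le_eLpNorm_unitBox n R hr
  obtain ⟨C₂, R', hC₂, h₂⟩ := exists_mem_polySpace_eLpNorm_sub_le n (2 * R + 1) hl hr hκ hκ1 hκr
  obtain ⟨C₃, hC₃, h₃⟩ := exists_eLpNorm_diffOp_le_fineDiff n hl.ne' hr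
  have hs := scale_ne_top r n 1
  refine ⟨C₁ * C₂ * (n * ((nbrs n R').card * (scale r n 1 * C₃))), R', by finiteness,
    fun f hf k m => ?_⟩
  set M : Fin n → ℤ := fun i => 2 * m i with hM
  obtain ⟨Q, hQ, h4⟩ := h₂ (fun x => f (dyadicMap (k + 1) M x)) (hf.comp (measurable_dyadicMap _ _))
  obtain ⟨P, hP, hPQ⟩ := exists_comp_dyadicMap_eq hQ (k + 1) M
  refine ⟨P, hP, (h₁ k m f P).trans ?_⟩
  simp only [← hM, hPQ]
  rw [mul_assoc C₁, mul_assoc C₁, mul_assoc C₂, ← lqNorm_const_mul hκ]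
  refine mul_le_mul' le_rfl (h4.trans (mul_le_mul' le_rfl (lqNorm_mono fun d => ?_)))
  set S := ∑ ν ∈ nbrs n R', fineDiff l r k d (m + ν) f with hS
  have h5 : ∀ i, ∀ ν ∈ nbrs n R', eLpNorm (diffOp l (((2 : ℝ) ^ d)⁻¹ • Pi.single i 1)
      fun x => f (dyadicMap (k + 1) M x)) r (volume.restrict (dyadicCubeIco 0 ν)) ≤
      scale r n 1 * C₃ * S := by
    intro i ν hν
    have e1 : (diffOp l (((2 : ℝ) ^ d)⁻¹ • Pi.single i 1) fun x => f (dyadicMap (k + 1) M x)) =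
        fun x => diffOp l (((2 : ℝ) ^ (k + 1))⁻¹ • ((2 : ℝ) ^ d)⁻¹ • Pi.single i 1) f
          (dyadicMap (k + 1) M x) := funext fun x => diffOp_comp_dyadicMap _ _ _ _ _ _
    have h6 : parent 1 ν ∈ nbrs n R' := mem_nbrs.2 fun j => by
      have := abs_le.1 (mem_nbrs.1 hν j)
      rw [abs_le, parent]
      constructor <;> omega
    have h7 : dyadicCubeIco (k + 1) (M + ν) ⊆ dyadicCubeIco k (m + parent 1 ν) := by
      rw [dyadicCubeIco_eq_iUnion k 1 (m + parent 1 ν)]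
      refine Set.subset_iUnion (fun m' : {m' // parent 1 m' = m + parent 1 ν} =>
        dyadicCubeIco (k + 1) (m' : Fin n → ℤ)) ⟨M + ν, ?_⟩
      ext j
      simp only [parent, Pi.add_apply, hM]
      omega
    rw [e1, eLpNorm_comp_dyadicMap, scale_add, mul_comm (scale r n k), mul_assoc, mul_assoc]
    refine mul_le_mul' le_rfl ?_
    calc _ ≤ scale r n k * eLpNorm (diffOp l (((2 : ℝ) ^ (k + 1))⁻¹ • ((2 : ℝ) ^ d)⁻¹ •
          Pi.single i 1) f) r (volume.restrict (dyadicCubeIco k (m + parent 1 ν))) :=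
          mul_le_mul' le_rfl (eLpNorm_mono_measure _ (Measure.restrict_mono h7 le_rfl))
      _ ≤ C₃ * fineDiff l r k d (m + parent 1 ν) f := by
          refine h₃ k d _ f _ hf fun j => ?_
          have e2 : ((2 : ℝ) ^ (k + 1))⁻¹ * ((2 : ℝ) ^ d)⁻¹ = ((2 : ℝ) ^ (k + d + 1))⁻¹ := by
            rw [← mul_inv, ← pow_add, add_right_comm]
          rw [smul_smul, e2, Pi.smul_apply, smul_eq_mul, abs_mul, abs_of_pos (by positivity)]
          refine mul_le_of_le_one_right (by positivity) ?_
          rcases eq_or_ne j i with rfl | hji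
          · simp
          · simp [Pi.single_eq_of_ne hji]
      _ ≤ C₃ * S := mul_le_mul' le_rfl
          (Finset.single_le_sum (f := fun ν => fineDiff l r k d (m + ν) f) (fun _ _ => bot_le) h6)
  calc _ ≤ ∑ _i : Fin n, ∑ _ν ∈ nbrs n R', scale r n 1 * C₃ * S :=
        Finset.sum_le_sum fun i _ => Finset.sum_le_sum fun ν hν => h5 i ν hν
    _ = _ := by
        simp only [Finset.sum_const, Finset.card_univ, Fintype.card_fin, nsmul_eq_mul]
        ring

/-- Local polynomial approximation is controlled by local differences at all finer scales. -/
theorem CoefWeight.exists_lqNorm_fineDiff_le {τ : ℕ → (Fin n → ℤ) → ℝ≥0∞}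
    (hτ : CoefWeight p r l ρ τ) (hp : p ≠ 0) (R : ℕ) : ∃ C : ℝ≥0∞, C ≠ ∞ ∧
    ∀ k d (f : (Fin n → ℝ) → ℝ),
      (lqNorm p fun m => τ k m * ∑ ν ∈ nbrs n R, fineDiff l r k d (m + ν) f) ≤
        C * (ρ ^ d * lqNorm p fun m => τ (k + d) m * cubeDiff l r (k + d) m f) := by
  obtain ⟨C₁, hC₁, h₁⟩ := hτ.exists_lqNorm_nbrs_le hp R
  obtain ⟨C₂, hC₂, h₂⟩ := hτ.exists_lqNorm_nbrs_le hp l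
  obtain ⟨C₃, hC₃, h₃⟩ := hτ.fine
  refine ⟨C₁ * (C₃ * C₂), by finiteness, fun k d f => ?_⟩
  rw [mul_assoc]
  refine (h₁ k fun m => fineDiff l r k d m f).trans (mul_le_mul' le_rfl ?_)
  set B : (Fin n → ℤ) → ℝ≥0∞ := fun m => ∑ ν ∈ nbrs n l, cubeDiff l r (k + d) (m + ν) f with hB
  have h4 : ∀ m, τ k m * fineDiff l r k d m f ≤ C₃ * ρ ^ d *
      lqNorm p fun m' : {m' // parent d m' = m} => τ (k + d) m' * B m' := by
    intro m
    have h5 := h₃ k d m fun m' => (scale r n (k + d))⁻¹ * B m'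
    have e1 : (lqNorm p fun m' : {m' // parent d m' = m} =>
        τ (k + d) m' * ((scale r n (k + d))⁻¹ * B m')) = (scale r n (k + d))⁻¹ *
        lqNorm p fun m' : {m' // parent d m' = m} => τ (k + d) m' * B m' := by
      rw [← lqNorm_const_mul hp]
      simp only [mul_left_comm]
    rw [e1] at h5
    rw [fineDiff, mul_left_comm]
    refine (mul_le_mul' le_rfl h5).trans_eq ?_
    have h6 := scale_ne_zero r n (k + d)
    have h7 := scale_ne_top r n (k + d)
    rw [scale_add] at h6 h7 ⊢
    generalize (lqNorm p fun m' : {m' // parent d m' = m} => τ (k + d) m' * B m') = Y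
    calc _ = C₃ * ρ ^ d * ((scale r n k * scale r n d) * (scale r n k * scale r n d)⁻¹) * Y := by ring
      _ = _ := by rw [ENNReal.mul_inv_cancel h6 h7, mul_one]
  calc _ ≤ lqNorm p fun m => C₃ * ρ ^ d *
        lqNorm p fun m' : {m' // parent d m' = m} => τ (k + d) m' * B m' := lqNorm_mono h4
    _ = C₃ * ρ ^ d * lqNorm p fun m => τ (k + d) m * B m := by
        rw [lqNorm_const_mul hp, lqNorm_fiberwise hp (parent d) fun m => τ (k + d) m * B m]
    _ ≤ C₃ * ρ ^ d * (C₂ * lqNorm p fun m => τ (k + d) m * cubeDiff l r (k + d) m f) :=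
        mul_le_mul' le_rfl (h₂ (k + d) fun m => cubeDiff l r (k + d) m f)
    _ = _ := by ring

theorem lqNorm_cubeDiff_le_besovNorm (hp : p ≠ 0) {t : ℕ → (Fin n → ℝ) → ℝ} (f : (Fin n → ℝ) → ℝ) :
    (lqNorm q fun k => lqNorm p fun m => weightCoef p t k m * cubeDiff l r k m f) ≤
      besovNorm l p q r t f :=
  (lqNorm_mono fun k => le_eLpNorm_weight_mul hp fun x => cubeDiff_le_localDiff l r k f x).trans
    le_self_add

/-- Minkowski's inequality takes the `l_p` quasi-norm inside the sum over finer scales. By `fine`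
the term `d` levels below carries `ρ ^ d`, and the discrete convolution estimate concludes. -/
theorem CoefWeight.exists_approx (hl : 0 < l) {κ : ℝ≥0∞} (hp : p ≠ 0) (hr : r ≠ 0) (hκ : κ ≠ 0)
    (hκ1 : κ ≤ 1) (hκp : κ ≤ p) (hκr : κ ≤ r) (hκq : κ ≤ q) (hρ : ρ < 1) {t : ℕ → (Fin n → ℝ) → ℝ}
    (hτ : CoefWeight p r l ρ (weightCoef p t)) (R : ℕ) : ∃ C : ℝ≥0∞, C ≠ ∞ ∧
    ∀ f : (Fin n → ℝ) → ℝ, Measurable f → ∃ P : ℕ → (Fin n → ℤ) → (Fin n → ℝ) → ℝ,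
      (∀ k m, P k m ∈ polySpace n l) ∧
      (lqNorm q fun k => lqNorm p fun m => weightCoef p t k m * approxErr r R k m f (P k m)) ≤
        C * besovNorm l p q r t f := by
  obtain ⟨C₁, R', hC₁, h₁⟩ := exists_mem_polySpace_approxErr_le (l := l) n R hl hr hκ hκ1 hκr
  obtain ⟨C₂, hC₂, h₂⟩ := hτ.exists_lqNorm_fineDiff_le hp R'
  have hκt : κ ≠ ∞ := (hκ1.trans_lt ENNReal.one_lt_top).ne
  have hG := lqNorm_geometric_ne_top hκ hκt hρ
  refine ⟨C₁ * C₂ * (lqNorm κ fun d : ℤ => ρ ^ d.natAbs), by finiteness, fun f hf => ?_⟩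
  choose P hP hPE using h₁ f hf
  refine ⟨P, hP, ?_⟩
  set A : ℕ → ℝ≥0∞ := fun k => lqNorm p fun m => weightCoef p t k m * cubeDiff l r k m f with hA
  have h3 : ∀ k, (lqNorm p fun m => weightCoef p t k m * approxErr r R k m f (P k m)) ≤
      C₁ * C₂ * lqNorm κ fun j : ℕ => ρ ^ ((j : ℤ) - k).natAbs * A j := by
    intro k
    calc _ ≤ lqNorm p fun m => C₁ * lqNorm κ fun d : ℕ =>
          weightCoef p t k m * ∑ ν ∈ nbrs n R', fineDiff l r k d (m + ν) f := by
          refine lqNorm_mono fun m => ?_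
          rw [lqNorm_const_mul hκ, mul_left_comm]
          exact mul_le_mul' le_rfl (hPE k m)
      _ ≤ C₁ * lqNorm κ fun d : ℕ => lqNorm p fun m =>
          weightCoef p t k m * ∑ ν ∈ nbrs n R', fineDiff l r k d (m + ν) f := by
          rw [lqNorm_const_mul hp]
          exact mul_le_mul' le_rfl (lqNorm_lqNorm_le hκ hκt hκp
            fun (d : ℕ) m => weightCoef p t k m * ∑ ν ∈ nbrs n R', fineDiff l r k d (m + ν) f)
      _ ≤ C₁ * (C₂ * lqNorm κ fun d : ℕ => ρ ^ d * A (k + d)) := by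
          rw [← lqNorm_const_mul hκ C₂]
          exact mul_le_mul' le_rfl (lqNorm_mono fun d => h₂ k d f)
      _ ≤ C₁ * (C₂ * lqNorm κ fun j : ℕ => ρ ^ ((j : ℤ) - k).natAbs * A j) := by
          refine mul_le_mul' le_rfl (mul_le_mul' le_rfl ?_)
          refine le_of_eq_of_le ?_ (lqNorm_comp_le (e := fun d => k + d) (add_right_injective k)
            fun j : ℕ => ρ ^ ((j : ℤ) - k).natAbs * A j)
          have : ∀ d : ℕ, (((k + d : ℕ) : ℤ) - k).natAbs = d := fun d => by omega
          simp only [this]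
      _ = _ := (mul_assoc _ _ _).symm
  refine (lqNorm_le_of_geometric hκ hκt hκq h3).trans ?_
  rw [mul_assoc (C₁ * C₂)]
  exact mul_le_mul' le_rfl (mul_le_mul' le_rfl (lqNorm_cubeDiff_le_besovNorm hp f))

end Approximation

/-! ### Spline coefficients obtained from local polynomials -/

section Coefficients

variable {n l : ℕ} {r : ℝ≥0∞}

/-- The coefficient uses the polynomial only at points within `R + l` cells of `M`, where its values
are bounded by its normalized quasi-norm over the cube. -/
theorem exists_enorm_sampleCoef_le (n l R : ℕ) (w : ℕ → ℝ) (hr : r ≠ 0) : ∃ C : ℝ≥0∞, C ≠ ∞ ∧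
    ∀ P ∈ polySpace n l, ∀ k (m M : Fin n → ℤ), (∀ i, |m i - M i| ≤ R) →
      ‖sampleCoef w l k P m‖ₑ ≤
        C * (scale r n k * eLpNorm P r (volume.restrict (dyadicCubeIco k M))) := by
  obtain ⟨C, hC, h⟩ := exists_enorm_le_scale_mul_eLpNorm n l (R + l) hr
  refine ⟨∑ ν ∈ Fintype.piFinset fun _ : Fin n => Finset.range (l + 1), ‖∏ i, w (ν i)‖ₑ * C,
    ENNReal.sum_ne_top.2 fun ν _ => ENNReal.mul_ne_top enorm_ne_top hC, fun P hP k m M hm => ?_⟩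
  rw [sampleCoef, Finset.sum_mul]
  refine (enorm_sum_le _ _).trans (Finset.sum_le_sum fun ν hν => ?_)
  rw [enorm_mul, mul_assoc]
  refine mul_le_mul' le_rfl (h P hP k M _ fun i => ?_)
  have h1 : ν i < l + 1 := Finset.mem_range.1 (Fintype.mem_piFinset.1 hν i)
  have h2 : (2 : ℝ) ^ k * (((m i : ℝ) + ν i) / 2 ^ k) - M i = ((m i - M i + ν i : ℤ) : ℝ) := by
    push_cast
    field_simp
    ring
  have h3 : |m i - M i + ν i| ≤ ((R + l : ℕ) : ℤ) := by
    have := abs_le.1 (hm i)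
    rw [abs_le]
    push_cast
    constructor <;> omega
  rw [h2, ← Int.cast_abs]
  exact_mod_cast h3

theorem measurable_of_mem_polySpace {P : (Fin n → ℝ) → ℝ} (hP : P ∈ polySpace n l) : Measurable P :=
  (continuous_of_mem_polySpace hP).measurable

theorem exists_eLpNorm_sub_le_add (hr : r ≠ 0) : ∃ C : ℝ≥0∞, C ≠ ∞ ∧
    ∀ (f P Q : (Fin n → ℝ) → ℝ) (μ : Measure (Fin n → ℝ)), Measurable f → Measurable P →
      Measurable Q → eLpNorm (P - Q) r μ ≤
        C * (eLpNorm (fun x => f x - P x) r μ + eLpNorm (fun x => f x - Q x) r μ) := by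
  obtain ⟨C, hC, h⟩ := exists_eLpNorm_sum_le (ι := Fin 2) hr
  refine ⟨C, hC, fun f P Q μ hf hP hQ => ?_⟩
  have h1 := h μ ![fun x => ‖f x - P x‖ₑ, fun x => ‖f x - Q x‖ₑ] fun j => by
    fin_cases j
    · exact (hf.sub hP).enorm.aemeasurable
    · exact (hf.sub hQ).enorm.aemeasurable
  simp only [Fin.sum_univ_two, Matrix.cons_val_zero, Matrix.cons_val_one, eLpNorm_enorm] at h1
  refine le_trans (eLpNorm_mono_enorm fun x => ?_) h1
  rw [enorm_eq_self, Pi.sub_apply, show P x - Q x = (f x - Q x) - (f x - P x) by ring]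
  exact enorm_sub_le.trans_eq (add_comm _ _)

theorem exists_enorm_sampleCoef_sub_le (n l R : ℕ) (w : ℕ → ℝ) (hr : r ≠ 0) : ∃ C : ℝ≥0∞, C ≠ ∞ ∧
    ∀ (f : (Fin n → ℝ) → ℝ), Measurable f → ∀ P ∈ polySpace n l, ∀ Q ∈ polySpace n l,
      ∀ k (m M : Fin n → ℤ), (∀ i, |m i - M i| ≤ R) →
      ‖sampleCoef w l k P m - sampleCoef w l k Q m‖ₑ ≤
        C * (scale r n k * eLpNorm (fun x => f x - P x) r (volume.restrict (dyadicCubeIco k M)) +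
          scale r n k * eLpNorm (fun x => f x - Q x) r (volume.restrict (dyadicCubeIco k M))) := by
  obtain ⟨C, hC, h⟩ := exists_enorm_sampleCoef_le n l R w hr
  obtain ⟨D, hD, h'⟩ := exists_eLpNorm_sub_le_add (n := n) hr
  refine ⟨C * D, by finiteness, fun f hf P hP Q hQ k m M hm => ?_⟩
  have h1 := h (P - Q) (Submodule.sub_mem _ hP hQ) k m M hm
  rw [sampleCoef_sub, Pi.sub_apply] at h1
  refine h1.trans ?_
  rw [← mul_add, mul_assoc, mul_left_comm D]
  exact mul_le_mul' le_rfl (mul_le_mul' le_rfl (h' f P Q _ hf (measurable_of_mem_polySpace hP)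
    (measurable_of_mem_polySpace hQ)))

theorem eLpNorm_le_approxErr {R k : ℕ} {m M : Fin n → ℤ} (h : ∀ i, |M i - m i| ≤ R)
    (f P : (Fin n → ℝ) → ℝ) :
    scale r n k * eLpNorm (fun x => f x - P x) r (volume.restrict (dyadicCubeIco k M)) ≤
      approxErr r R k m f P := by
  have h1 : M - m ∈ nbrs n R := mem_nbrs.2 h
  have h2 := Finset.single_le_sum (f := fun ν => eLpNorm (fun x => f x - P x) r
    (volume.restrict (dyadicCubeIco k (m + ν)))) (fun _ _ => bot_le) h1
  simp only [add_sub_cancel] at h2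
  exact mul_le_mul' le_rfl h2

theorem exists_enorm_refineCoef_le (n l : ℕ) : ∃ C : ℝ≥0∞, C ≠ ∞ ∧
    ∀ (c : (Fin n → ℤ) → ℝ) (m : Fin n → ℤ), ‖refineCoef l c m‖ₑ ≤
      C * ∑ ν ∈ nbrs n (l + 1), ‖c (parent 1 m + ν)‖ₑ := by
  refine ⟨∑ ν ∈ Fintype.piFinset fun _ : Fin n => Finset.range (l + 2), ‖∏ i, maskCoef l (ν i)‖ₑ,
    ENNReal.sum_ne_top.2 fun ν _ => enorm_ne_top, fun c m => ?_⟩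
  rw [refineCoef, Finset.sum_mul]
  refine (enorm_sum_le _ _).trans (Finset.sum_le_sum fun ν hν => ?_)
  split_ifs
  · rw [enorm_mul]
    refine mul_le_mul' le_rfl ?_
    have h1 : (fun i => (m i - ν i) / 2) - parent 1 m ∈ nbrs n (l + 1) := mem_nbrs.2 fun i => by
      have := Finset.mem_range.1 (Fintype.mem_piFinset.1 hν i)
      simp only [Pi.sub_apply, parent]
      rw [abs_le]
      push_cast
      constructor <;> omega
    have h2 := Finset.single_le_sum (f := fun ν => ‖c (parent 1 m + ν)‖ₑ) (fun _ _ => bot_le) h1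
    simpa only [add_sub_cancel] using h2
  · simp

/-- The coefficients at level `k` of the spline which near `Q_{k,m}` is close to `P k m`. -/
noncomputable def polyCoef (w : ℕ → ℝ) (l : ℕ) (P : ℕ → (Fin n → ℤ) → (Fin n → ℝ) → ℝ) (k : ℕ)
    (m : Fin n → ℤ) : ℝ := sampleCoef w l k (P k m) m

/-- The coefficients of the increments of a sequence of splines. -/
noncomputable def incrCoef (l : ℕ) (c : ℕ → (Fin n → ℤ) → ℝ) : ℕ → (Fin n → ℤ) → ℝ
  | 0 => c 0
  | k + 1 => c (k + 1) - refineCoef l (c k)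

/-- The sum telescopes because refining the coefficients does not change the spline. -/
theorem sum_splineLevel_incrCoef (l : ℕ) (c : ℕ → (Fin n → ℤ) → ℝ) (J : ℕ) (x : Fin n → ℝ) :
    ∑ k ∈ Finset.range (J + 1), splineLevel l (incrCoef l c) k x = splineOf l J (c J) x := by
  induction J with
  | zero => rw [zero_add, Finset.sum_range_one]; rfl
  | succ J ih =>
    have h1 : splineLevel l (incrCoef l c) (J + 1) x =
        splineOf l (J + 1) (c (J + 1) - refineCoef l (c J)) x := rfl
    rw [Finset.sum_range_succ, ih, h1, splineOf_sub, splineOf_refineCoef]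
    ring

variable {w : ℕ → ℝ}

/-- On one cube the local polynomial `Q` is reproduced exactly. What remains is a spline whose
coefficients sample the differences of neighbouring polynomials from `Q`, and these are bounded by
the errors on neighbouring cubes. -/
theorem exists_eLpNorm_sub_splineOf_le (hr : r ≠ 0) {R : ℕ} (hR : l ≤ R)
    (hw : ∀ P ∈ polySpace n l, ∀ k, splineOf l k (sampleCoef w l k P) = P) :
    ∃ C : ℝ≥0∞, C ≠ ∞ ∧ ∀ (f : (Fin n → ℝ) → ℝ) (P : ℕ → (Fin n → ℤ) → (Fin n → ℝ) → ℝ),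
      Measurable f → (∀ k m, P k m ∈ polySpace n l) → ∀ k m,
      scale r n k * eLpNorm (fun x => f x - splineOf l k (polyCoef w l P k) x) r
        (volume.restrict (dyadicCubeIco k m)) ≤
        C * ∑ ν ∈ nbrs n l, approxErr r R k (m + ν) f (P k (m + ν)) := by
  obtain ⟨C₁, hC₁, h₁⟩ := exists_eLpNorm_sum_le (ι := Fin 2) hr
  obtain ⟨C₂, hC₂, h₂⟩ := exists_enorm_sampleCoef_sub_le n l l w hr
  set D := ENNReal.ofReal (((2 : ℝ) ^ l) ^ n) with hD
  refine ⟨C₁ * (1 + D * (C₂ * (1 + (nbrs n l).card))), by finiteness, fun f P hf hP k m => ?_⟩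
  set c := polyCoef w l P k with hc
  set Q := P k m with hQ
  set d := c - sampleCoef w l k Q with hd
  set E : (Fin n → ℤ) → ℝ≥0∞ := fun M => approxErr r R k M f (P k M) with hE
  have hS : ∀ x, f x - splineOf l k c x = (f x - Q x) - splineOf l k d x := fun x => by
    rw [hd, splineOf_sub, hw Q (hP k m) k]
    ring
  have h3 := h₁ (volume.restrict (dyadicCubeIco k m)) ![fun x => ‖f x - Q x‖ₑ,
    fun x => ‖splineOf l k d x‖ₑ] fun j => by
      fin_cases j
      · exact (hf.sub (measurable_of_mem_polySpace (hP k m))).enorm.aemeasurable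
      · exact (measurable_splineOf l k d).enorm.aemeasurable
  simp only [Fin.sum_univ_two, Matrix.cons_val_zero, Matrix.cons_val_one, eLpNorm_enorm] at h3
  have h4 : eLpNorm (fun x => f x - splineOf l k c x) r (volume.restrict (dyadicCubeIco k m)) ≤
      C₁ * (eLpNorm (fun x => f x - Q x) r (volume.restrict (dyadicCubeIco k m)) +
        eLpNorm (splineOf l k d) r (volume.restrict (dyadicCubeIco k m))) := by
    refine le_trans (eLpNorm_mono_enorm fun x => ?_) h3
    rw [enorm_eq_self, hS]
    exact enorm_sub_le
  have hE0 : E m ≤ ∑ ν ∈ nbrs n l, E (m + ν) := by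
    have h5 : (0 : Fin n → ℤ) ∈ nbrs n l := mem_nbrs.2 fun i => by simp
    simpa using Finset.single_le_sum (f := fun ν => E (m + ν)) (fun _ _ => bot_le) h5
  have h6 : ∀ ν ∈ nbrs n l, ‖d (m + ν)‖ₑ ≤ C₂ * (E (m + ν) + E m) := by
    intro ν hν
    refine (h₂ f hf (P k (m + ν)) (hP _ _) Q (hP _ _) k (m + ν) m fun i => ?_).trans
      (mul_le_mul' le_rfl (add_le_add (eLpNorm_le_approxErr (fun i => ?_) _ _)
        (eLpNorm_le_approxErr (fun i => by simp) _ _)))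
    · simpa using mem_nbrs.1 hν i
    · have := mem_nbrs.1 hν i
      simp only [Pi.add_apply, sub_add_cancel_left, abs_neg]
      exact this.trans (by exact_mod_cast hR)
  have h7 : scale r n k * eLpNorm (splineOf l k d) r (volume.restrict (dyadicCubeIco k m)) ≤
      D * (C₂ * (1 + (nbrs n l).card)) * ∑ ν ∈ nbrs n l, E (m + ν) := by
    calc _ ≤ scale r n k * (D * (scale r n k)⁻¹ * ∑ ν ∈ nbrs n l, ‖d (m + ν)‖ₑ) :=
          mul_le_mul' le_rfl (eLpNorm_splineOf_le hr l k d m)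
      _ = D * (scale r n k * (scale r n k)⁻¹) * ∑ ν ∈ nbrs n l, ‖d (m + ν)‖ₑ := by ring
      _ = D * ∑ ν ∈ nbrs n l, ‖d (m + ν)‖ₑ := by
          rw [ENNReal.mul_inv_cancel (scale_ne_zero r n k) (scale_ne_top r n k), mul_one]
      _ ≤ D * ∑ ν ∈ nbrs n l, C₂ * (E (m + ν) + E m) :=
          mul_le_mul' le_rfl (Finset.sum_le_sum h6)
      _ = D * (C₂ * (∑ ν ∈ nbrs n l, E (m + ν) + (nbrs n l).card * E m)) := by
          rw [← Finset.mul_sum, Finset.sum_add_distrib, Finset.sum_const, nsmul_eq_mul]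
      _ ≤ D * (C₂ * (∑ ν ∈ nbrs n l, E (m + ν) + (nbrs n l).card * ∑ ν ∈ nbrs n l, E (m + ν))) := by
          gcongr
      _ = _ := by ring
  calc _ ≤ scale r n k * (C₁ * (eLpNorm (fun x => f x - Q x) r (volume.restrict (dyadicCubeIco k m)) +
        eLpNorm (splineOf l k d) r (volume.restrict (dyadicCubeIco k m)))) := mul_le_mul' le_rfl h4
    _ = C₁ * (scale r n k * eLpNorm (fun x => f x - Q x) r (volume.restrict (dyadicCubeIco k m)) +
        scale r n k * eLpNorm (splineOf l k d) r (volume.restrict (dyadicCubeIco k m))) := by ring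
    _ ≤ C₁ * (∑ ν ∈ nbrs n l, E (m + ν) +
          D * (C₂ * (1 + (nbrs n l).card)) * ∑ ν ∈ nbrs n l, E (m + ν)) :=
        mul_le_mul' le_rfl (add_le_add ((eLpNorm_le_approxErr (fun i => by simp) _ _).trans hE0) h7)
    _ = _ := by ring

/-- The polynomial `Q` of the parent cube is subtracted at both levels. Its contributions cancel
because refinement of its samples gives its samples at the next level; only differences of
polynomials that approximate `f` nearby remain. -/
theorem exists_enorm_incrCoef_succ_le (hr : r ≠ 0) {R : ℕ} (hR : l + 1 ≤ R)
    (hw : ∀ P ∈ polySpace n l, ∀ k, refineCoef l (sampleCoef w l k P) = sampleCoef w l (k + 1) P) :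
    ∃ C : ℝ≥0∞, C ≠ ∞ ∧ ∀ (f : (Fin n → ℝ) → ℝ) (P : ℕ → (Fin n → ℤ) → (Fin n → ℝ) → ℝ),
      Measurable f → (∀ k m, P k m ∈ polySpace n l) → ∀ k m,
      ‖incrCoef l (polyCoef w l P) (k + 1) m‖ₑ ≤
        C * (approxErr r R (k + 1) m f (P (k + 1) m) +
          ∑ ν ∈ nbrs n (l + 1), approxErr r R k (parent 1 m + ν) f (P k (parent 1 m + ν))) := by
  obtain ⟨C₁, hC₁, h₁⟩ := exists_enorm_sampleCoef_sub_le n l (l + 1) w hr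
  obtain ⟨C₂, hC₂, h₂⟩ := exists_enorm_refineCoef_le n l
  have hs := scale_ne_top r n 1
  refine ⟨C₁ * (1 + scale r n 1) + C₂ * (C₁ * (1 + (nbrs n (l + 1)).card)), by finiteness,
    fun f P hf hP k m => ?_⟩
  set M := parent 1 m with hM
  set Q := P k M with hQ
  set E : (Fin n → ℤ) → ℝ≥0∞ := fun M => approxErr r R k M f (P k M) with hE
  set S := ∑ ν ∈ nbrs n (l + 1), E (M + ν) with hS
  have hE0 : E M ≤ S := by
    have h5 : (0 : Fin n → ℤ) ∈ nbrs n (l + 1) := mem_nbrs.2 fun i => by simp; positivity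
    simpa using Finset.single_le_sum (f := fun ν => E (M + ν)) (fun _ _ => bot_le) h5
  set d := polyCoef w l P k - sampleCoef w l k Q with hd
  have h3 : incrCoef l (polyCoef w l P) (k + 1) m =
      (sampleCoef w l (k + 1) (P (k + 1) m) m - sampleCoef w l (k + 1) Q m) - refineCoef l d m := by
    have e1 : polyCoef w l P k = d + sampleCoef w l k Q := by rw [hd]; ring
    have e2 : incrCoef l (polyCoef w l P) (k + 1) m =
      sampleCoef w l (k + 1) (P (k + 1) m) m - refineCoef l (polyCoef w l P k) m := rfl
    rw [e2, e1, refineCoef_add, hw Q (hP _ _) k, Pi.add_apply]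
    ring
  have h4 : ‖sampleCoef w l (k + 1) (P (k + 1) m) m - sampleCoef w l (k + 1) Q m‖ₑ ≤
      C₁ * (approxErr r R (k + 1) m f (P (k + 1) m) + scale r n 1 * E M) := by
    refine (h₁ f hf (P (k + 1) m) (hP _ _) Q (hP _ _) (k + 1) m m fun i => by simp; positivity).trans
      (mul_le_mul' le_rfl (add_le_add (eLpNorm_le_approxErr (fun i => by simp) _ _) ?_))
    have h7 : dyadicCubeIco (k + 1) m ⊆ dyadicCubeIco k M := by
      rw [dyadicCubeIco_eq_iUnion k 1 M]
      exact Set.subset_iUnion (fun m' : {m' // parent 1 m' = M} =>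
        dyadicCubeIco (k + 1) (m' : Fin n → ℤ)) ⟨m, rfl⟩
    rw [scale_add, mul_comm (scale r n k), mul_assoc]
    refine mul_le_mul' le_rfl (le_trans (mul_le_mul' le_rfl (eLpNorm_mono_measure _
      (Measure.restrict_mono h7 le_rfl))) (eLpNorm_le_approxErr (fun i => by simp) _ _))
  have h6 : ∀ ν ∈ nbrs n (l + 1), ‖d (M + ν)‖ₑ ≤ C₁ * (E (M + ν) + E M) := by
    intro ν hν
    refine (h₁ f hf (P k (M + ν)) (hP _ _) Q (hP _ _) k (M + ν) M fun i => ?_).trans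
      (mul_le_mul' le_rfl (add_le_add (eLpNorm_le_approxErr (fun i => ?_) _ _)
        (eLpNorm_le_approxErr (fun i => by simp) _ _)))
    · simpa using mem_nbrs.1 hν i
    · have := mem_nbrs.1 hν i
      simp only [Pi.add_apply, sub_add_cancel_left, abs_neg]
      exact this.trans (by exact_mod_cast hR)
  have h8 : ‖refineCoef l d m‖ₑ ≤ C₂ * (C₁ * (1 + (nbrs n (l + 1)).card)) * S := by
    calc _ ≤ C₂ * ∑ ν ∈ nbrs n (l + 1), ‖d (M + ν)‖ₑ := h₂ d m
      _ ≤ C₂ * ∑ ν ∈ nbrs n (l + 1), C₁ * (E (M + ν) + E M) :=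
          mul_le_mul' le_rfl (Finset.sum_le_sum h6)
      _ = C₂ * (C₁ * (S + (nbrs n (l + 1)).card * E M)) := by
          rw [← Finset.mul_sum, Finset.sum_add_distrib, Finset.sum_const, nsmul_eq_mul]
      _ ≤ C₂ * (C₁ * (S + (nbrs n (l + 1)).card * S)) := by gcongr
      _ = _ := by ring
  generalize approxErr r R (k + 1) m f (P (k + 1) m) = A at h4 ⊢
  rw [h3]
  calc _ ≤ C₁ * (A + scale r n 1 * E M) + C₂ * (C₁ * (1 + (nbrs n (l + 1)).card)) * S :=
        enorm_sub_le.trans (add_le_add h4 h8)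
    _ ≤ C₁ * (A + scale r n 1 * S) + C₂ * (C₁ * (1 + (nbrs n (l + 1)).card)) * S := by gcongr
    _ ≤ C₁ * (A + scale r n 1 * S) + C₂ * (C₁ * (1 + (nbrs n (l + 1)).card)) * S +
          (C₁ * (scale r n 1 * A + S) + C₂ * (C₁ * (1 + (nbrs n (l + 1)).card)) * A) := le_self_add
    _ = _ := by ring

theorem exists_enorm_incrCoef_zero_le (n l R : ℕ) (w : ℕ → ℝ) (hr : r ≠ 0) :
    ∃ C : ℝ≥0∞, C ≠ ∞ ∧ ∀ (f : (Fin n → ℝ) → ℝ) (P : ℕ → (Fin n → ℤ) → (Fin n → ℝ) → ℝ),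
      Measurable f → (∀ k m, P k m ∈ polySpace n l) → ∀ m,
      ‖incrCoef l (polyCoef w l P) 0 m‖ₑ ≤
        C * (approxErr r R 0 m f (P 0 m) + eLpNorm f r (volume.restrict (dyadicCubeIco 0 m))) := by
  obtain ⟨C, hC, h⟩ := exists_enorm_sampleCoef_sub_le n l 0 w hr
  refine ⟨C, hC, fun f P hf hP m => ?_⟩
  have h1 := h f hf (P 0 m) (hP _ _) 0 (Submodule.zero_mem _) 0 m m fun i => by simp
  have e1 : sampleCoef w l 0 (0 : (Fin n → ℝ) → ℝ) m = 0 := by simp [sampleCoef]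
  have e2 : incrCoef l (polyCoef w l P) 0 m = sampleCoef w l 0 (P 0 m) m := rfl
  rw [e1, sub_zero, ← e2] at h1
  refine h1.trans (mul_le_mul' le_rfl (add_le_add
    (eLpNorm_le_approxErr (fun i => by simp) _ _) ?_))
  simp [scale_zero]

end Coefficients

/-! ### Norm estimate and convergence of the series of increments -/

section SplineExpansion

variable {n l : ℕ} {p q r ρ : ℝ≥0∞}

theorem lqNorm_single_le {q : ℝ≥0∞} (hq : q ≠ 0) (F : ℝ≥0∞) :
    (lqNorm q fun k : ℕ => if k = 0 then F else 0) ≤ F := by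
  rcases eq_or_ne q ∞ with rfl | hqt
  · rw [lqNorm_top]
    refine iSup_le fun k => ?_
    split_ifs <;> simp
  · have h0 : 0 < q.toReal := ENNReal.toReal_pos hq hqt
    rw [lqNorm_eq_tsum hqt, tsum_eq_single 0 fun k hk => by simp [hk, h0]]
    rw [if_pos rfl, ← ENNReal.rpow_mul, mul_one_div_cancel h0.ne', ENNReal.rpow_one]

/-- The shift by one level is treated as a convolution with kernel `2 ^ (-|d|)`. The constant `3 = 1
+ 2` pays for weight `1` at the level itself and weight `1/2` at the preceding one. -/
theorem exists_lqNorm_le_of_le_add_pred {κ : ℝ≥0∞} (hκ : κ ≠ 0) (hκt : κ ≠ ∞) (hκq : κ ≤ q) :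
    ∃ C : ℝ≥0∞, C ≠ ∞ ∧ ∀ (A X : ℕ → ℝ≥0∞) (F : ℝ≥0∞), X 0 ≤ A 0 + F →
      (∀ k, X (k + 1) ≤ A (k + 1) + A k) → lqNorm q X ≤ C * (lqNorm q A + F) := by
  have hq : q ≠ 0 := (hκ.bot_lt.trans_le hκq).ne'
  obtain ⟨C, hC, h⟩ := exists_lqNorm_sum_le (ι := Fin 2) hq
  have hG := lqNorm_geometric_ne_top hκ hκt (ρ := 2⁻¹) (by simp)
  have h2 : (2 : ℝ≥0∞)⁻¹ ≠ 0 := by simp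
  refine ⟨3 * ((lqNorm κ fun d : ℤ => (2⁻¹ : ℝ≥0∞) ^ d.natAbs) * C), by finiteness,
    fun A X F h0 hs => ?_⟩
  set B : ℕ → ℝ≥0∞ := fun k => A k + if k = 0 then F else 0 with hB
  have hAB : ∀ k, A k ≤ B k := fun k => le_self_add
  have h3 : lqNorm q B ≤ C * (lqNorm q A + F) := by
    have h4 := h ![A, fun k : ℕ => if k = 0 then F else 0]
    simp only [Fin.sum_univ_two, Matrix.cons_val_zero, Matrix.cons_val_one] at h4
    exact h4.trans (mul_le_mul' le_rfl (add_le_add le_rfl (lqNorm_single_le hq F)))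
  have h5 : ∀ i, X i ≤ 3 * lqNorm κ fun j : ℕ => (2⁻¹ : ℝ≥0∞) ^ ((j : ℤ) - i).natAbs * B j := by
    intro i
    set N := lqNorm κ fun j : ℕ => (2⁻¹ : ℝ≥0∞) ^ ((j : ℤ) - i).natAbs * B j with hN
    have h6 : B i ≤ N := by
      simpa using le_lqNorm hκ (fun j : ℕ => (2⁻¹ : ℝ≥0∞) ^ ((j : ℤ) - i).natAbs * B j) i
    cases i with
    | zero =>
      calc X 0 ≤ B 0 := by simpa [hB] using h0
        _ ≤ N := h6
        _ ≤ 3 * N := le_mul_of_one_le_left' (by norm_num)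
    | succ k =>
      have h7 := le_lqNorm hκ (fun j : ℕ => (2⁻¹ : ℝ≥0∞) ^ ((j : ℤ) - (k + 1 : ℕ)).natAbs * B j) k
      have e : ((k : ℤ) - (k + 1 : ℕ)).natAbs = 1 := by omega
      simp only [e, pow_one] at h7
      have h8 : B k ≤ 2 * N := by
        calc B k = 2 * (2⁻¹ * B k) := by
              rw [← mul_assoc, ENNReal.mul_inv_cancel (by simp) (by simp), one_mul]
          _ ≤ 2 * N := mul_le_mul' le_rfl h7
      calc X (k + 1) ≤ B (k + 1) + B k := (hs k).trans (add_le_add (hAB _) (hAB _))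
        _ ≤ N + 2 * N := add_le_add h6 h8
        _ = 3 * N := by ring
  refine (lqNorm_le_of_geometric hκ hκt hκq h5).trans ?_
  rw [mul_assoc, mul_assoc]
  exact mul_le_mul' le_rfl (mul_le_mul' le_rfl h3)

/-- The property `coarse` with `d = 1`, since `b` is constant on the children of a cube. -/
theorem CoefWeight.exists_lqNorm_parent_le {τ : ℕ → (Fin n → ℤ) → ℝ≥0∞}
    (hτ : CoefWeight p r l ρ τ) (hp : p ≠ 0) (hρ : ρ ≤ 1) : ∃ C : ℝ≥0∞, C ≠ ∞ ∧
    ∀ k (b : (Fin n → ℤ) → ℝ≥0∞), (lqNorm p fun m => τ (k + 1) m * b (parent 1 m)) ≤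
      C * lqNorm p fun m => τ k m * b m := by
  obtain ⟨C, hC, h⟩ := hτ.coarse
  refine ⟨C * 2 ^ l, by finiteness, fun k b => ?_⟩
  rw [← lqNorm_fiberwise hp (parent 1), ← lqNorm_const_mul hp]
  refine lqNorm_mono fun m => ?_
  calc _ = lqNorm p fun m' : {m' // parent 1 m' = m} => b m * τ (k + 1) m' := by
        refine congrArg _ (funext fun m' => ?_)
        rw [m'.2, mul_comm]
    _ = b m * lqNorm p fun m' : {m' // parent 1 m' = m} => τ (k + 1) m' := lqNorm_const_mul hp _ _
    _ ≤ b m * (C * ρ ^ 1 * 2 ^ (l * 1) * τ k m) := mul_le_mul' le_rfl (h k 1 m)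
    _ ≤ b m * (C * 1 * 2 ^ l * τ k m) := by
        rw [pow_one, mul_one]
        gcongr
    _ = _ := by ring

theorem lqNorm_weightCoef_eLpNorm_le (hp : p ≠ 0) {t : ℕ → (Fin n → ℝ) → ℝ} (f : (Fin n → ℝ) → ℝ) :
    (lqNorm p fun m => weightCoef p t 0 m * eLpNorm f r (volume.restrict (dyadicCubeIco 0 m))) ≤
      besovNorm l p q r t f := by
  refine le_trans (le_eLpNorm_weight_mul hp
    (b := fun m => eLpNorm f r (volume.restrict (dyadicCubeIco 0 m))) fun x => ?_) le_add_self
  have h1 := dyadicCubeIco_subset_cubeAt 0 x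
  rw [pow_zero, inv_one] at h1
  exact eLpNorm_mono_measure _ (Measure.restrict_mono h1 le_rfl)

/-- The splines associated with local polynomial approximations have coefficients controlled by the
approximation errors. -/
theorem CoefWeight.exists_coefNorm_incrCoef_le {κ : ℝ≥0∞} (hp : p ≠ 0) (hr : r ≠ 0) (hκ : κ ≠ 0)
    (hκt : κ ≠ ∞) (hκq : κ ≤ q) (hρ : ρ ≤ 1) {t : ℕ → (Fin n → ℝ) → ℝ}
    (hτ : CoefWeight p r l ρ (weightCoef p t)) {R : ℕ} (hR : l + 1 ≤ R) {w : ℕ → ℝ}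
    (hw : ∀ P ∈ polySpace n l, ∀ k, refineCoef l (sampleCoef w l k P) = sampleCoef w l (k + 1) P) :
    ∃ C : ℝ≥0∞, C ≠ ∞ ∧ ∀ (f : (Fin n → ℝ) → ℝ) (P : ℕ → (Fin n → ℤ) → (Fin n → ℝ) → ℝ),
      Measurable f → (∀ k m, P k m ∈ polySpace n l) →
      coefNorm p q t (incrCoef l (polyCoef w l P)) ≤
        C * ((lqNorm q fun k => lqNorm p fun m =>
          weightCoef p t k m * approxErr r R k m f (P k m)) + besovNorm l p q r t f) := by
  obtain ⟨C₁, hC₁, h₁⟩ := exists_enorm_incrCoef_succ_le hr hR hw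
  obtain ⟨C₂, hC₂, h₂⟩ := exists_enorm_incrCoef_zero_le n l R w hr
  obtain ⟨C₃, hC₃, h₃⟩ := exists_lqNorm_sum_le (ι := Fin 2) hp
  obtain ⟨C₄, hC₄, h₄⟩ := hτ.exists_lqNorm_parent_le hp hρ
  obtain ⟨C₅, hC₅, h₅⟩ := hτ.exists_lqNorm_nbrs_le hp (l + 1)
  obtain ⟨C₆, hC₆, h₆⟩ := exists_lqNorm_le_of_le_add_pred hκ hκt hκq
  have hq : q ≠ 0 := (hκ.bot_lt.trans_le hκq).ne'
  obtain ⟨D, hD⟩ : ∃ D, D = (C₁ + C₂) * C₃ * (1 + C₄ * C₅) := ⟨_, rfl⟩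
  have hDt : D ≠ ∞ := by rw [hD]; finiteness
  refine ⟨C₆ * D, by finiteness, fun f P hf hP => ?_⟩
  set β := incrCoef l (polyCoef w l P) with hβ
  set E : ℕ → (Fin n → ℤ) → ℝ≥0∞ := fun k m => approxErr r R k m f (P k m) with hE
  set A : ℕ → ℝ≥0∞ := fun k => lqNorm p fun m => weightCoef p t k m * E k m with hA
  set F := besovNorm l p q r t f with hF
  have hsum : ∀ (k : ℕ) (a b : (Fin n → ℤ) → ℝ≥0∞),
      (lqNorm p fun m => weightCoef p t k m * (a m + b m)) ≤
        C₃ * ((lqNorm p fun m => weightCoef p t k m * a m) +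
          lqNorm p fun m => weightCoef p t k m * b m) := by
    intro k a b
    have h7 := h₃ ![fun m => weightCoef p t k m * a m, fun m => weightCoef p t k m * b m]
    simpa only [Fin.sum_univ_two, Matrix.cons_val_zero, Matrix.cons_val_one, mul_add] using h7
  have hzero : (lqNorm p fun m => weightCoef p t 0 m * ‖β 0 m‖ₑ) ≤ D * A 0 + D * F := by
    calc _ ≤ lqNorm p fun m => C₂ * (weightCoef p t 0 m *
          (E 0 m + eLpNorm f r (volume.restrict (dyadicCubeIco 0 m)))) := by
          refine lqNorm_mono fun m => ?_
          rw [mul_left_comm]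
          exact mul_le_mul' le_rfl (h₂ f P hf hP m)
      _ ≤ C₂ * (C₃ * (A 0 + F)) := by
          rw [lqNorm_const_mul hp]
          refine mul_le_mul' le_rfl ((hsum 0 _ _).trans (mul_le_mul' le_rfl (add_le_add le_rfl ?_)))
          exact lqNorm_weightCoef_eLpNorm_le hp f
      _ ≤ D * (A 0 + F) := by
          rw [← mul_assoc, hD]
          refine mul_le_mul' ?_ le_rfl
          calc C₂ * C₃ ≤ (C₁ + C₂) * C₃ * 1 := by rw [mul_one]; exact mul_le_mul' le_add_self le_rfl
            _ ≤ _ := mul_le_mul' le_rfl le_self_add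
      _ = _ := mul_add _ _ _
  have hsucc : ∀ k, (lqNorm p fun m => weightCoef p t (k + 1) m * ‖β (k + 1) m‖ₑ) ≤
      D * A (k + 1) + D * A k := by
    intro k
    calc _ ≤ lqNorm p fun m => C₁ * (weightCoef p t (k + 1) m *
          (E (k + 1) m + ∑ ν ∈ nbrs n (l + 1), E k (parent 1 m + ν))) := by
          refine lqNorm_mono fun m => ?_
          rw [mul_left_comm]
          exact mul_le_mul' le_rfl (h₁ f P hf hP k m)
      _ ≤ C₁ * (C₃ * (A (k + 1) + C₄ * (C₅ * A k))) := by
          rw [lqNorm_const_mul hp]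
          refine mul_le_mul' le_rfl ((hsum _ _ _).trans (mul_le_mul' le_rfl (add_le_add le_rfl ?_)))
          exact (h₄ k fun m => ∑ ν ∈ nbrs n (l + 1), E k (m + ν)).trans
            (mul_le_mul' le_rfl (h₅ k (E k)))
      _ ≤ (C₁ + C₂) * (C₃ * ((A (k + 1) + C₄ * C₅ * A k) + (C₄ * C₅ * A (k + 1) + A k))) := by
          rw [← mul_assoc C₄]
          exact mul_le_mul' le_self_add (mul_le_mul' le_rfl le_self_add)
      _ = _ := by rw [hD]; ring
  have h8 := h₆ (fun k => D * A k) (fun k => lqNorm p fun m => weightCoef p t k m * ‖β k m‖ₑ)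
    (D * F) hzero hsucc
  rw [lqNorm_const_mul hq, ← mul_add, ← mul_assoc] at h8
  exact h8

/-- The property `fine` between level zero and level `k` turns a bound uniform in `k` into decay of
order `ρ ^ k` over a fixed unit cube. -/
theorem CoefWeight.tendsto_eLpNorm_dyadicCubeIco {τ : ℕ → (Fin n → ℤ) → ℝ≥0∞}
    (hτ : CoefWeight p r l ρ τ) (hp : p ≠ 0) (hr : r ≠ 0) (hρ : ρ < 1) {g : ℕ → (Fin n → ℝ) → ℝ}
    {B : ℝ≥0∞} (hB : B ≠ ∞) (h : ∀ k, (lqNorm p fun m => τ k m * (scale r n k *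
      eLpNorm (g k) r (volume.restrict (dyadicCubeIco k m)))) ≤ B) (m : Fin n → ℤ) :
    Tendsto (fun k => eLpNorm (g k) r (volume.restrict (dyadicCubeIco 0 m))) atTop (𝓝 0) := by
  obtain ⟨C, hC, hfine⟩ := hτ.fine
  have h0 := hτ.ne_zero 0 m
  have ht := hτ.ne_top 0 m
  have h1 : ∀ k, eLpNorm (g k) r (volume.restrict (dyadicCubeIco 0 m)) ≤
      (τ 0 m)⁻¹ * (C * B) * ρ ^ k := by
    intro k
    have e1 := eLpNorm_dyadicCubeIco hr (g k) 0 k m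
    simp only [zero_add] at e1
    have h2 := hfine 0 k m fun m' => eLpNorm (g k) r (volume.restrict (dyadicCubeIco k m'))
    simp only [zero_add] at h2
    rw [← e1, mul_assoc (C * ρ ^ k), ← lqNorm_const_mul hp] at h2
    have h3 : (lqNorm p fun m' : {m' // parent k m' = m} => scale r n k * (τ k m' *
        eLpNorm (g k) r (volume.restrict (dyadicCubeIco k (m' : Fin n → ℤ))))) ≤ B := by
      simp only [mul_left_comm (scale r n k)]
      exact (lqNorm_comp_le (e := fun m' : {m' // parent k m' = m} => (m' : Fin n → ℤ))
        Subtype.val_injective fun m' => τ k m' * (scale r n k *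
          eLpNorm (g k) r (volume.restrict (dyadicCubeIco k m')))).trans (h k)
    calc _ = (τ 0 m)⁻¹ * (τ 0 m * eLpNorm (g k) r (volume.restrict (dyadicCubeIco 0 m))) := by
          rw [← mul_assoc, ENNReal.inv_mul_cancel h0 ht, one_mul]
      _ ≤ (τ 0 m)⁻¹ * (C * ρ ^ k * B) := mul_le_mul' le_rfl (h2.trans (mul_le_mul' le_rfl h3))
      _ = _ := by ring
  have h2 : Tendsto (fun k => (τ 0 m)⁻¹ * (C * B) * ρ ^ k) atTop (𝓝 ((τ 0 m)⁻¹ * (C * B) * 0)) :=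
    ENNReal.Tendsto.const_mul (ENNReal.tendsto_pow_atTop_nhds_zero_of_lt_one hρ)
      (Or.inr (ENNReal.mul_ne_top (ENNReal.inv_ne_top.2 h0) (by finiteness)))
  rw [mul_zero] at h2
  exact tendsto_of_tendsto_of_tendsto_of_le_of_le tendsto_const_nhds h2 (fun _ => bot_le) h1

theorem tendsto_eLpNorm_of_dyadicCubeIco (hr : r ≠ 0) {g : ℕ → (Fin n → ℝ) → ℝ}
    (h : ∀ m, Tendsto (fun k => eLpNorm (g k) r (volume.restrict (dyadicCubeIco 0 m))) atTop (𝓝 0))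
    {K : Set (Fin n → ℝ)} (hK : IsCompact K) :
    Tendsto (fun k => eLpNorm (g k) r (volume.restrict K)) atTop (𝓝 0) := by
  obtain ⟨R, hR⟩ := exists_subset_iUnion_nbrs hK 0
  obtain ⟨C, hC, h'⟩ := exists_eLpNorm_restrict_iUnion_le (ι := nbrs n R) hr
  have h1 : Tendsto (fun k => C * ∑ m : nbrs n R,
      eLpNorm (g k) r (volume.restrict (dyadicCubeIco 0 (m : Fin n → ℤ)))) atTop
      (𝓝 (C * ∑ _m : nbrs n R, 0)) :=
    ENNReal.Tendsto.const_mul (tendsto_finsetSum _ fun m _ => h m) (Or.inr hC)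
  rw [Finset.sum_const_zero, mul_zero] at h1
  exact tendsto_of_tendsto_of_tendsto_of_le_of_le tendsto_const_nhds h1 (fun _ => bot_le)
    fun k => h' volume (g k) _ K hR

theorem MemLpLoc.aemeasurable {f : (Fin n → ℝ) → ℝ} (hf : MemLpLoc f r) : AEMeasurable f volume := by
  have h1 : (⋃ m : Fin n → ℤ, dyadicCubeIco 0 m) = Set.univ :=
    Set.eq_univ_of_forall fun x => Set.mem_iUnion.2 ⟨cellIndex 0 x, mem_dyadicCubeIco.2 rfl⟩
  rw [← Measure.restrict_univ (μ := (volume : Measure (Fin n → ℝ))), ← h1, aemeasurable_iUnion_iff]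
  exact fun m => ((hf _ isCompact_Icc).aestronglyMeasurable.mono_measure
    (Measure.restrict_mono (dyadicCubeIco_subset_Icc 0 m) le_rfl)).aemeasurable

theorem SplineSeriesTendsto.congr {β : ℕ → (Fin n → ℤ) → ℝ} {f g : (Fin n → ℝ) → ℝ}
    (h : SplineSeriesTendsto l r β f) (hfg : f =ᵐ[volume] g) : SplineSeriesTendsto l r β g :=
  fun K hK => (h K hK).congr fun J => eLpNorm_congr_ae <| ae_restrict_of_ae <|
    hfg.mono fun x hx => by simp only [hx]

/-- The partial sums are the splines built from the local polynomials. Their normalized errors are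
bounded uniformly in the level, which gives convergence on compact sets, and the errors also bound
the coefficients of the increments. -/
theorem exists_splineSeries_coefNorm_le (hl : 0 < l) {κ : ℝ≥0∞} (hp : p ≠ 0) (hr : r ≠ 0)
    (hκ : κ ≠ 0) (hκ1 : κ ≤ 1) (hκp : κ ≤ p) (hκr : κ ≤ r) (hκq : κ ≤ q) (hρ : ρ < 1)
    {t : ℕ → (Fin n → ℝ) → ℝ} (hτ : CoefWeight p r l ρ (weightCoef p t)) :
    ∃ C : ℝ≥0∞, C ≠ ∞ ∧ ∀ f : (Fin n → ℝ) → ℝ, MemLpLoc f r → besovNorm l p q r t f < ∞ →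
      ∃ β : ℕ → (Fin n → ℤ) → ℝ, SplineSeriesTendsto l r β f ∧
        coefNorm p q t β ≤ C * besovNorm l p q r t f := by
  have hκt : κ ≠ ∞ := (hκ1.trans_lt ENNReal.one_lt_top).ne
  have hq : q ≠ 0 := (hκ.bot_lt.trans_le hκq).ne'
  obtain ⟨w, hw⟩ := exists_weights n l
  obtain ⟨C₁, hC₁, h₁⟩ := hτ.exists_approx hl hp hr hκ hκ1 hκp hκr hκq hρ (l + 1)
  obtain ⟨C₂, hC₂, h₂⟩ := hτ.exists_coefNorm_incrCoef_le hp hr hκ hκt hκq hρ.le le_rfl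
    fun P hP => (hw P hP).2
  obtain ⟨C₃, hC₃, h₃⟩ := exists_eLpNorm_sub_splineOf_le hr (Nat.le_succ l)
    fun P hP => (hw P hP).1
  obtain ⟨C₄, hC₄, h₄⟩ := hτ.exists_lqNorm_nbrs_le hp l
  refine ⟨C₂ * (C₁ + 1), by finiteness, fun f₀ hf₀ hB₀ => ?_⟩
  -- A measurable representative is chosen; neither the quasi-norm nor the convergence notices the
  -- change.
  obtain ⟨f, hf, hff⟩ := hf₀.aemeasurable
  rw [besovNorm_congr l p q r t hff] at hB₀ ⊢
  obtain ⟨P, hP, hE⟩ := h₁ f hf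
  refine ⟨incrCoef l (polyCoef w l P), SplineSeriesTendsto.congr (fun K hK => ?_) hff.symm, ?_⟩
  -- Partial sums run over `range J`, so the spline of level `J` is the partial sum with `J + 1`
  -- terms.
  · rw [← tendsto_add_atTop_iff_nat 1]
    simp only [sum_splineLevel_incrCoef]
    refine tendsto_eLpNorm_of_dyadicCubeIco hr (fun m => ?_) hK
    refine hτ.tendsto_eLpNorm_dyadicCubeIco hp hr hρ (B := C₃ * (C₄ * (C₁ * besovNorm l p q r t f)))
      (by finiteness) (fun k => ?_) m
    calc _ ≤ lqNorm p fun m => C₃ * (weightCoef p t k m *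
          ∑ ν ∈ nbrs n l, approxErr r (l + 1) k (m + ν) f (P k (m + ν))) := by
          refine lqNorm_mono fun m => ?_
          rw [mul_left_comm C₃]
          exact mul_le_mul' le_rfl (h₃ f P hf hP k m)
      _ ≤ C₃ * (C₄ * lqNorm p fun m => weightCoef p t k m * approxErr r (l + 1) k m f (P k m)) := by
          rw [lqNorm_const_mul hp]
          exact mul_le_mul' le_rfl (h₄ k fun m => approxErr r (l + 1) k m f (P k m))
      _ ≤ _ := mul_le_mul' le_rfl (mul_le_mul' le_rfl ((le_lqNorm hq (fun k => lqNorm p fun m =>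
          weightCoef p t k m * approxErr r (l + 1) k m f (P k m)) k).trans hE))
  · refine (h₂ f P hf hP).trans ?_
    rw [mul_assoc, add_mul, one_mul]
    exact mul_le_mul' le_rfl (add_le_add hE le_rfl)

end SplineExpansion

end VarBesov

/-! ### The two inequalities -/

theorem theorem4p2 (n l : ℕ) (hn : 1 ≤ n) (hl : 1 ≤ l)
    (p q r θ : ℝ≥0∞) (hp : 0 < p) (hq : 0 < q) (hr : 0 < r)
    (hθ : 0 < θ) (hθpr : θ ≤ min p r)
    (α₃ : ℝ) (hα₃ : 0 ≤ α₃)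
    (α₁ α₂ : ℕ → ℝ) (hα₁ : ∀ k, 0 < α₁ k) (hα₂ : ∀ k, 0 < α₂ k)
    (μ : ℝ≥0) (hμ : 0 < μ) (hμle : (μ : ℝ≥0∞) ≤ min 1 (min θ q))
    (hHardy₁ : HardyTail (q / μ)
      (fun k => (α₁ k / (2 : ℝ) ^ ((k : ℝ) * n * ((θ⁻¹).toReal - (r⁻¹).toReal))) ^ (μ : ℝ)))
    (hHardy₂ : HardyHead (q / μ)
      (fun k => ((2 : ℝ) ^ (-((k : ℝ) * l)) * α₂ k) ^ (μ : ℝ)))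
    (t : ℕ → (Fin n → ℝ) → ℝ) (ht : Admissible p t)
    (htX : WeightClass α₁ α₂ α₃ (θ * (ratioExp p θ).conjExponent) p p (avgWeight p t)) :
    (∃ C : ℝ≥0, 0 < C ∧ ∀ f : (Fin n → ℝ) → ℝ, MemBesov l p q r t f →
      (∃ β : ℕ → (Fin n → ℤ) → ℝ, SplineSeriesTendsto l r β f ∧
        coefNorm p q t β ≤ C * besovNorm l p q r t f) ∧
      splineNorm l p q r t f ≤ C * besovNorm l p q r t f) ∧
    (∃ C : ℝ≥0, 0 < C ∧ ∀ β : ℕ → (Fin n → ℤ) → ℝ, coefNorm p q t β < ∞ →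
      ∃ f : (Fin n → ℝ) → ℝ, SplineSeriesTendsto l r β f ∧ MemBesov l p q r t f ∧
        besovNorm l p q r t f ≤ C * splineNorm l p q r t f) := by
  have hp0 := hp.ne'
  have hr0 := hr.ne'
  -- The exponent `μ` serves as `κ`: it is at most `1` and `q`, and through `θ` at most `p` and `r`.
  have hκ : (μ : ℝ≥0∞) ≠ 0 := by exact_mod_cast hμ.ne'
  have hκ1 : (μ : ℝ≥0∞) ≤ 1 := hμle.trans (min_le_left _ _)
  have hκθ : (μ : ℝ≥0∞) ≤ θ := hμle.trans ((min_le_right _ _).trans (min_le_left _ _))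
  have hκq : (μ : ℝ≥0∞) ≤ q := hμle.trans ((min_le_right _ _).trans (min_le_right _ _))
  have hκp : (μ : ℝ≥0∞) ≤ p := hκθ.trans (hθpr.trans (min_le_left _ _))
  have hκr : (μ : ℝ≥0∞) ≤ r := hκθ.trans (hθpr.trans (min_le_right _ _))
  have hnn : ∀ C : ℝ≥0∞, C ≠ ∞ → ∃ D : ℝ≥0, 0 < D ∧ C ≤ D := fun C hC =>
    ⟨C.toNNReal + 1, by positivity, by
      rw [ENNReal.coe_add, ENNReal.coe_toNNReal hC]
      exact le_self_add⟩
  obtain ⟨ρ, hρ, hτ⟩ := exists_coefWeight hp hθ hθpr hα₁ hα₂ hμ hκq hHardy₁ hHardy₂ ht htX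
  constructor
  · obtain ⟨C, hC, h⟩ := exists_splineSeries_coefNorm_le hl hp0 hr0 hκ hκ1 hκp hκr hκq hρ hτ
    obtain ⟨D, hD, hCD⟩ := hnn C hC
    refine ⟨D, hD, fun f hf => ?_⟩
    obtain ⟨β, hβ, hβle⟩ := h f hf.1 hf.2
    have h1 := hβle.trans (mul_le_mul' hCD le_rfl)
    exact ⟨⟨β, hβ, h1⟩, (iInf₂_le β hβ).trans h1⟩
  · obtain ⟨C, hC, h⟩ := exists_splineSeries_besovNorm_le hp0 hr0 hκ hκ1 hκp hκr hκq hρ hτ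
    obtain ⟨D, hD, hCD⟩ := hnn C hC
    refine ⟨D, hD, fun β hβ => ?_⟩
    obtain ⟨f, hf, hfm, hfle⟩ := h β hβ
    refine ⟨f, hf, ⟨hfm, hfle.trans_lt (ENNReal.mul_lt_top hC.lt_top hβ)⟩, ?_⟩
    have hD0 : (D : ℝ≥0∞) ≠ 0 := by exact_mod_cast hD.ne'
    rw [← ENNReal.div_le_iff' hD0 ENNReal.coe_ne_top]
    -- Every competing series with finite coefficient norm has a sum satisfying the same bound, and
    -- this sum agrees with `f` almost everywhere. An infinite coefficient norm makes the inequality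
    -- trivial.
    refine le_iInf₂ fun β' hβ' => ?_
    rw [ENNReal.div_le_iff' hD0 ENNReal.coe_ne_top]
    rcases eq_or_ne (coefNorm p q t β') ∞ with htop | htop
    · rw [htop, ENNReal.mul_top hD0]
      exact le_top
    · obtain ⟨g, hg, hgm, hgle⟩ := h β' htop.lt_top
      rw [besovNorm_congr l p q r t (hβ'.ae_eq hr0 hg hfm hgm)]
      exact hgle.trans (mul_le_mul' hCD le_rfl)
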